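/- **Parameters.** An Extreme Harmonic algorithm has parameters $N\ge 1$, $K\ge 0$; type boundaries $1=t_1\ge t_2\ge\dots\ge t_N>0$; spaces $0<\mathrm{redspace}_1<\dots<\mathrm{redspace}_K$; and for each type $i\le N$ a fraction $\alpha_i\in[0,1/3)$ and integers $\mathrm{redfit}_i$, $\mathrm{leaves}(i)\in\{0,\dots,K\}$, $\mathrm{needs}(i)$. An item of size in $(t_{j+1},t_j]$ has type $j<N$, an item of size in $(0,t_N]$ has type $N$; no such interval has $1/2$ or $1/3$ as an inner point. Items and types are large if contained in $(1/2,1]$, medium if contained in $(1/3,1/2]$, small otherwise. Put $\mathrm{bluefit}_i=\lfloor 1/t_i\rfloor$ and $\varepsilon=t_N$. We require: $\alpha_i=0$ for large $i$; $\alpha_N=\mathrm{leaves}(N)=0$; $\mathrm{redspace}_{\mathrm{leaves}(i)}\le 1-\mathrm{bluefit}_i t_i$ if $i$ is not large and $\mathrm{leaves}(i)>0$; if $\alpha_i>0$, then $1\le\mathrm{needs}(i)\le K$, $\mathrm{redfit}_i\ge1$, $\mathrm{redfit}_i t_i\le\mathrm{redspace}_{\mathrm{needs}(i)}$, with $\mathrm{redfit}_i=1$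 if $i$ is medium and $\mathrm{redspace}_{\mathrm{needs}(i)}\le 1/3$ if $i$ is small; and every $t_i\in(1/3,1/2)$ is one of the spaces. While packing, $\mathrm{leaves}=K$ for a large item of size $<2/3$ and $\mathrm{leaves}=0$ for one of size $\ge 2/3$. A type is *active* if it is medium and $\alpha_i>0$. **Packing.** Items are red, blue (provisionally or definitely) or *bonus*. A bin is *mixed* if it has items of both colors or a bonus item. A red item of size $z$ and a blue item of size $y$ are *combinable* if $y$ has positive $\mathrm{leaves}$ and: $y+z\le1$ in case $y$ is large and $z$ is medium; needs of $z$ is at most leaves of $y$ otherwise. $n^i$ is the number of non-bonus items labelled with type $i$ and $n^i_{\mathrm{red}}$ the number of (provisionally) red ones; here an item that is labelled with a type $i$ other than its own (a *reduced* item) counts $\mathrm{redfit}_i$ times. *Pack$(p,c)$*, with $p$ of type $i$: put $p$ into a bin with items of type $i$ and definite color $c$ that has fewer than $\mathrm{bluefit}_i$ (if $c$ is blue), respectively $\mathrm{redfit}_i$ (if $c$ is red), items of color $c$; if there is none, into a non-mixed bin with an item of the other color that is combinable with $p$, making all colors in it definite; if there is none, into a new bin. The color of $p$ is provisional if $p$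 is put into a new bin and $i$ is active, else definite. Type $N$ items are instead packed by size into bins of such items, by any rule that opens a new bin only if the item does not fit into the newest of these bins. When $p$ of type $i$ arrives: (1) If $n^i_{\mathrm{red}}<\lfloor\alpha_i(n^i+1)\rfloor$: if there is a bonus item of type $i$, or $\mathrm{redspace}_{\mathrm{needs}(i)}\le1/3$ and there is any bonus item, label one such item as type $i$, color it red (it is no longer bonus) and Pack$(p,\text{blue})$; otherwise Pack$(p,\text{red})$. (2) Otherwise, if $i$ is active and some non-mixed bin has a blue large item combinable with $p$, put $p$ into such a bin as a bonus item; else Pack$(p,\text{blue})$. (3) Then, for every active type $i$, do the following once each, in this order, whenever possible; only items labelled $i$ are considered, $n(\mathcal M)$ and $n_{\mathrm{red}}(\mathcal M)$ count the (red) ones with mark $\mathcal M$, and marked items get definite colors. - An unmarked blue item in a bin with a marked blue item gets its mark. - With $x$ minimal such that $\lfloor\alpha_i(n(\mathcal R)+2x+1)\rfloor>n_{\mathrm{red}}(\mathcal R)$: mark $x$ provisionally blue items and one bonus item (or, if there is none, one unmarked red item in a mixed bin) $\mathcal R$; the bonus item becomes red and is no longer bonus. - With $x$ minimal such that $\lfloor\alpha_i(n(\mathcal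 B)+x+1)\rfloor>n_{\mathrm{red}}(\mathcal B)$: mark one provisionally red item, and all blue items in a set of mixed bins with two unmarked blue items each and $x$ or $x+1$ such items in total, $\mathcal B$. - With $x$ minimal such that $\lfloor\alpha_i(n(\mathcal N)+2x+1)\rfloor>n_{\mathrm{red}}(\mathcal N)$, if there are at least $x$ provisionally blue items and one provisionally red item: mark the $x$ largest provisionally colored items and the smallest one $\mathcal N$; by switching colors among provisionally colored items, the former become blue and the latter red. All choices not specified are arbitrary. $\mathcal A(\sigma)$ is the number of bins used on input $\sigma$. **Post-processing.** It turns the packing of $\sigma$ into a packing of a multiset $\sigma'$ of items. "While possible" means until no such step applies. (a) Remove all bins with a provisionally colored item; all partially filled pure blue bins (no red or bonus item, blue items with leaves $0$, and fewer than $\mathrm{bluefit}_i$ items, or total size at most $1-\varepsilon$ for type $N$); all bins whose only blue item has mark $\mathcal N$ or $\mathcal R$, and all bins with items that were marked in the same step as such an item (an item that copied the mark of another one counts as marked with it). (b) For every active $i$: let $x_{\mathcal R}$, $x_{\mathcal B}$ be the minimal $x$ with $\lfloor\alpha_i(n(\mathcal M)+x+1)\rfloor>n_{\mathrm{red}}(\mathcal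 M)$ for $\mathcal M=\mathcal R,\mathcal B$, at each time. While possible, re-mark as $\mathcal R$ the largest red $\mathcal N$-item among those in mixed bins, together with the blue items in a set of bins with two blue $\mathcal N$-items each and $x_{\mathcal R}$ or $x_{\mathcal R}+1$ such items in total. Then do the same for $\mathcal B$-items in place of $\mathcal N$-items, then for unmarked items (in these two cases with any red item in a mixed bin). Then, while possible, re-mark as $\mathcal B$ the largest red $\mathcal N$-item together with the blue items in a set of mixed bins with two blue $\mathcal N$-items each and $x_{\mathcal B}$ or $x_{\mathcal B}+1$ such items in total. (c) Remove all mixed bins with $\mathcal N$-items or with red $\mathcal B$-items. Then, for each active $i$ and each mark $\mathcal M$, as long as $n_{\mathrm{red}}(\mathcal M)\ne\lfloor\alpha_i n(\mathcal M)\rfloor$, remove a bin with a blue (if $n_{\mathrm{red}}(\mathcal M)$ is too small) or red (if it is too large) $\mathcal M$-item of type $i$. (d) For every active $i$, while possible: take a set of $m$ bins, each with a bonus item of type $i$ and a large item, with $2m\in\{x_{\mathcal R}+2,x_{\mathcal R}+3\}$. In $m-1$ of them reduce the large item to a blue type $i$ item and color the bonus item blue; color the bonus item in the last one red; mark all these type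 $i$ items $\mathcal R$. None of the former bonus items is bonus any more. (e) Replace each reduced item, labelled $j$, by $\mathrm{redfit}_j$ red items of size $t_j$. Remove all remaining bonus items and all unmarked items of active types. For each type $i$, while $n^i_{\mathrm{red}}>\lfloor\alpha_i n^i\rfloor$, remove a red item of type $i$. **Weights.** For $1\le k\le K+1$ and an item $p$ of size $x$, type $t$ and mark $\mathcal M$ (if any), let $w_k(p)=v_k(p)=\frac{x}{1-\varepsilon}$ if $t=N$. If $t<N$, let $b_t=\frac{1-\alpha_t}{\mathrm{bluefit}_t}$, and $r_t=\frac{\alpha_t}{\mathrm{redfit}_t}$ ($r_t=0$ if $\alpha_t=0$). Then $$w_k(p)=\begin{cases}b_t+r_t&\text{if }\mathrm{needs}(t)>k\text{, or }\mathrm{needs}(t)=k\text{ and }\mathcal M\ne\mathcal R,\\ b_t&\text{otherwise,}\end{cases}\qquad v_k(p)=\begin{cases}b_t+r_t&\text{if }\ell(p)<k,\\ r_t&\text{if }\ell(p)\ge k,\end{cases}$$ where $\ell(p)=\mathrm{leaves}(t)$ if $p$ is not large; for a large item of size $x<2/3$, $\ell(p)$ is the largest $j\le K$ with $\mathrm{redspace}_j\le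 1-x$ ($0$ if there is none); and $\ell(p)=0$ if $x\ge2/3$. **Theorem.** For every choice of the parameters there is a constant $C$ such that for every input sequence $\sigma$ of items with sizes in $(0,1]$, every execution $\mathcal A$ of the Extreme Harmonic algorithm on $\sigma$, and every result $\sigma'=\{\mathfrak p_1,\dots,\mathfrak p_n\}$ of post-processing the packing obtained, $$\mathcal A(\sigma)\le\max_{1\le k\le K+1}\min\Big\{\sum_{i=1}^n w_k(\mathfrak p_i),\ \sum_{i=1}^n v_k(\mathfrak p_i)\Big\}+C .$$ -/

import Mathlib

namespace ExtremeHarmonic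

noncomputable section

open scoped Classical

/-! ### Parameters of the framework -/

/-- The parameters of an Extreme Harmonic algorithm.  Types are numbered `1, …, N`, spaces for red
items are numbered `1, …, K`; values at other indices are irrelevant.  `leaves i` is only used for
types with `t i ≤ 1/2` (see `leavesOf`), and `redfit i`, `needs i` only if `0 < redfrac i`. -/
structure Params where
  N : ℕ
  K : ℕ
  t : ℕ → ℝ
  redspace : ℕ → ℝ
  redfrac : ℕ → ℝ
  redfit : ℕ → ℕ
  leaves : ℕ → ℕ
  needs : ℕ → ℕ
  one_le_N : 1 ≤ N
  t_one : t 1 = 1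
  t_anti : ∀ i j, 1 ≤ i → i ≤ j → j ≤ N → t j ≤ t i
  t_pos : 0 < t N
  /-- no type contains `1/2` or `1/3` as an inner point of its interval -/
  no_straddle : ∀ i, 1 ≤ i → i < N →
    ¬ (t (i + 1) < 1 / 2 ∧ 1 / 2 < t i) ∧ ¬ (t (i + 1) < 1 / 3 ∧ 1 / 3 < t i)
  no_straddle_last : t N ≤ 1 / 3
  redspace_pos : ∀ j, 1 ≤ j → j ≤ K → 0 < redspace j
  redspace_lt : ∀ i j, 1 ≤ i → i < j → j ≤ K → redspace i < redspace j
  redfrac_nonneg : ∀ i, 1 ≤ i → i ≤ N → 0 ≤ redfrac i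
  redfrac_lt : ∀ i, 1 ≤ i → i ≤ N → redfrac i < 1 / 3
  /-- large items are never red -/
  redfrac_large : ∀ i, 1 ≤ i → i ≤ N → 1 / 2 < t i → redfrac i = 0
  /-- the items of the last type are packed by size into pure blue bins -/
  redfrac_last : redfrac N = 0
  leaves_last : leaves N = 0
  leaves_le : ∀ i, 1 ≤ i → i ≤ N → leaves i ≤ K
  /-- `⌊1 / t i⌋` blue items of type `i` leave the space with index `leaves i` unused -/
  leaves_space : ∀ i, 1 ≤ i → i ≤ N → t i ≤ 1 / 2 → 0 < leaves i →
    redspace (leaves i) ≤ 1 - (⌊1 / t i⌋₊ : ℝ) * t i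
  needs_pos : ∀ i, 1 ≤ i → i ≤ N → 0 < redfrac i → 1 ≤ needs i
  needs_le : ∀ i, 1 ≤ i → i ≤ N → 0 < redfrac i → needs i ≤ K
  redfit_pos : ∀ i, 1 ≤ i → i ≤ N → 0 < redfrac i → 1 ≤ redfit i
  /-- `redfit i` red items of type `i` use at most the space with index `needs i` -/
  redfit_space : ∀ i, 1 ≤ i → i ≤ N → 0 < redfrac i →
    (redfit i : ℝ) * t i ≤ redspace (needs i)
  redfit_medium : ∀ i, 1 ≤ i → i ≤ N → 0 < redfrac i → 1 / 3 < t i → redfit i = 1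
  needs_small : ∀ i, 1 ≤ i → i ≤ N → 0 < redfrac i → t i ≤ 1 / 3 → redspace (needs i) ≤ 1 / 3
  /-- every medium type boundary below `1/2` is one of the spaces -/
  medium_mem : ∀ i, 1 ≤ i → i ≤ N → 1 / 3 < t i → t i < 1 / 2 →
    ∃ j, 1 ≤ j ∧ j ≤ K ∧ redspace j = t i

namespace Params

variable (P : Params)

/-- The type of an item of size `x ∈ (0, 1]`: the largest `j ≤ N` with `x ≤ t j`, that is,
`x ∈ (t (j + 1), t j]` if `j < N` and `x ∈ (0, t N]` if `j = N`. -/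
def typeOf (x : ℝ) : ℕ := Nat.findGreatest (fun j => 1 ≤ j ∧ x ≤ P.t j) P.N

def bluefit (i : ℕ) : ℕ := ⌊1 / P.t i⌋₊

def IsMediumType (i : ℕ) : Prop := 1 / 3 < P.t i ∧ P.t i ≤ 1 / 2

/-- The medium types with a positive fraction of red items: their items receive provisional
colours and marks. -/
def IsActive (i : ℕ) : Prop := P.IsMediumType i ∧ 0 < P.redfrac i

/-- The value of `leaves` for a blue item of size `x` that is used while packing: for a large item
it is `K` if `x < 2/3` and `0` otherwise. -/
def leavesOf (x : ℝ) : ℕ :=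
  if 1 / 2 < x then (if x < 2 / 3 then P.K else 0) else P.leaves (P.typeOf x)

end Params

def IsLarge (x : ℝ) : Prop := 1 / 2 < x

def IsMedium (x : ℝ) : Prop := 1 / 3 < x ∧ x ≤ 1 / 2

/-! ### Packings -/

inductive Color
  | red
  | blue

inductive Mark
  | N
  | B
  | R

/-- An item has a provisional colour, a definite colour, or it is a bonus item (no colour). -/
inductive Status
  | prov (c : Color)
  | fixed (c : Color)
  | bonus

/-- A packed item.  `typ` is the type with which it is labelled, `batch` is the number of items
that had arrived when its mark was assigned (used only in post-processing), and `bin` is the bin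
that contains it. -/
structure Item where
  size : ℝ
  typ : ℕ
  status : Status
  mark : Option Mark
  batch : ℕ
  bin : ℕ

/-- A packing: the packed items, each with the bin that contains it. -/
abbrev Packing := Multiset Item

def Item.HasColor (p : Item) (c : Color) : Prop := p.status = .prov c ∨ p.status = .fixed c

/-- The items in bin `b`. -/
def content (s : Packing) (b : ℕ) : Packing := s.filter (fun p => p.bin = b)

/-- The number of (nonempty) bins. -/
def numBins (s : Packing) : ℕ := (s.map Item.bin).toFinset.card

def HasBlue (s : Packing) (b : ℕ) : Prop := ∃ p ∈ s, p.bin = b ∧ p.HasColor .blue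

def HasRed (s : Packing) (b : ℕ) : Prop := ∃ p ∈ s, p.bin = b ∧ p.HasColor .red

def HasBonus (s : Packing) (b : ℕ) : Prop := ∃ p ∈ s, p.bin = b ∧ p.status = .bonus

/-- Bins with items of both colours, and bins with a bonus item. -/
def Mixed (s : Packing) (b : ℕ) : Prop := (HasBlue s b ∧ HasRed s b) ∨ HasBonus s b

namespace Params

variable (P : Params)

/-- A reduced item: a former bonus item that is labelled with a type different from its own. -/
def Reduced (p : Item) : Prop := p.typ ≠ P.typeOf p.size

/-- The number of items as which `p` is counted: a reduced item counts as `redfit j` items of the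
type `j` with which it is labelled. -/
def mult (p : Item) : ℕ := if P.Reduced p then P.redfit p.typ else 1

/-- The number of items of type `i`; bonus items are not counted. -/
def nTot (s : Packing) (i : ℕ) : ℕ :=
  ((s.filter (fun p => p.typ = i ∧ p.status ≠ .bonus)).map P.mult).sum

/-- The number of (provisionally) red items of type `i`. -/
def nRed (s : Packing) (i : ℕ) : ℕ :=
  ((s.filter (fun p => p.typ = i ∧ p.HasColor .red)).map P.mult).sum

end Params

/-- The number of items of type `i` with mark `m`. -/
def nTotMark (s : Packing) (i : ℕ) (m : Mark) : ℕ :=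
  (s.filter (fun p => p.typ = i ∧ p.mark = some m)).card

/-- The number of red items of type `i` with mark `m`. -/
def nRedMark (s : Packing) (i : ℕ) (m : Mark) : ℕ :=
  (s.filter (fun p => p.typ = i ∧ p.mark = some m ∧ p.HasColor .red)).card

/-! ### Packing one item -/

def Status.fix : Status → Status
  | .prov c => .fixed c
  | .fixed c => .fixed c
  | .bonus => .bonus

/-- Make the colours of all items in bin `b` definite. -/
def fixBin (s : Packing) (b : ℕ) : Packing :=
  s.map (fun p => if p.bin = b then { p with status := p.status.fix } else p)

namespace Params

variable (P : Params)

def fit (c : Color) (i : ℕ) : ℕ :=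
  match c with
  | .red => P.redfit i
  | .blue => P.bluefit i

/-- Bin `b` contains items of the type of `x` with definite colour `c`, and it can receive the
item of size `x` as an additional one of these.  For the last type this is decided by size. -/
def OpenBin (s : Packing) (x : ℝ) (c : Color) (b : ℕ) : Prop :=
  (∃ p ∈ s, p.bin = b ∧ p.typ = P.typeOf x ∧ p.status = .fixed c) ∧
  if P.typeOf x = P.N then ((content s b).map Item.size).sum + x ≤ 1
  else (((content s b).filter (fun p => p.HasColor c)).map P.mult).sum < P.fit c (P.typeOf x)

/-- Whether a blue item of size `y` and a red item of size `z` may share a bin: for a large and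
a medium item this depends on the sizes, otherwise on `leaves` and `needs`. -/
def Combinable (y z : ℝ) : Prop :=
  0 < P.leavesOf y ∧
  if IsLarge y ∧ IsMedium z then z ≤ 1 - y else P.needs (P.typeOf z) ≤ P.leavesOf y

/-- The unmixed bin `b` is `c`-compatible with a new item of size `x` that gets colour `c`. -/
def Compatible (s : Packing) (x : ℝ) (c : Color) (b : ℕ) : Prop :=
  ¬ Mixed s b ∧
  match c with
  | .red => ∃ p ∈ s, p.bin = b ∧ p.HasColor .blue ∧ P.Combinable p.size x
  | .blue => ∃ p ∈ s, p.bin = b ∧ p.HasColor .red ∧ P.Combinable x p.size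

/-- The possible results of packing an item of size `x` with (provisional) colour `c`.  A new bin
gets a larger number than all bins before it.  For the last type any rule such as Next Fit or
First Fit is allowed: a new bin may be opened if the item does not fit into the newest bin with
items of this type. -/
def Pack (s : Packing) (x : ℝ) (c : Color) (s' : Packing) : Prop :=
  (∃ b, P.OpenBin s x c b ∧
    s' = (⟨x, P.typeOf x, .fixed c, none, 0, b⟩ : Item) ::ₘ s) ∨
  ((∀ b, P.OpenBin s x c b → P.typeOf x = P.N ∧ ∃ p ∈ s, p.typ = P.N ∧ b < p.bin) ∧
    ((∃ b, P.Compatible s x c b ∧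
        s' = (⟨x, P.typeOf x, .fixed c, none, 0, b⟩ : Item) ::ₘ fixBin s b) ∨
      ((∀ b, ¬ P.Compatible s x c b) ∧
        ∃ b, (∀ p ∈ s, p.bin < b) ∧
          s' = (⟨x, P.typeOf x, if P.IsActive (P.typeOf x) then .prov c else .fixed c,
            none, 0, b⟩ : Item) ::ₘ s)))

/-- An unmixed bin with a blue large item into which a medium item of size `x` fits. -/
def LargeBin (s : Packing) (x : ℝ) (b : ℕ) : Prop :=
  ¬ Mixed s b ∧ ∃ p ∈ s, p.bin = b ∧ p.HasColor .blue ∧ IsLarge p.size ∧ P.Combinable p.size x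

/-- The bonus item `q` may be relabelled as (red) item(s) of type `i`. -/
def Replaceable (i : ℕ) (q : Item) : Prop :=
  q.status = .bonus ∧ (q.typ = i ∨ P.redspace (P.needs i) ≤ 1 / 3)

/-- The possible results of packing a newly arrived item of size `x`, before marking. -/
def PackNew (s : Packing) (x : ℝ) (s' : Packing) : Prop :=
  let i := P.typeOf x
  if P.nRed s i < ⌊P.redfrac i * ((P.nTot s i : ℝ) + 1)⌋₊ then
    if ∃ q ∈ s, P.Replaceable i q then
      ∃ q r, s = q ::ₘ r ∧ P.Replaceable i q ∧
        P.Pack ({ q with typ := i, status := .fixed .red } ::ₘ r) x .blue s'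
    else P.Pack s x .red s'
  else
    if P.IsActive i ∧ ∃ b, P.LargeBin s x b then
      ∃ b, P.LargeBin s x b ∧ s' = (⟨x, i, .bonus, none, 0, b⟩ : Item) ::ₘ s
    else P.Pack s x .blue s'

end Params

/-! ### Marking and colouring -/

/-- Perform the step `r` once if it is possible, and nothing otherwise. -/
def IfStep (r : Packing → Packing → Prop) (s s' : Packing) : Prop :=
  r s s' ∨ (s' = s ∧ ∀ u, ¬ r s u)

/-- Perform the step `r` as long as it is possible. -/
def WhileStep (r : Packing → Packing → Prop) (s s' : Packing) : Prop :=
  Relation.ReflTransGen r s s' ∧ ∀ u, ¬ r s' u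

/-- Perform `r 1, …, r n` in this order. -/
def ForTypes (r : ℕ → Packing → Packing → Prop) : ℕ → Packing → Packing → Prop
  | 0, s, s' => s' = s
  | n + 1, s, s' => ∃ u, ForTypes r n s u ∧ r (n + 1) u s'

/-- The number of blue items of type `i` with mark `m` (`none`: unmarked) in bin `b` is two. -/
def HasPair (s : Packing) (i : ℕ) (m : Option Mark) (b : ℕ) : Prop :=
  ((content s b).filter (fun p => p.typ = i ∧ p.HasColor .blue ∧ p.mark = m)).card = 2

/-- Give an unmarked blue item in a bin with a marked blue item the mark of the latter. -/
def copyMark (i : ℕ) (s s' : Packing) : Prop :=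
  ∃ p₁ r, s = p₁ ::ₘ r ∧ p₁.typ = i ∧ p₁.HasColor .blue ∧ p₁.mark = none ∧
    ∃ p₂ ∈ r, p₂.bin = p₁.bin ∧ p₂.typ = i ∧ p₂.HasColor .blue ∧ p₂.mark ≠ none ∧
      s' = { p₁ with mark := p₂.mark, batch := p₂.batch } ::ₘ r

/-- Set the mark of an item at time `τ` and give it the definite colour `c`. -/
def Item.assign (p : Item) (m : Mark) (τ : ℕ) (c : Color) : Item :=
  { p with mark := some m, batch := τ, status := .fixed c }

namespace Params

variable (P : Params)

/-- The minimum `x` with `⌊α (n(m) + 2 x + 1)⌋ > n_red(m)`, for type `i`. -/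
def xTwo (s : Packing) (i : ℕ) (m : Mark) : ℕ :=
  sInf {x : ℕ | nRedMark s i m < ⌊P.redfrac i * ((nTotMark s i m : ℝ) + 2 * x + 1)⌋₊}

/-- The minimum `x` with `⌊α (n(m) + x + 1)⌋ > n_red(m)`, for type `i`. -/
def xOne (s : Packing) (i : ℕ) (m : Mark) : ℕ :=
  sInf {x : ℕ | nRedMark s i m < ⌊P.redfrac i * ((nTotMark s i m : ℝ) + x + 1)⌋₊}

/-- Mark `x` provisionally blue items `S` and one unmarked red or bonus item `q` in a mixed bin
with `R`, preferably a bonus item; `q` is then (no longer bonus but) red. -/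
def markR (i τ : ℕ) (s s' : Packing) : Prop :=
  ∃ (S : Packing) (q : Item) (r : Packing), s = S + q ::ₘ r ∧
    S.card = P.xTwo s i .R ∧
    (∀ p ∈ S, p.typ = i ∧ p.status = .prov .blue) ∧
    q.typ = i ∧ q.mark = none ∧
    (q.status = .bonus ∨
      (q.status = .fixed .red ∧ Mixed s q.bin ∧ ¬ ∃ p ∈ s, p.typ = i ∧ p.status = .bonus)) ∧
    s' = S.map (fun p => p.assign .R τ .blue) + q.assign .R τ .red ::ₘ r

/-- Mark the blue items in a set `T` of mixed bins, with two unmarked blue items each, and one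
provisionally red item `q` with `B`. -/
def markB (i τ : ℕ) (s s' : Packing) : Prop :=
  ∃ (T : Finset ℕ) (q : Item) (r : Packing), s = q ::ₘ r ∧
    (∀ b ∈ T, Mixed s b ∧ HasPair s i none b) ∧
    (2 * T.card = P.xOne s i .B ∨ 2 * T.card = P.xOne s i .B + 1) ∧
    q.typ = i ∧ q.status = .prov .red ∧
    s' = q.assign .B τ .red ::ₘ
      r.map (fun p => if p.bin ∈ T ∧ p.typ = i ∧ p.HasColor .blue then p.assign .B τ .blue else p)

/-- Mark the `x` largest provisionally coloured items `S` and the smallest one, `q`, with `N`.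
The items in `S` become blue and `q` becomes red.  Colours are only switched between
provisionally coloured items: `U₁` and `U₂` are the remaining ones that become red and blue by
switches; the total number of red ones stays the same, and an item becomes blue only through a
switch with `q` in case `q` was provisionally blue. -/
def markN (i τ : ℕ) (s s' : Packing) : Prop :=
  ∃ (S : Packing) (q : Item) (U₁ U₂ U₃ r : Packing), s = S + q ::ₘ (U₁ + U₂ + U₃) + r ∧
    S.card = P.xTwo s i .N ∧
    (∀ p ∈ S + q ::ₘ (U₁ + U₂ + U₃), p.typ = i ∧ ∃ c, p.status = .prov c) ∧
    (∀ p ∈ r, ¬ (p.typ = i ∧ ∃ c, p.status = .prov c)) ∧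
    P.xTwo s i .N ≤ (s.filter (fun p => p.typ = i ∧ p.status = .prov .blue)).card ∧
    (∃ p ∈ s, p.typ = i ∧ p.status = .prov .red) ∧
    (∀ p ∈ S, ∀ u ∈ q ::ₘ (U₁ + U₂ + U₃), u.size ≤ p.size) ∧
    (∀ p ∈ S + q ::ₘ (U₁ + U₂ + U₃), q.size ≤ p.size) ∧
    (∀ p ∈ U₁, p.status = .prov .blue) ∧ (∀ p ∈ U₂, p.status = .prov .red) ∧
    U₂.card ≤ (if q.status = .prov .blue then 1 else 0) ∧
    (s.filter (fun p => p.typ = i ∧ p.status = .prov .red)).card =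
      1 + U₁.card + (U₃.filter (fun p => p.status = .prov .red)).card ∧
    s' = S.map (fun p => p.assign .N τ .blue) + q.assign .N τ .red ::ₘ
      (U₁.map (fun p => { p with status := .prov .red }) +
        U₂.map (fun p => { p with status := .prov .blue }) + U₃) + r

/-- One execution of the marking and colouring procedure for type `i` at time `τ`. -/
def markAndColor (τ i : ℕ) (s s' : Packing) : Prop :=
  if P.IsActive i then
    ∃ s₁ s₂ s₃, IfStep (copyMark i) s s₁ ∧ IfStep (P.markR i τ) s₁ s₂ ∧
      IfStep (P.markB i τ) s₂ s₃ ∧ IfStep (P.markN i τ) s₃ s'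
  else s' = s

/-- `Run P σ s`: an Extreme Harmonic algorithm with parameters `P` can produce the packing `s`
on the input sequence `σ`. -/
inductive Run : List ℝ → Packing → Prop
  | nil : Run [] 0
  | snoc (σ : List ℝ) (x : ℝ) (s u s' : Packing) : Run σ s → P.PackNew s x u →
      ForTypes (P.markAndColor (σ.length + 1)) P.N u s' → Run (σ ++ [x]) s'

/-! ### Post-processing -/

/-- A pure blue bin that is only partially filled. -/
def PartialPure (s : Packing) (b : ℕ) : Prop :=
  ¬ HasRed s b ∧ ¬ HasBonus s b ∧ ∃ p ∈ s, p.bin = b ∧ p.HasColor .blue ∧ P.leavesOf p.size = 0 ∧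
    if p.typ = P.N then ((content s b).map Item.size).sum ≤ 1 - P.t P.N
    else ((content s b).filter (fun q => q.HasColor .blue)).card < P.bluefit p.typ

/-- `q` is a blue item with mark `N` or `R` that is the only blue item in its bin. -/
def SingleBlue (s : Packing) (q : Item) : Prop :=
  q ∈ s ∧ q.HasColor .blue ∧ (q.mark = some .N ∨ q.mark = some .R) ∧
    ((content s q.bin).filter (fun p => p.HasColor .blue)).card = 1

/-- The bins that are removed first: those with provisionally coloured items, partially filled
pure blue bins, bins with a single blue `N`- or `R`-item, and all bins with items that received
their marks in the same step as such an item. -/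
def BadBin (s : Packing) (b : ℕ) : Prop :=
  (∃ p ∈ s, p.bin = b ∧ ∃ c, p.status = .prov c) ∨ P.PartialPure s b ∨
  ∃ q, SingleBlue s q ∧
    (q.bin = b ∨ ∃ p ∈ s, p.bin = b ∧ p.typ = q.typ ∧ p.mark = q.mark ∧ p.batch = q.batch)

/-- Change the mark from `m` to `m'` for one red item `q` of type `i` and for all blue items of
type `i` in a set `T` of bins with two blue items of mark `m` and type `i` each, where `T`
contains `x` or `x + 1` such items in total.  `okRed` and `okBin` are additional conditions on `q`
and on the bins in `T`. -/
def reassign (i : ℕ) (m : Option Mark) (m' : Mark) (okRed : Packing → Item → Prop)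
    (okBin : Packing → ℕ → Prop) (s s' : Packing) : Prop :=
  ∃ (T : Finset ℕ) (q : Item) (r : Packing), s = q ::ₘ r ∧
    (∀ b ∈ T, HasPair s i m b ∧ okBin s b) ∧
    (2 * T.card = P.xOne s i m' ∨ 2 * T.card = P.xOne s i m' + 1) ∧
    q.typ = i ∧ q.HasColor .red ∧ q.mark = m ∧ okRed s q ∧
    s' = { q with mark := some m' } ::ₘ
      r.map (fun p => if p.bin ∈ T ∧ p.typ = i ∧ p.HasColor .blue ∧ p.mark = m
        then { p with mark := some m' } else p)

/-- The final marking for type `i`. -/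
def finalMark (i : ℕ) (s s' : Packing) : Prop :=
  if P.IsActive i then
    ∃ s₁ s₂ s₃,
      WhileStep (P.reassign i (some .N) .R
        (fun u q => Mixed u q.bin ∧ ∀ p ∈ u, p.typ = i → p.HasColor .red → p.mark = some .N →
          Mixed u p.bin → p.size ≤ q.size) (fun _ _ => True)) s s₁ ∧
      WhileStep (P.reassign i (some .B) .R (fun u q => Mixed u q.bin) (fun _ _ => True)) s₁ s₂ ∧
      WhileStep (P.reassign i none .R (fun u q => Mixed u q.bin) (fun _ _ => True)) s₂ s₃ ∧
      WhileStep (P.reassign i (some .N) .B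
        (fun u q => ∀ p ∈ u, p.typ = i → p.HasColor .red → p.mark = some .N → p.size ≤ q.size)
        Mixed) s₃ s'
  else s' = s

/-- The mixed bins with `N`-items and the mixed bins with red `B`-items. -/
def WronglyMixed (s : Packing) (b : ℕ) : Prop :=
  Mixed s b ∧ ∃ p ∈ s, p.bin = b ∧
    (p.mark = some .N ∨ (p.mark = some .B ∧ p.HasColor .red))

/-- Remove a bin with blue (red) items of type `i` and mark `m`, if there are too few (too many)
red ones. -/
def restoreStep (i : ℕ) (m : Mark) (s s' : Packing) : Prop :=
  ∃ p ∈ s, p.typ = i ∧ p.mark = some m ∧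
    ((nRedMark s i m < ⌊P.redfrac i * (nTotMark s i m : ℝ)⌋₊ ∧ p.HasColor .blue) ∨
      (⌊P.redfrac i * (nTotMark s i m : ℝ)⌋₊ < nRedMark s i m ∧ p.HasColor .red)) ∧
    s' = s.filter (fun q => q.bin ≠ p.bin)

/-- Restore `n_red(m) = ⌊α n(m)⌋` for the three marks `m` and type `i`. -/
def restore (i : ℕ) (s s' : Packing) : Prop :=
  if P.IsActive i then
    ∃ s₁ s₂, WhileStep (P.restoreStep i .N) s s₁ ∧ WhileStep (P.restoreStep i .B) s₁ s₂ ∧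
      WhileStep (P.restoreStep i .R) s₂ s'
  else s' = s

/-- Take a set `T` of bins with a bonus item of type `i` and a large item each, which contains
`x + 2` or `x + 3` medium and large items in total.  In all of these bins but one (`b₀`) the large
item is replaced by a smaller item of type `i`, and both items become blue; the bonus item in `b₀`
becomes red.  All these items of type `i` get the mark `R`. -/
def shrinkStep (i : ℕ) (s s' : Packing) : Prop :=
  ∃ (T : Finset ℕ) (b₀ : ℕ) (f : ℕ → ℝ), b₀ ∈ T ∧
    (∀ b ∈ T, (∃ p ∈ s, p.bin = b ∧ p.typ = i ∧ p.status = .bonus) ∧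
      ∃ p ∈ s, p.bin = b ∧ IsLarge p.size) ∧
    (2 * T.card = P.xOne s i .R + 2 ∨ 2 * T.card = P.xOne s i .R + 3) ∧
    (∀ b ∈ T, 0 < f b ∧ P.typeOf (f b) = i) ∧
    s' = s.map (fun p =>
      if p.bin ∈ T then
        if p.status = .bonus then
          { p with status := .fixed (if p.bin = b₀ then .red else .blue), mark := some .R }
        else if IsLarge p.size ∧ p.bin ≠ b₀ then
          { p with size := f p.bin, typ := i, mark := some .R }
        else p
      else p)

def shrink (i : ℕ) (s s' : Packing) : Prop :=
  if P.IsActive i then WhileStep (P.shrinkStep i) s s' else s' = s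

/-- Split each reduced item, labelled with type `j`, into `redfit j` red items of type `j`. -/
def splitReduced (s : Packing) : Packing :=
  s.bind (fun p => if P.Reduced p then
    Multiset.replicate (P.redfit p.typ) { p with size := P.t p.typ } else {p})

/-- Remove the bonus items and the unmarked items of types that carry marks. -/
def dropUnmarked (s : Packing) : Packing :=
  s.filter (fun p => p.status ≠ .bonus ∧ ¬ (P.IsActive p.typ ∧ p.mark = none))

/-- Remove one superfluous red item of type `i`. -/
def dropRedStep (i : ℕ) (s s' : Packing) : Prop :=
  ⌊P.redfrac i * (P.nTot s i : ℝ)⌋₊ < P.nRed s i ∧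
    ∃ p, s = p ::ₘ s' ∧ p.typ = i ∧ p.HasColor .red

/-- `PostResult P s s'`: the post-processing of the packing `s` can result in the packing `s'`
of the modified input. -/
def PostResult (s s' : Packing) : Prop :=
  ∃ s₁ s₂ s₃,
    ForTypes P.finalMark P.N (s.filter (fun p => ¬ P.BadBin s p.bin)) s₁ ∧
    ForTypes P.restore P.N (s₁.filter (fun p => ¬ WronglyMixed s₁ p.bin)) s₂ ∧
    ForTypes P.shrink P.N s₂ s₃ ∧
    ForTypes (fun i => WhileStep (P.dropRedStep i)) P.N (P.dropUnmarked (P.splitReduced s₃)) s'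

/-! ### Weights -/

/-- The class of a blue item of size `x` and type `i` in the weight functions.  For a large item of
size less than `2/3` it is the largest index `j ≤ K` with `redspace j ≤ 1 - x`, so that the class is
at least `k > 0` if and only if red items that need the space `redspace k` fit with the item. -/
def blueClass (x : ℝ) (i : ℕ) : ℕ :=
  if 1 / 2 < x then
    (if x < 2 / 3 then Nat.findGreatest (fun j => 1 ≤ j ∧ P.redspace j ≤ 1 - x) P.K else 0)
  else P.leaves i

/-- The weight function `w_k`, which counts all blue items. -/
def w (k : ℕ) (p : Item) : ℝ :=
  if p.typ = P.N then p.size / (1 - P.t P.N)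
  else (1 - P.redfrac p.typ) / P.bluefit p.typ +
    if k < P.needs p.typ ∨ (P.needs p.typ = k ∧ p.mark ≠ some .R)
    then P.redfrac p.typ / P.redfit p.typ else 0

/-- The weight function `v_k`, which counts all red items. -/
def v (k : ℕ) (p : Item) : ℝ :=
  if p.typ = P.N then p.size / (1 - P.t P.N)
  else (if P.blueClass p.size p.typ < k then (1 - P.redfrac p.typ) / P.bluefit p.typ else 0) +
    P.redfrac p.typ / P.redfit p.typ

end Params

end

end ExtremeHarmonic

/-! The bins are counted in two ways. Suppose that every bin is full and contains no bonus item. Let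
`k` be the smallest `needs` of a red item in an unmixed bin, and `K + 1` if there is none. Charge
every bin with blue items to these. The other bins are unmixed and red, so their items need space at
least `k`, and none of them has mark `R`, because a red `R`-item always shares its bin with a blue
item. Hence the blue items together with the red ones that `w_k` counts pay for all bins
(`Clean.one_le_blueShare`). Alternatively, charge every bin with red items to these. The other bins
are blue, and their items are not combinable with the unmixed red type that needs `k`, so their
class is below `k`, as in `v_k` (`Clean.one_le_redShare`). Both counts use the same `k`, which gives
the minimum inside the maximum.

A weight is the average of the shares of a blue and of a red item with coefficients `1 - α` and `α`.
Total weight and total share of a type therefore differ by a bounded factor times its deficit `α n -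
n_red` (`PostInv.sum_share_le`). As `w_k` depends on the mark, the deficit has to be bounded for
every type and every mark separately. So three things must be shown: these deficits are bounded, all
but boundedly many bins are full, and unmixed blue and red bins are never combinable (`Separated`).
A bounded number of bins may be discarded at any time, since a bin has boundedly many items of each
type other than the last and hence changes every deficit by a bounded amount (`PostInv.cut`).

For types that are not active this is the usual Harmonic argument. For an active type `i` every bin
has one of finitely many kinds, and each action of the algorithm moves bins between kinds; thus the
problem becomes one about a vector of counts (`Kind.Inv.step`). The provisionally blue bins are
controlled by a potential: their number plus 3/2 times the deficits of the marks `R` and `N`, where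
a bin with one marked blue item counts as if it had two. An arrival raises it by at most 1, and
marking `x` blue items and a red one with `R` or `N` changes it by `-x (1 - 3 α) - 3/2 (1 - α) ≤
-1`; this is where `α < 1/3` is needed. If no such step is possible after a new bin was opened, then
either all red items are marked or the blue ones are too few for a step, and both cases bound their
number directly. The provisionally red bins are controlled by the surplus of red items among the
unmarked ones, which a `B`-step does not change.

Post-processing keeps the deficits bounded. A step that changes marks to `m'` takes the least number
of blue items for which another red one is permitted, so it cannot push the deficit of `m'` out of
its bounds (`abs_dev_step`), and what `m'` gains the old mark loses. When a loop ends although a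
suitable red item is left, there are few pairs of blue items (`stuck_pairs`); when no red item is
left, the bounded deficit again forces few pairs. Hence few unmarked items and few wrongly mixed
bins remain. Restoring the fractions removes boundedly many bins, as every removal brings the
deficit closer to 1/2 by at least `α` (`restoreStep_effect`). Replacing bonus bins by bins with mark
`R` keeps the number of bins and all bounds (`shrinkStep_effect`), and at its end few bonus items
are left. The remaining defective bins are discarded for the count only: their items still belong to
the modified input and have nonnegative weight, so what is lost is only the bounded weight of the
superfluous red items that are dropped (`sum_weight_le`). -/

namespace ExtremeHarmonic

noncomputable section

open scoped Classical

/-! ### Types of items -/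

namespace Params

variable (P : Params)

/-- The index `i` is an active type. -/
structure Act (i : ℕ) : Prop where
  pos : 1 ≤ i
  le : i ≤ P.N
  active : P.IsActive i

variable {P}

lemma typeOf_le (x : ℝ) : P.typeOf x ≤ P.N := Nat.findGreatest_le _

lemma typeOf_spec {x : ℝ} (hx : x ≤ 1) : 1 ≤ P.typeOf x ∧ x ≤ P.t (P.typeOf x) :=
  Nat.findGreatest_spec (P := fun j => 1 ≤ j ∧ x ≤ P.t j) P.one_le_N
    ⟨le_rfl, by rw [P.t_one]; exact hx⟩

lemma t_lt_of_typeOf_lt {x : ℝ} {j : ℕ} (h : P.typeOf x < j) (hj : j ≤ P.N) : P.t j < x := by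
  have := Nat.findGreatest_is_greatest (P := fun j => 1 ≤ j ∧ x ≤ P.t j) h hj
  by_contra hc
  exact this ⟨by omega, not_lt.mp hc⟩

/-- Post-processing replaces reduced items labelled `j` by items of size `t j`, which must then have
type `j`. As boundaries may coincide, this is only true for an index that is the type of some item.
-/
lemma typeOf_t {x : ℝ} (hx : x ≤ 1) : P.typeOf (P.t (P.typeOf x)) = P.typeOf x := by
  obtain ⟨h1, h2⟩ := typeOf_spec (P := P) hx
  have hle := typeOf_le (P := P) x
  apply le_antisymm
  · by_contra hc
    push Not at hc
    have h3 := t_lt_of_typeOf_lt (P := P) hc (typeOf_le _)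
    have h4 : P.t (P.typeOf x) ≤ 1 := by
      rw [← P.t_one]; exact P.t_anti _ _ le_rfl h1 hle
    have h5 := (typeOf_spec (P := P) h4).2
    linarith
  · exact Nat.le_findGreatest hle ⟨h1, le_rfl⟩

lemma t_pos' {i : ℕ} (h1 : 1 ≤ i) (h : i ≤ P.N) : 0 < P.t i :=
  P.t_pos.trans_le (P.t_anti _ _ h1 h le_rfl)

lemma t_le_one {i : ℕ} (h1 : 1 ≤ i) (h : i ≤ P.N) : P.t i ≤ 1 := by
  rw [← P.t_one]; exact P.t_anti _ _ le_rfl h1 h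

/-- No type interval has `1/2` as an inner point, so the size class can be read off the upper
boundary of the type. The same holds for medium items and `1/3`. -/
lemma isLarge_iff {x : ℝ} (hx : x ≤ 1) : IsLarge x ↔ 1 / 2 < P.t (P.typeOf x) := by
  obtain ⟨h1, h2⟩ := typeOf_spec (P := P) hx
  constructor
  · intro h; exact lt_of_lt_of_le h h2
  · intro h
    have hN : P.typeOf x < P.N := by
      refine lt_of_le_of_ne (typeOf_le x) fun he => ?_
      rw [he] at h; have := P.no_straddle_last; linarith
    have h3 := t_lt_of_typeOf_lt (P := P) (Nat.lt_succ_self (P.typeOf x)) hN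
    have h4 := (P.no_straddle _ h1 hN).1
    push Not at h4
    by_contra hc
    have : x ≤ 1 / 2 := not_lt.mp hc
    exact absurd (h4 (by linarith)) (by linarith)

lemma isMedium_iff {x : ℝ} (hx : x ≤ 1) : IsMedium x ↔ P.IsMediumType (P.typeOf x) := by
  obtain ⟨h1, h2⟩ := typeOf_spec (P := P) hx
  have hl := isLarge_iff (P := P) hx
  unfold IsLarge at hl
  constructor
  · rintro ⟨h, h'⟩
    exact ⟨by linarith, by by_contra hc; exact absurd (hl.2 (not_le.mp hc)) (by linarith)⟩
  · rintro ⟨h, h'⟩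
    have hN : P.typeOf x < P.N := by
      refine lt_of_le_of_ne (typeOf_le x) fun he => ?_
      rw [he] at h; have := P.no_straddle_last; linarith
    have h3 := t_lt_of_typeOf_lt (P := P) (Nat.lt_succ_self (P.typeOf x)) hN
    have h4 := (P.no_straddle _ h1 hN).2
    push Not at h4
    refine ⟨?_, by linarith⟩
    by_contra hc
    exact absurd (h4 (by linarith)) (by linarith)

lemma bluefit_pos {i : ℕ} (h1 : 1 ≤ i) (h : i ≤ P.N) : 1 ≤ P.bluefit i := by
  unfold bluefit
  rw [Nat.le_floor_iff (by have := t_pos' h1 h; positivity)]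
  rw [le_div_iff₀ (t_pos' h1 h)]; simpa using t_le_one h1 h

lemma bluefit_large {i : ℕ} (h1 : 1 ≤ i) (h : i ≤ P.N) (hl : 1 / 2 < P.t i) :
    P.bluefit i = 1 := by
  refine le_antisymm ?_ (bluefit_pos h1 h)
  unfold bluefit
  rw [← Nat.lt_succ_iff, Nat.floor_lt (by have := t_pos' h1 h; positivity),
    div_lt_iff₀ (t_pos' h1 h)]
  push_cast; linarith

lemma bluefit_medium {i : ℕ} (hm : P.IsMediumType i) : P.bluefit i = 2 := by
  obtain ⟨h1, h2⟩ := hm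
  have h0 : 0 < P.t i := by linarith
  unfold bluefit
  rw [Nat.floor_eq_iff (by positivity)]
  rw [le_div_iff₀ h0, div_lt_iff₀ h0]
  push_cast
  constructor <;> linarith

lemma Act.redfit {i : ℕ} (h : P.Act i) : P.redfit i = 1 :=
  P.redfit_medium i h.pos h.le h.active.2 h.active.1.1

lemma Act.redfrac_pos {i : ℕ} (h : P.Act i) : 0 < P.redfrac i := h.active.2

lemma Act.redfrac_lt {i : ℕ} (h : P.Act i) : P.redfrac i < 1 / 3 := P.redfrac_lt i h.pos h.le

lemma Act.bluefit {i : ℕ} (h : P.Act i) : P.bluefit i = 2 := bluefit_medium h.active.1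

lemma Act.fit {i : ℕ} (h : P.Act i) : P.fit .blue i = 2 := h.bluefit

lemma Act.ne_last {i : ℕ} (h : P.Act i) : i ≠ P.N := by
  rintro rfl
  have h1 := P.no_straddle_last; have h2 := h.active.1.1; linarith

/-- Red items of active types need more than `1/3` and those of small types at most `1/3`, so the
test `redspace (needs i) ≤ 1/3` of the algorithm separates the active types from the other types
with red items. -/
lemma Act.space {i : ℕ} (h : P.Act i) : 1 / 3 < P.redspace (P.needs i) := by
  have h1 := P.redfit_space i h.pos h.le h.redfrac_pos
  rw [h.redfit] at h1
  have h2 := h.active.1.1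
  push_cast at h1; linarith

lemma act_of_space {i : ℕ} (h1 : 1 ≤ i) (h : i ≤ P.N) (hr : 0 < P.redfrac i)
    (hs : ¬ P.redspace (P.needs i) ≤ 1 / 3) : P.Act i := by
  refine ⟨h1, h, ⟨?_, ?_⟩, hr⟩
  · by_contra hc
    exact hs (P.needs_small i h1 h hr (not_lt.mp hc))
  · by_contra hc
    have := P.redfrac_large i h1 h (not_le.mp hc)
    linarith

lemma redspace_mono {i j : ℕ} (h1 : 1 ≤ i) (h : i ≤ j) (hj : j ≤ P.K) :
    P.redspace i ≤ P.redspace j := by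
  rcases h.eq_or_lt with rfl | h
  · rfl
  · exact (P.redspace_lt i j h1 h hj).le

/-- The space that is left by two blue items of a medium type does not suffice for a red item of a
medium type. -/
lemma leaves_lt_needs {i j : ℕ} (hi1 : 1 ≤ i) (hi : i ≤ P.N) (hm : P.IsMediumType i)
    (hj : P.Act j) : P.leaves i < P.needs j := by
  by_contra hc
  push Not at hc
  have hn := P.needs_pos j hj.pos hj.le hj.redfrac_pos
  have h1 := redspace_mono hn hc (P.leaves_le i hi1 hi)
  -- Two items of size above `1/3` leave less than `1/3`, whereas a red item of an active type needs
  -- more than that.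
  have h2 := P.leaves_space i hi1 hi hm.2 (by omega)
  have h3 := bluefit_medium hm
  unfold Params.bluefit at h3
  rw [h3] at h2
  have h4 := hj.space
  have h5 := hm.1
  push_cast at h2
  linarith

lemma leavesOf_not_large {x : ℝ} (h : ¬ IsLarge x) : P.leavesOf x = P.leaves (P.typeOf x) := by
  unfold leavesOf; unfold IsLarge at h; rw [if_neg h]

variable (P) in
/-- A blue item of size `y` is combinable with every item of type `j`. -/
def TypeCombinable (y : ℝ) (j : ℕ) : Prop :=
  0 < P.leavesOf y ∧
  if IsLarge y ∧ P.IsMediumType j then P.t j ≤ 1 - y else P.needs j ≤ P.leavesOf y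

/-- Invariants about unmixed bins refer to red types rather than red sizes, because colour switches
may exchange a red item for another one of its type. The bound `t j` makes the condition on types
stronger than the one on sizes that the algorithm tests. -/
lemma TypeCombinable.combinable {y z : ℝ} (hz : z ≤ 1)
    (h : P.TypeCombinable y (P.typeOf z)) : P.Combinable y z := by
  refine ⟨h.1, ?_⟩
  have h2 := h.2
  rw [← isMedium_iff hz] at h2
  split_ifs at h2 ⊢ with h3
  · exact (typeOf_spec hz).2.trans h2
  · exact h2

lemma typeCombinable_congr {y y' : ℝ} {j : ℕ} (h : P.typeOf y = P.typeOf y') (hy : ¬ IsLarge y)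
    (hy' : ¬ IsLarge y') : P.TypeCombinable y j ↔ P.TypeCombinable y' j := by
  simp only [TypeCombinable, leavesOf_not_large hy, leavesOf_not_large hy', h, hy, hy', false_and,
    if_false]

lemma not_isLarge_of_medium {y : ℝ} (hy : y ≤ 1) (h : P.IsMediumType (P.typeOf y)) :
    ¬ IsLarge y := by
  rw [isLarge_iff (P := P) hy]; exact not_lt.mpr h.2

lemma not_typeCombinable_medium {y : ℝ} {j : ℕ} (hy : y ≤ 1)
    (h : P.IsMediumType (P.typeOf y)) (hj : P.Act j) : ¬ P.TypeCombinable y j := by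
  have hl := not_isLarge_of_medium hy h
  rintro ⟨-, h2⟩
  simp only [hl, false_and, if_false, leavesOf_not_large hl] at h2
  have := leaves_lt_needs (typeOf_spec hy).1 (typeOf_le y) h hj
  omega

lemma not_combinable_medium {y z : ℝ} (hy : y ≤ 1)
    (h : P.IsMediumType (P.typeOf y)) (hj : P.Act (P.typeOf z)) : ¬ P.Combinable y z := by
  have hl := not_isLarge_of_medium hy h
  rintro ⟨-, h2⟩
  simp only [hl, false_and, if_false, leavesOf_not_large hl] at h2
  have := leaves_lt_needs (typeOf_spec hy).1 (typeOf_le y) h hj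
  omega

lemma leavesOf_last {y : ℝ} (hy : y ≤ 1) (h : P.typeOf y = P.N) : P.leavesOf y = 0 := by
  rw [leavesOf_not_large, h, P.leaves_last]
  rw [isLarge_iff (P := P) hy, h]
  have := P.no_straddle_last
  linarith

end Params

/-! ### Colours -/

lemma Item.hasColor_fixed {p : Item} {c d : Color} (h : p.status = .fixed c) :
    p.HasColor d ↔ c = d := by
  unfold Item.HasColor; rw [h]; simp

lemma Item.hasColor_prov {p : Item} {c d : Color} (h : p.status = .prov c) :
    p.HasColor d ↔ c = d := by
  unfold Item.HasColor; rw [h]; simp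

lemma Item.not_hasColor_bonus {p : Item} {d : Color} (h : p.status = .bonus) :
    ¬ p.HasColor d := by
  unfold Item.HasColor; rw [h]; simp

lemma Item.color_cases (p : Item) : p.HasColor .blue ∨ p.HasColor .red ∨ p.status = .bonus := by
  unfold Item.HasColor
  rcases p with ⟨_, _, (⟨⟨⟩⟩ | ⟨⟨⟩⟩ | _), _, _, _⟩ <;> simp

lemma Item.HasColor.unique {p : Item} {c d : Color} (h : p.HasColor c) (h' : p.HasColor d) :
    c = d := by
  rcases h with h | h
  · exact (Item.hasColor_prov h).1 h'
  · exact (Item.hasColor_fixed h).1 h'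

lemma Item.HasColor.not_bonus {p : Item} {c : Color} (h : p.HasColor c) : p.status ≠ .bonus :=
  fun hb => Item.not_hasColor_bonus hb h

lemma Item.not_bonus_iff {p : Item} : p.status ≠ .bonus ↔ p.HasColor .blue ∨ p.HasColor .red := by
  constructor
  · intro h; rcases p.color_cases with h' | h' | h'
    · exact .inl h'
    · exact .inr h'
    · exact absurd h' h
  · rintro (h | h) <;> exact h.not_bonus

/-! ### Contents of bins -/

@[simp] lemma mem_content {s : Packing} {b : ℕ} {p : Item} :
    p ∈ content s b ↔ p ∈ s ∧ p.bin = b := by simp [content]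

lemma content_cons (p : Item) (s : Packing) (b : ℕ) :
    content (p ::ₘ s) b = if p.bin = b then p ::ₘ content s b else content s b := by
  unfold content; rw [Multiset.filter_cons]; split_ifs <;> simp

lemma content_cons_self (p : Item) (s : Packing) :
    content (p ::ₘ s) p.bin = p ::ₘ content s p.bin := by rw [content_cons, if_pos rfl]

lemma content_cons_ne {p : Item} {s : Packing} {b : ℕ} (h : p.bin ≠ b) :
    content (p ::ₘ s) b = content s b := by rw [content_cons, if_neg h]

lemma content_map {g : Item → Item} (hg : ∀ p, (g p).bin = p.bin) (s : Packing) (b : ℕ) :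
    content (s.map g) b = (content s b).map g := by
  unfold content; rw [Multiset.filter_map]; simp [hg]

lemma content_filter_bin (s : Packing) (Q : ℕ → Prop) (b : ℕ) :
    content (s.filter (fun p => Q p.bin)) b = if Q b then content s b else 0 := by
  unfold content
  rw [Multiset.filter_filter]
  split_ifs with h
  · apply Multiset.filter_congr; intro p _; constructor
    · exact fun h => h.1
    · rintro rfl; exact ⟨rfl, h⟩
  · rw [Multiset.filter_eq_nil]; rintro p _ ⟨rfl, h'⟩; exact h h'

/-- Whether the items `c` of one bin make it a mixed one. -/
def MixedC (c : Packing) : Prop :=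
  ((∃ p ∈ c, p.HasColor .blue) ∧ ∃ p ∈ c, p.HasColor .red) ∨ ∃ p ∈ c, p.status = .bonus

lemma hasBlue_iff {s : Packing} {b : ℕ} : HasBlue s b ↔ ∃ p ∈ content s b, p.HasColor .blue := by
  simp [HasBlue, and_assoc]

lemma hasRed_iff {s : Packing} {b : ℕ} : HasRed s b ↔ ∃ p ∈ content s b, p.HasColor .red := by
  simp [HasRed, and_assoc]

lemma hasBonus_iff {s : Packing} {b : ℕ} :
    HasBonus s b ↔ ∃ p ∈ content s b, p.status = .bonus := by
  simp [HasBonus, and_assoc]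

lemma mixed_iff {s : Packing} {b : ℕ} : Mixed s b ↔ MixedC (content s b) := by
  unfold Mixed MixedC; rw [hasBlue_iff, hasRed_iff, hasBonus_iff]

lemma mixed_congr {s s' : Packing} {b : ℕ} (h : content s b = content s' b) :
    Mixed s b ↔ Mixed s' b := by rw [mixed_iff, mixed_iff, h]

lemma not_mixed_color {s : Packing} {p q : Item} {c d : Color} (hm : ¬ Mixed s p.bin)
    (hp : p ∈ s) (hc : p.HasColor c) (hq : q ∈ s) (hb : q.bin = p.bin) (hd : q.HasColor d) :
    c = d := by
  by_contra hne
  apply hm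
  left
  rcases c <;> rcases d
  · exact absurd rfl hne
  · exact ⟨⟨q, hq, hb, hd⟩, p, hp, rfl, hc⟩
  · exact ⟨⟨p, hp, rfl, hc⟩, q, hq, hb, hd⟩
  · exact absurd rfl hne

/-! ### The items in one bin -/

namespace Params

variable (P : Params)

/-- The number of items of colour `col` among `c`. -/
def colSum (c : Packing) (col : Color) : ℕ :=
  ((c.filter (fun p => p.HasColor col)).map P.mult).sum

/-- The conditions that the contents `c` of a bin satisfy at any time. -/
structure GoodBin (c : Packing) : Prop where
  item : ∀ p ∈ c, 0 < p.size ∧ p.size ≤ 1 ∧ 1 ≤ p.typ ∧ p.typ ≤ P.N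
  -- A bonus item gets a foreign label `i` only if `redspace (needs i) ≤ 1/3`, so `i` is not active,
  -- and its large companion provides the blue item. The last clause is needed when the item is
  -- split into items of size `t i`.
  reduced : ∀ p ∈ c, p.typ ≠ P.typeOf p.size → p.HasColor .red ∧ ¬ P.Act p.typ ∧
    (∃ y ∈ c, y.HasColor .blue) ∧ P.typeOf (P.t p.typ) = p.typ
  red_pos : ∀ p ∈ c, p.HasColor .red → 0 < P.redfrac p.typ
  prov : ∀ p ∈ c, ∀ col, p.status = .prov col → P.Act p.typ ∧ p.mark = none ∧ c = {p}
  bonus : ∀ p ∈ c, p.status = .bonus → P.Act p.typ ∧ p.mark = none ∧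
    ∃ y, c = {p, y} ∧ y.status = .fixed .blue ∧ IsLarge y.size
  mark : ∀ p ∈ c, p.mark ≠ none → P.Act p.typ
  same : ∀ col, ∀ p ∈ c, ∀ q ∈ c, p.HasColor col → q.HasColor col → p.typ = q.typ
  act_red : ∀ p ∈ c, ∀ q ∈ c, p.HasColor .blue → q.HasColor .red → P.Act p.typ → ¬ P.Act q.typ
  csum : ∀ col, ∀ p ∈ c, p.HasColor col → p.typ ≠ P.N → P.colSum c col ≤ P.fit col p.typ
  -- The second alternative covers the moment between packing an item next to a marked one and
  -- copying the mark.
  unmarked : ∀ p ∈ c, P.Act p.typ → p.mark = none → ∀ col, p.status = .fixed col →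
    ((∃ y ∈ c, y.HasColor .blue) ∧ ∃ y ∈ c, y.HasColor .red) ∨
      ∃ q ∈ c, q.typ = p.typ ∧ q.mark ≠ none
  -- This is why `w_k` may ignore red `R`-items with `needs = k`: the bins that have to be paid for
  -- by their red items contain none.
  mark_R : ∀ p ∈ c, p.HasColor .red → p.mark = some .R → ∃ y ∈ c, y.HasColor .blue
  last : ∀ p ∈ c, p.typ = P.N → ∀ q ∈ c, q.typ = P.N

variable {P}

lemma colSum_cons (p : Item) (c : Packing) (col : Color) :
    P.colSum (p ::ₘ c) col = (if p.HasColor col then P.mult p else 0) + P.colSum c col := by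
  unfold colSum; rw [Multiset.filter_cons]; split_ifs <;> simp

lemma colSum_zero (col : Color) : P.colSum 0 col = 0 := by simp [colSum]

lemma colSum_singleton (p : Item) (col : Color) :
    P.colSum {p} col = if p.HasColor col then P.mult p else 0 := by
  rw [← Multiset.cons_zero, colSum_cons, colSum_zero, add_zero]

lemma colSum_eq_zero {c : Packing} {col : Color} (h : ∀ p ∈ c, ¬ p.HasColor col) :
    P.colSum c col = 0 := by
  unfold colSum; rw [Multiset.filter_eq_nil.2 h]; simp

lemma mult_of_typ {p : Item} (h : p.typ = P.typeOf p.size) : P.mult p = 1 := by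
  simp [mult, Reduced, h]

lemma mult_of_act {p : Item} (h : P.Act p.typ) : P.mult p = 1 := by
  simp [mult, h.redfit]

lemma one_le_fit_of_pos {i : ℕ} {col : Color} (h1 : 1 ≤ i) (h : i ≤ P.N)
    (hr : col = .red → 0 < P.redfrac i) : 1 ≤ P.fit col i := by
  rcases col
  · exact P.redfit_pos i h1 h (hr rfl)
  · exact bluefit_pos h1 h

lemma redfrac_pos_ne_last {i : ℕ} (h : 0 < P.redfrac i) : i ≠ P.N := by
  rintro rfl; rw [P.redfrac_last] at h; exact lt_irrefl _ h

/-! ### Changes to a single bin that keep it good -/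

namespace GoodBin

variable {c : Packing}

lemma zero : P.GoodBin 0 := by constructor <;> simp

lemma typ_eq_of_blue (h : P.GoodBin c) {p : Item} (hp : p ∈ c) (hb : p.HasColor .blue) :
    p.typ = P.typeOf p.size := by
  by_contra hc
  have := (h.reduced p hp hc).1.unique hb
  cases this

lemma typ_eq_of_act (h : P.GoodBin c) {p : Item} (hp : p ∈ c) (hb : P.Act p.typ) :
    p.typ = P.typeOf p.size := by
  by_contra hc
  exact (h.reduced p hp hc).2.1 hb

lemma one_le_mult (h : P.GoodBin c) {p : Item} (hp : p ∈ c) : 1 ≤ P.mult p := by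
  by_cases ht : p.typ = P.typeOf p.size
  · rw [mult_of_typ ht]
  · simp only [mult, Reduced, ne_eq, ht, not_false_eq_true, if_true]
    obtain ⟨-, -, h1, h2⟩ := h.item p hp
    exact P.redfit_pos _ h1 h2 (h.red_pos p hp (h.reduced p hp ht).1)

lemma mult_le_colSum {p : Item} (hp : p ∈ c) {col : Color} (hc : p.HasColor col) :
    P.mult p ≤ P.colSum c col := by
  obtain ⟨r, rfl⟩ := Multiset.exists_cons_of_mem hp
  rw [colSum_cons, if_pos hc]; omega

lemma blue_card (h : P.GoodBin c) :
    (c.filter (fun p => p.HasColor .blue)).card = P.colSum c .blue := by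
  unfold colSum
  rw [Multiset.map_congr rfl (g := fun _ => 1), Multiset.map_const', Multiset.sum_replicate,
    smul_eq_mul, mul_one]
  intro p hp
  rw [Multiset.mem_filter] at hp
  exact mult_of_typ (h.typ_eq_of_blue hp.1 hp.2)

lemma not_prov_of_fixed (h : P.GoodBin c) {q : Item} (hq : q ∈ c) {col : Color}
    (hf : q.status = .fixed col) {p : Item} (hp : p ∈ c) (d : Color) : p.status ≠ .prov d := by
  intro hd
  have := (h.prov p hp d hd).2.2
  rw [this, Multiset.mem_singleton] at hq
  subst hq; rw [hf] at hd; cases hd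

/-- A bin with an item of an active type, in single. -/
lemma single {p : Item} (hs : 0 < p.size ∧ p.size ≤ 1) (ht : p.typ = P.typeOf p.size)
    (ha : P.Act p.typ)
    (hst : (∃ col, p.status = .prov col ∧ p.mark = none) ∨
      ∃ col m, p.status = .fixed col ∧ p.mark = some m ∧ (col = .red → m ≠ .R)) :
    P.GoodBin {p} := by
  have hnb : p.status ≠ .bonus := by
    rcases hst with ⟨col, h, -⟩ | ⟨col, m, h, -⟩ <;> rw [h] <;> simp
  constructor
  case csum =>
    simp only [Multiset.mem_singleton, forall_eq]
    intro col hcol _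
    rw [colSum_singleton, if_pos hcol, mult_of_act ha]
    exact one_le_fit_of_pos ha.pos ha.le (fun _ => ha.redfrac_pos)
  all_goals simp only [Multiset.mem_singleton, forall_eq, exists_eq_left]
  · exact ⟨hs.1, hs.2, ha.pos, ha.le⟩
  · exact fun h => absurd ht h
  · exact fun _ => ha.redfrac_pos
  · intro col hcol
    rcases hst with ⟨_, h, h'⟩ | ⟨_, _, h, -⟩
    · exact ⟨ha, h', trivial⟩
    · rw [h] at hcol; cases hcol
  · exact fun h => absurd h hnb
  · exact fun _ => ha
  · simp
  · intro h h'; cases h.unique h'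
  · intro _ hm col hcol
    rcases hst with ⟨_, h, h'⟩ | ⟨_, _, h, h', -⟩
    · rw [h] at hcol; cases hcol
    · rw [hm] at h'; cases h'
  · intro hc hm
    rcases hst with ⟨_, h, h'⟩ | ⟨_, m, h, h', h''⟩
    · rw [hm] at h'; cases h'
    · rw [Item.hasColor_fixed h] at hc
      rw [hm] at h'; cases h'
      exact absurd rfl (h'' hc)
  · simp

/-- A new bin with one item. -/
lemma new {x : ℝ} (hx : 0 < x ∧ x ≤ 1) {col : Color}
    (hr : col = .red → 0 < P.redfrac (P.typeOf x)) (b : ℕ) :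
    P.GoodBin {⟨x, P.typeOf x, if P.IsActive (P.typeOf x) then .prov col else .fixed col,
      none, 0, b⟩} := by
  obtain ⟨h1, h2⟩ := typeOf_spec (P := P) hx.2
  by_cases ha : P.IsActive (P.typeOf x)
  · exact single hx rfl ⟨h1, typeOf_le x, ha⟩ (.inl ⟨col, by simp [ha], rfl⟩)
  · simp only [ha, if_false]
    have hna : ¬ P.Act (P.typeOf x) := fun h => ha h.active
    constructor
    case csum =>
      simp only [Multiset.mem_singleton, forall_eq]
      intro col' hcol _
      rw [colSum_singleton, if_pos hcol, mult_of_typ rfl]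
      rw [Item.hasColor_fixed rfl] at hcol
      exact one_le_fit_of_pos h1 (typeOf_le x) (fun h => hr (hcol.trans h))
    all_goals simp only [Multiset.mem_singleton, forall_eq, exists_eq_left]
    · exact ⟨hx.1, hx.2, h1, typeOf_le x⟩
    · simp
    · intro h; rw [Item.hasColor_fixed rfl] at h; exact hr h
    · simp
    · simp
    · simp
    · simp
    · exact fun _ _ h => absurd h hna
    · exact fun h => absurd h hna
    · simp
    · simp

/-- An item is added to a bin with items of its type and colour. -/
lemma add_open (h : P.GoodBin c) {x : ℝ} (hx : 0 < x ∧ x ≤ 1) {col : Color}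
    (hr : col = .red → 0 < P.redfrac (P.typeOf x)) {q : Item} (hq : q ∈ c)
    (hqt : q.typ = P.typeOf x) (hqs : q.status = .fixed col)
    (hfit : P.typeOf x = P.N ∨ P.colSum c col < P.fit col (P.typeOf x)) (b : ℕ) :
    P.GoodBin (⟨x, P.typeOf x, .fixed col, none, 0, b⟩ ::ₘ c) := by
  obtain ⟨h1, h2⟩ := typeOf_spec (P := P) hx.2
  have hqc : q.HasColor col := .inr hqs
  set p : Item := ⟨x, P.typeOf x, .fixed col, none, 0, b⟩ with hp
  have hpc : ∀ d, p.HasColor d ↔ col = d := fun d => Item.hasColor_fixed rfl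
  -- The companion of a bonus item is a large blue item. It would be `q`, but `bluefit` is 1 for
  -- large types, so its bin has no room.
  have hnb : ∀ p' ∈ c, p'.status ≠ .bonus := by
    intro p' hp' hb
    obtain ⟨-, -, y, hy, hy1, hy2⟩ := h.bonus p' hp' hb
    have hqy : q = y := by
      rw [hy] at hq; simp at hq
      rcases hq with rfl | hq
      · rw [hb] at hqs; cases hqs
      · exact hq
    subst hqy
    rw [hy1] at hqs; cases hqs
    have hl := (isLarge_iff (P := P) (h.item q hq).2.1).1 hy2
    have h3 := h.typ_eq_of_blue hq hqc
    rw [← h3, hqt] at hl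
    rcases hfit with hfit | hfit
    · rw [hfit] at hl; have := P.no_straddle_last; linarith
    · have h4 := bluefit_large h1 (typeOf_le x) hl
      have h5 := mult_le_colSum (P := P) hq hqc
      have h6 := h.one_le_mult hq
      simp only [fit, h4] at hfit; omega
  constructor
  case csum =>
    intro d p' hp' hd hN
    have hsame : ∀ p' ∈ p ::ₘ c, p'.HasColor col → p'.typ = P.typeOf x := by
      intro p' hp' hc'
      rcases Multiset.mem_cons.1 hp' with rfl | hp'
      · rfl
      · rw [← hqt]; exact h.same col _ hp' _ hq hc' hqc
    rw [colSum_cons]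
    by_cases hcd : col = d
    · subst hcd
      rw [if_pos ((hpc _).2 rfl), mult_of_typ rfl]
      rw [hsame p' hp' hd] at hN ⊢
      have := hfit.resolve_left hN
      omega
    · rw [if_neg (by rw [hpc]; exact hcd), zero_add]
      rcases Multiset.mem_cons.1 hp' with rfl | hp'
      · exact absurd ((hpc _).1 hd) hcd
      · exact h.csum d p' hp' hd hN
  all_goals simp only [Multiset.mem_cons, forall_eq_or_imp, exists_eq_or_imp]
  · exact ⟨⟨hx.1, hx.2, h1, typeOf_le x⟩, h.item⟩
  · refine ⟨fun h => absurd rfl h, fun a ha h' => ?_⟩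
    obtain ⟨h3, h4, h5, h6⟩ := h.reduced a ha h'
    exact ⟨h3, h4, .inr h5, h6⟩
  · exact ⟨fun h => hr ((hpc _).1 h), h.red_pos⟩
  · exact ⟨by simp [hp], fun a ha d hd => absurd hd (h.not_prov_of_fixed hq hqs ha d)⟩
  · exact ⟨by simp [hp], fun a ha hb => absurd hb (hnb a ha)⟩
  · exact ⟨by simp [hp], h.mark⟩
  · intro d
    refine ⟨⟨fun _ _ => trivial, fun a ha hd had => ?_⟩, fun a ha => ⟨fun had hd => ?_, h.same d a ha⟩⟩
    · have := (hpc d).1 hd; subst this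
      change P.typeOf x = _
      rw [← hqt]; exact h.same _ _ hq _ ha hqc had
    · have := (hpc d).1 hd; subst this
      change _ = P.typeOf x
      rw [← hqt]; exact h.same _ _ ha _ hq had hqc
  · have hpt : p.typ = q.typ := hqt.symm
    rw [hpt]
    simp only [hpc]
    refine ⟨⟨fun h h' => ?_, fun a ha hb har => ?_⟩, fun a ha => ⟨fun had hd => ?_, h.act_red a ha⟩⟩
    · rw [h] at h'; cases h'
    · subst hb; exact h.act_red q hq a ha hqc har
    · subst hd; exact h.act_red a ha q hq had hqc
  -- The new item inherits the alternative from `q`; if `q` is marked, it is itself the marked item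
  -- of the same type.
  · refine ⟨fun ha _ d _ => ?_, fun a ha h' hm d hd => ?_⟩
    · by_cases hqm : q.mark = none
      · rcases h.unmarked q hq (by rw [hqt]; exact ha) hqm _ hqs with ⟨h3, h4⟩ | ⟨q', h3, h4⟩
        · exact .inl ⟨.inr h3, .inr h4⟩
        · exact .inr (.inr ⟨q', h3, h4.1.trans hqt, h4.2⟩)
      · exact .inr (.inr ⟨q, hq, hqt, hqm⟩)
    · rcases h.unmarked a ha h' hm d hd with ⟨h3, h4⟩ | h3
      · exact .inl ⟨.inr h3, .inr h4⟩
      · exact .inr (.inr h3)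
  · exact ⟨fun _ h => absurd h (by simp [hp]), fun a ha h' hm => .inr (h.mark_R a ha h' hm)⟩
  · refine ⟨fun h' => ⟨h', fun a ha => ?_⟩, fun a ha h' => ⟨?_, h.last a ha h'⟩⟩
    · exact h.last q hq (hqt.trans h') a ha
    · exact hqt.symm.trans (h.last a ha h' q hq)

end GoodBin

end Params

/-- The item with its colour made definite. -/
def Item.fixed (p : Item) : Item := { p with status := p.status.fix }

lemma Item.fixed_hasColor (p : Item) (c : Color) : p.fixed.HasColor c ↔ p.HasColor c := by
  rcases p with ⟨_, _, (_ | _ | _), _, _, _⟩ <;> simp [Item.fixed, Status.fix, Item.HasColor]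

lemma Item.fixed_bonus (p : Item) : p.fixed.status = .bonus ↔ p.status = .bonus := by
  rcases p with ⟨_, _, (_ | _ | _), _, _, _⟩ <;> simp [Item.fixed, Status.fix]

lemma Item.fixed_not_prov (p : Item) (c : Color) : p.fixed.status ≠ .prov c := by
  rcases p with ⟨_, _, (_ | _ | _), _, _, _⟩ <;> simp [Item.fixed, Status.fix]

lemma Item.fixed_of_hasColor {p : Item} {c : Color} (h : p.HasColor c) :
    p.fixed.status = .fixed c := by
  rcases h with h | h <;> simp [Item.fixed, h, Status.fix]

@[simp] lemma Item.fixed_size (p : Item) : p.fixed.size = p.size := rfl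
@[simp] lemma Item.fixed_typ (p : Item) : p.fixed.typ = p.typ := rfl
@[simp] lemma Item.fixed_mark (p : Item) : p.fixed.mark = p.mark := rfl

lemma content_fixBin (s : Packing) (b b' : ℕ) :
    content (fixBin s b) b' = if b' = b then (content s b').map Item.fixed else content s b' := by
  unfold fixBin
  rw [content_map (fun p => by split_ifs <;> rfl)]
  split_ifs with h
  · apply Multiset.map_congr rfl; intro p hp
    rw [mem_content] at hp; rw [if_pos (hp.2.trans h)]; rfl
  · conv_rhs => rw [← Multiset.map_id (content s b')]
    apply Multiset.map_congr rfl; intro p hp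
    rw [mem_content] at hp; rw [if_neg (by rw [hp.2]; exact h)]; rfl

namespace Params

variable {P : Params}

lemma colSum_map_fixed (c : Packing) (col : Color) :
    P.colSum (c.map Item.fixed) col = P.colSum c col := by
  unfold colSum
  rw [Multiset.filter_map, Multiset.map_map]
  congr 1
  have : ((fun p => p.HasColor col) ∘ Item.fixed) = fun p : Item => p.HasColor col := by
    funext p; simp [Item.fixed_hasColor]
  simp only [this]; rfl

namespace GoodBin

variable {c : Packing}

/-- An item is added to a bin with items of the other colour only. -/
lemma add_compatible (h : P.GoodBin c) {x : ℝ} (hx : 0 < x ∧ x ≤ 1) {col d : Color} (hcd : col ≠ d)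
    (hr : col = .red → 0 < P.redfrac (P.typeOf x)) (hc : ∀ q ∈ c, q.HasColor d)
    (hne : ∃ q, q ∈ c) (hlast : P.typeOf x ≠ P.N) (hlast' : ∀ q ∈ c, q.typ ≠ P.N)
    (hact : ∀ q ∈ c, ¬ (P.Act q.typ ∧ P.Act (P.typeOf x))) (b : ℕ) :
    P.GoodBin (⟨x, P.typeOf x, .fixed col, none, 0, b⟩ ::ₘ c.map Item.fixed) := by
  obtain ⟨h1, h2⟩ := typeOf_spec (P := P) hx.2
  set p : Item := ⟨x, P.typeOf x, .fixed col, none, 0, b⟩ with hp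
  have hpc : ∀ e, p.HasColor e ↔ col = e := fun e => Item.hasColor_fixed rfl
  have hcol : ∀ a ∈ c, ∀ e, a.HasColor e → e = d := fun a ha e hae => hae.unique (hc a ha)
  obtain ⟨q, hq⟩ := hne
  have hcols : (p.HasColor .blue ∨ ∃ y ∈ c, y.HasColor .blue) ∧
      (p.HasColor .red ∨ ∃ y ∈ c, y.HasColor .red) := by
    rcases col <;> rcases d
    · exact absurd rfl hcd
    · exact ⟨.inr ⟨q, hq, hc q hq⟩, .inl ((hpc _).2 rfl)⟩
    · exact ⟨.inl ((hpc _).2 rfl), .inr ⟨q, hq, hc q hq⟩⟩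
    · exact absurd rfl hcd
  constructor
  case csum =>
    intro e p' hp' he hN
    rw [colSum_cons, colSum_map_fixed]
    by_cases hce : col = e
    · subst hce
      rw [if_pos ((hpc _).2 rfl), mult_of_typ rfl,
        colSum_eq_zero (fun a ha hae => hcd (hcol a ha _ hae))]
      rcases Multiset.mem_cons.1 hp' with rfl | hp'
      · exact one_le_fit_of_pos h1 (typeOf_le x) hr
      · obtain ⟨a, ha, rfl⟩ := Multiset.mem_map.1 hp'
        rw [Item.fixed_hasColor] at he
        exact absurd (hcol a ha _ he) hcd
    · rw [if_neg (by rw [hpc]; exact hce), zero_add]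
      rcases Multiset.mem_cons.1 hp' with rfl | hp'
      · exact absurd ((hpc _).1 he) hce
      · obtain ⟨a, ha, rfl⟩ := Multiset.mem_map.1 hp'
        rw [Item.fixed_hasColor] at he
        exact h.csum e a ha he hN
  all_goals simp only [Multiset.mem_cons, forall_eq_or_imp, exists_eq_or_imp, Multiset.mem_map,
    forall_exists_index, and_imp, forall_apply_eq_imp_iff₂, Item.fixed_size, Item.fixed_typ,
    Item.fixed_mark, Item.fixed_hasColor, exists_exists_and_eq_and]
  · exact ⟨⟨hx.1, hx.2, h1, typeOf_le x⟩, h.item⟩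
  · refine ⟨fun h => absurd rfl h, fun a ha h' => ?_⟩
    obtain ⟨h3, h4, h5, h6⟩ := h.reduced a ha h'
    exact ⟨h3, h4, hcols.1, h6⟩
  · exact ⟨fun h => hr ((hpc _).1 h), h.red_pos⟩
  · exact ⟨by simp [hp], fun a ha e he => absurd he (a.fixed_not_prov e)⟩
  · refine ⟨by simp [hp], fun a ha hb => ?_⟩
    rw [Item.fixed_bonus] at hb
    exact absurd (hc a ha) (Item.not_hasColor_bonus hb)
  · exact ⟨by simp [hp], h.mark⟩
  · intro e
    refine ⟨⟨fun _ _ => trivial, fun a ha he hae => ?_⟩,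
      fun a ha => ⟨fun hae he => ?_, h.same e a ha⟩⟩
    · exact absurd (((hpc e).1 he).trans (hcol a ha e hae)) hcd
    · exact absurd (((hpc e).1 he).trans (hcol a ha e hae)) hcd
  · refine ⟨⟨fun h h' => ?_, fun a ha hb har h3 h4 => hact a ha ⟨h4, h3⟩⟩,
      fun a ha => ⟨fun had hd h3 h4 => hact a ha ⟨h3, h4⟩, h.act_red a ha⟩⟩
    cases h.unique h'
  · exact ⟨fun _ _ _ _ => .inl hcols, fun _ _ _ _ _ _ => .inl hcols⟩
  · exact ⟨fun _ h => absurd h (by simp [hp]), fun a ha h' hm => hcols.1⟩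
  · refine ⟨fun h' => absurd h' hlast, fun a ha h' => absurd h' (hlast' a ha)⟩

/-- A bonus item is added to a bin with a large item. -/
lemma add_bonus (h : P.GoodBin c) {x : ℝ} (hx : 0 < x ∧ x ≤ 1) (ha : P.IsActive (P.typeOf x))
    (hm : ¬ MixedC c) {y : Item} (hy : y ∈ c) (hyb : y.HasColor .blue) (hyl : IsLarge y.size)
    (b : ℕ) : P.GoodBin (⟨x, P.typeOf x, .bonus, none, 0, b⟩ ::ₘ c) := by
  obtain ⟨h1, h2⟩ := typeOf_spec (P := P) hx.2
  have hact : P.Act (P.typeOf x) := ⟨h1, typeOf_le x, ha⟩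
  have hyt := h.typ_eq_of_blue hy hyb
  have hyl' := (isLarge_iff (P := P) (h.item y hy).2.1).1 hyl
  rw [← hyt] at hyl'
  have hblue : ∀ q ∈ c, q.HasColor .blue := by
    intro q hq
    rcases q.color_cases with h' | h' | h'
    · exact h'
    · exact absurd (.inl ⟨⟨y, hy, hyb⟩, q, hq, h'⟩) hm
    · exact absurd (.inr ⟨q, hq, h'⟩) hm
  have hny : ¬ P.Act y.typ := fun h' => absurd hyl' (not_lt.mpr h'.active.1.2)
  have hfix : y.status = .fixed .blue := by
    rcases hyb with h' | h'
    · exact absurd (h.prov y hy _ h').1 hny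
    · exact h'
  -- The bin is unmixed, so all its items are blue, and the large item `y` already uses up `bluefit
  -- = 1`.
  have hcy : c = {y} := by
    obtain ⟨r, rfl⟩ := Multiset.exists_cons_of_mem hy
    have h3 := h.csum .blue y hy hyb (by
      intro h'; rw [h'] at hyl'; have := P.no_straddle_last; linarith)
    have h4 := h.item y hy
    simp only [fit, bluefit_large h4.2.2.1 h4.2.2.2 hyl'] at h3
    rw [colSum_cons, if_pos hyb, mult_of_typ hyt] at h3
    rcases Multiset.empty_or_exists_mem r with rfl | ⟨z, hz⟩
    · rfl
    · have h5 := mult_le_colSum (P := P) hz (hblue z (Multiset.mem_cons_of_mem hz))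
      have h6 := h.one_le_mult (Multiset.mem_cons_of_mem hz)
      omega
  subst hcy
  set p : Item := ⟨x, P.typeOf x, .bonus, none, 0, b⟩ with hp
  have hpc : ∀ e, ¬ p.HasColor e := fun e => Item.not_hasColor_bonus rfl
  constructor
  case csum =>
    intro e p' hp' he hN
    rw [colSum_cons, if_neg (hpc e), zero_add]
    rcases Multiset.mem_cons.1 hp' with rfl | hp'
    · exact absurd he (hpc e)
    · exact h.csum e p' hp' he hN
  case bonus =>
    simp only [Multiset.mem_cons, forall_eq_or_imp, Multiset.mem_singleton, forall_eq]
    refine ⟨fun _ => ⟨hact, rfl, y, rfl, hfix, hyl⟩, fun h' => ?_⟩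
    rw [hfix] at h'; cases h'
  all_goals simp only [Multiset.mem_cons, forall_eq_or_imp, exists_eq_or_imp,
    Multiset.mem_singleton, forall_eq, exists_eq_left]
  · exact ⟨⟨hx.1, hx.2, h1, typeOf_le x⟩, h.item y hy⟩
  · exact ⟨fun h => absurd rfl h, fun h' => absurd hyt h'⟩
  · exact ⟨fun h => absurd h (hpc _), h.red_pos y hy⟩
  · exact ⟨by simp [hp], by simp [hfix]⟩
  · exact ⟨by simp [hp], h.mark y hy⟩
  · simp [hpc]
  · simp only [hpc, false_implies, implies_true, true_and]
    intro h3 h4; cases h3.unique h4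
  · exact ⟨by simp [hp], fun h' => absurd h' hny⟩
  · exact ⟨fun h' => absurd h' (hpc _), fun h' _ => by cases hyb.unique h'⟩
  · refine ⟨fun h' => absurd h' hact.ne_last, fun h' => ?_⟩
    rw [h'] at hyl'; have := P.no_straddle_last; linarith

lemma bonus_y (h : P.GoodBin c) {y : Item} (hy : y ∈ c) (hyb : y.status = .fixed .blue)
    (hyl : IsLarge y.size) : y.typ = P.typeOf y.size ∧ 1 / 2 < P.t y.typ ∧ ¬ P.Act y.typ ∧
      y.typ ≠ P.N ∧ y.mark = none := by
  have hyt := h.typ_eq_of_blue hy (.inr hyb)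
  have hyl' := (isLarge_iff (P := P) (h.item y hy).2.1).1 hyl
  rw [← hyt] at hyl'
  have hny : ¬ P.Act y.typ := fun h' => absurd hyl' (not_lt.mpr h'.active.1.2)
  refine ⟨hyt, hyl', hny, ?_, ?_⟩
  · intro h'; rw [h'] at hyl'; have := P.no_straddle_last; linarith
  · by_contra hm; exact hny (h.mark y hy hm)

/-- A bonus item becomes red. -/
lemma relabel {q q' : Item} (h : P.GoodBin (q ::ₘ c)) (hq : q.status = .bonus)
    (h1 : 1 ≤ q'.typ) (hN : q'.typ ≤ P.N) (hr : 0 < P.redfrac q'.typ) (hs : q'.size = q.size)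
    (hst : q'.status = .fixed .red)
    (ht : q'.typ = q.typ ∨ (¬ P.Act q'.typ ∧ P.typeOf (P.t q'.typ) = q'.typ))
    (hm : q'.mark = none ∨ P.Act q'.typ) :
    P.GoodBin (q' ::ₘ c) := by
  have hqm : q ∈ q ::ₘ c := Multiset.mem_cons_self q c
  obtain ⟨hqa, hqm', y, hc, hyb, hyl⟩ := h.bonus q hqm hq
  have hcy : c = {y} := by
    have : q ::ₘ c = q ::ₘ {y} := hc
    exact (Multiset.cons_inj_right q).1 this
  subst hcy
  have hy : y ∈ q ::ₘ {y} := by simp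
  obtain ⟨hyt, hyl', hny, hyN, hym⟩ := h.bonus_y hy hyb hyl
  have hyc : y.HasColor .blue := .inr hyb
  have hyr : ¬ y.HasColor .red := fun h' => by cases hyc.unique h'
  have hqc : ∀ e, q'.HasColor e ↔ .red = e := fun e => Item.hasColor_fixed hst
  have hqs := h.item q hqm
  have hqt := h.typ_eq_of_act hqm hqa
  constructor
  case csum =>
    intro e p' hp' he hN'
    rw [colSum_cons, colSum_singleton, hqc]
    rcases e
    · rw [if_pos rfl, if_neg hyr, add_zero]
      rcases Multiset.mem_cons.1 hp' with rfl | hp'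
      · have h3 := P.redfit_pos p'.typ h1 hN hr
        simp only [mult, fit]; split_ifs <;> omega
      · rw [Multiset.mem_singleton] at hp'; subst hp'; exact absurd he hyr
    · simp only [reduceCtorEq, if_false, hyc, if_true, mult_of_typ hyt]
      rcases Multiset.mem_cons.1 hp' with rfl | hp'
      · rw [hqc] at he; cases he
      · rw [Multiset.mem_singleton] at hp'; subst hp'
        exact bluefit_pos (h.item p' hy).2.2.1 (h.item p' hy).2.2.2
  all_goals simp only [Multiset.mem_cons, forall_eq_or_imp, exists_eq_or_imp,
    Multiset.mem_singleton, forall_eq, exists_eq_left]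
  · exact ⟨⟨hs ▸ hqs.1, hs ▸ hqs.2.1, h1, hN⟩, h.item y hy⟩
  · refine ⟨fun h' => ⟨(hqc _).2 rfl, ?_⟩, fun h' => absurd hyt h'⟩
    rw [hs] at h'
    rcases ht with ht | ht
    · rw [ht] at h'; exact absurd hqt h'
    · exact ⟨ht.1, .inr hyc, ht.2⟩
  · exact ⟨fun _ => hr, fun h' => absurd h' hyr⟩
  · simp [hst, hyb]
  · simp [hst, hyb]
  · exact ⟨fun h' => hm.resolve_left h', fun h' => absurd hym h'⟩
  · intro e
    simp only [hqc, true_and, implies_true, and_true]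
    exact ⟨fun h' h'' => by subst h'; exact absurd h'' hyr,
      fun h' h'' => by subst h''; exact absurd h' hyr⟩
  · simp [hqc, hny, hyr]
  · exact ⟨fun _ _ _ _ => .inl ⟨.inr hyc, .inl ((hqc _).2 rfl)⟩, fun h' => absurd h' hny⟩
  · exact ⟨fun _ _ => .inr hyc, fun h' => absurd h' hyr⟩
  · exact ⟨fun h' => absurd h' (redfrac_pos_ne_last hr), fun h' => absurd h' hyN⟩

/-- Marks that may be changed without violating `GoodBin`. -/
def _root_.ExtremeHarmonic.Params.Remark (P : Params) (c : Packing) (p p' : Item) : Prop :=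
  p'.size = p.size ∧ p'.typ = p.typ ∧ p'.status = p.status ∧ p'.bin = p.bin ∧
    (p'.mark = p.mark ∨ (p'.mark ≠ none ∧ P.Act p.typ ∧ (∃ col, p.status = .fixed col) ∧
      (p.HasColor .red → p'.mark = some .R → ∃ y ∈ c, y.HasColor .blue)))

/-- Marks enter only through `prov`, `bonus`, `mark`, `unmarked` and `mark_R`. A mark that changes
sits on a definitely coloured item of an active type and is not erased, and a red item gets `R` only
next to a blue one, so all of these survive. -/
lemma remark {c' : Packing} (h : P.GoodBin c) (hr : Multiset.Rel (P.Remark c) c c') :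
    P.GoodBin c' := by
  have hr1 : ∀ p' ∈ c', ∃ p ∈ c, P.Remark c p p' := by
    intro p' hp'
    obtain ⟨p, hp, hpp⟩ := Multiset.exists_mem_of_rel_of_mem (Multiset.rel_flip.2 hr) hp'
    exact ⟨p, hp, hpp⟩
  have hr2 : ∀ p ∈ c, ∃ p' ∈ c', P.Remark c p p' :=
    fun p hp => Multiset.exists_mem_of_rel_of_mem hr hp
  have hcol : ∀ p p', P.Remark c p p' → ∀ e, p'.HasColor e ↔ p.HasColor e := by
    intro p p' hp e; unfold Item.HasColor; rw [hp.2.2.1]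
  have hex : ∀ e, (∃ y ∈ c, y.HasColor e) → ∃ y ∈ c', y.HasColor e := by
    rintro e ⟨y, hy, hye⟩
    obtain ⟨y', hy', hyy⟩ := hr2 y hy
    exact ⟨y', hy', (hcol y y' hyy e).2 hye⟩
  have hsum : ∀ e, P.colSum c' e = P.colSum c e := by
    intro e
    have : ∀ {c c₁ c₂ : Packing}, Multiset.Rel (P.Remark c) c₁ c₂ →
        P.colSum c₂ e = P.colSum c₁ e := by
      intro c c₁ c₂ h
      induction h with
      | zero => rfl
      | cons h1 h2 ih =>
        rename_i p p' _ _
        have hm : P.mult p' = P.mult p := by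
          have hred : P.Reduced p' ↔ P.Reduced p := by simp only [Reduced, h1.1, h1.2.1]
          unfold mult; rw [h1.2.1]; exact if_congr hred rfl rfl
        have hc : p'.HasColor e ↔ p.HasColor e := by unfold Item.HasColor; rw [h1.2.2.1]
        rw [colSum_cons, colSum_cons, ih, hm]
        simp only [hc]
    exact this hr
  constructor
  · intro p' hp'
    obtain ⟨p, hp, hpp⟩ := hr1 p' hp'
    rw [hpp.1, hpp.2.1]; exact h.item p hp
  · intro p' hp' ht
    obtain ⟨p, hp, hpp⟩ := hr1 p' hp'
    rw [hpp.1, hpp.2.1] at ht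
    obtain ⟨h1, h2, h3, h4⟩ := h.reduced p hp ht
    rw [hpp.2.1]
    exact ⟨(hcol p p' hpp _).2 h1, h2, hex _ h3, h4⟩
  · intro p' hp' hc
    obtain ⟨p, hp, hpp⟩ := hr1 p' hp'
    rw [hpp.2.1]; exact h.red_pos p hp ((hcol p p' hpp _).1 hc)
  · intro p' hp' col hc
    obtain ⟨p, hp, hpp⟩ := hr1 p' hp'
    rw [hpp.2.2.1] at hc
    obtain ⟨h1, h2, h3⟩ := h.prov p hp col hc
    rw [hpp.2.1]
    refine ⟨h1, ?_, ?_⟩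
    · rcases hpp.2.2.2.2 with h4 | ⟨-, -, ⟨e, h4⟩, -⟩
      · rw [h4, h2]
      · rw [hc] at h4; cases h4
    · rw [h3, ← Multiset.cons_zero] at hr
      obtain ⟨a, t, h4, h5, h6⟩ := Multiset.rel_cons_left.1 hr
      rw [Multiset.rel_zero_left] at h5
      subst h5; subst h6
      rw [Multiset.cons_zero, Multiset.mem_singleton] at hp'
      rw [hp']; rfl
  · intro p' hp' hb
    obtain ⟨p, hp, hpp⟩ := hr1 p' hp'
    rw [hpp.2.2.1] at hb
    obtain ⟨h1, h2, y, h3, h4, h5⟩ := h.bonus p hp hb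
    rw [hpp.2.1]
    have hy : y ∈ c := by rw [h3]; simp
    refine ⟨h1, ?_, ?_⟩
    · rcases hpp.2.2.2.2 with h6 | ⟨-, -, ⟨e, h6⟩, -⟩
      · rw [h6, h2]
      · rw [hb] at h6; cases h6
    · have hr' := hr
      rw [h3] at hr'
      have hr'' : Multiset.Rel (P.Remark {p, y}) (p ::ₘ y ::ₘ 0) c' := hr'
      obtain ⟨a, t, h6, h7, h8⟩ := Multiset.rel_cons_left.1 hr''
      obtain ⟨a', t', h9, h10, h11⟩ := Multiset.rel_cons_left.1 h7
      rw [Multiset.rel_zero_left] at h10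
      subst h10; subst h11; subst h8
      have hpa : p' = a := by
        rw [Multiset.mem_cons, Multiset.cons_zero, Multiset.mem_singleton] at hp'
        rcases hp' with hp' | hp'
        · exact hp'
        · exfalso
          subst hp'
          have h12 := h9.2.2.1
          rw [hpp.2.2.1, hb, h4] at h12; cases h12
      subst hpa
      exact ⟨a', rfl, h9.2.2.1.trans h4, by rw [h9.1]; exact h5⟩
  · intro p' hp' hm
    obtain ⟨p, hp, hpp⟩ := hr1 p' hp'
    rw [hpp.2.1]
    rcases hpp.2.2.2.2 with h6 | ⟨-, h6, -⟩
    · rw [h6] at hm; exact h.mark p hp hm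
    · exact h6
  · intro col p' hp' q' hq' hpc hqc
    obtain ⟨p, hp, hpp⟩ := hr1 p' hp'
    obtain ⟨q, hq, hqq⟩ := hr1 q' hq'
    rw [hpp.2.1, hqq.2.1]
    exact h.same col p hp q hq ((hcol p p' hpp _).1 hpc) ((hcol q q' hqq _).1 hqc)
  · intro p' hp' q' hq' hpc hqc
    obtain ⟨p, hp, hpp⟩ := hr1 p' hp'
    obtain ⟨q, hq, hqq⟩ := hr1 q' hq'
    rw [hpp.2.1, hqq.2.1]
    exact h.act_red p hp q hq ((hcol p p' hpp _).1 hpc) ((hcol q q' hqq _).1 hqc)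
  · intro col p' hp' hpc
    obtain ⟨p, hp, hpp⟩ := hr1 p' hp'
    rw [hsum, hpp.2.1]
    exact h.csum col p hp ((hcol p p' hpp _).1 hpc)
  · intro p' hp' ha hm col hs
    obtain ⟨p, hp, hpp⟩ := hr1 p' hp'
    rw [hpp.2.1] at ha ⊢
    rw [hpp.2.2.1] at hs
    have hm' : p.mark = none := by
      rcases hpp.2.2.2.2 with h6 | ⟨h6, -⟩
      · rw [← h6, hm]
      · exact absurd hm h6
    rcases h.unmarked p hp ha hm' col hs with ⟨h1, h2⟩ | ⟨q, hq, h1, h2⟩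
    · exact .inl ⟨hex _ h1, hex _ h2⟩
    · obtain ⟨q', hq', hqq⟩ := hr2 q hq
      refine .inr ⟨q', hq', hqq.2.1.trans h1, ?_⟩
      rcases hqq.2.2.2.2 with h6 | ⟨h6, -⟩
      · rw [h6]; exact h2
      · exact h6
  · intro p' hp' hc hm
    obtain ⟨p, hp, hpp⟩ := hr1 p' hp'
    have hc' := (hcol p p' hpp _).1 hc
    rcases hpp.2.2.2.2 with h6 | ⟨-, -, -, h6⟩
    · rw [h6] at hm; exact hex _ (h.mark_R p hp hc' hm)
    · exact hex _ (h6 hc' hm)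
  · intro p' hp' ht q' hq'
    obtain ⟨p, hp, hpp⟩ := hr1 p' hp'
    obtain ⟨q, hq, hqq⟩ := hr1 q' hq'
    rw [hqq.2.1]; rw [hpp.2.1] at ht
    exact h.last p hp ht q hq

lemma _root_.ExtremeHarmonic.Params.Remark.refl (c : Packing) (p : Item) : P.Remark c p p :=
  ⟨rfl, rfl, rfl, rfl, .inl rfl⟩

/-- The mark of one item changes. -/
lemma remark_cons {p p' : Item} (h : P.GoodBin (p ::ₘ c)) (hr : P.Remark (p ::ₘ c) p p') :
    P.GoodBin (p' ::ₘ c) :=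
  h.remark (Multiset.Rel.cons hr (Multiset.rel_refl_of_refl_on fun q _ => Remark.refl _ q))

lemma remark_map {g : Item → Item} (h : P.GoodBin c) (hr : ∀ p ∈ c, P.Remark c p (g p)) :
    P.GoodBin (c.map g) := by
  refine h.remark (Multiset.rel_map_right.2 ?_)
  exact Multiset.rel_refl_of_refl_on hr

end GoodBin

end Params

/-! ### Kinds of bins with respect to an active type -/

/-- The bins that are in use. -/
def bins (s : Packing) : Finset ℕ := (s.map Item.bin).toFinset

lemma mem_bins {s : Packing} {b : ℕ} : b ∈ bins s ↔ ∃ p ∈ s, p.bin = b := by simp [bins]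

lemma content_eq_zero {s : Packing} {b : ℕ} (h : b ∉ bins s) : content s b = 0 := by
  rw [mem_bins] at h; push Not at h
  exact Multiset.filter_eq_nil.2 h

lemma content_ne_zero {s : Packing} {b : ℕ} : content s b ≠ 0 ↔ b ∈ bins s := by
  constructor
  · intro h; by_contra hc; exact h (content_eq_zero hc)
  · rw [mem_bins]; rintro ⟨p, hp, rfl⟩ h
    have : p ∈ content s p.bin := by simp [hp]
    rw [h] at this; simp at this

lemma numBins_eq (s : Packing) : numBins s = (bins s).card := by
  unfold numBins bins; congr

lemma sum_content {M : Type*} [AddCommMonoid M] (f : Item → M) (s : Packing) {U : Finset ℕ}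
    (hU : bins s ⊆ U) : ∑ b ∈ U, ((content s b).map f).sum = (s.map f).sum := by
  induction s using Multiset.induction_on with
  | empty => simp [content]
  | cons p s ih =>
    have hp : p.bin ∈ U := hU (mem_bins.2 ⟨p, by simp, rfl⟩)
    have hs : bins s ⊆ U := fun b hb => by
      obtain ⟨q, hq, rfl⟩ := mem_bins.1 hb
      exact hU (mem_bins.2 ⟨q, by simp [hq], rfl⟩)
    rw [Multiset.map_cons, Multiset.sum_cons, ← ih hs]
    have : ∀ b, ((content (p ::ₘ s) b).map f).sum =
        (if p.bin = b then f p else 0) + ((content s b).map f).sum := by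
      intro b; rw [content_cons]; split_ifs <;> simp
    simp only [this, Finset.sum_add_distrib]
    rw [Finset.sum_ite_eq U p.bin, if_pos hp]

/-- The kinds of bins with respect to an active type `i`: `O` has no items of type `i`, `PB` and
`PR` have one provisionally blue or red one, `U1`, `U2`, `RU` have one or two definitely blue or one
red unmarked ones, and in the other cases the blue or red ones are marked.  `XR` and `XN` have one
marked blue item and an unmarked one. -/
inductive Kind
  | O | PB | PR | U1 | U2 | R1 | R2 | N1 | N2 | B2 | RU | RR | RN | RB | XR | XN
  deriving DecidableEq

namespace Kind

/-- The colours and marks of the items of type `i`. -/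
def ms : Kind → Multiset (Status × Option Mark)
  | O => 0
  | PB => {(.prov .blue, none)}
  | PR => {(.prov .red, none)}
  | U1 => {(.fixed .blue, none)}
  | U2 => {(.fixed .blue, none), (.fixed .blue, none)}
  | R1 => {(.fixed .blue, some .R)}
  | R2 => {(.fixed .blue, some .R), (.fixed .blue, some .R)}
  | N1 => {(.fixed .blue, some .N)}
  | N2 => {(.fixed .blue, some .N), (.fixed .blue, some .N)}
  | B2 => {(.fixed .blue, some .B), (.fixed .blue, some .B)}
  | RU => {(.fixed .red, none)}
  | RR => {(.fixed .red, some .R)}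
  | RN => {(.fixed .red, some .N)}
  | RB => {(.fixed .red, some .B)}
  | XR => {(.fixed .blue, none), (.fixed .blue, some .R)}
  | XN => {(.fixed .blue, none), (.fixed .blue, some .N)}

/-- An arbitrary numbering of colours and marks. -/
def markCode : Status × Option Mark → ℕ
  | (.prov .blue, _) => 0
  | (.prov .red, _) => 1
  | (.bonus, _) => 2
  | (.fixed .blue, none) => 3
  | (.fixed .blue, some .R) => 4
  | (.fixed .blue, some .N) => 5
  | (.fixed .blue, some .B) => 6
  | (.fixed .red, none) => 7
  | (.fixed .red, some .R) => 8
  | (.fixed .red, some .N) => 9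
  | (.fixed .red, some .B) => 10

/-- The numbers of the colours and marks. -/
def code : Kind → Multiset ℕ
  | O => 0
  | PB => {0}
  | PR => {1}
  | U1 => {3}
  | U2 => {3, 3}
  | R1 => {4}
  | R2 => {4, 4}
  | N1 => {5}
  | N2 => {5, 5}
  | B2 => {6, 6}
  | RU => {7}
  | RR => {8}
  | RN => {9}
  | RB => {10}
  | XR => {3, 4}
  | XN => {3, 5}

lemma map_markCode (k : Kind) : k.ms.map markCode = k.code := by
  cases k <;> simp [ms, code, markCode]

/-- All kinds. -/
def all : Finset Kind :=
  {O, PB, PR, U1, U2, R1, R2, N1, N2, B2, RU, RR, RN, RB, XR, XN}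

lemma mem_all (k : Kind) : k ∈ all := by cases k <;> simp [all]

/-- Passing to numbers turns the injectivity of `ms` into a finite check. The numbering need not
separate all pairs of colour and mark, only those that occur in the kinds. -/
lemma code_injective : ∀ k ∈ all, ∀ k' ∈ all, k.code = k'.code → k = k' := by decide

lemma ms_injective {k k' : Kind} (h : k.ms = k'.ms) : k = k' := by
  apply code_injective k (mem_all k) k' (mem_all k')
  rw [← map_markCode, ← map_markCode, h]

lemma ms_eq_iff {k k' : Kind} : k.ms = k'.ms ↔ k = k' := ⟨ms_injective, fun h => h ▸ rfl⟩

/-- The kinds of bins that occur after the marking and colouring procedure. -/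
def Rest (k : Kind) : Prop := k ≠ XR ∧ k ≠ XN

end Kind

/-! ### Counting items through the kinds of their bins -/

/-- The colours and marks of the items of type `i` among `c`. -/
def sg (i : ℕ) (c : Packing) : Multiset (Status × Option Mark) :=
  (c.filter (fun p => p.typ = i ∧ p.status ≠ .bonus)).map (fun p => (p.status, p.mark))

lemma sg_zero (i : ℕ) : sg i 0 = 0 := by simp [sg]

lemma sg_cons (i : ℕ) (p : Item) (c : Packing) : sg i (p ::ₘ c) =
    if p.typ = i ∧ p.status ≠ .bonus then (p.status, p.mark) ::ₘ sg i c else sg i c := by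
  unfold sg; rw [Multiset.filter_cons]; split_ifs <;> simp

lemma sg_cons_pos {i : ℕ} {p : Item} {c : Packing} (h : p.typ = i) (hb : p.status ≠ .bonus) :
    sg i (p ::ₘ c) = (p.status, p.mark) ::ₘ sg i c := by
  rw [sg_cons, if_pos ⟨h, hb⟩]

lemma sg_cons_neg {i : ℕ} {p : Item} {c : Packing} (h : p.typ ≠ i ∨ p.status = .bonus) :
    sg i (p ::ₘ c) = sg i c := by
  rw [sg_cons, if_neg]; rintro ⟨h1, h2⟩; rcases h with h | h
  · exact h h1
  · exact h2 h

lemma sg_eq_zero {i : ℕ} {c : Packing} (h : ∀ p ∈ c, p.typ ≠ i ∨ p.status = .bonus) :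
    sg i c = 0 := by
  unfold sg
  rw [Multiset.filter_eq_nil.2, Multiset.map_zero]
  rintro p hp ⟨h1, h2⟩
  rcases h p hp with h | h
  · exact h h1
  · exact h2 h

lemma mem_sg {i : ℕ} {c : Packing} {p : Item} (hp : p ∈ c) (h : p.typ = i)
    (hb : p.status ≠ .bonus) : (p.status, p.mark) ∈ sg i c :=
  Multiset.mem_map_of_mem (fun p : Item => (p.status, p.mark))
    (Multiset.mem_filter.2 ⟨hp, h, hb⟩)

lemma exists_of_mem_sg {i : ℕ} {c : Packing} {st : Status} {m : Option Mark}
    (h : (st, m) ∈ sg i c) : ∃ p ∈ c, p.typ = i ∧ p.status = st ∧ p.mark = m ∧ st ≠ .bonus := by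
  unfold sg at h
  obtain ⟨p, hp, he⟩ := Multiset.mem_map.1 h
  rw [Multiset.mem_filter] at hp
  simp only [Prod.mk.injEq] at he
  exact ⟨p, hp.1, hp.2.1, he.1, he.2, he.1 ▸ hp.2.2⟩

/-- Every bin has one of the kinds with respect to type `i`. -/
def Kinded (s : Packing) (i : ℕ) : Prop := ∀ b, ∃ k : Kind, sg i (content s b) = k.ms

/-- Every bin has one of the kinds without bins with one marked blue item and an unmarked one. -/
def KindedRest (s : Packing) (i : ℕ) : Prop :=
  ∀ b, ∃ k : Kind, k.Rest ∧ sg i (content s b) = k.ms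

lemma KindedRest.kinded {s : Packing} {i : ℕ} (h : KindedRest s i) : Kinded s i :=
  fun b => let ⟨k, _, hk⟩ := h b; ⟨k, hk⟩

/-- The number of bins of kind `k`. -/
def kcount (s : Packing) (i : ℕ) (k : Kind) : ℕ := {b | sg i (content s b) = k.ms}.ncard

/-- All unused bin numbers have kind `O`, so the set counted for `O` is infinite and `ncard` takes
its default value 0 there. For every other kind only bins in use contribute; this is why `O` is
excluded throughout. -/
lemma kcount_eq {s : Packing} {i : ℕ} {k : Kind} (hk : k ≠ .O) {U : Finset ℕ} (hU : bins s ⊆ U) :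
    kcount s i k = (U.filter (fun b => sg i (content s b) = k.ms)).card := by
  unfold kcount
  rw [← Set.ncard_coe_finset]
  congr 1
  ext b
  simp only [Set.mem_ofPred_eq, Finset.coe_filter]
  refine ⟨fun h => ⟨?_, h⟩, fun h => h.2⟩
  by_contra hb
  rw [content_eq_zero (fun h' => hb (hU h')), sg_zero] at h
  exact hk (Kind.ms_injective (k := .O) h).symm

/-- Bins outside `T` contribute equally to both counts. The additive form avoids subtraction of
natural numbers. -/
lemma kcount_change {s s' : Packing} {i : ℕ} (T : Finset ℕ)
    (h : ∀ b ∉ T, sg i (content s' b) = sg i (content s b)) {k : Kind} (hk : k ≠ .O) :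
    kcount s' i k + (T.filter (fun b => sg i (content s b) = k.ms)).card =
      kcount s i k + (T.filter (fun b => sg i (content s' b) = k.ms)).card := by
  have hU : T ⊆ bins s ∪ bins s' ∪ T := Finset.subset_union_right
  rw [kcount_eq hk (U := bins s ∪ bins s' ∪ T) (by intro b; simp +contextual),
    kcount_eq hk (s := s) (U := bins s ∪ bins s' ∪ T) (by intro b; simp +contextual)]
  generalize bins s ∪ bins s' ∪ T = U at hU
  have key : ∀ s : Packing, (U.filter (fun b => sg i (content s b) = k.ms)).card =
      (T.filter (fun b => sg i (content s b) = k.ms)).card +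
        ((U \ T).filter (fun b => sg i (content s b) = k.ms)).card := by
    intro s
    rw [← Finset.card_union_of_disjoint, ← Finset.filter_union, Finset.union_sdiff_of_subset hU]
    exact Finset.disjoint_filter_filter Finset.disjoint_sdiff
  rw [key s, key s']
  have : (U \ T).filter (fun b => sg i (content s' b) = k.ms) =
      (U \ T).filter (fun b => sg i (content s b) = k.ms) := by
    apply Finset.filter_congr
    intro b hb; rw [h b (Finset.mem_sdiff.1 hb).2]
  rw [this]; omega

/-- `x` bins change their kind from `k` to `k'`. -/
def Move (x : ℕ) (k k' : Kind) (a a' : Kind → ℕ) : Prop :=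
  ∀ l, l ≠ .O → a' l + (if k = l then x else 0) = a l + (if k' = l then x else 0)

lemma Move.refl (k k' : Kind) (a : Kind → ℕ) : Move 0 k k' a a := by intro l _; simp

lemma kcount_move {s s' : Packing} {i : ℕ} (T : Finset ℕ) {k k' : Kind}
    (h : ∀ b ∉ T, sg i (content s' b) = sg i (content s b))
    (h1 : ∀ b ∈ T, sg i (content s b) = k.ms) (h2 : ∀ b ∈ T, sg i (content s' b) = k'.ms) :
    Move T.card k k' (kcount s i) (kcount s' i) := by
  intro l hl
  have := kcount_change T h hl
  rw [Finset.filter_congr (q := fun _ => k = l), Finset.filter_congr (s := T)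
    (p := fun b => sg i (content s' b) = l.ms) (q := fun _ => k' = l)] at this
  · simpa [Finset.filter_const, apply_ite Finset.card] using this
  · intro b hb; rw [h2 b hb, Kind.ms_eq_iff]
  · intro b hb; rw [h1 b hb, Kind.ms_eq_iff]

lemma kcount_move_one {s s' : Packing} {i : ℕ} (b : ℕ) {k k' : Kind}
    (h : ∀ b' ≠ b, sg i (content s' b') = sg i (content s b'))
    (h1 : sg i (content s b) = k.ms) (h2 : sg i (content s' b) = k'.ms) :
    Move 1 k k' (kcount s i) (kcount s' i) := by
  have := kcount_move {b} (k := k) (k' := k') (s := s) (s' := s') (i := i)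
    (by simpa using h) (by simpa using h1) (by simpa using h2)
  simpa using this

/-- Items are grouped by bins and bins by kinds. Hence all numbers of items of type `i` that the
algorithm looks at are fixed linear functions of the vector of kind counts, and the analysis can
forget the packing. -/
lemma sum_eq_kcount {s : Packing} {i : ℕ} (h : Kinded s i) (g : Status × Option Mark → ℕ) :
    ((s.filter (fun p => p.typ = i ∧ p.status ≠ .bonus)).map (fun p => g (p.status, p.mark))).sum =
      ∑ k ∈ Kind.all, kcount s i k * (k.ms.map g).sum := by
  choose κ hκ using h
  have h1 : ((s.filter (fun p => p.typ = i ∧ p.status ≠ .bonus)).map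
      (fun p => g (p.status, p.mark))).sum = ∑ b ∈ bins s, ((κ b).ms.map g).sum := by
    have hsub : bins (s.filter (fun p => p.typ = i ∧ p.status ≠ .bonus)) ⊆ bins s := by
      intro b; rw [mem_bins, mem_bins]; rintro ⟨p, hp, rfl⟩
      exact ⟨p, (Multiset.mem_filter.1 hp).1, rfl⟩
    rw [← sum_content _ _ hsub]
    refine Finset.sum_congr rfl fun b _ => ?_
    rw [← hκ b]
    unfold sg content
    rw [Multiset.map_map, Multiset.filter_comm]; rfl
  rw [h1, ← Finset.sum_fiberwise_of_maps_to (g := κ) (t := Kind.all) (fun b _ => Kind.mem_all _)]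
  refine Finset.sum_congr rfl fun k _ => ?_
  rw [Finset.sum_congr rfl (g := fun _ => (k.ms.map g).sum), Finset.sum_const, smul_eq_mul]
  · by_cases hk : k = .O
    · subst hk; simp [Kind.ms]
    · rw [kcount_eq hk (Finset.Subset.refl _)]
      congr 2
      apply Finset.filter_congr
      intro b _; rw [hκ b, Kind.ms_eq_iff]
  · intro b hb; rw [(Finset.mem_filter.1 hb).2]

lemma sum_map_ite_card {A : Type*} (t : Multiset A) (Q : A → Prop) [DecidablePred Q] :
    (t.map (fun q => if Q q then 1 else 0)).sum = (t.filter Q).card := by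
  induction t using Multiset.induction_on with
  | empty => simp
  | cons a t ih =>
    rw [Multiset.map_cons, Multiset.sum_cons, ih, Multiset.filter_cons]
    split_ifs <;> simp [add_comm]

lemma card_eq_kcount {s : Packing} {i : ℕ} (h : Kinded s i) {R : Item → Prop} [DecidablePred R]
    (Q : Status × Option Mark → Prop) [DecidablePred Q]
    (hR : ∀ p ∈ s, R p ↔ p.typ = i ∧ p.status ≠ .bonus ∧ Q (p.status, p.mark)) :
    (s.filter R).card = ∑ k ∈ Kind.all, kcount s i k * (k.ms.filter Q).card := by
  have h1 := sum_eq_kcount h (fun q => if Q q then 1 else 0)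
  simp only [sum_map_ite_card] at h1
  rw [← h1, Multiset.filter_filter]
  congr 1
  apply Multiset.filter_congr
  intro p hp; rw [hR p hp]; tauto

namespace Kind

/-- The number of items in a family of bins with the given numbers of bins of each kind. -/
def tot (a : Kind → ℕ) : ℕ := a PB + a PR + a U1 + 2 * a U2 + a R1 + 2 * a R2 + a N1 + 2 * a N2 +
  2 * a B2 + a RU + a RR + a RN + a RB + 2 * a XR + 2 * a XN

/-- The number of red items. -/
def red (a : Kind → ℕ) : ℕ := a PR + a RU + a RR + a RN + a RB

/-- The number of items with mark `m`. -/
def totMark (a : Kind → ℕ) : Mark → ℕ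
  | .R => a R1 + 2 * a R2 + a RR + a XR
  | .N => a N1 + 2 * a N2 + a RN + a XN
  | .B => 2 * a B2 + a RB

/-- The kind of the bins with a red item with mark `m`. -/
def redKind : Option Mark → Kind
  | none => RU
  | some .R => RR
  | some .N => RN
  | some .B => RB

/-- The kind of the bins with two blue items with mark `m`. -/
def pairKind : Option Mark → Kind
  | none => U2
  | some .R => R2
  | some .N => N2
  | some .B => B2

end Kind

/-- The bin `b` has one of the conditions that hold at any time. -/
def GoodBins (P : Params) (s : Packing) : Prop := ∀ b, P.GoodBin (content s b)

lemma mem_content_self {s : Packing} {p : Item} (h : p ∈ s) : p ∈ content s p.bin := by simp [h]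

namespace Params

variable {P : Params} {s : Packing} {i : ℕ}

lemma sum_mult_eq (hi : P.Act i) {R : Item → Prop} [DecidablePred R] (hR : ∀ p, R p → p.typ = i) :
    ((s.filter R).map P.mult).sum = (s.filter R).card := by
  rw [Multiset.map_congr rfl (g := fun _ => 1), Multiset.map_const', Multiset.sum_replicate,
    smul_eq_mul, mul_one]
  intro p hp
  rw [Multiset.mem_filter] at hp
  exact mult_of_act (hR p hp.2 ▸ hi)

lemma nTot_eq (hi : P.Act i) (h : Kinded s i) : P.nTot s i = Kind.tot (kcount s i) := by
  unfold nTot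
  rw [sum_mult_eq hi (fun _ h => h.1), card_eq_kcount h (fun _ => True)]
  · simp [Kind.all, Kind.ms, Kind.tot]; ring
  · simp

lemma nRed_eq (hi : P.Act i) (h : Kinded s i) : P.nRed s i = Kind.red (kcount s i) := by
  unfold nRed
  rw [sum_mult_eq hi (fun _ h => h.1),
    card_eq_kcount h (fun q => q.1 = .prov .red ∨ q.1 = .fixed .red)]
  · simp [Kind.all, Kind.ms, Kind.red, Multiset.filter_singleton]; ring
  · intro p _
    constructor
    · exact fun h => ⟨h.1, h.2.not_bonus, h.2⟩
    · exact fun h => ⟨h.1, h.2.2⟩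

end Params

lemma nTotMark_eq {P : Params} {s : Packing} {i : ℕ} (hg : GoodBins P s) (h : Kinded s i)
    (m : Mark) : nTotMark s i m = Kind.totMark (kcount s i) m := by
  unfold nTotMark
  rw [card_eq_kcount h (fun q => q.2 = some m)]
  · cases m <;> simp [Kind.all, Kind.ms, Kind.totMark, Multiset.filter_singleton] <;> ring
  · intro p hp
    constructor
    · refine fun h => ⟨h.1, fun hb => ?_, h.2⟩
      have := ((hg p.bin).bonus p (mem_content_self hp) hb).2.1
      rw [this] at h; cases h.2
    · exact fun h => ⟨h.1, h.2.2⟩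

lemma nRedMark_eq {s : Packing} {i : ℕ} (h : Kinded s i)
    (m : Mark) : nRedMark s i m = kcount s i (Kind.redKind (some m)) := by
  unfold nRedMark
  rw [card_eq_kcount h (fun q => q.2 = some m ∧ (q.1 = .prov .red ∨ q.1 = .fixed .red))]
  · cases m <;> simp [Kind.all, Kind.ms, Kind.redKind, Multiset.filter_singleton]
  · intro p hp
    constructor
    · exact fun h => ⟨h.1, h.2.2.not_bonus, h.2⟩
    · exact fun h => ⟨h.1, h.2.2⟩

lemma card_prov_eq {s : Packing} {i : ℕ} (h : Kinded s i) (c : Color) :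
    (s.filter (fun p => p.typ = i ∧ p.status = .prov c)).card =
      kcount s i (match c with | .red => .PR | .blue => .PB) := by
  rw [card_eq_kcount h (fun q => q.1 = .prov c)]
  · cases c <;> simp [Kind.all, Kind.ms, Multiset.filter_singleton]
  · intro p hp
    constructor
    · exact fun h => ⟨h.1, by simp [h.2], h.2⟩
    · exact fun h => ⟨h.1, h.2.2⟩

/-! ### The numbers of bins of each kind -/

namespace Kind

/-- The minimum `x` with `⌊α (n + 2 x + 1)⌋ > r`. -/
def xt (α : ℝ) (n r : ℕ) : ℕ := sInf {x : ℕ | r < ⌊α * ((n : ℝ) + 2 * x + 1)⌋₊}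

/-- The minimum `x` with `⌊α (n + x + 1)⌋ > r`. -/
def xo (α : ℝ) (n r : ℕ) : ℕ := sInf {x : ℕ | r < ⌊α * ((n : ℝ) + x + 1)⌋₊}

variable {α : ℝ}

/-- These are membership of the minimum and failure of its predecessor, with the floor removed. All
estimates for marking steps use only these two inequalities; the second one is not available for `x
= 0`, where the old bounds take over. -/
lemma xt_spec (hα : 0 < α) (n r : ℕ) : (r : ℝ) + 1 ≤ α * (n + 2 * xt α n r + 1) ∧
    (xt α n r ≠ 0 → α * (n + 2 * xt α n r - 1) < r + 1) := by
  have hne : {x : ℕ | r < ⌊α * ((n : ℝ) + 2 * x + 1)⌋₊}.Nonempty := by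
    obtain ⟨x, hx⟩ := exists_nat_ge ((r + 1) / α)
    refine ⟨x, ?_⟩
    rw [div_le_iff₀ hα] at hx
    change r + 1 ≤ _
    rw [Nat.le_floor_iff (by positivity)]
    push_cast
    have : 0 ≤ α * n := by positivity
    have : 0 ≤ α * x := by positivity
    nlinarith
  constructor
  · have h := Nat.sInf_mem hne
    change r + 1 ≤ _ at h
    rw [Nat.le_floor_iff (by positivity)] at h
    push_cast at h
    exact h
  · intro h0
    have h := Nat.notMem_of_lt_sInf (s := {x : ℕ | r < ⌊α * ((n : ℝ) + 2 * x + 1)⌋₊})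
      (m := xt α n r - 1) (by change _ < xt α n r; omega)
    change ¬ (r < _) at h
    rw [not_lt, ← Nat.lt_succ_iff, Nat.floor_lt (by positivity)] at h
    have h1 : ((xt α n r - 1 : ℕ) : ℝ) = xt α n r - 1 := by
      rw [Nat.cast_sub (by omega)]; simp
    rw [h1] at h
    push_cast at h
    linarith

lemma xo_spec (hα : 0 < α) (n r : ℕ) : (r : ℝ) + 1 ≤ α * (n + xo α n r + 1) ∧
    (xo α n r ≠ 0 → α * (n + xo α n r) < r + 1) := by
  have hne : {x : ℕ | r < ⌊α * ((n : ℝ) + x + 1)⌋₊}.Nonempty := by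
    obtain ⟨x, hx⟩ := exists_nat_ge ((r + 1) / α)
    refine ⟨x, ?_⟩
    rw [div_le_iff₀ hα] at hx
    change r + 1 ≤ _
    rw [Nat.le_floor_iff (by positivity)]
    push_cast
    have : 0 ≤ α * n := by positivity
    nlinarith
  constructor
  · have h := Nat.sInf_mem hne
    change r + 1 ≤ _ at h
    rw [Nat.le_floor_iff (by positivity)] at h
    push_cast at h
    exact h
  · intro h0
    have h := Nat.notMem_of_lt_sInf (s := {x : ℕ | r < ⌊α * ((n : ℝ) + x + 1)⌋₊})
      (m := xo α n r - 1) (by change _ < xo α n r; omega)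
    change ¬ (r < _) at h
    rw [not_lt, ← Nat.lt_succ_iff, Nat.floor_lt (by positivity)] at h
    have h1 : ((xo α n r - 1 : ℕ) : ℝ) = xo α n r - 1 := by
      rw [Nat.cast_sub (by omega)]; simp
    rw [h1] at h
    push_cast at h
    linarith

lemma _root_.ExtremeHarmonic.Move.real {x : ℕ} {k k' : Kind} {a a' : Kind → ℕ}
    (h : Move x k k' a a') : ∀ l, l ≠ .O → (a' l : ℝ) =
      a l + (if k' = l then (x : ℝ) else 0) - (if k = l then (x : ℝ) else 0) := by
  intro l hl
  have := h l hl
  split_ifs at this ⊢ <;> (rw [eq_sub_iff_add_eq]; exact_mod_cast this)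

lemma _root_.ExtremeHarmonic.Move.eqs {x : ℕ} {k k' : Kind} {a a' : Kind → ℕ}
    (h : Move x k k' a a') :
    (a' PB : ℝ) = a PB + (if k' = PB then (x : ℝ) else 0) - (if k = PB then (x : ℝ) else 0) ∧
    (a' PR : ℝ) = a PR + (if k' = PR then (x : ℝ) else 0) - (if k = PR then (x : ℝ) else 0) ∧
    (a' U1 : ℝ) = a U1 + (if k' = U1 then (x : ℝ) else 0) - (if k = U1 then (x : ℝ) else 0) ∧
    (a' U2 : ℝ) = a U2 + (if k' = U2 then (x : ℝ) else 0) - (if k = U2 then (x : ℝ) else 0) ∧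
    (a' R1 : ℝ) = a R1 + (if k' = R1 then (x : ℝ) else 0) - (if k = R1 then (x : ℝ) else 0) ∧
    (a' R2 : ℝ) = a R2 + (if k' = R2 then (x : ℝ) else 0) - (if k = R2 then (x : ℝ) else 0) ∧
    (a' N1 : ℝ) = a N1 + (if k' = N1 then (x : ℝ) else 0) - (if k = N1 then (x : ℝ) else 0) ∧
    (a' N2 : ℝ) = a N2 + (if k' = N2 then (x : ℝ) else 0) - (if k = N2 then (x : ℝ) else 0) ∧
    (a' B2 : ℝ) = a B2 + (if k' = B2 then (x : ℝ) else 0) - (if k = B2 then (x : ℝ) else 0) ∧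
    (a' RU : ℝ) = a RU + (if k' = RU then (x : ℝ) else 0) - (if k = RU then (x : ℝ) else 0) ∧
    (a' RR : ℝ) = a RR + (if k' = RR then (x : ℝ) else 0) - (if k = RR then (x : ℝ) else 0) ∧
    (a' RN : ℝ) = a RN + (if k' = RN then (x : ℝ) else 0) - (if k = RN then (x : ℝ) else 0) ∧
    (a' RB : ℝ) = a RB + (if k' = RB then (x : ℝ) else 0) - (if k = RB then (x : ℝ) else 0) ∧
    (a' XR : ℝ) = a XR + (if k' = XR then (x : ℝ) else 0) - (if k = XR then (x : ℝ) else 0) ∧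
    (a' XN : ℝ) = a XN + (if k' = XN then (x : ℝ) else 0) - (if k = XN then (x : ℝ) else 0) := by
  refine ⟨?_, ?_, ?_, ?_, ?_, ?_, ?_, ?_, ?_, ?_, ?_, ?_, ?_, ?_, ?_⟩ <;>
    exact h.real _ (by simp)

/-- The deficits of red items among the items with the three marks, where for `R` and `N` the items
are counted that can still be added to the bins with blue ones. -/
def gapR (α : ℝ) (a : Kind → ℕ) : ℝ := α * (2 * a R1 + 2 * a R2 + a RR) - a RR
/-- See `gapR`. -/
def gapN (α : ℝ) (a : Kind → ℕ) : ℝ := α * (2 * a N1 + 2 * a N2 + a RN) - a RN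
/-- See `gapR`. -/
def gapB (α : ℝ) (a : Kind → ℕ) : ℝ := α * (2 * a B2 + a RB) - a RB

/-- The total number of items, as a real number. -/
def rtot (a : Kind → ℕ) : ℝ := a PB + a PR + a U1 + 2 * a U2 + a R1 + 2 * a R2 + a N1 + 2 * a N2 +
  2 * a B2 + a RU + a RR + a RN + a RB

/-- The number of red items, as a real number. -/
def rred (a : Kind → ℕ) : ℝ := a PR + a RU + a RR + a RN + a RB

/-- A bound for `potential`. -/
def potMax (α : ℝ) : ℝ := (1 / α + 9) / (1 - 3 * α)
/-- A bound for `gapR` and `gapN`. -/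
def gapMax (α : ℝ) : ℝ := α * (potMax α + 3)
/-- A bound for `surplus`. -/
def surplusMax (α : ℝ) : ℝ := α * potMax α + 2 * gapMax α + 1
/-- A bound for the number of provisionally red items. -/
def provRedMax (α : ℝ) : ℝ := 3 / 2 * (surplusMax α + 2 + α * (potMax α + 1))

/-- The potential that bounds the number of provisionally blue items. -/
def potential (α : ℝ) (a : Kind → ℕ) : ℝ := a PB + 3 / 2 * (gapR α a + gapN α a)

/-- The surplus of red items among the unmarked items that are not provisionally blue. -/
def surplus (α : ℝ) (a : Kind → ℕ) : ℝ :=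
  (1 - α) * (a PR + a RU) - α * (a U1 + 2 * a U2) - gapB α a

/-- Invariants of the numbers of bins of each kind that hold after every single step. -/
structure Core (α : ℝ) (a : Kind → ℕ) : Prop where
  gapR_nonneg : 0 ≤ gapR α a
  gapR_le : gapR α a ≤ gapMax α
  gapN_nonneg : 0 ≤ gapN α a
  gapN_le : gapN α a ≤ gapMax α
  gapB_nonneg : 0 ≤ gapB α a
  gapB_le : gapB α a ≤ 1
  lower : α * rtot a - 1 < rred a
  open_le : (a PB : ℝ) + a U1 + a R1 + a N1 ≤ potMax α + 1
  surplus_le : surplus α a ≤ surplusMax α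
  noX : a XR = 0 ∧ a XN = 0

/-- The invariants of the numbers of bins of each kind. -/
structure Inv (α : ℝ) (a : Kind → ℕ) : Prop extends Core α a where
  potential_le : potential α a ≤ potMax α
  provRed_le : (a PR : ℝ) ≤ provRedMax α

/-- The possible changes when a blue item is packed. -/
inductive BlueStep (a a' : Kind → ℕ) : Prop
  | openU (h : Move 1 U1 U2 a a')
  | openR (h : Move 1 R1 R2 a a')
  | openN (h : Move 1 N1 N2 a a')
  | mix (h0 : a U1 = 0 ∧ a R1 = 0 ∧ a N1 = 0) (h : Move 1 O U1 a a')
  | new (h0 : a U1 = 0 ∧ a R1 = 0 ∧ a N1 = 0) (h : Move 1 O PB a a')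

/-- The possible changes when an item arrives. -/
inductive Arrive (α : ℝ) (a a' : Kind → ℕ) : Prop
  | none (h : Move 0 O O a a')
  | fixBlue (h : Move 1 PB U1 a a')
  | fixRed (h : Move 1 PR RU a a')
  | blue (h0 : ⌊α * ((tot a : ℝ) + 1)⌋₊ ≤ red a) (h : BlueStep a a')
  | relabel {b : Kind → ℕ} (h0 : red a < ⌊α * ((tot a : ℝ) + 1)⌋₊) (h : Move 1 O RU a b)
      (h' : BlueStep b a')
  | redMix (h0 : red a < ⌊α * ((tot a : ℝ) + 1)⌋₊) (h : Move 1 O RU a a')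
  | redNew (h0 : red a < ⌊α * ((tot a : ℝ) + 1)⌋₊) (h : Move 1 O PR a a')

/-- The possible changes in the marking steps. -/
def StepR (α : ℝ) (a a' : Kind → ℕ) : Prop :=
  (∃ b, Move (xt α (totMark a .R) (a RR)) PB R1 a b ∧ (Move 1 O RR b a' ∨ Move 1 RU RR b a')) ∨
    (a' = a ∧ (a RU = 0 ∨ a PB < xt α (totMark a .R) (a RR)))

/-- See `StepR`. -/
def StepB (α : ℝ) (a a' : Kind → ℕ) : Prop :=
  (∃ t b, (2 * t = xo α (totMark a .B) (a RB) ∨ 2 * t = xo α (totMark a .B) (a RB) + 1) ∧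
    Move t U2 B2 a b ∧ Move 1 PR RB b a') ∨
    (a' = a ∧ (a PR = 0 ∨ 2 * a U2 < xo α (totMark a .B) (a RB)))

/-- See `StepR`. -/
def StepN (α : ℝ) (a a' : Kind → ℕ) : Prop :=
  (∃ b, Move (xt α (totMark a .N) (a RN)) PB N1 a b ∧ Move 1 PR RN b a') ∨
    (a' = a ∧ (a PR = 0 ∨ a PB < xt α (totMark a .N) (a RN)))

lemma cast_tot {a : Kind → ℕ} (h : a XR = 0 ∧ a XN = 0) : (tot a : ℝ) = rtot a := by
  unfold tot rtot; rw [h.1, h.2]; push_cast; ring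

lemma cast_red {a : Kind → ℕ} : (red a : ℝ) = rred a := by
  unfold red rred; push_cast; ring

lemma potMax_nonneg (h0 : 0 < α) (h1 : α < 1 / 3) : 0 ≤ potMax α := by
  unfold potMax; apply div_nonneg
  · positivity
  · linarith

/-- `potMax` is the solution of `M = 1/α + 3 α (M + 3)`, positive for `α < 1/3`. Here `1/α` bounds
the provisionally blue bins when no marking step is possible, and the rest is 3/2 times the largest
values of both gaps. -/
lemma mul_potMax (h0 : 0 < α) (h1 : α < 1 / 3) : 1 / α + 3 * gapMax α ≤ potMax α := by
  have h2 : potMax α * (1 - 3 * α) = 1 / α + 9 := by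
    unfold potMax; rw [div_mul_cancel₀]; linarith
  unfold gapMax
  linarith

/-! ### The invariants of the counts survive arrivals and marking steps -/

section

variable {a a' : Kind → ℕ}

/-- A second item in an `R1`- or `N1`-bin costs nothing because the gaps count such bins as
complete. Only a new provisionally blue bin raises the potential, and it is opened only if no bin
with a single definitely blue item exists; that information is kept for the case that no marking
step follows. -/
lemma BlueStep.potential (h : BlueStep a a') :
    potential α a' ≤ potential α a ∨
      (potential α a' ≤ potential α a + 1 ∧ a' U1 = 0 ∧ a' R1 = 0 ∧ a' N1 = 0) := by
  cases h
  case new z h =>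
    right
    have e := h.eqs
    have e1 := h .U1 (by simp)
    have e2 := h .R1 (by simp)
    have e3 := h .N1 (by simp)
    simp at e e1 e2 e3
    refine ⟨?_, by omega, by omega, by omega⟩
    simp only [Kind.potential, gapR, gapN, e]; linarith
  all_goals
    left
    rename_i h
    have e := h.eqs
    simp at e
    simp only [Kind.potential, gapR, gapN, e]; linarith

lemma BlueStep.provRed (h : BlueStep a a') : (a' PR : ℝ) = a PR := by
  cases h <;> (rename_i h; have e := h.eqs; simp at e; simp [e])

variable (h0 : 0 < α) (h1 : α < 1 / 3)
include h0 h1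

/-- `hlow` reserves room in `lower` for the item that arrives. A further bin with a single blue item
arises only when all such bins are provisional, and then `hPB` gives `open_le`. The gaps do not
change and the surplus does not grow. -/
lemma BlueStep.core (h : BlueStep a a') (ha : Core α a)
    (hlow : α * (rtot a + 1) - 1 < rred a) (hPB : (a PB : ℝ) ≤ potMax α) : Core α a' := by
  obtain ⟨g1, g2, g3, g4, g5, g6, g7, g8, g9, g10, g11⟩ := ha
  simp only [gapR, gapN, gapB, rtot, rred, surplus] at g1 g2 g3 g4 g5 g6 g7 g8 g9 hlow
  cases h
  case mix h0 h =>
    obtain ⟨z1, z2, z3⟩ := h0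
    have y1 : (a U1 : ℝ) = 0 := by simp [z1]
    have y2 : (a R1 : ℝ) = 0 := by simp [z2]
    have y3 : (a N1 : ℝ) = 0 := by simp [z3]
    have e := h.eqs
    have e2 := h .XR (by simp)
    have e3 := h .XN (by simp)
    simp at e e2 e3
    constructor
    case noX => omega
    all_goals simp only [gapR, gapN, gapB, rtot, rred, surplus, e]
    all_goals linarith
  case new h0 h =>
    obtain ⟨z1, z2, z3⟩ := h0
    have y1 : (a U1 : ℝ) = 0 := by simp [z1]
    have y2 : (a R1 : ℝ) = 0 := by simp [z2]
    have y3 : (a N1 : ℝ) = 0 := by simp [z3]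
    have e := h.eqs
    have e2 := h .XR (by simp)
    have e3 := h .XN (by simp)
    simp at e e2 e3
    constructor
    case noX => omega
    all_goals simp only [gapR, gapN, gapB, rtot, rred, surplus, e]
    all_goals linarith
  all_goals
    rename_i h
    have e := h.eqs
    have e2 := h .XR (by simp)
    have e3 := h .XN (by simp)
    simp at e e2 e3
    constructor
    case noX => omega
    all_goals simp only [gapR, gapN, gapB, rtot, rred, surplus, e]
    all_goals linarith

/-- The surplus equals `rred - α rtot + α PB + gapR + gapN - α R1 - α N1`. By the guard, the red
items number at most `α` times the total after the step, so the surplus is bounded by the other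
terms. The second conclusion is the room in `lower` needed for the blue item that follows a
relabelled bonus item. -/
lemma Core.red_step {k : Kind} (ha : Core α a) (hP : Kind.potential α a ≤ potMax α)
    (hg : red a < ⌊α * ((tot a : ℝ) + 1)⌋₊) (h : Move 1 O k a a') (hk : k = RU ∨ k = PR) :
    Core α a' ∧ α * (rtot a' + 1) - 1 < rred a' ∧ Kind.potential α a' = Kind.potential α a ∧
      (a' PR : ℝ) ≤ a PR + 1 ∧ a' PB = a PB := by
  have hg' : rred a + 1 ≤ α * (rtot a + 1) := by
    have := Nat.succ_le_of_lt hg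
    rw [Nat.le_floor_iff (by positivity)] at this
    rw [← cast_red, ← cast_tot ha.noX]; exact_mod_cast this
  obtain ⟨g1, g2, g3, g4, g5, g6, g7, g8, g9, g10, g11⟩ := ha
  have p1 : (0 : ℝ) ≤ α * a R1 := by positivity
  have p2 : (0 : ℝ) ≤ α * a N1 := by positivity
  have p3 : α * a PB ≤ α * potMax α := by
    apply mul_le_mul_of_nonneg_left _ h0.le
    simp only [Kind.potential] at hP; linarith
  simp only [gapR, gapN, gapB, rtot, rred, surplus] at g1 g2 g3 g4 g5 g6 g7 g8 g9 hg'
  have e := h.eqs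
  have e1 := h .PB (by simp)
  have e2 := h .XR (by simp)
  have e3 := h .XN (by simp)
  rcases hk with rfl | rfl
  all_goals
    simp at e e1 e2 e3
    refine ⟨?_, ?_, ?_, ?_, e1⟩
    · constructor
      case noX => omega
      all_goals simp only [gapR, gapN, gapB, rtot, rred, surplus, surplusMax, e]
      all_goals linarith
    · simp only [rtot, rred, e]; linarith
    · simp only [Kind.potential, gapR, gapN, e]; try ring
    · simp only [e]; linarith

/-- The state after an arrival. -/
lemma Arrive.core (h : Arrive α a a') (ha : Inv α a) : Core α a' ∧
    (Kind.potential α a' ≤ potMax α ∨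
      (Kind.potential α a' ≤ potMax α + 1 ∧ a' U1 = 0 ∧ a' R1 = 0 ∧ a' N1 = 0)) ∧
    (a' PR : ℝ) ≤ provRedMax α + 1 := by
  have hc := ha.toCore
  have hP := ha.potential_le
  have hR := ha.provRed_le
  have hPB : (a PB : ℝ) ≤ potMax α := by
    have g1 := hc.gapR_nonneg; have g2 := hc.gapN_nonneg
    simp only [Kind.potential] at hP; linarith
  cases h
  case blue h2 h =>
    refine ⟨h.core h0 h1 hc ?_ hPB, ?_, ?_⟩
    · have := Nat.lt_floor_add_one (α * ((tot a : ℝ) + 1))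
      have h3 : ((⌊α * ((tot a : ℝ) + 1)⌋₊ : ℕ) : ℝ) ≤ red a := by exact_mod_cast h2
      rw [cast_red] at h3; rw [cast_tot hc.noX] at this h3; linarith
    · rcases h.potential (α := α) with h | h
      · left; linarith
      · right; exact ⟨by linarith [h.1], h.2⟩
    · rw [h.provRed]; linarith
  case relabel b h2 h3 h =>
    obtain ⟨k1, k2, k3, k4, k5⟩ := hc.red_step h0 h1 hP h2 h3 (.inl rfl)
    refine ⟨h.core h0 h1 k1 k2 (by rw [k5]; exact hPB), ?_, ?_⟩
    · rcases h.potential (α := α) with h | h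
      · left; linarith
      · right; exact ⟨by linarith [h.1], h.2⟩
    · rw [h.provRed]; linarith
  case redMix h2 h =>
    obtain ⟨k1, k2, k3, k4, k5⟩ := hc.red_step h0 h1 hP h2 h (.inl rfl)
    exact ⟨k1, .inl (by linarith), by linarith⟩
  case redNew h2 h =>
    obtain ⟨k1, k2, k3, k4, k5⟩ := hc.red_step h0 h1 hP h2 h (.inr rfl)
    exact ⟨k1, .inl (by linarith), by linarith⟩
  all_goals
    rename_i h
    have e := h.eqs
    have e2 := h .XR (by simp)
    have e3 := h .XN (by simp)
    simp at e e2 e3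
    obtain ⟨g1, g2, g3, g4, g5, g6, g7, g8, g9, g10, g11⟩ := hc
    simp only [gapR, gapN, gapB, rtot, rred, surplus] at g1 g2 g3 g4 g5 g6 g7 g8 g9
    simp only [Kind.potential, gapR, gapN] at hP
    refine ⟨?_, .inl ?_, ?_⟩
    · constructor
      case noX => omega
      all_goals simp only [gapR, gapN, gapB, rtot, rred, surplus, e]
      all_goals linarith
    · simp only [Kind.potential, gapR, gapN, e]; linarith
    · simp only [e]; linarith

/-- The potential changes by `-x + 3/2 (2 α x + α - 1) = -x (1 - 3 α) - 3/2 (1 - α)`, which is at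
most `-1` for `α < 1/3`. The choice of `x` as a number permitting one more red item keeps the gap
nonnegative, and its minimality bounds the gap from above. -/
lemma StepR.core (h : StepR α a a') (ha : Core α a) : Core α a' ∧ a' PR = a PR ∧
    a' U2 = a U2 ∧ (Kind.potential α a' ≤ Kind.potential α a - 1 ∨
      (a' = a ∧ (a RU = 0 ∨ a PB < xt α (totMark a .R) (a RR)))) := by
  rcases h with ⟨b, h, h'⟩ | ⟨rfl, h⟩
  · set x := xt α (totMark a .R) (a RR) with hx
    obtain ⟨s1, s2⟩ := xt_spec h0 (totMark a .R) (a RR)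
    rw [← hx] at s1 s2
    obtain ⟨g1, g2, g3, g4, g5, g6, g7, g8, g9, g10, g11⟩ := ha
    simp only [totMark, g10] at s1 s2
    push_cast at s1 s2
    have p1 : (0 : ℝ) ≤ α * a R1 := by positivity
    have p2 : α * a R1 ≤ α * (potMax α + 1) := by
      apply mul_le_mul_of_nonneg_left _ h0.le
      have : (0 : ℝ) ≤ a PB := by positivity
      have : (0 : ℝ) ≤ a U1 := by positivity
      have : (0 : ℝ) ≤ a N1 := by positivity
      linarith
    have p3 : (0 : ℝ) ≤ x * (1 - 3 * α) := by
      apply mul_nonneg (by positivity); linarith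
    have p4 : (0 : ℝ) ≤ α * x := by positivity
    -- The left side is the new gap. It exceeds the quantity in the minimality condition by `α (a R1
    -- + 2)`, and `a R1 ≤ potMax α + 1`, whence the value of `gapMax`.
    have s3 : α * (2 * a R1 + 2 * a R2 + a RR + 2 * x + 1) - a RR - 1 ≤ gapMax α := by
      by_cases hx0 : x = 0
      · rw [hx0]; simp only [gapR] at g2; push_cast; linarith
      · have := s2 hx0; simp only [gapMax]; linarith
    simp only [gapR, gapN, gapB, rtot, rred, surplus] at g1 g2 g3 g4 g5 g6 g7 g8 g9
    have e := h.eqs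
    have e2 := h .XR (by simp)
    have e3 := h .XN (by simp)
    have e4 := h .PR (by simp)
    have e5 := h .U2 (by simp)
    simp at e e2 e3 e4 e5
    rcases h' with h' | h'
    all_goals
      have e' := h'.eqs
      have e2' := h' .XR (by simp)
      have e3' := h' .XN (by simp)
      have e4' := h' .PR (by simp)
      have e5' := h' .U2 (by simp)
      simp at e' e2' e3' e4' e5'
      refine ⟨?_, by omega, by omega, .inl ?_⟩
      · constructor
        case noX => omega
        all_goals simp only [gapR, gapN, gapB, rtot, rred, surplus, e', e]
        all_goals linarith
      · simp only [Kind.potential, gapR, gapN, e', e]; linarith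
  · exact ⟨ha, rfl, rfl, .inr ⟨rfl, h⟩⟩

/-- Moving `2 t` blue items and a red one from unmarked to `B` changes `gapB` by exactly what it
takes from the rest of the surplus, so the surplus is constant. With `2 t` equal to `x` or `x + 1`,
the new `gapB` lies between 0 and `2 α < 1` if `x ≠ 0`, and decreases if `x = 0`. -/
lemma StepB.core (h : StepB α a a') (ha : Core α a) : Core α a' ∧
    Kind.potential α a' = Kind.potential α a ∧ a' PB = a PB ∧ a' RU = a RU ∧ a' U1 = a U1 ∧
    a' R1 = a R1 ∧ a' N1 = a N1 ∧ totMark a' .R = totMark a .R ∧ a' RR = a RR ∧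
    a' PR ≤ a PR ∧
    ((a' PR : ℝ) ≤ a PR - 1 ∨
      (a' = a ∧ (a PR = 0 ∨ 2 * a U2 < xo α (totMark a .B) (a RB)))) := by
  rcases h with ⟨t, b, ht, h, h'⟩ | ⟨rfl, h⟩
  · set x := xo α (totMark a .B) (a RB) with hx
    obtain ⟨s1, s2⟩ := xo_spec h0 (totMark a .B) (a RB)
    rw [← hx] at s1 s2
    obtain ⟨g1, g2, g3, g4, g5, g6, g7, g8, g9, g10, g11⟩ := ha
    simp only [totMark] at s1 s2
    push_cast at s1 s2
    have t1 : (x : ℝ) ≤ 2 * t ∧ (2 * t : ℝ) ≤ x + 1 := by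
      constructor
      · exact_mod_cast (by omega : x ≤ 2 * t)
      · exact_mod_cast (by omega : 2 * t ≤ x + 1)
    have t2 : α * x ≤ α * (2 * t) := mul_le_mul_of_nonneg_left t1.1 h0.le
    have t3 : α * (2 * t) ≤ α * (x + 1) := mul_le_mul_of_nonneg_left t1.2 h0.le
    have s3 : α * (2 * a B2 + a RB + 2 * t + 1) - a RB - 1 ≤ 1 := by
      by_cases hx0 : x = 0
      · have : t = 0 := by omega
        rw [this]; simp only [gapB] at g6; push_cast; linarith
      · have := s2 hx0; linarith
    simp only [gapR, gapN, gapB, rtot, rred, surplus] at g1 g2 g3 g4 g5 g6 g7 g8 g9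
    have e := h.eqs
    have e' := h'.eqs
    have n : ∀ l, l ≠ .O → l ≠ .U2 → l ≠ .B2 → l ≠ .PR → l ≠ .RB → a' l = a l := by
      intro l l1 l2 l3 l4 l5
      have i1 := h l l1
      have i2 := h' l l1
      simp only [l2.symm, l3.symm, l4.symm, l5.symm, if_false, add_zero] at i1 i2
      rw [i2, i1]
    have e4 := h .PR (by simp)
    have e5 := h' .PR (by simp)
    simp at e e' e4 e5
    refine ⟨?_, ?_, n _ (by simp) (by simp) (by simp) (by simp) (by simp),
      n _ (by simp) (by simp) (by simp) (by simp) (by simp),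
      n _ (by simp) (by simp) (by simp) (by simp) (by simp),
      n _ (by simp) (by simp) (by simp) (by simp) (by simp),
      n _ (by simp) (by simp) (by simp) (by simp) (by simp), ?_,
      n _ (by simp) (by simp) (by simp) (by simp) (by simp), by omega, .inl ?_⟩
    · constructor
      case noX =>
        rw [n .XR (by simp) (by simp) (by simp) (by simp) (by simp),
          n .XN (by simp) (by simp) (by simp) (by simp) (by simp)]; exact ⟨g10, g11⟩
      all_goals simp only [gapR, gapN, gapB, rtot, rred, surplus, e', e]
      all_goals linarith
    · simp only [Kind.potential, gapR, gapN, e', e]; try ring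
    · simp only [totMark]
      rw [n .XR (by simp) (by simp) (by simp) (by simp) (by simp),
        n .R1 (by simp) (by simp) (by simp) (by simp) (by simp),
        n .R2 (by simp) (by simp) (by simp) (by simp) (by simp),
        n .RR (by simp) (by simp) (by simp) (by simp) (by simp)]
    · simp only [e', e]; linarith
  · exact ⟨ha, rfl, rfl, rfl, rfl, rfl, rfl, rfl, rfl, le_rfl, .inr ⟨rfl, h⟩⟩

/-- The calculation is the one for `R`; here the red item is provisional, so the number of
provisionally red items falls as well. -/
lemma StepN.core (h : StepN α a a') (ha : Core α a) : Core α a' ∧ a' PR ≤ a PR ∧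
    ((Kind.potential α a' ≤ Kind.potential α a - 1 ∧ (a' PR : ℝ) ≤ a PR - 1) ∨
      (a' = a ∧ (a PR = 0 ∨ a PB < xt α (totMark a .N) (a RN)))) := by
  rcases h with ⟨b, h, h'⟩ | ⟨rfl, h⟩
  · set x := xt α (totMark a .N) (a RN) with hx
    obtain ⟨s1, s2⟩ := xt_spec h0 (totMark a .N) (a RN)
    rw [← hx] at s1 s2
    obtain ⟨g1, g2, g3, g4, g5, g6, g7, g8, g9, g10, g11⟩ := ha
    simp only [totMark, g11] at s1 s2
    push_cast at s1 s2
    have p1 : (0 : ℝ) ≤ α * a N1 := by positivity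
    have p2 : α * a N1 ≤ α * (potMax α + 1) := by
      apply mul_le_mul_of_nonneg_left _ h0.le
      have : (0 : ℝ) ≤ a PB := by positivity
      have : (0 : ℝ) ≤ a U1 := by positivity
      have : (0 : ℝ) ≤ a R1 := by positivity
      linarith
    have p3 : (0 : ℝ) ≤ x * (1 - 3 * α) := by
      apply mul_nonneg (by positivity); linarith
    have p4 : (0 : ℝ) ≤ α * x := by positivity
    have s3 : α * (2 * a N1 + 2 * a N2 + a RN + 2 * x + 1) - a RN - 1 ≤ gapMax α := by
      by_cases hx0 : x = 0
      · rw [hx0]; simp only [gapN] at g4; push_cast; linarith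
      · have := s2 hx0; simp only [gapMax]; linarith
    simp only [gapR, gapN, gapB, rtot, rred, surplus] at g1 g2 g3 g4 g5 g6 g7 g8 g9
    have e := h.eqs
    have e2 := h .XR (by simp)
    have e3 := h .XN (by simp)
    have e4 := h .PR (by simp)
    simp at e e2 e3 e4
    have e' := h'.eqs
    have e2' := h' .XR (by simp)
    have e3' := h' .XN (by simp)
    have e4' := h' .PR (by simp)
    simp at e' e2' e3' e4'
    refine ⟨?_, by omega, .inl ⟨?_, ?_⟩⟩
    · constructor
      case noX => omega
      all_goals simp only [gapR, gapN, gapB, rtot, rred, surplus, e', e]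
      all_goals linarith
    · simp only [Kind.potential, gapR, gapN, e', e]; linarith
    · simp only [e', e]; linarith
  · exact ⟨ha, le_rfl, .inr ⟨rfl, h⟩⟩

/-- The invariants are maintained when an item arrives and the marking steps are performed. -/
lemma Inv.step {a₀ a₁ a₂ a₃ a₄ : Kind → ℕ} (ha : Inv α a₀) (hA : Arrive α a₀ a₁)
    (hR : StepR α a₁ a₂) (hB : StepB α a₂ a₃) (hN : StepN α a₃ a₄) : Inv α a₄ := by
  obtain ⟨c1, p1, r1⟩ := hA.core h0 h1 ha
  obtain ⟨c2, r2, u2, p2⟩ := hR.core h0 h1 c1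
  obtain ⟨c3, p3, b1, b2, b3, b4, b5, b6, b7, r3', r3⟩ := hB.core h0 h1 c2
  obtain ⟨c4, r4', p4⟩ := hN.core h0 h1 c3
  have hM := mul_potMax h0 h1
  have hrr : (a₂ PR : ℝ) = a₁ PR := by rw [r2]
  have hr3 : (a₃ PR : ℝ) ≤ a₂ PR := by exact_mod_cast r3'
  have hr4 : (a₄ PR : ℝ) ≤ a₃ PR := by exact_mod_cast r4'
  refine ⟨c4, ?_, ?_⟩
  · rcases p1 with p1 | ⟨p1, z1, z2, z3⟩
    · have q2 : Kind.potential α a₂ ≤ Kind.potential α a₁ := by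
        rcases p2 with p2 | ⟨rfl, -⟩
        · linarith
        · rfl
      have q4 : Kind.potential α a₄ ≤ Kind.potential α a₃ := by
        rcases p4 with p4 | ⟨rfl, -⟩
        · linarith [p4.1]
        · rfl
      linarith
    -- A bin was opened, which cost at most 1. A successful `R`- or `N`-step pays this back;
    -- otherwise the reasons for both failures bound the number of provisionally blue bins.
    · rcases p2 with p2 | ⟨rfl, hRn⟩
      · have q4 : Kind.potential α a₄ ≤ Kind.potential α a₃ := by
          rcases p4 with p4 | ⟨rfl, -⟩
          · linarith [p4.1]
          · rfl
        linarith
      · rcases p4 with p4 | ⟨rfl, hNn⟩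
        · linarith [p4.1]
        -- The failure of a step for lack of blue items gives `PB < x`, and minimality of `x`
        -- together with `r ≤ α n` gives `α (2 x - 1) < 1`.
        · have key : ∀ (n r x : ℕ), (r : ℝ) ≤ α * n → x = xt α n r → a₄ PB < x →
              (a₄ PB : ℝ) ≤ 1 / α := by
            intro n r x hr hx hlt
            obtain ⟨-, s2⟩ := xt_spec h0 n r
            rw [← hx] at s2
            have s3 := s2 (by omega)
            have s4 : (a₄ PB : ℝ) + 1 ≤ x := by exact_mod_cast hlt
            rw [le_div_iff₀ h0]
            have s5 : α * (a₄ PB + 1) ≤ α * x := mul_le_mul_of_nonneg_left s4 h0.le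
            have s6 : 0 ≤ α * (a₄ PB : ℝ) := by positivity
            linarith
          have y1 : (a₄ U1 : ℝ) = 0 := by rw [b3, z1]; simp
          have y2 : (a₄ R1 : ℝ) = 0 := by rw [b4, z2]; simp
          have y3 : (a₄ N1 : ℝ) = 0 := by rw [b5, z3]; simp
          obtain ⟨g1, g2, g3, g4, g5, g6, g7, g8, g9, g10, g11⟩ := c4
          have goal1 : (a₄ PB : ℝ) ≤ 1 / α := by
            rcases hNn with hNn | hNn
            · rcases hRn with hRn | hRn
              -- No unmarked red item exists. Each mark has at most the fraction `α` of red items,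
              -- so by `lower` the unmarked items number less than `1/α`.
              · have y4 : (a₄ PR : ℝ) = 0 := by rw [hNn]; simp
                have y5 : (a₄ RU : ℝ) = 0 := by rw [b2, hRn]; simp
                rw [le_div_iff₀ h0]
                simp only [gapR, gapN, gapB, rtot, rred] at g1 g3 g5 g7
                rw [y1, y2, y3, y4, y5] at g7
                rw [y2] at g1
                rw [y3] at g3
                have : 0 ≤ α * (a₄ U2 : ℝ) := by positivity
                linarith
              · refine key (totMark a₄ .R) (a₄ RR) _ ?_ rfl (by rw [b1, b6, b7]; exact hRn)
                simp only [gapR, y2] at g1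
                simp only [totMark, g10, b4, z2]
                push_cast; linarith
            · refine key _ _ _ ?_ rfl hNn
              simp only [gapN, y3] at g3
              simp only [totMark, g11, b5, z3]
              push_cast; linarith
          simp only [Kind.potential]
          linarith
  · rcases r3 with r3 | ⟨e3, hBn⟩
    · linarith
    · rcases p4 with ⟨-, p4⟩ | ⟨rfl, hNn⟩
      · linarith
      · subst e3
        rcases hBn with hBn | hBn
        · rw [hBn]
          have := potMax_nonneg h0 h1
          simp only [provRedMax, surplusMax, gapMax]
          push_cast; positivity
        -- The `B`-step failed for lack of pairs, so minimality of `x` and `gapB ≥ 0` give `2 α U2 <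
        -- 1`. The bound for the surplus then limits `(1 - α) PR`, and `1 - α ≥ 2/3` explains the
        -- factor 3/2 in `provRedMax`.
        · obtain ⟨g1, g2, g3, g4, g5, g6, g7, g8, g9, g10, g11⟩ := c4
          obtain ⟨-, s2⟩ := xo_spec h0 (totMark a₄ .B) (a₄ RB)
          set x := xo α (totMark a₄ .B) (a₄ RB)
          have s3 := s2 (by omega)
          simp only [totMark] at s3
          push_cast at s3
          have s4 : (2 * a₄ U2 : ℝ) ≤ x := by exact_mod_cast hBn.le
          have s5 : α * (2 * a₄ U2) ≤ α * x := mul_le_mul_of_nonneg_left s4 h0.le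
          have s6 : α * a₄ U1 ≤ α * (potMax α + 1) := by
            apply mul_le_mul_of_nonneg_left _ h0.le
            have : (0 : ℝ) ≤ a₄ PB := by positivity
            have : (0 : ℝ) ≤ a₄ R1 := by positivity
            have : (0 : ℝ) ≤ a₄ N1 := by positivity
            linarith
          simp only [gapB] at g5
          have s7 : (0 : ℝ) ≤ (1 - α) * a₄ RU := mul_nonneg (by linarith) (by positivity)
          have s8 : (0 : ℝ) ≤ (1 / 3 - α) * a₄ PR := mul_nonneg (by linarith) (by positivity)
          simp only [surplus] at g9
          simp only [provRedMax]
          linarith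

end

/-- This bounds the number of bins affected by one `R`-step. Post-processing discards all bins
marked together with a single blue item, which is affordable only with such a bound. -/
lemma Core.xt_R_le {a : Kind → ℕ} (h0 : 0 < α) (h1 : α < 1 / 3) (ha : Core α a) :
    (xt α (totMark a .R) (a RR) : ℝ) ≤ 1 / α + potMax α + 2 := by
  obtain ⟨-, s2⟩ := xt_spec h0 (totMark a .R) (a RR)
  obtain ⟨g1, g2, g3, g4, g5, g6, g7, g8, g9, g10, g11⟩ := ha
  have hM := potMax_nonneg h0 h1
  set x := xt α (totMark a .R) (a RR)
  by_cases hx : x = 0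
  · rw [hx]; push_cast; positivity
  · have s3 := s2 hx
    simp only [totMark, g10] at s3
    push_cast at s3
    simp only [gapR] at g1
    have p2 : α * a R1 ≤ α * (potMax α + 1) := by
      apply mul_le_mul_of_nonneg_left _ h0.le
      have : (0 : ℝ) ≤ a PB := by positivity
      have : (0 : ℝ) ≤ a U1 := by positivity
      have : (0 : ℝ) ≤ a N1 := by positivity
      linarith
    have p3 : (0 : ℝ) ≤ α * x := by positivity
    have : α * x ≤ α * (1 / α + potMax α + 2) := by
      have : α * (1 / α) = 1 := by field_simp
      linarith
    exact le_of_mul_le_mul_left this h0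

lemma Core.xt_N_le {a : Kind → ℕ} (h0 : 0 < α) (h1 : α < 1 / 3) (ha : Core α a) :
    (xt α (totMark a .N) (a RN) : ℝ) ≤ 1 / α + potMax α + 2 := by
  obtain ⟨-, s2⟩ := xt_spec h0 (totMark a .N) (a RN)
  obtain ⟨g1, g2, g3, g4, g5, g6, g7, g8, g9, g10, g11⟩ := ha
  have hM := potMax_nonneg h0 h1
  set x := xt α (totMark a .N) (a RN)
  by_cases hx : x = 0
  · rw [hx]; push_cast; positivity
  · have s3 := s2 hx
    simp only [totMark, g11] at s3
    push_cast at s3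
    simp only [gapN] at g3
    have p2 : α * a N1 ≤ α * (potMax α + 1) := by
      apply mul_le_mul_of_nonneg_left _ h0.le
      have : (0 : ℝ) ≤ a PB := by positivity
      have : (0 : ℝ) ≤ a U1 := by positivity
      have : (0 : ℝ) ≤ a R1 := by positivity
      linarith
    have p3 : (0 : ℝ) ≤ α * x := by positivity
    have : α * x ≤ α * (1 / α + potMax α + 2) := by
      have : α * (1 / α) = 1 := by field_simp
      linarith
    exact le_of_mul_le_mul_left this h0

lemma Inv.zero (h0 : 0 < α) (h1 : α < 1 / 3) {a : Kind → ℕ} (ha : ∀ k, k ≠ .O → a k = 0) :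
    Inv α a := by
  have hM := potMax_nonneg h0 h1
  have hg : 0 ≤ gapMax α := by unfold gapMax; positivity
  have hs : 0 ≤ surplusMax α := by unfold surplusMax; positivity
  have hp : 0 ≤ provRedMax α := by unfold provRedMax; positivity
  refine ⟨?_, ?_, ?_⟩
  · constructor
    all_goals simp [gapR, gapN, gapB, rtot, rred, surplus, ha, hg, hs]
    linarith
  · simp [potential, gapR, gapN, ha, hM]
  · simp [ha, hp]

end Kind

/-! ### Unmixed bins -/

/-- The item without its mark and with a definite colour. -/
def Item.erase (p : Item) : Item := { p with status := p.status.fix, mark := none, batch := 0 }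

lemma Item.erase_hasColor (p : Item) (c : Color) : p.erase.HasColor c ↔ p.HasColor c :=
  p.fixed_hasColor c

lemma Item.erase_bonus (p : Item) : p.erase.status = .bonus ↔ p.status = .bonus := p.fixed_bonus

/-- There is a blue item of size `y` in an unmixed bin. -/
def UnmixedBlue (s : Packing) (y : ℝ) : Prop :=
  ∃ p ∈ s, p.HasColor .blue ∧ p.size = y ∧ ¬ Mixed s p.bin

/-- There is a red item of type `j` in an unmixed bin. -/
def UnmixedRed (s : Packing) (j : ℕ) : Prop :=
  ∃ p ∈ s, p.HasColor .red ∧ p.typ = j ∧ ¬ Mixed s p.bin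

/-- There is a bonus item. -/
def SomeBonus (s : Packing) : Prop := ∃ p ∈ s, p.status = .bonus

/-- Items that are combinable are not in different unmixed bins. -/
structure Separated (P : Params) (s : Packing) : Prop where
  comb : ∀ y j, UnmixedBlue s y → UnmixedRed s j → ¬ P.TypeCombinable y j
  bonus : SomeBonus s → ∀ j, UnmixedRed s j → P.Act j

/-- A blue item may be replaced by an old one combinable with at least the same types; this is what
happens when it joins an open bin of its type or when colours are switched. -/
lemma Separated.of_imp {P : Params} {s s' : Packing} (h : Separated P s)
    (hb : ∀ y, UnmixedBlue s' y →
      ∃ y', UnmixedBlue s y' ∧ ∀ j, P.TypeCombinable y j → P.TypeCombinable y' j)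
    (hr : ∀ j, UnmixedRed s' j → UnmixedRed s j) (ho : SomeBonus s' → SomeBonus s) :
    Separated P s' where
  comb y j h1 h2 h3 := by
    obtain ⟨y', h4, h5⟩ := hb y h1
    exact h.comb y' j h4 (hr j h2) (h5 j h3)
  bonus h1 j h2 := h.bonus (ho h1) j (hr j h2)

lemma mixed_erase (s : Packing) (b : ℕ) : Mixed (s.map Item.erase) b ↔ Mixed s b := by
  simp only [Mixed, HasBlue, HasRed, HasBonus, Multiset.mem_map, exists_exists_and_eq_and,
    Item.erase_hasColor, Item.erase_bonus]
  rfl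

lemma unmixedBlue_erase (s : Packing) (y : ℝ) :
    UnmixedBlue (s.map Item.erase) y ↔ UnmixedBlue s y := by
  simp only [UnmixedBlue, mixed_erase, Multiset.mem_map, exists_exists_and_eq_and,
    Item.erase_hasColor]
  rfl

lemma unmixedRed_erase (s : Packing) (j : ℕ) :
    UnmixedRed (s.map Item.erase) j ↔ UnmixedRed s j := by
  simp only [UnmixedRed, mixed_erase, Multiset.mem_map, exists_exists_and_eq_and,
    Item.erase_hasColor]
  rfl

lemma someBonus_erase (s : Packing) : SomeBonus (s.map Item.erase) ↔ SomeBonus s := by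
  simp only [SomeBonus, Multiset.mem_map, exists_exists_and_eq_and, Item.erase_bonus]

/-- The packings agree up to marks and up to whether colours are definite. -/
def SameColors (s s' : Packing) : Prop := s.map Item.erase = s'.map Item.erase

lemma SameColors.mixed {s s' : Packing} (h : SameColors s s') (b : ℕ) :
    Mixed s' b ↔ Mixed s b := by rw [← mixed_erase, ← h, mixed_erase]

lemma SameColors.unmixedRed {s s' : Packing} (h : SameColors s s') (j : ℕ) :
    UnmixedRed s' j ↔ UnmixedRed s j := by rw [← unmixedRed_erase, ← h, unmixedRed_erase]

lemma SameColors.unmixedBlue {s s' : Packing} (h : SameColors s s') (j : ℝ) :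
    UnmixedBlue s' j ↔ UnmixedBlue s j := by rw [← unmixedBlue_erase, ← h, unmixedBlue_erase]

lemma SameColors.someBonus {s s' : Packing} (h : SameColors s s') :
    SomeBonus s' ↔ SomeBonus s := by rw [← someBonus_erase, ← h, someBonus_erase]

lemma SameColors.separated {P : Params} {s s' : Packing} (h : SameColors s s')
    (hs : Separated P s) : Separated P s' :=
  hs.of_imp (fun y hy => ⟨y, (h.unmixedBlue y).1 hy, fun _ h => h⟩)
    (fun j hj => (h.unmixedRed j).1 hj) h.someBonus.1

lemma SameColors.bins {s s' : Packing} (h : SameColors s s') :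
    ExtremeHarmonic.bins s' = ExtremeHarmonic.bins s := by
  have : ∀ s : Packing, ExtremeHarmonic.bins (s.map Item.erase) = ExtremeHarmonic.bins s := by
    intro s; ext b; simp only [mem_bins, Multiset.mem_map, exists_exists_and_eq_and]; rfl
  rw [← this s', ← h, this]

/-- The packings have the same items of all types other than `i`. -/
def SameOff (i : ℕ) (s s' : Packing) : Prop :=
  ∀ j, j ≠ i → s'.filter (fun p => p.typ = j) = s.filter (fun p => p.typ = j)

lemma SameOff.refl (i : ℕ) (s : Packing) : SameOff i s s := fun _ _ => rfl

lemma SameOff.trans {i : ℕ} {s s' s'' : Packing} (h : SameOff i s s') (h' : SameOff i s' s'') :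
    SameOff i s s'' := fun j hj => (h' j hj).trans (h j hj)

lemma SameOff.of_rel {i : ℕ} {A A' : Packing} (h : Multiset.Rel
    (fun p p' => p' = p ∨ (p.typ = i ∧ p'.typ = i)) A A') : SameOff i A A' := by
  intro j hj
  induction h with
  | zero => rfl
  | cons h1 h2 ih =>
    rw [Multiset.filter_cons, Multiset.filter_cons, ih]
    rcases h1 with rfl | ⟨h1, h3⟩
    · rfl
    · rw [if_neg (by rw [h3]; exact hj.symm), if_neg (by rw [h1]; exact hj.symm)]

lemma SameOff.add {i : ℕ} {A A' B B' : Packing} (h : SameOff i A A') (h' : SameOff i B B') :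
    SameOff i (A + B) (A' + B') := fun j hj => by
  rw [Multiset.filter_add, Multiset.filter_add, h j hj, h' j hj]

lemma SameOff.cons {i : ℕ} {p p' : Item} {A A' : Packing} (h : p.typ = i) (h1 : p'.typ = i)
    (h' : SameOff i A A') : SameOff i (p ::ₘ A) (p' ::ₘ A') := fun j hj => by
  rw [Multiset.filter_cons, Multiset.filter_cons, h' j hj, if_neg (by rw [h1]; exact hj.symm),
    if_neg (by rw [h]; exact hj.symm)]

lemma SameOff.map {i : ℕ} {g : Item → Item} {A : Packing}
    (h : ∀ p ∈ A, g p = p ∨ (p.typ = i ∧ (g p).typ = i)) : SameOff i A (A.map g) :=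
  SameOff.of_rel (Multiset.rel_map_right.2 (Multiset.rel_refl_of_refl_on h))

lemma content_filter (s : Packing) (Q : Item → Prop) [DecidablePred Q] (b : ℕ) :
    content (s.filter Q) b = (content s b).filter Q := by
  unfold content; exact Multiset.filter_comm _ _ _

lemma sg_filter (i : ℕ) (c : Packing) : sg i (c.filter (fun p => p.typ = i)) = sg i c := by
  unfold sg; rw [Multiset.filter_filter]
  congr 1; apply Multiset.filter_congr; intro p _; tauto

lemma SameOff.sg {i j : ℕ} {s s' : Packing} (h : SameOff i s s') (hj : j ≠ i) (b : ℕ) :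
    sg j (content s' b) = sg j (content s b) := by
  rw [← sg_filter, ← content_filter s', h j hj, content_filter, sg_filter]

lemma SameOff.kindedRest {i j : ℕ} {s s' : Packing} (h : SameOff i s s') (hj : j ≠ i)
    (hk : KindedRest s j) : KindedRest s' j := fun b => by rw [h.sg hj]; exact hk b

lemma SameOff.kcount {i j : ℕ} {s s' : Packing} (h : SameOff i s s') (hj : j ≠ i) :
    kcount s' j = kcount s j := by
  funext k; unfold ExtremeHarmonic.kcount; simp only [h.sg hj]

/-! ### Changing single items -/

lemma GoodBins.update {P : Params} {p p' : Item} {r : Packing} (h : GoodBins P (p ::ₘ r))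
    (hb : p'.bin = p.bin) (h' : P.GoodBin (p' ::ₘ content r p.bin)) : GoodBins P (p' ::ₘ r) := by
  intro b
  rw [content_cons]
  split_ifs with hb'
  · rw [← hb', hb]; exact h'
  · have := h b; rwa [content_cons, if_neg (by rw [← hb]; exact hb')] at this

lemma sg_update_ne {i : ℕ} {p p' : Item} {r : Packing} (hb : p'.bin = p.bin) {b : ℕ}
    (h : b ≠ p.bin) : sg i (content (p' ::ₘ r) b) = sg i (content (p ::ₘ r) b) := by
  rw [content_cons_ne (by rw [hb]; exact h.symm), content_cons_ne h.symm]

/-- Provisionally coloured items of type `i` are alone in their bins. -/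
lemma GoodBins.content_prov {P : Params} {p : Item} {r : Packing} (h : GoodBins P (p ::ₘ r))
    {c : Color} (hp : p.status = .prov c) : content r p.bin = 0 := by
  have h1 := h p.bin
  rw [content_cons_self] at h1
  have h2 := (h1.prov p (by simp) c hp).2.2
  exact (Multiset.cons_inj_right p).1 (h2.trans (Multiset.cons_zero p).symm)

/-- A possible change of a provisionally coloured item of type `i`. -/
def ProvUpdate (i : ℕ) (p p' : Item) : Prop :=
  p.typ = i ∧ (∃ c, p.status = .prov c) ∧ p'.size = p.size ∧ p'.typ = i ∧ p'.bin = p.bin ∧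
    ((∃ c, p'.status = .prov c ∧ p'.mark = none) ∨ ∃ c m, p'.status = .fixed c ∧ p'.mark = some m ∧
      (c = .red → m ≠ .R) ∧ (c = .blue → m ≠ .B))

/-- The number of items among `A` that are alone in bins of kind `k`. -/
def ncount (A : Packing) (k : Kind) : ℕ :=
  (A.filter (fun p => {(p.status, p.mark)} = k.ms)).card

lemma ncount_cons (p : Item) (A : Packing) (k : Kind) :
    ncount (p ::ₘ A) k = ncount A k + if {(p.status, p.mark)} = k.ms then 1 else 0 := by
  unfold ncount; rw [Multiset.filter_cons]; split_ifs <;> simp [add_comm]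

lemma ncount_add (A B : Packing) (k : Kind) : ncount (A + B) k = ncount A k + ncount B k := by
  unfold ncount; rw [Multiset.filter_add, Multiset.card_add]

lemma ncount_const {A : Packing} {k k' : Kind} (h : ∀ p ∈ A, {(p.status, p.mark)} = k'.ms) :
    ncount A k = if k' = k then A.card else 0 := by
  unfold ncount
  split_ifs with hk
  · subst hk; rw [Multiset.filter_eq_self.2 h]
  · rw [Multiset.card_eq_zero, Multiset.filter_eq_nil]
    intro p hp h'; rw [h p hp, Kind.ms_eq_iff] at h'; exact hk h'

/-- A provisionally coloured item is alone in its bin, so changes to several of them do not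
interact. No bin involved is mixed before or after, and each kind count changes by the numbers of
items that enter and leave it. -/
lemma provUpdates {P : Params} {i : ℕ} (hi : P.Act i) {A A' : Packing}
    (hrel : Multiset.Rel (ProvUpdate i) A A') : ∀ r : Packing, GoodBins P (A + r) →
    GoodBins P (A' + r) ∧ (∀ b, Mixed (A' + r) b ↔ Mixed (A + r) b) ∧
    (KindedRest (A + r) i → KindedRest (A' + r) i) ∧
    ∀ k, k ≠ .O → kcount (A' + r) i k + ncount A k = kcount (A + r) i k + ncount A' k := by
  induction hrel with
  | zero => exact fun r h => ⟨h, fun _ => Iff.rfl, fun h => h, fun _ _ => rfl⟩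
  | @cons p p' A A' h1 h2 ih =>
    intro r hg
    obtain ⟨ht, ⟨c, hc⟩, hs, ht', hb, hst⟩ := h1
    rw [Multiset.cons_add] at hg
    have hz := hg.content_prov hc
    have hgood := hg p.bin
    rw [content_cons_self, hz] at hgood
    have hmem : p ∈ p ::ₘ (0 : Packing) := by simp
    have hsize := hgood.item p hmem
    have hpt := hgood.typ_eq_of_act hmem (ht ▸ hi)
    have hpm := (hgood.prov p hmem c hc).2.1
    have hgood' : P.GoodBin {p'} := by
      refine Params.GoodBin.single (hs ▸ ⟨hsize.1, hsize.2.1⟩) ?_ (ht' ▸ hi) ?_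
      · rw [hs, ht', ← hpt, ht]
      · rcases hst with h | ⟨c, m, h3, h4, h5, -⟩
        · exact .inl h
        · exact .inr ⟨c, m, h3, h4, h5⟩
    have hg1 : GoodBins P (p' ::ₘ (A + r)) := hg.update hb (by rw [hz]; exact hgood')
    have hz' : content (A + r) p'.bin = 0 := by rw [hb]; exact hz
    -- The item that has been changed joins the remainder, which is why the induction hypothesis
    -- quantifies over `r`.
    have e1 : p' ::ₘ (A + r) = A + (p' ::ₘ r) := (Multiset.add_cons p' A r).symm
    obtain ⟨k1, k2, k3, k4⟩ := ih (p' ::ₘ r) (by rw [← e1]; exact hg1)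
    have e2 : A' + (p' ::ₘ r) = p' ::ₘ A' + r := by rw [Multiset.add_cons, Multiset.cons_add]
    rw [e2, ← e1] at k2 k3 k4
    rw [e2] at k1
    rw [Multiset.cons_add p A r]
    have hpnb : p.status ≠ .bonus := by rw [hc]; simp
    have hpnb' : p'.status ≠ .bonus := by
      rcases hst with ⟨c, h, -⟩ | ⟨c, m, h, -⟩ <;> rw [h] <;> simp
    have hsg : ∀ b, b ≠ p.bin → sg i (content (p' ::ₘ (A + r)) b) =
        sg i (content (p ::ₘ (A + r)) b) := fun b hbb => sg_update_ne hb hbb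
    have hsg1 : sg i (content (p ::ₘ (A + r)) p.bin) = {(p.status, p.mark)} := by
      rw [content_cons_self, hz, sg_cons_pos ht hpnb, sg_zero]; rfl
    have hsg2 : sg i (content (p' ::ₘ (A + r)) p.bin) = {(p'.status, p'.mark)} := by
      rw [← hb, content_cons_self, hz', sg_cons_pos ht' hpnb', sg_zero]; rfl
    refine ⟨k1, fun b => (k2 b).trans ?_, fun hK => k3 fun b => ?_, fun k hk => ?_⟩
    · by_cases hbb : b = p.bin
      · subst hbb
        have hno : ∀ q : Item, q.status ≠ .bonus → ¬ MixedC {q} := by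
          intro q hq
          unfold MixedC
          simp only [Multiset.mem_singleton, exists_eq_left]
          rintro (⟨h3, h4⟩ | h3)
          · cases h3.unique h4
          · exact hq h3
        rw [mixed_iff, mixed_iff]
        conv_lhs => rw [← hb, content_cons_self, hz']
        rw [content_cons_self, hz]
        exact iff_of_false (hno p' hpnb') (hno p hpnb)
      · rw [mixed_iff, mixed_iff, content_cons_ne (by rw [hb]; exact Ne.symm hbb),
          content_cons_ne (Ne.symm hbb)]
    · by_cases hbb : b = p.bin
      · subst hbb
        rw [hsg2]
        rcases hst with ⟨c, h3, h4⟩ | ⟨c, m, h3, h4, h5, h6⟩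
        · cases c
          · exact ⟨.PR, by simp [Kind.Rest], by simp [Kind.ms, h3, h4]⟩
          · exact ⟨.PB, by simp [Kind.Rest], by simp [Kind.ms, h3, h4]⟩
        · cases c <;> cases m
          · exact ⟨.RN, by simp [Kind.Rest], by simp [Kind.ms, h3, h4]⟩
          · exact ⟨.RB, by simp [Kind.Rest], by simp [Kind.ms, h3, h4]⟩
          · exact absurd rfl (h5 rfl)
          · exact ⟨.N1, by simp [Kind.Rest], by simp [Kind.ms, h3, h4]⟩
          · exact absurd rfl (h6 rfl)
          · exact ⟨.R1, by simp [Kind.Rest], by simp [Kind.ms, h3, h4]⟩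
      · rw [hsg b hbb]; exact hK b
    · have h3 := k4 k hk
      have h4 := kcount_change (s := p ::ₘ (A + r)) (s' := p' ::ₘ (A + r)) {p.bin}
        (fun b hbb => hsg b (by simpa using hbb)) hk
      rw [Finset.filter_singleton, Finset.filter_singleton, hsg1, hsg2] at h4
      rw [ncount_cons, ncount_cons]
      simp only [apply_ite Finset.card, Finset.card_singleton, Finset.card_empty] at h4
      omega

/-- A bonus item becomes red. -/
lemma relabel_mixed {P : Params} {q q' : Item} {r : Packing} (hg : GoodBins P (q ::ₘ r))
    (hq : q.status = .bonus) (hb : q'.bin = q.bin) (hst : q'.status = .fixed .red) (b : ℕ) :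
    Mixed (q' ::ₘ r) b ↔ Mixed (q ::ₘ r) b := by
  by_cases hbb : b = q.bin
  · subst hbb
    have h1 := hg q.bin
    rw [content_cons_self] at h1
    obtain ⟨-, -, y, hy, hys, -⟩ := h1.bonus q (by simp) hq
    have hy' : content r q.bin = {y} := (Multiset.cons_inj_right q).1 hy
    have hyr : y ∈ content r q.bin := by rw [hy']; simp
    rw [mem_content] at hyr
    apply iff_of_true
    · left
      exact ⟨⟨y, by simp [hyr.1], hyr.2, .inr hys⟩, q', by simp, hb, .inr hst⟩
    · right
      exact ⟨q, by simp, rfl, hq⟩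
  · rw [mixed_iff, mixed_iff, content_cons_ne (by rw [hb]; exact Ne.symm hbb),
      content_cons_ne (Ne.symm hbb)]

/-- The bin of a bonus item is mixed and stays so, now with a blue and a red item. Hence no item
appears in an unmixed bin. -/
lemma relabel_separated {P : Params} {q q' : Item} {r : Packing} (hg : GoodBins P (q ::ₘ r))
    (hq : q.status = .bonus) (hb : q'.bin = q.bin) (hst : q'.status = .fixed .red)
    (h : Separated P (q ::ₘ r)) : Separated P (q' ::ₘ r) := by
  have hm := relabel_mixed hg hq hb hst
  refine h.of_imp ?_ ?_ ?_
  · rintro y ⟨p, hp, hpb, hps, hpm⟩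
    refine ⟨y, ⟨p, ?_, hpb, hps, by rwa [← hm]⟩, fun _ h => h⟩
    rcases Multiset.mem_cons.1 hp with rfl | hp
    · rw [Item.hasColor_fixed hst] at hpb; cases hpb
    · exact Multiset.mem_cons_of_mem hp
  · rintro j ⟨p, hp, hpr, hpt, hpm⟩
    rw [hm] at hpm
    rcases Multiset.mem_cons.1 hp with rfl | hp
    · exact absurd (.inr ⟨q, by simp, hb.symm, hq⟩) hpm
    · exact ⟨p, Multiset.mem_cons_of_mem hp, hpr, hpt, hpm⟩
  · rintro _
    exact ⟨q, by simp, hq⟩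

/-! ### Marking and colouring -/

/-- The items of type `i` with mark `m` have been marked until time `T`, and those that were marked
at the same time are in at most `C` bins. -/
structure Batched (s : Packing) (i : ℕ) (m : Mark) (T C : ℕ) : Prop where
  le : ∀ p ∈ s, p.typ = i → p.mark = some m → p.batch ≤ T
  class_card : ∀ τ, ∃ F : Finset ℕ, F.card ≤ C ∧
    ∀ p ∈ s, p.typ = i → p.mark = some m → p.batch = τ → p.bin ∈ F

lemma Batched.of_subset {s s' : Packing} {i : ℕ} {m : Mark} {T C : ℕ} (h : Batched s i m T C)
    (hs : ∀ p' ∈ s', p'.typ = i → p'.mark = some m → ∃ p ∈ s, p.typ = i ∧ p.mark = some m ∧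
      p.batch = p'.batch ∧ p.bin = p'.bin) : Batched s' i m T C where
  le p' h1 h2 h3 := by
    obtain ⟨p, h4, h5, h6, h7, -⟩ := hs p' h1 h2 h3
    rw [← h7]; exact h.le p h4 h5 h6
  class_card τ := by
    obtain ⟨F, hF, h4⟩ := h.class_card τ
    refine ⟨F, hF, fun p' h1 h2 h3 h8 => ?_⟩
    obtain ⟨p, h5, h6, h7, h9, h10⟩ := hs p' h1 h2 h3
    rw [← h10]; exact h4 p h5 h6 h7 (h9.trans h8)

lemma Batched.mono {s : Packing} {i : ℕ} {m : Mark} {T T' C : ℕ} (h : Batched s i m T C)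
    (hT : T ≤ T') : Batched s i m T' C :=
  ⟨fun p h1 h2 h3 => (h.le p h1 h2 h3).trans hT, h.class_card⟩

/-- At most one step per mark and type is performed at time `T + 1`, and no older item has this
time. The new class lies in `F`, and the old classes only lose items. -/
lemma Batched.new_class {s s' : Packing} {i : ℕ} {m : Mark} {T C : ℕ} (h : Batched s i m T C)
    {F : Finset ℕ} (hF : F.card ≤ C)
    (hs : ∀ p' ∈ s', p'.typ = i → p'.mark = some m → p' ∈ s ∨ p'.batch = T + 1 ∧ p'.bin ∈ F) :
    Batched s' i m (T + 1) C where
  le p' h1 h2 h3 := by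
    rcases hs p' h1 h2 h3 with h4 | h4
    · exact (h.le p' h4 h2 h3).trans (Nat.le_succ T)
    · exact h4.1.le
  class_card τ := by
    by_cases hτ : τ = T + 1
    · refine ⟨F, hF, fun p' h1 h2 h3 h4 => ?_⟩
      rcases hs p' h1 h2 h3 with h5 | h5
      · have := h.le p' h5 h2 h3; omega
      · exact h5.2
    · obtain ⟨F', hF', h4⟩ := h.class_card τ
      refine ⟨F', hF', fun p' h1 h2 h3 h5 => ?_⟩
      rcases hs p' h1 h2 h3 with h6 | h6
      · exact h4 p' h6 h2 h3 h5
      · exact absurd (h5.symm.trans h6.1) hτ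

lemma SameOff.batched {i j : ℕ} {s s' : Packing} (h : SameOff i s s') (hj : j ≠ i) {m : Mark}
    {T C : ℕ} (hb : Batched s j m T C) : Batched s' j m T C := by
  refine hb.of_subset fun p h1 h2 h3 => ⟨p, ?_, h2, h3, rfl, rfl⟩
  have : p ∈ s'.filter (fun p => p.typ = j) := Multiset.mem_filter.2 ⟨h1, h2⟩
  rw [h j hj] at this
  exact (Multiset.mem_filter.1 this).1

/-! ### The four marking steps as changes of the counts -/

/-- The effect of a part of the marking procedure for the active type `i`. -/
structure Effect (P : Params) (i : ℕ) (s s' : Packing) : Prop where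
  good : GoodBins P s'
  sep : Separated P s'
  off : SameOff i s s'
  rest : KindedRest s' i

/-- The state after an item of type `i` may have been packed into a bin with a marked item. -/
def Arrived (α : ℝ) (a : Kind → ℕ) (i : ℕ) (s : Packing) : Prop :=
  (KindedRest s i ∧ Kind.Arrive α a (kcount s i)) ∨
  ∃ b₀ k k', ((k, k') = (Kind.XR, Kind.R2) ∨ (k, k') = (Kind.XN, Kind.N2)) ∧
    sg i (content s b₀) = k.ms ∧ (∀ b ≠ b₀, ∃ l : Kind, l.Rest ∧ sg i (content s b) = l.ms) ∧
    ∀ a', Move 1 k k' (kcount s i) a' → Kind.Arrive α a a'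

lemma Kind.Rest.not_half_marked {k : Kind} (hk : k.Rest) {st st' : Status} {m : Mark}
    (h : (st, none) ∈ k.ms) (h' : (st', some m) ∈ k.ms) : False := by
  unfold Kind.Rest at hk
  cases k <;> simp_all [Kind.ms]

lemma marked_not_bonus {P : Params} {s : Packing} (hg : GoodBins P s) {p : Item} (hp : p ∈ s)
    (hm : p.mark ≠ none) : p.status ≠ .bonus :=
  fun hb => hm ((hg p.bin).bonus p (mem_content_self hp) hb).2.1

lemma not_half_marked {s : Packing} {i b : ℕ} {k : Kind} (hk : k.Rest)
    (hb : sg i (content s b) = k.ms) {p₁ p₂ : Item} (h1 : p₁ ∈ content s b)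
    (h2 : p₂ ∈ content s b) (ht1 : p₁.typ = i) (ht2 : p₂.typ = i) (hs1 : p₁.status ≠ .bonus)
    (hs2 : p₂.status ≠ .bonus) (hm1 : p₁.mark = none) (hm2 : p₂.mark ≠ none) : False := by
  have h3 := mem_sg h1 ht1 hs1
  have h4 := mem_sg h2 ht2 hs2
  rw [hb] at h3 h4
  obtain ⟨m, hm⟩ := Option.ne_none_iff_exists'.1 hm2
  rw [hm1] at h3; rw [hm] at h4
  exact hk.not_half_marked h3 h4

/-- The only bin that can contain an unmarked item next to a marked one is that of the item just
packed. Its kind `XR` or `XN` is turned into `R2` or `N2`, and the counts then agree with one of the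
changes listed in `Kind.Arrive`. Copying the time along with the mark keeps the classes in the same
bins. -/
lemma copyMark_effect {P : Params} {i : ℕ} (hi : P.Act i) {α : ℝ} {a : Kind → ℕ} {s s' : Packing}
    (hg : GoodBins P s) (hs : Separated P s) (hA : Arrived α a i s)
    (h : IfStep (copyMark i) s s') :
    Effect P i s s' ∧ Kind.Arrive α a (kcount s' i) ∧
      ∀ m T C, Batched s i m T C → Batched s' i m T C := by
  rcases h with ⟨p₁, r, rfl, ht1, hc1, hm1, p₂, hp2, hb2, ht2, hc2, hm2, rfl⟩ | ⟨rfl, h⟩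
  · have hp1c : p₁ ∈ content (p₁ ::ₘ r) p₁.bin := mem_content_self (Multiset.mem_cons_self p₁ r)
    have hp2c : p₂ ∈ content (p₁ ::ₘ r) p₁.bin := by simp [hp2, hb2]
    have hbad : ∀ k : Kind, k.Rest → sg i (content (p₁ ::ₘ r) p₁.bin) ≠ k.ms :=
      fun k hk hkb => not_half_marked hk hkb hp1c hp2c ht1 ht2 hc1.not_bonus hc2.not_bonus hm1 hm2
    rcases hA with ⟨hA, -⟩ | ⟨b₀, k, k', hk, hb0, hne, hA⟩
    · obtain ⟨k, hk, hkb⟩ := hA p₁.bin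
      exact absurd hkb (hbad k hk)
    have hb : p₁.bin = b₀ := by
      by_contra hb
      obtain ⟨l, hl, hlb⟩ := hne _ hb
      exact hbad l hl hlb
    subst hb
    set p' : Item := { p₁ with mark := p₂.mark, batch := p₂.batch } with hp'
    obtain ⟨m, hm⟩ := Option.ne_none_iff_exists'.1 hm2
    have hsg1 := hb0
    rw [content_cons_self, sg_cons_pos ht1 hc1.not_bonus, hm1] at hsg1
    have h2 : (p₂.status, some m) ∈ sg i (content r p₁.bin) := by
      rw [← hm]; exact mem_sg (by simp [hp2, hb2]) ht2 hc2.not_bonus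
    have hst : p₁.status = .fixed .blue := by
      have : (p₁.status, none) ∈ k.ms := by rw [← hsg1]; simp
      rcases hk with hk | hk <;> cases hk <;> simpa [Kind.ms] using this
    have hsg2 : sg i (content (p' ::ₘ r) p₁.bin) = k'.ms := by
      change sg i (content (p' ::ₘ r) p'.bin) = k'.ms
      rw [content_cons_self, sg_cons_pos (show p'.typ = i from ht1) hc1.not_bonus]
      change (p₁.status, p₂.mark) ::ₘ sg i (content r p₁.bin) = _
      rw [hst] at hsg1 ⊢
      rcases hk with hk | hk <;> cases hk
      all_goals
        have hsg3 : sg i (content r p₁.bin) = {(.fixed .blue, some _)} :=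
          (Multiset.cons_inj_right _).1 hsg1
        rw [hsg3] at h2 ⊢
        rw [Multiset.mem_singleton, Prod.mk.injEq] at h2
        rw [hm, h2.2]; rfl
    have hsg3 : ∀ b ≠ p₁.bin, sg i (content (p' ::ₘ r) b) = sg i (content (p₁ ::ₘ r) b) :=
      fun b hb => sg_update_ne (p := p₁) (p' := p') rfl hb
    refine ⟨⟨?_, ?_, SameOff.cons ht1 ht1 (SameOff.refl _ _), fun b => ?_⟩,
      hA _ (kcount_move_one p₁.bin hsg3 hb0 hsg2), fun m T C hB => hB.of_subset fun q hq h1 h2 => ?_⟩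
    · refine hg.update rfl ?_
      have h1 := hg p₁.bin
      rw [content_cons_self] at h1
      refine h1.remark_cons ⟨rfl, rfl, rfl, rfl, .inr ⟨hm2, ht1 ▸ hi, ⟨_, hst⟩, fun h => ?_⟩⟩
      cases h.unique hc1
    · apply SameColors.separated _ hs
      simp only [SameColors, Multiset.map_cons]; rfl
    · by_cases hb : b = p₁.bin
      · subst hb
        exact ⟨k', by rcases hk with hk | hk <;> cases hk <;> simp [Kind.Rest], hsg2⟩
      · rw [hsg3 b hb]; exact hne b hb
    · rcases Multiset.mem_cons.1 hq with rfl | hq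
      · exact ⟨p₂, by simp [hp2], ht2, h2, rfl, hb2⟩
      · exact ⟨q, by simp [hq], h1, h2, rfl, rfl⟩
  · rcases hA with ⟨hA, hA'⟩ | ⟨b₀, k, k', hk, hb0, hne, hA⟩
    · exact ⟨⟨hg, hs, SameOff.refl _ _, hA⟩, hA', fun _ _ _ h => h⟩
    · exfalso
      have h1 : (Status.fixed .blue, none) ∈ sg i (content s' b₀) := by
        rw [hb0]; rcases hk with hk | hk <;> cases hk <;> simp [Kind.ms]
      obtain ⟨p₁, hp1, ht1, hs1, hm1, -⟩ := exists_of_mem_sg h1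
      rw [mem_content] at hp1
      obtain ⟨hp1, rfl⟩ := hp1
      obtain ⟨r, rfl⟩ := Multiset.exists_cons_of_mem hp1
      rw [content_cons_self, sg_cons_pos ht1 (by rw [hs1]; simp), hs1, hm1] at hb0
      obtain ⟨m, hm⟩ : ∃ m, sg i (content r p₁.bin) = {(.fixed .blue, some m)} := by
        rcases hk with hk | hk <;> cases hk
        · exact ⟨.R, (Multiset.cons_inj_right _).1 hb0⟩
        · exact ⟨.N, (Multiset.cons_inj_right _).1 hb0⟩
      obtain ⟨p₂, hp2, ht2, hs2, hm2, -⟩ := exists_of_mem_sg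
        (i := i) (c := content r p₁.bin) (st := .fixed .blue) (m := some m) (by rw [hm]; simp)
      rw [mem_content] at hp2
      exact h _ ⟨p₁, r, rfl, ht1, .inr hs1, hm1, p₂, hp2.1, hp2.2, ht2, .inr hs2, by simp [hm2], rfl⟩

lemma exists_of_kcount {s : Packing} {i : ℕ} {k : Kind} (h : kcount s i k ≠ 0) :
    ∃ b, sg i (content s b) = k.ms := by
  by_contra hc; push Not at hc
  apply h
  unfold kcount
  convert Set.ncard_empty ℕ
  ext b; simp [hc b]

lemma kind_of_red {k : Kind} {m : Option Mark} (h : (Status.fixed .red, m) ∈ k.ms) :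
    k = Kind.redKind m := by
  cases k <;> simp_all [Kind.ms, Kind.redKind]

lemma redKind_ms (m : Option Mark) : (Kind.redKind m).ms = {(.fixed .red, m)} := by
  rcases m with _ | _ | _ | _ <;> rfl

lemma pairKind_ms (m : Option Mark) :
    (Kind.pairKind m).ms = {(.fixed .blue, m), (.fixed .blue, m)} := by
  rcases m with _ | _ | _ | _ <;> rfl

lemma redKind_rest (m : Option Mark) : (Kind.redKind m).Rest := by
  rcases m with _ | _ | _ | _ <;> simp [Kind.redKind, Kind.Rest]

lemma pairKind_rest (m : Option Mark) : (Kind.pairKind m).Rest := by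
  rcases m with _ | _ | _ | _ <;> simp [Kind.pairKind, Kind.Rest]

/-- Unmarked items of an active type with a definite colour are in mixed bins. -/
lemma mixed_of_unmarked {P : Params} {s : Packing} {i : ℕ} (hi : P.Act i) (hg : GoodBins P s)
    (hk : KindedRest s i) {q : Item} (hq : q ∈ s) (ht : q.typ = i) (hm : q.mark = none) {c : Color}
    (hc : q.status = .fixed c) :
    (∃ y ∈ content s q.bin, y.HasColor .blue) ∧ ∃ y ∈ content s q.bin, y.HasColor .red := by
  rcases (hg q.bin).unmarked q (mem_content_self hq) (ht ▸ hi) hm c hc with h | ⟨q', h1, h2, h3⟩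
  · exact h
  · exfalso
    obtain ⟨k, hk1, hk2⟩ := hk q.bin
    exact not_half_marked hk1 hk2 (mem_content_self hq) h1 ht (h2.trans ht) (by rw [hc]; simp)
      (marked_not_bonus hg (mem_content.1 h1).1 h3) hm h3

lemma Mixed.of_colors {s : Packing} {b : ℕ} (h : (∃ y ∈ content s b, y.HasColor .blue) ∧
    ∃ y ∈ content s b, y.HasColor .red) : Mixed s b := mixed_iff.2 (.inl h)

/-- In the bin of a bonus item there are no coloured items of an active type. -/
lemma sg_bonus {P : Params} {i : ℕ} (hi : P.Act i) {q : Item} {c : Packing}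
    (hg : P.GoodBin (q ::ₘ c)) (hq : q.status = .bonus) : sg i c = 0 := by
  obtain ⟨-, -, y, hc, hyb, hyl⟩ := hg.bonus q (by simp) hq
  have hcy : c = {y} := (Multiset.cons_inj_right q).1 hc
  obtain ⟨-, -, hny, -, -⟩ := hg.bonus_y (by rw [hcy]; simp) hyb hyl
  rw [hcy]
  refine sg_eq_zero fun p hp => .inl ?_
  rw [Multiset.mem_singleton] at hp
  rw [hp]; rintro rfl; exact hny hi

lemma xTwo_eq {P : Params} {s : Packing} {i : ℕ} (hg : GoodBins P s) (h : Kinded s i) (m : Mark) :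
    P.xTwo s i m = Kind.xt (P.redfrac i) (Kind.totMark (kcount s i) m)
      (kcount s i (Kind.redKind (some m))) := by
  rw [← nTotMark_eq hg h, ← nRedMark_eq h]; rfl

lemma xOne_eq {P : Params} {s : Packing} {i : ℕ} (hg : GoodBins P s) (h : Kinded s i) (m : Mark) :
    P.xOne s i m = Kind.xo (P.redfrac i) (Kind.totMark (kcount s i) m)
      (kcount s i (Kind.redKind (some m))) := by
  rw [← nTotMark_eq hg h, ← nRedMark_eq h]; rfl

lemma exists_le_of_le_card {A : Type*} {s : Multiset A} {x : ℕ} (hx : x ≤ s.card) :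
    ∃ S ≤ s, S.card = x := by
  induction s using Quotient.inductionOn with
  | _ l =>
    refine ⟨(l.take x : List A), ?_, ?_⟩
    · exact Multiset.coe_le.2 (l.take_sublist x).subperm
    · simpa using hx

lemma exists_split {A : Type*} (s : Multiset A) (Q : A → Prop) [DecidablePred Q] {x : ℕ}
    (hx : x ≤ (s.filter Q).card) : ∃ S r, s = S + r ∧ S.card = x ∧ (∀ p ∈ S, Q p) ∧
      ∀ p ∈ s, ¬ Q p → p ∈ r := by
  obtain ⟨S, hS, hc⟩ := exists_le_of_le_card hx
  obtain ⟨r, hr⟩ := Multiset.le_iff_exists_add.1 hS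
  refine ⟨S, r + s.filter (fun p => ¬ Q p), ?_, hc, fun p hp => ?_, fun p hp hQ => ?_⟩
  · rw [← add_assoc, ← hr, Multiset.filter_add_not]
  · exact (Multiset.mem_filter.1 (Multiset.mem_of_le hS hp)).2
  · exact Multiset.mem_add.2 (.inr (Multiset.mem_filter.2 ⟨hp, hQ⟩))

/-- The step is the change of the provisional items in `S` followed by that of `q`. Conversely,
enough provisionally blue items and a bin of kind `RU` make the step possible, so its failure gives
the second alternative of `StepR`. The new class consists of `x + 1` items, hence `hC`. -/
lemma markR_effect {P : Params} {i : ℕ} (hi : P.Act i) {s s' : Packing} {τ C : ℕ}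
    (hg : GoodBins P s) (hs : Separated P s) (hk : KindedRest s i)
    (h : IfStep (P.markR i (τ + 1)) s s') (hC : P.xTwo s i .R + 1 ≤ C) :
    Effect P i s s' ∧ Kind.StepR (P.redfrac i) (kcount s i) (kcount s' i) ∧
      (Batched s i .R τ C → Batched s' i .R (τ + 1) C) ∧
      ∀ T, Batched s i .N T C → Batched s' i .N T C := by
  have hx := xTwo_eq hg hk.kinded .R
  rcases h with ⟨S, q, r, rfl, hcard, hS, hqt, hqm, hq, rfl⟩ | ⟨rfl, h⟩
  · set S' := S.map (fun p => p.assign .R (τ + 1) .blue) with hS'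
    set q' := q.assign .R (τ + 1) .red with hq'
    have hrel : Multiset.Rel (ProvUpdate i) S S' :=
      Multiset.rel_map_right.2 (Multiset.rel_refl_of_refl_on fun p hp =>
        ⟨(hS p hp).1, ⟨_, (hS p hp).2⟩, rfl, (hS p hp).1, rfl,
          .inr ⟨.blue, .R, rfl, rfl, by simp, by simp⟩⟩)
    obtain ⟨k1, k2, k3, k4⟩ := provUpdates hi hrel (q ::ₘ r) hg
    replace k3 := k3 hk
    have hmarkS : ∀ p ∈ S, p.mark = none := fun p hp =>
      ((hg p.bin).prov p (mem_content_self (by simp [hp])) _ (hS p hp).2).2.1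
    have hmove1 : Move (P.xTwo (S + q ::ₘ r) i .R) .PB .R1 (kcount (S + q ::ₘ r) i)
        (kcount (S' + q ::ₘ r) i) := by
      intro l hl
      have h1 : ncount S l = if Kind.PB = l then S.card else 0 :=
        ncount_const fun p hp => by rw [(hS p hp).2, hmarkS p hp]; rfl
      have h2 : ncount S' l = if Kind.R1 = l then S'.card else 0 :=
        ncount_const fun p hp => by
          obtain ⟨p, -, rfl⟩ := Multiset.mem_map.1 hp; rfl
      have h3 := k4 l hl
      rw [h1, h2, hS', Multiset.card_map, hcard] at h3
      exact h3
    have hsep : Separated P (S' + q ::ₘ r) := by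
      apply SameColors.separated _ hs
      simp only [SameColors, Multiset.map_add, hS', Multiset.map_map]
      congr 1
      apply Multiset.map_congr rfl
      intro p hp
      simp [Item.erase, Item.assign, (hS p hp).2, Status.fix]
    rw [Multiset.add_cons] at k1 hsep
    have hgq := k1 q.bin
    rw [content_cons_self] at hgq
    have hqa : P.Act q'.typ := by change P.Act q.typ; rw [hqt]; exact hi
    have hsg0 : ∀ b ≠ q.bin, sg i (content (S' + q' ::ₘ r) b) =
        sg i (content (S' + q ::ₘ r) b) := fun b hb => by
      rw [Multiset.add_cons, Multiset.add_cons]; exact sg_update_ne (p := q) (p' := q') rfl hb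
    have key : ∃ k : Kind, (k = .O ∨ k = .RU) ∧ sg i (content (S' + q ::ₘ r) q.bin) = k.ms ∧
        sg i (content (S' + q' ::ₘ r) q.bin) = Kind.RR.ms ∧
        GoodBins P (q' ::ₘ (S' + r)) ∧ Separated P (q' ::ₘ (S' + r)) := by
      have e2 : sg i (content (S' + q' ::ₘ r) q.bin) =
          (.fixed .red, some .R) ::ₘ sg i (content (S' + r) q.bin) := by
        rw [Multiset.add_cons]
        change sg i (content (q' ::ₘ (S' + r)) q'.bin) = _
        rw [content_cons_self, sg_cons_pos (show q'.typ = i from hqt)]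
        · rfl
        · change Status.fixed .red ≠ _; simp
      -- A bonus item is not counted and turns a bin of kind `O` into one of kind `RR`; an unmarked
      -- red item turns `RU` into `RR`.
      rcases hq with hq | ⟨hq, hqmix, -⟩
      · have hz := sg_bonus hi hgq hq
        refine ⟨.O, .inl rfl, ?_, ?_, k1.update rfl ?_, relabel_separated k1 hq rfl rfl hsep⟩
        · rw [Multiset.add_cons, content_cons_self, sg_cons_neg (.inr hq), hz]; rfl
        · rw [e2, hz]; rfl
        · exact hgq.relabel hq hqa.pos hqa.le hqa.redfrac_pos rfl rfl (.inl rfl) (.inr hqa)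
      · obtain ⟨k, hk1, hk2⟩ := k3 q.bin
        have hmem : (Status.fixed .red, (none : Option Mark)) ∈ k.ms := by
          rw [← hk2, ← hq, ← hqm]
          exact mem_sg (mem_content_self (by simp)) hqt (by rw [hq]; simp)
        have hk3 := kind_of_red hmem
        rw [hk3, redKind_ms, Multiset.add_cons, content_cons_self,
          sg_cons_pos hqt (by rw [hq]; simp), hq, hqm] at hk2
        have hz : sg i (content (S' + r) q.bin) = 0 :=
          (Multiset.cons_inj_right _).1 (hk2.trans (Multiset.cons_zero _).symm)
        have hsc : SameColors (q ::ₘ (S' + r)) (q' ::ₘ (S' + r)) := by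
          simp only [SameColors, Multiset.map_cons]
          congr 1
          simp [Item.erase, hq', Item.assign, hq, Status.fix]
        refine ⟨.RU, .inr rfl, ?_, ?_, k1.update rfl ?_, hsc.separated hsep⟩
        · rw [Multiset.add_cons, content_cons_self, sg_cons_pos hqt (by rw [hq]; simp), hz, hq, hqm]
          rfl
        · rw [e2, hz]; rfl
        · refine hgq.remark_cons ⟨rfl, rfl, hq.symm, rfl, .inr ⟨by simp [hq', Item.assign], hqa,
            ⟨_, hq⟩, fun _ _ => ?_⟩⟩
          rw [← k2, mixed_iff, Multiset.add_cons, content_cons_self] at hqmix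
          rcases hqmix with hqmix | ⟨p, hp, hpb⟩
          · exact hqmix.1
          · obtain ⟨-, -, y, hy, hyb, -⟩ := hgq.bonus p hp hpb
            exact ⟨y, by rw [hy]; simp, .inr hyb⟩
    obtain ⟨k, hk1, hk2, hk3, hk4, hk5⟩ := key
    rw [← Multiset.add_cons] at hk4 hk5
    refine ⟨⟨hk4, hk5, ?_, fun b => ?_⟩, .inl ⟨_, hx ▸ hmove1, ?_⟩, fun hB => ?_, fun T hB => ?_⟩
    · refine SameOff.add (SameOff.map fun p hp => .inr ⟨(hS p hp).1, (hS p hp).1⟩)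
        (SameOff.cons hqt hqt (SameOff.refl _ _))
    · by_cases hb : b = q.bin
      · subst hb; exact ⟨.RR, by simp [Kind.Rest], hk3⟩
      · rw [hsg0 b hb]; exact k3 b
    · rcases hk1 with rfl | rfl
      · exact .inl (kcount_move_one q.bin hsg0 hk2 hk3)
      · exact .inr (kcount_move_one q.bin hsg0 hk2 hk3)
    · refine hB.new_class (F := ((q ::ₘ S).map Item.bin).toFinset) ?_ fun p' hp' _ _ => ?_
      · refine (Multiset.toFinset_card_le _).trans ?_
        rw [Multiset.card_map, Multiset.card_cons, hcard]; exact hC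
      · rcases Multiset.mem_add.1 hp' with hp' | hp'
        · obtain ⟨p, hp, rfl⟩ := Multiset.mem_map.1 hp'
          refine .inr ⟨rfl, ?_⟩
          rw [Multiset.mem_toFinset]
          exact Multiset.mem_map.2 ⟨p, by simp [hp], rfl⟩
        · rcases Multiset.mem_cons.1 hp' with rfl | hp'
          · exact .inr ⟨rfl, by rw [Multiset.mem_toFinset]; exact Multiset.mem_map.2 ⟨q, by simp, rfl⟩⟩
          · exact .inl (by simp [hp'])
    · refine hB.of_subset fun p' hp' h1 h2 => ?_
      rcases Multiset.mem_add.1 hp' with hp' | hp'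
      · obtain ⟨p, hp, rfl⟩ := Multiset.mem_map.1 hp'
        simp [Item.assign] at h2
      · rcases Multiset.mem_cons.1 hp' with rfl | hp'
        · simp [hq', Item.assign] at h2
        · exact ⟨p', by simp [hp'], h1, h2, rfl, rfl⟩
  · refine ⟨⟨hg, hs, SameOff.refl _ _, hk⟩, .inr ⟨rfl, ?_⟩, fun hB => hB.mono (Nat.le_succ τ),
      fun _ h => h⟩
    by_contra hc
    push Not at hc
    obtain ⟨h1, h2⟩ := hc
    change _ ≤ kcount s' i .PB at h2
    have h3 := card_prov_eq hk.kinded .blue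
    simp only at h3
    obtain ⟨S, r, hsr, hcard, hS, hr⟩ := exists_split s'
      (fun p => p.typ = i ∧ p.status = .prov .blue) (x := P.xTwo s' i .R) (by
        rw [h3, hx]; exact h2)
    obtain ⟨b, hb⟩ := exists_of_kcount h1
    obtain ⟨q, hq1, hq2, hq3, hq4, -⟩ := exists_of_mem_sg (i := i) (c := content s' b)
      (st := .fixed .red) (m := none) (by rw [hb]; simp [Kind.ms])
    rw [mem_content] at hq1
    -- The rule prefers bonus items, so the red item may be used only if there are none. Its bin is
    -- mixed because unmarked items with a definite colour are only in bins of both colours at this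
    -- point.
    have key : ∃ q ∈ s', q.typ = i ∧ q.mark = none ∧ (q.status = .bonus ∨
        (q.status = .fixed .red ∧ Mixed s' q.bin ∧ ¬ ∃ p ∈ s', p.typ = i ∧ p.status = .bonus)) := by
      by_cases hbo : ∃ p ∈ s', p.typ = i ∧ p.status = .bonus
      · obtain ⟨p, hp, hpt, hpb⟩ := hbo
        exact ⟨p, hp, hpt, ((hg p.bin).bonus p (mem_content_self hp) hpb).2.1, .inl hpb⟩
      · exact ⟨q, hq1.1, hq2, hq4, .inr ⟨hq3,
          Mixed.of_colors (mixed_of_unmarked hi hg hk hq1.1 hq2 hq4 hq3), hbo⟩⟩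
    obtain ⟨p, hp, hpt, hpm, hpq⟩ := key
    have hpr : p ∈ r := hr p hp (by
      rintro ⟨-, h6⟩; rw [h6] at hpq; simp at hpq)
    obtain ⟨r', rfl⟩ := Multiset.exists_cons_of_mem hpr
    exact h _ ⟨S, p, r', hsr, hcard, hS, hpt, hpm, hpq, rfl⟩

lemma sg_map {i : ℕ} {c : Packing} {g : Item → Item} (f : Status × Option Mark → Status × Option Mark)
    (h1 : ∀ p ∈ c, (g p).typ = p.typ) (h2 : ∀ p ∈ c, (g p).status = .bonus ↔ p.status = .bonus)
    (h3 : ∀ p ∈ c, p.typ = i → p.status ≠ .bonus → ((g p).status, (g p).mark) = f (p.status, p.mark)) :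
    sg i (c.map g) = (sg i c).map f := by
  induction c using Multiset.induction_on with
  | empty => simp [sg_zero]
  | cons p c ih =>
    have ih' := ih (fun p hp => h1 p (by simp [hp])) (fun p hp => h2 p (by simp [hp]))
      (fun p hp => h3 p (by simp [hp]))
    have e1 := h1 p (by simp)
    have e2 := h2 p (by simp)
    rw [Multiset.map_cons]
    by_cases hp : p.typ = i ∧ p.status ≠ .bonus
    · rw [sg_cons_pos hp.1 hp.2, sg_cons_pos (e1.trans hp.1) (by rw [ne_eq, e2]; exact hp.2), ih',
        Multiset.map_cons, h3 p (by simp) hp.1 hp.2]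
    · have hp' : p.typ ≠ i ∨ p.status = .bonus := by tauto
      rw [sg_cons_neg hp', sg_cons_neg (by rw [e1, e2]; exact hp'), ih']

lemma hasPair_iff {s : Packing} {i b : ℕ} {m : Option Mark} (h : KindedRest s i) :
    HasPair s i m b ↔ sg i (content s b) = (Kind.pairKind m).ms := by
  obtain ⟨k, hk, hkb⟩ := h b
  have h1 : ((content s b).filter (fun p => p.typ = i ∧ p.HasColor .blue ∧ p.mark = m)).card =
      ((sg i (content s b)).filter
        (fun q => (q.1 = .prov .blue ∨ q.1 = .fixed .blue) ∧ q.2 = m)).card := by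
    unfold sg
    rw [Multiset.filter_map, Multiset.card_map, Multiset.filter_filter]
    congr 1
    apply Multiset.filter_congr
    intro p _
    simp only [Function.comp]
    constructor
    · rintro ⟨h1, h2, h3⟩; exact ⟨⟨h2, h3⟩, h1, h2.not_bonus⟩
    · rintro ⟨⟨h2, h3⟩, h1, -⟩; exact ⟨h1, h2, h3⟩
  unfold HasPair
  rw [h1, hkb, Kind.ms_eq_iff]
  unfold Kind.Rest at hk
  rcases m with _ | _ | _ | _ <;> cases k <;>
    simp_all [Kind.ms, Kind.pairKind, Multiset.filter_singleton]

/-- The blue items of type `i` in the bins `T`, which have two of them with mark `m`. -/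
lemma item_of_pair {s : Packing} {i b : ℕ} {m : Option Mark}
    (hb : sg i (content s b) = (Kind.pairKind m).ms) {p : Item} (hp : p ∈ s) (hpb : p.bin = b)
    (ht : p.typ = i) (hnb : p.status ≠ .bonus) : p.status = .fixed .blue ∧ p.mark = m := by
  have h := mem_sg (i := i) (c := content s b) (by simp [hp, hpb]) ht hnb
  rw [hb, pairKind_ms] at h
  simpa using h

/-- The marks of the items of type `i` in bins with two blue ones are changed. -/
lemma pairs_effect {P : Params} {i : ℕ} (hi : P.Act i) {s : Packing} {m : Option Mark} {M : Mark}
    (hg : GoodBins P s) (hk : KindedRest s i) {T : Finset ℕ}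
    (hT : ∀ b ∈ T, sg i (content s b) = (Kind.pairKind m).ms) {g : Item → Item}
    (hg1 : ∀ p ∈ s, p.bin ∈ T → p.typ = i → p.status = .fixed .blue → p.mark = m →
      ((g p).size = p.size ∧ (g p).typ = p.typ ∧ (g p).status = p.status ∧ (g p).bin = p.bin) ∧
        (g p).mark = some M)
    (hg2 : ∀ p ∈ s, ¬ (p.bin ∈ T ∧ p.typ = i ∧ p.HasColor .blue ∧ p.mark = m) → g p = p) :
    GoodBins P (s.map g) ∧ SameColors s (s.map g) ∧ SameOff i s (s.map g) ∧ KindedRest (s.map g) i ∧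
      Move T.card (Kind.pairKind m) (Kind.pairKind (some M)) (kcount s i) (kcount (s.map g) i) := by
  have hcase : ∀ p ∈ s, (p.bin ∈ T ∧ p.typ = i ∧ p.status = .fixed .blue ∧ p.mark = m ∧
      ((g p).size = p.size ∧ (g p).typ = p.typ ∧ (g p).status = p.status ∧ (g p).bin = p.bin) ∧
        (g p).mark = some M) ∨ g p = p := by
    intro p hp
    by_cases h : p.bin ∈ T ∧ p.typ = i ∧ p.HasColor .blue ∧ p.mark = m
    · obtain ⟨h1, h2, h3, h4⟩ := h
      have h5 := (item_of_pair (hT _ h1) hp rfl h2 h3.not_bonus).1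
      exact .inl ⟨h1, h2, h5, h4, hg1 p hp h1 h2 h5 h4⟩
    · exact .inr (hg2 p hp h)
  have hbasic : ∀ p ∈ s, (g p).size = p.size ∧ (g p).typ = p.typ ∧ (g p).status = p.status ∧
      (g p).bin = p.bin := by
    intro p hp
    rcases hcase p hp with h | h
    · exact h.2.2.2.2.1
    · rw [h]; exact ⟨rfl, rfl, rfl, rfl⟩
  have hcont : ∀ b, content (s.map g) b = (content s b).map g := by
    intro b; unfold content; rw [Multiset.filter_map]
    congr 1; apply Multiset.filter_congr
    intro p hp; simp [(hbasic p hp).2.2.2]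
  have hsgT : ∀ b ∈ T, sg i (content (s.map g) b) = (Kind.pairKind (some M)).ms := by
    intro b hb
    rw [hcont, sg_map (fun q => (q.1, some M)), hT b hb, pairKind_ms, pairKind_ms]
    · rfl
    · exact fun p hp => (hbasic p (mem_content.1 hp).1).2.1
    · exact fun p hp => by rw [(hbasic p (mem_content.1 hp).1).2.2.1]
    · intro p hp ht hnb
      rw [mem_content] at hp
      obtain ⟨h1, h2⟩ := item_of_pair (hT b hb) hp.1 hp.2 ht hnb
      obtain ⟨h3, h4⟩ := hg1 p hp.1 (hp.2 ▸ hb) ht h1 h2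
      rw [h3.2.2.1, h4]
  have hsgN : ∀ b ∉ T, sg i (content (s.map g) b) = sg i (content s b) := by
    intro b hb
    rw [hcont]
    congr 1
    conv_rhs => rw [← Multiset.map_id (content s b)]
    apply Multiset.map_congr rfl
    intro p hp
    rw [mem_content] at hp
    exact hg2 p hp.1 (fun h => hb (hp.2 ▸ h.1))
  refine ⟨fun b => ?_, ?_, ?_, fun b => ?_, kcount_move T hsgN hT hsgT⟩
  · rw [hcont]
    refine (hg b).remark_map fun p hp => ?_
    rw [mem_content] at hp
    obtain ⟨h1, h2, h3, h4⟩ := hbasic p hp.1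
    refine ⟨h1, h2, h3, h4, ?_⟩
    rcases hcase p hp.1 with h | h
    · refine .inr ⟨by rw [h.2.2.2.2.2]; simp, h.2.1 ▸ hi, ⟨_, h.2.2.1⟩, fun h' => ?_⟩
      rw [Item.hasColor_fixed h.2.2.1] at h'; cases h'
    · rw [h]; exact .inl rfl
  · unfold SameColors
    rw [Multiset.map_map]
    apply Multiset.map_congr rfl
    intro p hp
    obtain ⟨h1, h2, h3, h4⟩ := hbasic p hp
    simp only [Function.comp, Item.erase, h1, h2, h3, h4]
  · refine SameOff.map fun p hp => ?_
    rcases hcase p hp with h | h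
    · exact .inr ⟨h.2.1, h.2.2.2.2.1.2.1.trans h.2.1⟩
    · exact .inl h
  · by_cases hb : b ∈ T
    · exact ⟨_, pairKind_rest _, hsgT b hb⟩
    · rw [hsgN b hb]; exact hk b

/-- A set of bins with two blue items each. -/
lemma exists_pairs {s : Packing} {i : ℕ} {m : Option Mark} {n : ℕ}
    (h : n ≤ kcount s i (Kind.pairKind m)) : ∃ T : Finset ℕ, T.card = n ∧
      ∀ b ∈ T, sg i (content s b) = (Kind.pairKind m).ms := by
  rw [kcount_eq (by rcases m with _ | _ | _ | _ <;> simp [Kind.pairKind]) (Finset.Subset.refl _)] at h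
  obtain ⟨T, h1, h2⟩ := Finset.exists_subset_card_eq h
  exact ⟨T, h2, fun b hb => (Finset.mem_filter.1 (h1 hb)).2⟩

/-- The change of one provisionally coloured item that gets a mark. -/
lemma assign_red_effect {P : Params} {i : ℕ} (hi : P.Act i) {q : Item} {r : Packing} {m : Mark}
    {τ : ℕ} (hg : GoodBins P (q ::ₘ r)) (hk : KindedRest (q ::ₘ r) i) (ht : q.typ = i)
    (hq : q.status = .prov .red) (hm : m ≠ .R) :
    GoodBins P (q.assign m τ .red ::ₘ r) ∧ KindedRest (q.assign m τ .red ::ₘ r) i ∧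
      Move 1 .PR (Kind.redKind (some m)) (kcount (q ::ₘ r) i)
        (kcount (q.assign m τ .red ::ₘ r) i) := by
  have hrel : Multiset.Rel (ProvUpdate i) {q} {q.assign m τ .red} := by
    refine Multiset.Rel.cons ⟨ht, ⟨_, hq⟩, rfl, ht, rfl, .inr ⟨.red, m, rfl, rfl, fun _ => hm, ?_⟩⟩
      Multiset.Rel.zero
    simp
  have hqm := ((hg q.bin).prov q (mem_content_self (by simp)) _ hq).2.1
  obtain ⟨k1, k2, k3, k4⟩ := provUpdates hi hrel r (by simpa using hg)
  rw [Multiset.singleton_add] at k1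
  rw [Multiset.singleton_add, Multiset.singleton_add] at k3
  refine ⟨k1, k3 hk, fun l hl => ?_⟩
  have h3 := k4 l hl
  rw [Multiset.singleton_add, Multiset.singleton_add, ncount_const (k' := .PR),
    ncount_const (k' := Kind.redKind (some m))] at h3
  · simpa using h3
  · simp [redKind_ms, Item.assign]
  · simp [hq, hqm, Kind.ms]

/-- The pairs and the provisionally red item are changed one after the other; the map that marks the
pairs does not touch the red item. Times of `B`-marks are not tracked because no bin is discarded on
account of a single blue `B`-item: these items always come in pairs. -/
lemma markB_effect {P : Params} {i : ℕ} (hi : P.Act i) {s s' : Packing} {τ : ℕ}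
    (hg : GoodBins P s) (hs : Separated P s) (hk : KindedRest s i)
    (h : IfStep (P.markB i τ) s s') :
    Effect P i s s' ∧ Kind.StepB (P.redfrac i) (kcount s i) (kcount s' i) ∧
      ∀ m T C, m ≠ .B → Batched s i m T C → Batched s' i m T C := by
  have hx := xOne_eq hg hk.kinded .B
  rcases h with ⟨T, q, r, rfl, hT, hcard, hqt, hq, rfl⟩ | ⟨rfl, h⟩
  · set g : Item → Item := fun p =>
      if p.bin ∈ T ∧ p.typ = i ∧ p.HasColor .blue then p.assign .B τ .blue else p with hgdef
    have hT' : ∀ b ∈ T, sg i (content (q ::ₘ r) b) = (Kind.pairKind none).ms :=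
      fun b hb => (hasPair_iff hk).1 (hT b hb).2
    obtain ⟨k1, k2, k3, k4, k5⟩ := pairs_effect hi (M := .B) hg hk hT' (g := g)
      (by
        intro p _ h1 h2 h3 h4
        have : g p = p.assign .B τ .blue := if_pos ⟨h1, h2, .inr h3⟩
        rw [this]
        exact ⟨⟨rfl, rfl, h3.symm, rfl⟩, rfl⟩)
      (by
        intro p hp h1
        refine if_neg fun h2 => h1 ⟨h2.1, h2.2.1, h2.2.2, ?_⟩
        exact (item_of_pair (hT' _ h2.1) hp rfl h2.2.1 h2.2.2.not_bonus).2)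
    have hgq : g q = q := if_neg fun h => by
      rw [Item.hasColor_prov hq] at h; cases h.2.2
    have hmap : (q ::ₘ r).map g = q ::ₘ r.map g := by rw [Multiset.map_cons, hgq]
    rw [hmap] at k1 k2 k3 k4 k5
    obtain ⟨e1, e2, e3⟩ := assign_red_effect hi (m := .B) (τ := τ) k1 k4 hqt hq (by simp)
    have hsc : SameColors (q ::ₘ r.map g) (q.assign .B τ .red ::ₘ r.map g) := by
      simp only [SameColors, Multiset.map_cons]
      congr 1
      simp [Item.erase, Item.assign, hq, Status.fix]
    refine ⟨⟨e1, hsc.separated (k2.separated hs), k3.trans (SameOff.cons hqt hqt (SameOff.refl _ _)),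
      e2⟩, .inl ⟨T.card, _, hx ▸ hcard, k5, e3⟩, fun m T' C hm hB => hB.of_subset fun p' hp' h1 h2 => ?_⟩
    rcases Multiset.mem_cons.1 hp' with rfl | hp'
    · exact absurd (Option.some.inj h2).symm hm
    · obtain ⟨p, hp, rfl⟩ := Multiset.mem_map.1 hp'
      by_cases hc : p.bin ∈ T ∧ p.typ = i ∧ p.HasColor .blue
      · have : g p = p.assign .B τ .blue := if_pos hc
        rw [this] at h2
        exact absurd (Option.some.inj h2).symm hm
      · have : g p = p := if_neg hc
        rw [this] at h1 h2 ⊢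
        exact ⟨p, by simp [hp], h1, h2, rfl, rfl⟩
  · refine ⟨⟨hg, hs, SameOff.refl _ _, hk⟩, .inr ⟨rfl, ?_⟩, fun _ _ _ _ h => h⟩
    by_contra hc
    push Not at hc
    obtain ⟨h1, h2⟩ := hc
    change Kind.xo _ _ (kcount s' i (Kind.redKind (some .B))) ≤ _ at h2
    rw [← hx] at h2
    obtain ⟨b, hb⟩ := exists_of_kcount h1
    obtain ⟨q, hq1, hq2, hq3, hq4, -⟩ := exists_of_mem_sg (i := i) (c := content s' b)
      (st := .prov .red) (m := none) (by rw [hb]; simp [Kind.ms])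
    rw [mem_content] at hq1
    obtain ⟨r, rfl⟩ := Multiset.exists_cons_of_mem hq1.1
    -- Rounding `x/2` up gives a number of bins with `x` or `x + 1` blue items.
    obtain ⟨T, hT1, hT2⟩ := exists_pairs (m := none) (n := (P.xOne (q ::ₘ r) i .B + 1) / 2)
      (show _ ≤ kcount (q ::ₘ r) i .U2 by omega)
    refine h _ ⟨T, q, r, rfl, fun b hb => ⟨?_, (hasPair_iff hk).2 (hT2 b hb)⟩, by omega, hq2, hq3, rfl⟩
    obtain ⟨p, hp1, hp2, hp3, hp4, -⟩ := exists_of_mem_sg (i := i) (c := content (q ::ₘ r) b)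
      (st := .fixed .blue) (m := none) (by rw [hT2 b hb]; simp [pairKind_ms])
    rw [mem_content] at hp1
    obtain ⟨hp1, rfl⟩ := hp1
    exact Mixed.of_colors (mixed_of_unmarked hi hg hk hp1 hp2 hp4 hp3)

lemma ncount_prov {A : Packing} (h : ∀ p ∈ A, p.mark = none) :
    ncount A .PR = (A.filter (fun p => p.status = .prov .red)).card ∧
      ncount A .PB = (A.filter (fun p => p.status = .prov .blue)).card := by
  constructor
  all_goals
    unfold ncount
    congr 1
    apply Multiset.filter_congr
    intro p hp
    simp [Kind.ms, h p hp]

lemma exists_largest (A : Packing) {x : ℕ} (hx : x ≤ A.card) : ∃ S T : Packing, A = S + T ∧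
    S.card = x ∧ ∀ p ∈ S, ∀ u ∈ T, u.size ≤ p.size := by
  induction x with
  | zero => exact ⟨0, A, by simp, by simp, by simp⟩
  | succ x ih =>
    obtain ⟨S, T, rfl, h1, h2⟩ := ih (by omega)
    have hT : T.toFinset.Nonempty := by
      rw [Multiset.toFinset_nonempty]
      rintro rfl
      simp at hx; omega
    obtain ⟨p, hp, hmax⟩ := T.toFinset.exists_max_image Item.size hT
    rw [Multiset.mem_toFinset] at hp
    obtain ⟨T', rfl⟩ := Multiset.exists_cons_of_mem hp
    refine ⟨p ::ₘ S, T', by simp, by simp [h1], fun p' hp' u hu => ?_⟩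
    rcases Multiset.mem_cons.1 hp' with rfl | hp'
    · exact hmax u (by simp [hu])
    · exact h2 p' hp' u (by simp [hu])

lemma exists_smallest {A : Packing} (hA : 0 < A.card) : ∃ q r, A = q ::ₘ r ∧
    ∀ p ∈ A, q.size ≤ p.size := by
  have hT : A.toFinset.Nonempty := by
    rw [Multiset.toFinset_nonempty]
    rintro rfl
    simp at hA
  obtain ⟨p, hp, hmin⟩ := A.toFinset.exists_min_image Item.size hT
  rw [Multiset.mem_toFinset] at hp
  obtain ⟨T', rfl⟩ := Multiset.exists_cons_of_mem hp
  exact ⟨p, T', rfl, fun u hu => hmin u (by simpa using hu)⟩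

lemma card_filter_prov {A : Packing} (h : ∀ p ∈ A, ∃ c, p.status = .prov c) :
    (A.filter (fun p => p.status = .prov .red)).card +
      (A.filter (fun p => p.status = .prov .blue)).card = A.card := by
  rw [← Multiset.card_add]
  conv_rhs => rw [← Multiset.filter_add_not (fun p => p.status = .prov .red) A]
  congr 2
  apply Multiset.filter_congr
  intro p hp
  obtain ⟨c, hc⟩ := h p hp
  rw [hc]; cases c <;> simp

/-- The marked items need not have had the colours they receive, but only switches are allowed and
the total number of red items is kept. So the counts change as if `x` bins of kind `PB` became `N1`
and one of kind `PR` became `RN`. Unmixed colours of type `i` do not newly arise, since both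
provisional colours were present wherever a switch needs them. -/
lemma markN_effect {P : Params} {i : ℕ} (hi : P.Act i) {s s' : Packing} {τ C : ℕ}
    (hg : GoodBins P s) (hs : Separated P s) (hk : KindedRest s i)
    (h : IfStep (P.markN i (τ + 1)) s s') (hC : P.xTwo s i .N + 1 ≤ C) :
    Effect P i s s' ∧ Kind.StepN (P.redfrac i) (kcount s i) (kcount s' i) ∧
      (Batched s i .N τ C → Batched s' i .N (τ + 1) C) ∧
      ∀ T, Batched s i .R T C → Batched s' i .R T C := by
  have hx := xTwo_eq hg hk.kinded .N
  have hPB := card_prov_eq hk.kinded .blue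
  have hPR := card_prov_eq hk.kinded .red
  simp only at hPB hPR
  rcases h with ⟨S, q, U₁, U₂, U₃, r, hsr, hcard, hprov, hr, hxle, ⟨p₁, hp₁, hp₁t, hp₁s⟩, -, -, hU1,
    hU2, hU2c, hred, hs'⟩ | ⟨rfl, h⟩
  · have hmark : ∀ p ∈ s, (∃ c, p.status = .prov c) → p.mark = none := fun p hp ⟨c, hc⟩ =>
      ((hg p.bin).prov p (mem_content_self hp) _ hc).2.1
    set A := S + q ::ₘ (U₁ + U₂ + U₃) with hA
    set A' := S.map (fun p => p.assign .N (τ + 1) .blue) + q.assign .N (τ + 1) .red ::ₘ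
      (U₁.map (fun p => { p with status := .prov .red }) +
        U₂.map (fun p => { p with status := .prov .blue }) + U₃) with hA'
    have hAs : ∀ p ∈ A, p ∈ s := fun p hp => by rw [hsr]; exact Multiset.mem_add.2 (.inl hp)
    have hmA : ∀ p ∈ A, p.mark = none := fun p hp => hmark p (hAs p hp) (hprov p hp).2
    have mS : ∀ p ∈ S, p ∈ A := fun p hp => by simp [hA, hp]
    have m1 : ∀ p ∈ U₁, p ∈ A := fun p hp => by simp [hA, hp]
    have m2 : ∀ p ∈ U₂, p ∈ A := fun p hp => by simp [hA, hp]
    have m3 : ∀ p ∈ U₃, p ∈ A := fun p hp => by simp [hA, hp]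
    have mq : q ∈ A := by simp [hA]
    have hrel : Multiset.Rel (ProvUpdate i) A A' := by
      refine Multiset.Rel.add ?_ (Multiset.Rel.cons ?_ (Multiset.Rel.add (Multiset.Rel.add ?_ ?_) ?_))
      · refine Multiset.rel_map_right.2 (Multiset.rel_refl_of_refl_on fun p hp => ?_)
        obtain ⟨h1, h2⟩ := hprov p (mS p hp)
        exact ⟨h1, h2, rfl, h1, rfl, .inr ⟨.blue, .N, rfl, rfl, by simp, by simp⟩⟩
      · obtain ⟨h1, h2⟩ := hprov q mq
        exact ⟨h1, h2, rfl, h1, rfl, .inr ⟨.red, .N, rfl, rfl, by simp, by simp⟩⟩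
      · refine Multiset.rel_map_right.2 (Multiset.rel_refl_of_refl_on fun p hp => ?_)
        obtain ⟨h1, h2⟩ := hprov p (m1 p hp)
        exact ⟨h1, h2, rfl, h1, rfl, .inl ⟨.red, rfl, hmA p (m1 p hp)⟩⟩
      · refine Multiset.rel_map_right.2 (Multiset.rel_refl_of_refl_on fun p hp => ?_)
        obtain ⟨h1, h2⟩ := hprov p (m2 p hp)
        exact ⟨h1, h2, rfl, h1, rfl, .inl ⟨.blue, rfl, hmA p (m2 p hp)⟩⟩
      · refine Multiset.rel_refl_of_refl_on fun p hp => ?_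
        obtain ⟨h1, c, h2⟩ := hprov p (m3 p hp)
        exact ⟨h1, ⟨c, h2⟩, rfl, h1, rfl, .inl ⟨c, h2, hmA p (m3 p hp)⟩⟩
    subst hsr
    subst hs'
    obtain ⟨k1, k2, k3, k4⟩ := provUpdates hi hrel r hg
    have hcount : ∀ c, (A + r).filter (fun p => p.typ = i ∧ p.status = .prov c) =
        A.filter (fun p => p.status = .prov c) := by
      intro c
      rw [Multiset.filter_add, (Multiset.filter_eq_nil (s := r)).2, add_zero]
      · apply Multiset.filter_congr
        intro p hp; simp [(hprov p hp).1]
      · rintro p hp ⟨h1, h2⟩; exact hr p hp ⟨h1, c, h2⟩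
    have hAcard : A.card = S.card + 1 + U₁.card + U₂.card + U₃.card := by
      rw [hA]; simp; ring
    have hsum := card_filter_prov (fun p hp => (hprov p hp).2)
    have hsum3 := card_filter_prov (fun p hp => (hprov p (m3 p hp)).2)
    obtain ⟨n1, n2⟩ := ncount_prov hmA
    obtain ⟨n3, n4⟩ := ncount_prov (fun p hp => hmA p (m3 p hp))
    have nz : ∀ B : Packing, (∀ p ∈ B, p.mark = none ∧ ∃ c, p.status = .prov c) → ∀ l, l ≠ .PB →
        l ≠ .PR → l ≠ .O → ncount B l = 0 := by
      intro B hB l h1 h2 h3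
      unfold ncount
      rw [Multiset.card_eq_zero, Multiset.filter_eq_nil]
      intro p hp he
      obtain ⟨h4, c, h5⟩ := hB p hp
      rw [h4, h5] at he
      cases c
      · exact h2 (Kind.ms_injective (k' := .PR) he.symm)
      · exact h1 (Kind.ms_injective (k' := .PB) he.symm)
    have nA' : ∀ l, ncount A' l = (if Kind.N1 = l then S.card else 0) +
        ((if Kind.PR = l then U₁.card else 0) + (if Kind.PB = l then U₂.card else 0) +
          ncount U₃ l + (if Kind.RN = l then 1 else 0)) := by
      intro l
      rw [hA', ncount_add, ncount_cons, ncount_add, ncount_add, ncount_const (k' := .N1),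
        ncount_const (k' := .PR), ncount_const (k' := .PB)]
      · simp only [Multiset.card_map]
        congr 2
        exact if_congr (Kind.ms_eq_iff (k := .RN)) rfl rfl
      · intro p hp
        obtain ⟨p, hp', rfl⟩ := Multiset.mem_map.1 hp
        simp [Kind.ms, hmA p (m2 p hp')]
      · intro p hp
        obtain ⟨p, hp', rfl⟩ := Multiset.mem_map.1 hp
        simp [Kind.ms, hmA p (m1 p hp')]
      · intro p hp
        obtain ⟨p, hp, rfl⟩ := Multiset.mem_map.1 hp
        rfl
    rw [hcount] at hPB hPR hxle hred
    -- The intermediate vector is only a bookkeeping device; because of the switches it need not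
    -- belong to an actual packing.
    refine ⟨⟨k1, ?_, ?_, k3 hk⟩, .inl ⟨fun l => kcount (A + r) i l +
      (if Kind.N1 = l then S.card else 0) - (if Kind.PB = l then S.card else 0), ?_, ?_⟩,
      fun hB => ?_, fun T hB => ?_⟩
    -- An item that becomes blue has a provisionally blue predecessor of the same type somewhere,
    -- and combinability of a medium blue item depends on its type only.
    · have hA's : ∀ p' ∈ A', ∃ p ∈ A, p'.size = p.size ∧ p'.typ = i ∧ p'.bin = p.bin ∧
          p'.status ≠ .bonus ∧ (p'.HasColor .blue →
            p' = p ∨ ∃ p₀ ∈ A, p₀.status = .prov .blue) := by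
        intro p' hp'
        rw [hA'] at hp'
        simp only [Multiset.mem_add, Multiset.mem_cons, Multiset.mem_map] at hp'
        rcases hp' with ⟨p, hp, rfl⟩ | rfl | (⟨p, hp, rfl⟩ | ⟨p, hp, rfl⟩) | hp
        · refine ⟨p, mS p hp, rfl, (hprov p (mS p hp)).1, rfl, by simp [Item.assign], fun _ => .inr ?_⟩
          have h1 : 0 < S.card := Multiset.card_pos_iff_exists_mem.2 ⟨p, hp⟩
          obtain ⟨p₀, h2⟩ := Multiset.card_pos_iff_exists_mem.1 (show 0 < (A.filter
            (fun p => p.status = .prov .blue)).card by omega)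
          exact ⟨p₀, Multiset.mem_filter.1 h2⟩
        · refine ⟨q, mq, rfl, (hprov q mq).1, rfl, by simp [Item.assign], fun h => ?_⟩
          rw [Item.hasColor_fixed (c := .red) rfl] at h; cases h
        · refine ⟨p, m1 p hp, rfl, (hprov p (m1 p hp)).1, rfl, by simp, fun h => ?_⟩
          rw [Item.hasColor_prov (c := .red) rfl] at h; cases h
        · refine ⟨p, m2 p hp, rfl, (hprov p (m2 p hp)).1, rfl, by simp, fun _ => .inr ⟨q, mq, ?_⟩⟩
          by_contra hq
          rw [if_neg hq] at hU2c
          have h1 : 0 < U₂.card := Multiset.card_pos_iff_exists_mem.2 ⟨p, hp⟩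
          omega
        · obtain ⟨h1, c, h2⟩ := hprov p' (m3 p' hp)
          exact ⟨p', m3 p' hp, rfl, h1, rfl, by simp [h2], fun _ => .inl rfl⟩
      have hunm : ∀ p ∈ A, ¬ Mixed (A + r) p.bin := by
        intro p hp hm
        obtain ⟨c, hc⟩ := (hprov p hp).2
        have h1 := ((hg p.bin).prov p (mem_content_self (hAs p hp)) c hc).2.2
        rw [mixed_iff, h1] at hm
        unfold MixedC at hm
        simp only [Multiset.mem_singleton, exists_eq_left, hc, reduceCtorEq, or_false] at hm
        cases hm.1.unique hm.2
      refine hs.of_imp ?_ ?_ ?_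
      · rintro y ⟨p', hp', h1, rfl, h3⟩
        rw [k2] at h3
        rcases Multiset.mem_add.1 hp' with hp' | hp'
        · obtain ⟨p, hp, e1, e2, e3, -, e4⟩ := hA's p' hp'
          rcases e4 h1 with rfl | ⟨p₀, hp₀, e5⟩
          · exact ⟨p'.size, ⟨p', hAs _ hp, h1, rfl, h3⟩, fun _ h => h⟩
          · refine ⟨p₀.size, ⟨p₀, hAs _ hp₀, .inl e5, rfl, hunm p₀ hp₀⟩, fun j hj => ?_⟩
            have f1 := (hg p.bin).typ_eq_of_act (mem_content_self (hAs p hp))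
              (by rw [(hprov p hp).1]; exact hi)
            have f2 := (hg p₀.bin).typ_eq_of_act (mem_content_self (hAs p₀ hp₀))
              (by rw [(hprov p₀ hp₀).1]; exact hi)
            have f3 := ((hg p.bin).item p (mem_content_self (hAs p hp))).2.1
            have f4 := ((hg p₀.bin).item p₀ (mem_content_self (hAs p₀ hp₀))).2.1
            rw [(hprov p hp).1] at f1; rw [(hprov p₀ hp₀).1] at f2
            rw [e1] at hj
            exact (Params.typeCombinable_congr (f1.symm.trans f2)
              (Params.not_isLarge_of_medium f3 (f1 ▸ hi.active.1))
              (Params.not_isLarge_of_medium f4 (f2 ▸ hi.active.1))).1 hj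
        · exact ⟨p'.size, ⟨p', by simp [hp'], h1, rfl, h3⟩, fun _ h => h⟩
      · rintro j ⟨p', hp', h1, rfl, h3⟩
        rw [k2] at h3
        rcases Multiset.mem_add.1 hp' with hp' | hp'
        · obtain ⟨p, hp, e1, e2, e3, -⟩ := hA's p' hp'
          have hp₁A : p₁ ∈ A := by
            rcases Multiset.mem_add.1 hp₁ with h4 | h4
            · exact h4
            · exact absurd ⟨hp₁t, _, hp₁s⟩ (hr p₁ h4)
          exact ⟨p₁, hp₁, .inl hp₁s, hp₁t.trans e2.symm, hunm p₁ hp₁A⟩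
        · exact ⟨p', by simp [hp'], h1, rfl, h3⟩
      · rintro ⟨p', hp', h1⟩
        rcases Multiset.mem_add.1 hp' with hp' | hp'
        · obtain ⟨p, hp, e1, e2, e3, e4, -⟩ := hA's p' hp'
          exact absurd h1 e4
        · exact ⟨p', by simp [hp'], h1⟩
    · refine SameOff.add (SameOff.of_rel (hrel.mono fun p _ p' _ h => .inr ⟨h.1, h.2.2.2.1⟩))
        (SameOff.refl _ _)
    · intro l hl
      rw [show Kind.xt (P.redfrac i) (Kind.totMark (kcount (A + r) i) .N) (kcount (A + r) i .RN) =
        S.card from hx.symm.trans hcard.symm]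
      by_cases hl' : Kind.PB = l
      · subst hl'; simp; omega
      · simp [hl']
    · intro l hl
      have h1 := k4 l hl
      rw [nA'] at h1
      by_cases l1 : l = .PB
      · subst l1
        simp at h1 ⊢
        omega
      · by_cases l2 : l = .PR
        · subst l2
          simp at h1 ⊢
          omega
        · rw [nz A (fun p hp => ⟨hmA p hp, (hprov p hp).2⟩) l l1 l2 hl,
            nz U₃ (fun p hp => ⟨hmA p (m3 p hp), (hprov p (m3 p hp)).2⟩) l l1 l2 hl] at h1
          simp [Ne.symm l1, Ne.symm l2] at h1 ⊢
          omega
    · refine hB.new_class (F := ((q ::ₘ S).map Item.bin).toFinset) ?_ fun p' hp' _ h2 => ?_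
      · refine (Multiset.toFinset_card_le _).trans ?_
        rw [Multiset.card_map, Multiset.card_cons, hcard]; exact hC
      · rw [hA'] at hp'
        simp only [Multiset.mem_add, Multiset.mem_cons, Multiset.mem_map] at hp'
        rcases hp' with (⟨p, hp, rfl⟩ | rfl | (⟨p, hp, rfl⟩ | ⟨p, hp, rfl⟩) | hp) | hp
        · exact .inr ⟨rfl, by
            rw [Multiset.mem_toFinset]; exact Multiset.mem_map.2 ⟨p, by simp [hp], rfl⟩⟩
        · exact .inr ⟨rfl, by
            rw [Multiset.mem_toFinset]; exact Multiset.mem_map.2 ⟨q, by simp, rfl⟩⟩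
        · simp [hmA p (m1 p hp)] at h2
        · simp [hmA p (m2 p hp)] at h2
        · exact .inl (hAs p' (m3 p' hp))
        · exact .inl (by simp [hp])
    · refine hB.of_subset fun p' hp' h1 h2 => ?_
      rw [hA'] at hp'
      simp only [Multiset.mem_add, Multiset.mem_cons, Multiset.mem_map] at hp'
      rcases hp' with (⟨p, hp, rfl⟩ | rfl | (⟨p, hp, rfl⟩ | ⟨p, hp, rfl⟩) | hp) | hp
      · simp [Item.assign] at h2
      · simp [Item.assign] at h2
      · simp [hmA p (m1 p hp)] at h2
      · simp [hmA p (m2 p hp)] at h2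
      · exact ⟨p', hAs p' (m3 p' hp), h1, h2, rfl, rfl⟩
      · exact ⟨p', by simp [hp], h1, h2, rfl, rfl⟩
  · refine ⟨⟨hg, hs, SameOff.refl _ _, hk⟩, .inr ⟨rfl, ?_⟩, fun hB => hB.mono (Nat.le_succ τ),
      fun _ h => h⟩
    by_contra hc
    push Not at hc
    obtain ⟨h1, h2⟩ := hc
    change Kind.xt _ _ (kcount s' i (Kind.redKind (some .N))) ≤ _ at h2
    rw [← hx, ← hPB] at h2
    rw [← hPR] at h1
    set A := s'.filter (fun p => p.typ = i ∧ ∃ c, p.status = .prov c) with hA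
    have hprov : ∀ p ∈ A, p.typ = i ∧ ∃ c, p.status = .prov c := fun p hp =>
      (Multiset.mem_filter.1 hp).2
    have hcount : ∀ c, s'.filter (fun p => p.typ = i ∧ p.status = .prov c) =
        A.filter (fun p => p.status = .prov c) := by
      intro c
      rw [hA, Multiset.filter_filter]
      apply Multiset.filter_congr
      intro p hp
      constructor
      · rintro ⟨h3, h4⟩; exact ⟨h4, h3, c, h4⟩
      · rintro ⟨h3, h4, -⟩; exact ⟨h4, h3⟩
    obtain ⟨p₁, hp₁⟩ := Multiset.card_pos_iff_exists_mem.1 (Nat.pos_of_ne_zero h1)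
    rw [Multiset.mem_filter] at hp₁
    have h2' := h2
    rw [hcount] at h1 h2
    have hsum := card_filter_prov (fun p hp => (hprov p hp).2)
    obtain ⟨S, T, hST, hS, hST'⟩ := exists_largest A (x := P.xTwo s' i .N) (by omega)
    have hcST : A.card = S.card + T.card := by rw [hST, Multiset.card_add]
    obtain ⟨q, V, rfl, hq⟩ := exists_smallest (A := T) (by omega)
    have hqA : q ∈ A := by rw [hST]; simp
    have hVA : ∀ p ∈ V, p ∈ A := fun p hp => by rw [hST]; simp [hp]
    have hSA : ∀ p ∈ S, p ∈ A := fun p hp => by rw [hST]; simp [hp]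
    have hsumS := card_filter_prov (fun p hp => (hprov p (hSA p hp)).2)
    have hc : ∀ c, (A.filter (fun p => p.status = .prov c)).card =
        (S.filter (fun p => p.status = .prov c)).card + ((if q.status = .prov c then 1 else 0) +
          (V.filter (fun p => p.status = .prov c)).card) := by
      intro c
      rw [hST, Multiset.filter_add, Multiset.filter_cons, Multiset.card_add, Multiset.card_add]
      congr 2
      split_ifs <;> simp
    have hcr := hc .red
    have hcb := hc .blue
    -- If neither `S` nor `q` contains a red item, then `q` becomes red and one red item of `V` must
    -- become blue. Otherwise the red items of `S` and `q`, except for one, have to hand over their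
    -- colour to blue items of `V`; enough of these exist because there are at least `x = S.card`
    -- blue items in total.
    have key : ∃ U₁ U₂ U₃ : Packing, V = U₁ + U₂ + U₃ ∧ (∀ p ∈ U₁, p.status = .prov .blue) ∧
        (∀ p ∈ U₂, p.status = .prov .red) ∧
        U₂.card ≤ (if q.status = .prov .blue then 1 else 0) ∧
        (A.filter (fun p => p.status = .prov .red)).card =
          1 + U₁.card + (U₃.filter (fun p => p.status = .prov .red)).card := by
      by_cases ha : (S.filter (fun p => p.status = .prov .red)).card +
        (if q.status = .prov .red then 1 else 0) = 0
      · have hqb : q.status = .prov .blue := by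
          obtain ⟨c, hc⟩ := (hprov q hqA).2
          cases c
          · rw [if_pos hc] at ha; omega
          · exact hc
        obtain ⟨u, hu⟩ := Multiset.card_pos_iff_exists_mem.1
          (show 0 < (V.filter (fun p => p.status = .prov .red)).card by omega)
        rw [Multiset.mem_filter] at hu
        obtain ⟨V', rfl⟩ := Multiset.exists_cons_of_mem hu.1
        refine ⟨0, {u}, V', by simp, by simp, by simpa using hu.2, by simp [hqb], ?_⟩
        rw [Multiset.filter_cons, if_pos hu.2, Multiset.card_add, Multiset.card_singleton] at hcr
        simp only [Multiset.card_zero]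
        omega
      · obtain ⟨c, hqc⟩ := (hprov q hqA).2
        have h3 : (if q.status = .prov .red then 1 else 0) +
            (if q.status = .prov .blue then 1 else 0) = 1 := by rw [hqc]; cases c <;> simp
        obtain ⟨U₁, r, hr, hU1, hU1', hr'⟩ := exists_split V (fun p => p.status = .prov .blue)
          (x := (S.filter (fun p => p.status = .prov .red)).card +
            (if q.status = .prov .red then 1 else 0) - 1) (by omega)
        refine ⟨U₁, 0, r, by simpa using hr, hU1', by simp, by simp, ?_⟩
        have h4 : (V.filter (fun p => p.status = .prov .red)).card =
            (r.filter (fun p => p.status = .prov .red)).card := by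
          rw [hr, Multiset.filter_add, Multiset.filter_eq_nil.2, zero_add]
          intro p hp h4; rw [hU1' p hp] at h4; cases h4
        omega
    obtain ⟨U₁, U₂, U₃, rfl, e1, e2, e3, e4⟩ := key
    refine h _ ⟨S, q, U₁, U₂, U₃, s'.filter (fun p => ¬ (p.typ = i ∧ ∃ c, p.status = .prov c)),
      ?_, hS, fun p hp => hprov p (by rw [hST]; exact hp), fun p hp => (Multiset.mem_filter.1 hp).2,
      h2', ⟨p₁, hp₁⟩, hST', ?_, e1, e2, e3, by rw [hcount]; exact e4, rfl⟩
    · rw [← hST, hA, Multiset.filter_add_not]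
    · intro p hp
      rcases Multiset.mem_add.1 hp with hp | hp
      · exact hST' p hp q (by simp)
      · exact hq p hp

/-! ### Packing one item -/

/-- A new item in bin `b`. -/
abbrev newItem (P : Params) (x : ℝ) (st : Status) (b : ℕ) : Item := ⟨x, P.typeOf x, st, none, 0, b⟩

variable {P : Params} {s : Packing} {x : ℝ} {c : Color} {b : ℕ}

lemma item_spec (hg : GoodBins P s) {p : Item} (hp : p ∈ s) :
    0 < p.size ∧ p.size ≤ 1 ∧ 1 ≤ p.typ ∧ p.typ ≤ P.N := (hg p.bin).item p (mem_content_self hp)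

lemma typ_of_blue (hg : GoodBins P s) {p : Item} (hp : p ∈ s) (hb : p.HasColor .blue) :
    p.typ = P.typeOf p.size := (hg p.bin).typ_eq_of_blue (mem_content_self hp) hb

/-- Red items in unmixed bins are not reduced. -/
lemma typ_of_unmixed_red (hg : GoodBins P s) {p : Item} (hp : p ∈ s) (hr : p.HasColor .red)
    (hm : ¬ Mixed s p.bin) : p.typ = P.typeOf p.size := by
  by_contra hc
  have h1 := (hg p.bin).reduced p (mem_content_self hp) hc
  exact hm (Mixed.of_colors ⟨h1.2.2.1, p, mem_content_self hp, hr⟩)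

lemma mixedC_cons {p : Item} {c : Packing} (h : p.status ≠ .bonus)
    (h' : ∀ d, p.HasColor d → ∃ q ∈ c, q.HasColor d) : MixedC (p ::ₘ c) ↔ MixedC c := by
  have h2 : ∀ d, (∃ q ∈ p ::ₘ c, q.HasColor d) ↔ ∃ q ∈ c, q.HasColor d := by
    intro d
    refine ⟨?_, fun ⟨q, hq, hd⟩ => ⟨q, Multiset.mem_cons_of_mem hq, hd⟩⟩
    rintro ⟨q, hq, hd⟩
    rcases Multiset.mem_cons.1 hq with rfl | hq
    · exact h' d hd
    · exact ⟨q, hq, hd⟩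
  unfold MixedC
  rw [h2, h2]
  refine or_congr Iff.rfl ⟨?_, fun ⟨q, hq, hd⟩ => ⟨q, Multiset.mem_cons_of_mem hq, hd⟩⟩
  rintro ⟨q, hq, hd⟩
  rcases Multiset.mem_cons.1 hq with rfl | hq
  · exact absurd hd h
  · exact ⟨q, hq, hd⟩

/-- The new item has the type and colour of an item `q` already in the bin, so neither the mixed
bins nor the types in unmixed bins change. -/
lemma open_effect (hg : GoodBins P s) (hs : Separated P s) (hx : 0 < x ∧ x ≤ 1)
    (hr : c = .red → 0 < P.redfrac (P.typeOf x)) (ho : P.OpenBin s x c b) :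
    GoodBins P (newItem P x (.fixed c) b ::ₘ s) ∧ Separated P (newItem P x (.fixed c) b ::ₘ s) := by
  obtain ⟨⟨q, hq, hqb, hqt, hqs⟩, hfit⟩ := ho
  have hqc : q ∈ content s b := by simp [hq, hqb]
  have hcol : q.HasColor c := .inr hqs
  have hfit' : P.typeOf x = P.N ∨ P.colSum (content s b) c < P.fit c (P.typeOf x) := by
    split_ifs at hfit with h
    · exact .inl h
    · exact .inr hfit
  set p := newItem P x (.fixed c) b with hp
  have hpc : ∀ d, p.HasColor d ↔ c = d := fun d => Item.hasColor_fixed rfl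
  have hmix : ∀ b', Mixed (p ::ₘ s) b' ↔ Mixed s b' := by
    intro b'
    rw [mixed_iff, mixed_iff, content_cons]
    split_ifs with hb
    · have hb' : b = b' := hb
      subst hb'
      refine mixedC_cons (by simp [hp]) fun d hd => ⟨q, hqc, ?_⟩
      rw [← (hpc d).1 hd]; exact hcol
    · rfl
  refine ⟨fun b' => ?_, hs.of_imp ?_ ?_ ?_⟩
  · rw [content_cons]
    split_ifs with hb
    · have hb' : b = b' := hb
      subst hb'
      exact (hg b).add_open hx hr hqc hqt hqs hfit' b
    · exact hg b'
  · rintro y ⟨p', hp', h1, rfl, h2⟩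
    rw [hmix] at h2
    rcases Multiset.mem_cons.1 hp' with rfl | hp'
    · obtain rfl := (hpc _).1 h1
      refine ⟨q.size, ⟨q, hq, hcol, rfl, by rw [hqb]; exact h2⟩, fun j hj => ?_⟩
      have h3 := typ_of_blue hg hq hcol
      have h4 := item_spec hg hq
      -- Sizes matter for large blue items, but a bin with one is full. So the item is not large and
      -- only its type counts.
      have h5 : ¬ IsLarge q.size := by
        rw [Params.isLarge_iff (P := P) h4.2.1, ← h3, hqt]
        intro hl
        rcases hfit' with h | h
        · rw [h] at hl; have := P.no_straddle_last; linarith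
        · have h6 := Params.bluefit_large (Params.typeOf_spec hx.2).1 (Params.typeOf_le x) hl
          have h7 := Params.GoodBin.mult_le_colSum (P := P) hqc hcol
          have h8 := (hg b).one_le_mult hqc
          simp only [Params.fit, h6] at h; omega
      have h6 : ¬ IsLarge x := by
        rw [Params.isLarge_iff (P := P) hx.2, ← hqt, h3, ← Params.isLarge_iff (P := P) h4.2.1]
        exact h5
      exact (Params.typeCombinable_congr (y := x) (y' := q.size) (by rw [← h3, hqt]) h6 h5).1 hj
    · exact ⟨p'.size, ⟨p', hp', h1, rfl, h2⟩, fun _ h => h⟩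
  · rintro j ⟨p', hp', h1, rfl, h2⟩
    rw [hmix] at h2
    rcases Multiset.mem_cons.1 hp' with rfl | hp'
    · obtain rfl := (hpc _).1 h1
      exact ⟨q, hq, hcol, hqt, by rw [hqb]; exact h2⟩
    · exact ⟨p', hp', h1, rfl, h2⟩
  · rintro ⟨p', hp', h1⟩
    rcases Multiset.mem_cons.1 hp' with rfl | hp'
    · simp [hp] at h1
    · exact ⟨p', hp', h1⟩

lemma fixBin_eq (s : Packing) (b : ℕ) : fixBin s b =
    s.map (fun p => if p.bin = b then p.fixed else p) := rfl

lemma sameColors_fixBin (s : Packing) (b : ℕ) : SameColors s (fixBin s b) := by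
  unfold SameColors
  rw [fixBin_eq, Multiset.map_map]
  apply Multiset.map_congr rfl
  intro p _
  simp only [Function.comp]
  split_ifs
  · rcases p with ⟨_, _, (_ | _ | _), _, _, _⟩ <;> rfl
  · rfl

/-- The properties of a compatible bin. -/
lemma compatible_spec (hg : GoodBins P s) (hx : 0 < x ∧ x ≤ 1)
    (hco : P.Compatible s x c b) : ∃ d, c ≠ d ∧ (∀ q ∈ content s b, q.HasColor d) ∧
      (∃ q, q ∈ content s b) ∧ (c = .blue → P.typeOf x ≠ P.N) ∧
      (c = .red → ∀ q ∈ content s b, q.typ ≠ P.N) ∧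
      ∀ q ∈ content s b, ¬ (P.Act q.typ ∧ P.Act (P.typeOf x)) := by
  obtain ⟨hm, hc⟩ := hco
  have hcol : ∀ d, (∃ q ∈ content s b, q.HasColor d) → ∀ q ∈ content s b, q.HasColor d := by
    rintro d ⟨q, hq, hqd⟩ q' hq'
    rw [mem_content] at hq hq'
    have hne : q'.status ≠ .bonus := fun h => hm (.inr ⟨q', hq'.1, hq'.2, h⟩)
    rcases Item.not_bonus_iff.1 hne with h | h
    all_goals
      have := not_mixed_color (p := q) (q := q') (by rw [hq.2]; exact hm) hq.1 hqd hq'.1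
        (hq'.2.trans hq.2.symm) h
      rw [this]; exact h
  rcases c
  · simp only at hc
    obtain ⟨q, hq, hqb, hqc, hcomb⟩ := hc
    have hq' : q ∈ content s b := by simp [hq, hqb]
    have h1 := typ_of_blue hg hq hqc
    have h2 := item_spec hg hq
    have hsame : ∀ q' ∈ content s b, q'.typ = q.typ := fun q' h =>
      (hg b).same .blue q' h q hq' (hcol _ ⟨q, hq', hqc⟩ q' h) hqc
    refine ⟨.blue, by simp, hcol _ ⟨q, hq', hqc⟩, ⟨q, hq'⟩, by simp, fun _ q' h h' => ?_, ?_⟩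
    · rw [hsame q' h, h1] at h'
      have h3 := hcomb.1
      rw [Params.leavesOf_last h2.2.1 h'] at h3; exact lt_irrefl _ h3
    · rintro q' h ⟨h3, h4⟩
      rw [hsame q' h, h1] at h3
      exact Params.not_combinable_medium h2.2.1 h3.active.1 h4 hcomb
  · simp only at hc
    obtain ⟨q, hq, hqb, hqc, hcomb⟩ := hc
    have hq' : q ∈ content s b := by simp [hq, hqb]
    have h1 := typ_of_unmixed_red hg hq hqc (by rw [hqb]; exact hm)
    have hsame : ∀ q' ∈ content s b, q'.typ = q.typ := fun q' h =>
      (hg b).same .red q' h q hq' (hcol _ ⟨q, hq', hqc⟩ q' h) hqc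
    refine ⟨.red, by simp, hcol _ ⟨q, hq', hqc⟩, ⟨q, hq'⟩, fun _ h' => ?_, by simp, ?_⟩
    · have h3 := hcomb.1
      rw [Params.leavesOf_last hx.2 h'] at h3; exact lt_irrefl _ h3
    · rintro q' h ⟨h3, h4⟩
      rw [hsame q' h, h1] at h3
      exact Params.not_combinable_medium hx.2 h4.active.1 h3 hcomb

lemma content_compatible (b' : ℕ) (st : Status) :
    content (newItem P x st b ::ₘ fixBin s b) b' =
      if b = b' then newItem P x st b ::ₘ (content s b).map Item.fixed else content s b' := by
  rw [content_cons]
  change (if b = b' then _ else _) = _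
  rw [content_fixBin]
  split_ifs with h1 h2
  · subst h1; rfl
  · exact absurd h1.symm h2
  · rename_i h; exact absurd h.symm h1
  · rfl

/-- The receiving bin becomes mixed, so the unmixed items only become fewer and `Separated`
persists. -/
lemma compatible_effect (hg : GoodBins P s) (hs : Separated P s) (hx : 0 < x ∧ x ≤ 1)
    (hr : c = .red → 0 < P.redfrac (P.typeOf x)) (hco : P.Compatible s x c b) :
    GoodBins P (newItem P x (.fixed c) b ::ₘ fixBin s b) ∧
      Separated P (newItem P x (.fixed c) b ::ₘ fixBin s b) := by
  obtain ⟨d, hcd, hcol, ⟨q, hq⟩, hN1, hN2, hact⟩ := compatible_spec hg hx hco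
  have hsc := sameColors_fixBin s b
  have hs' := hsc.separated hs
  have hmixb : Mixed (newItem P x (.fixed c) b ::ₘ fixBin s b) b := by
    refine Mixed.of_colors ?_
    rw [content_compatible, if_pos rfl]
    simp only [Multiset.mem_cons, exists_eq_or_imp, Multiset.mem_map, exists_exists_and_eq_and,
      Item.fixed_hasColor]
    have h1 : (newItem P x (.fixed c) b).HasColor c := .inr rfl
    rcases c <;> rcases d
    · exact absurd rfl hcd
    · exact ⟨.inr ⟨q, hq, hcol q hq⟩, .inl h1⟩
    · exact ⟨.inl h1, .inr ⟨q, hq, hcol q hq⟩⟩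
    · exact absurd rfl hcd
  have hmix : ∀ b', b' ≠ b → (Mixed (newItem P x (.fixed c) b ::ₘ fixBin s b) b' ↔
      Mixed (fixBin s b) b') := by
    intro b' hb'
    rw [mixed_iff, mixed_iff, content_cons_ne (Ne.symm hb')]
  refine ⟨fun b' => ?_, hs'.of_imp ?_ ?_ ?_⟩
  · rw [content_compatible]
    split_ifs
    · refine (hg b).add_compatible hx hcd hr hcol ⟨q, hq⟩ ?_ ?_ hact b
      · rcases c
        · exact Params.redfrac_pos_ne_last (hr rfl)
        · exact hN1 rfl
      · rcases c
        · exact hN2 rfl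
        · intro q' hq'
          cases d
          · exact Params.redfrac_pos_ne_last ((hg b).red_pos q' hq' (hcol q' hq'))
          · exact absurd rfl hcd
    · exact hg b'
  · rintro y ⟨p', hp', h1, rfl, h2⟩
    have hb : p'.bin ≠ b := fun h => h2 (h ▸ hmixb)
    rw [hmix _ hb] at h2
    rcases Multiset.mem_cons.1 hp' with rfl | hp'
    · exact absurd rfl hb
    · exact ⟨p'.size, ⟨p', hp', h1, rfl, h2⟩, fun _ h => h⟩
  · rintro j ⟨p', hp', h1, rfl, h2⟩
    have hb : p'.bin ≠ b := fun h => h2 (h ▸ hmixb)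
    rw [hmix _ hb] at h2
    rcases Multiset.mem_cons.1 hp' with rfl | hp'
    · exact absurd rfl hb
    · exact ⟨p', hp', h1, rfl, h2⟩
  · rintro ⟨p', hp', h1⟩
    rcases Multiset.mem_cons.1 hp' with rfl | hp'
    · simp at h1
    · exact ⟨p', hp', h1⟩

lemma content_fresh (hb : ∀ p ∈ s, p.bin < b) : content s b = 0 :=
  Multiset.filter_eq_nil.2 fun p hp => (hb p hp).ne

/-- A new bin is opened only if no unmixed bin is compatible, which is exactly separation for the
new item, given that combinability with a type implies combinability with the actual size. Red items
in unmixed bins are not reduced, so their label is their own type. The clause on bonus items is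
supplied by `hbo`. -/
lemma new_effect (hg : GoodBins P s) (hs : Separated P s) (hx : 0 < x ∧ x ≤ 1)
    (hr : c = .red → 0 < P.redfrac (P.typeOf x))
    (hbo : c = .red → SomeBonus s → P.Act (P.typeOf x))
    (hco : ∀ b, ¬ P.Compatible s x c b) (hb : ∀ p ∈ s, p.bin < b) {st : Status}
    (hst : st = if P.IsActive (P.typeOf x) then .prov c else .fixed c) :
    GoodBins P (newItem P x st b ::ₘ s) ∧ Separated P (newItem P x st b ::ₘ s) := by
  have hz := content_fresh hb
  set p := newItem P x st b with hp
  have hpc : ∀ d, p.HasColor d ↔ c = d := fun d => by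
    by_cases ha : P.IsActive (P.typeOf x)
    · rw [if_pos ha] at hst; exact Item.hasColor_prov hst
    · rw [if_neg ha] at hst; exact Item.hasColor_fixed hst
  have hpn : p.status ≠ .bonus := ((hpc c).2 rfl).not_bonus
  have hmix : ∀ b', b' ≠ b → (Mixed (p ::ₘ s) b' ↔ Mixed s b') := by
    intro b' hb'
    rw [mixed_iff, mixed_iff, content_cons_ne (Ne.symm hb')]
  have hmem : ∀ p' ∈ s, p'.bin ≠ b := fun p' h => (hb p' h).ne
  have hblue : ∀ y, UnmixedBlue (p ::ₘ s) y → UnmixedBlue s y ∨ (c = .blue ∧ y = x) := by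
    rintro y ⟨p', hp', h1, rfl, h2⟩
    rcases Multiset.mem_cons.1 hp' with rfl | hp'
    · exact .inr ⟨(hpc _).1 h1, rfl⟩
    · exact .inl ⟨p', hp', h1, rfl, by rwa [hmix _ (hmem p' hp')] at h2⟩
  have hred : ∀ j, UnmixedRed (p ::ₘ s) j → UnmixedRed s j ∨ (c = .red ∧ j = P.typeOf x) := by
    rintro y ⟨p', hp', h1, rfl, h2⟩
    rcases Multiset.mem_cons.1 hp' with rfl | hp'
    · exact .inr ⟨(hpc _).1 h1, rfl⟩
    · exact .inl ⟨p', hp', h1, rfl, by rwa [hmix _ (hmem p' hp')] at h2⟩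
  refine ⟨fun b' => ?_, ⟨?_, ?_⟩⟩
  · rw [content_cons]
    split_ifs with h
    · have h' : b = b' := h
      subst h'
      rw [hz, hp, hst]
      exact Params.GoodBin.new hx hr b
    · exact hg b'
  · intro y j hy hj h
    rcases hblue y hy with hy | ⟨rfl, rfl⟩
    · rcases hred j hj with hj | ⟨rfl, rfl⟩
      · exact hs.comb y j hy hj h
      · obtain ⟨q, hq, hqc, rfl, hqm⟩ := hy
        exact hco q.bin ⟨hqm, q, hq, rfl, hqc, h.combinable hx.2⟩
    · rcases hred j hj with hj | ⟨h1, -⟩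
      · obtain ⟨q, hq, hqc, rfl, hqm⟩ := hj
        rw [typ_of_unmixed_red hg hq hqc hqm] at h
        exact hco q.bin ⟨hqm, q, hq, rfl, hqc, h.combinable (item_spec hg hq).2.1⟩
      · cases h1
  · rintro ⟨q, hq, hqb⟩ j hj
    have hsb : SomeBonus s := by
      rcases Multiset.mem_cons.1 hq with rfl | hq
      · exact absurd hqb hpn
      · exact ⟨q, hq, hqb⟩
    rcases hred j hj with hj | ⟨h1, rfl⟩
    · exact hs.bonus hsb j hj
    · exact hbo h1 hsb

/-! ### The numbers of bins of each kind -/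

/-- The possible changes of the bins of a type when an item of another type is packed. -/
def Passive (a a' : Kind → ℕ) : Prop :=
  Move 0 .O .O a a' ∨ Move 1 .PB .U1 a a' ∨ Move 1 .PR .RU a a'

lemma Passive.arrive {α : ℝ} {a a' : Kind → ℕ} (h : Passive a a') : Kind.Arrive α a a' := by
  rcases h with h | h | h
  · exact .none h
  · exact .fixBlue h
  · exact .fixRed h

/-- The kind of the bins with one unmarked item of definite colour `c`. -/
def Kind.mixed : Color → Kind
  | .red => .RU
  | .blue => .U1

/-- The kind of the bins with an item of provisional colour `c`. -/
def Kind.prov : Color → Kind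
  | .red => .PR
  | .blue => .PB

lemma kcount_congr {s' : Packing} {i : ℕ} (h : ∀ b, sg i (content s' b) = sg i (content s b)) :
    kcount s' i = kcount s i := by
  funext k; unfold kcount; simp only [h]

lemma sg_fixed (hg : GoodBins P s) (b i : ℕ) :
    sg i ((content s b).map Item.fixed) = sg i (content s b) ∨
    ∃ k k', ((k, k') = (Kind.PB, Kind.U1) ∨ (k, k') = (Kind.PR, Kind.RU)) ∧
      sg i (content s b) = k.ms ∧ sg i ((content s b).map Item.fixed) = k'.ms := by
  by_cases h : ∃ q ∈ content s b, ∃ d, q.status = .prov d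
  · obtain ⟨q, hq, d, hd⟩ := h
    obtain ⟨-, hm, hc⟩ := (hg b).prov q hq d hd
    rw [hc, Multiset.map_singleton, ← Multiset.cons_zero, ← Multiset.cons_zero]
    by_cases ht : q.typ = i
    · right
      rw [sg_cons_pos ht (by rw [hd]; simp), sg_cons_pos (p := q.fixed) ht
        (by rw [ne_eq, Item.fixed_bonus, hd]; simp), sg_zero, Item.fixed_mark, hm,
        Item.fixed_of_hasColor (.inl hd), hd]
      cases d
      · exact ⟨.PR, .RU, .inr rfl, rfl, rfl⟩
      · exact ⟨.PB, .U1, .inl rfl, rfl, rfl⟩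
    · left
      rw [sg_cons_neg (.inl ht), sg_cons_neg (p := q.fixed) (.inl ht)]
  · left
    push Not at h
    congr 1
    conv_rhs => rw [← Multiset.map_id (content s b)]
    apply Multiset.map_congr rfl
    intro p hp
    rcases p with ⟨_, _, (d | _ | _), _, _, _⟩
    · exact absurd rfl (h _ hp d)
    · rfl
    · rfl

/-- For a type other than that of the arriving item, the only possible effect is that a provisional
colour in the receiving bin becomes definite. -/
lemma passive_compatible (hg : GoodBins P s) {i : ℕ} (hk : KindedRest s i) (hi : P.typeOf x ≠ i)
    (st : Status) : KindedRest (newItem P x st b ::ₘ fixBin s b) i ∧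
      Passive (kcount s i) (kcount (newItem P x st b ::ₘ fixBin s b) i) := by
  have h1 : ∀ b' ≠ b, sg i (content (newItem P x st b ::ₘ fixBin s b) b') =
      sg i (content s b') := fun b' hb => by rw [content_compatible, if_neg (Ne.symm hb)]
  have h2 : sg i (content (newItem P x st b ::ₘ fixBin s b) b) =
      sg i ((content s b).map Item.fixed) := by
    rw [content_compatible, if_pos rfl, sg_cons_neg (.inl hi)]
  rcases sg_fixed hg b i with h | ⟨k, k', h, h3, h4⟩
  · have h5 : ∀ b', sg i (content (newItem P x st b ::ₘ fixBin s b) b') =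
      sg i (content s b') := fun b' => by
        by_cases hb : b' = b
        · rw [hb, h2, h]
        · exact h1 b' hb
    refine ⟨fun b' => by rw [h5]; exact hk b', .inl ?_⟩
    rw [kcount_congr h5]; exact Move.refl _ _ _
  · refine ⟨fun b' => ?_, .inr ?_⟩
    · by_cases hb : b' = b
      · rw [hb, h2, h4]
        refine ⟨k', ?_, rfl⟩
        rcases h with h | h <;> cases h <;> simp [Kind.Rest]
      · rw [h1 b' hb]; exact hk b'
    · have := kcount_move_one b h1 h3 (h2.trans h4)
      rcases h with h | h <;> cases h
      · exact .inl this
      · exact .inr this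

lemma passive_cons {p : Item} {i : ℕ} (hk : KindedRest s i) (hi : p.typ ≠ i ∨ p.status = .bonus) :
    KindedRest (p ::ₘ s) i ∧ kcount (p ::ₘ s) i = kcount s i := by
  have h : ∀ b, sg i (content (p ::ₘ s) b) = sg i (content s b) := fun b => by
    rw [content_cons]; split_ifs
    · rw [sg_cons_neg hi]
    · rfl
  exact ⟨fun b => by rw [h]; exact hk b, kcount_congr h⟩

/-- The state after a blue item of the active type `i` has been packed. -/
def BlueArrived (a : Kind → ℕ) (i : ℕ) (s : Packing) : Prop :=
  (KindedRest s i ∧ Kind.BlueStep a (kcount s i)) ∨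
  ∃ b₀ k k', ((k, k') = (Kind.XR, Kind.R2) ∨ (k, k') = (Kind.XN, Kind.N2)) ∧
    sg i (content s b₀) = k.ms ∧ (∀ b ≠ b₀, ∃ l : Kind, l.Rest ∧ sg i (content s b) = l.ms) ∧
    ∀ a', Move 1 k k' (kcount s i) a' → Kind.BlueStep a a'

lemma BlueArrived.arrived {α : ℝ} {a a₀ : Kind → ℕ} {i : ℕ} (h : BlueArrived a i s)
    (h' : ∀ a', Kind.BlueStep a a' → Kind.Arrive α a₀ a') : Arrived α a₀ i s := by
  rcases h with ⟨h1, h2⟩ | ⟨b, k, k', h1, h2, h3, h4⟩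
  · exact .inl ⟨h1, h' _ h2⟩
  · exact .inr ⟨b, k, k', h1, h2, h3, fun a' ha => h' _ (h4 a' ha)⟩

lemma Move.comp {n : ℕ} {k k' k'' : Kind} {a a' a'' : Kind → ℕ} (h : Move n k k' a a')
    (h' : Move n k' k'' a' a'') : Move n k k'' a a'' := by
  intro l hl
  have h1 := h l hl; have h2 := h' l hl
  split_ifs at h1 h2 ⊢ <;> omega

lemma kind_single_blue {k : Kind} {m : Option Mark} {σ : Multiset (Status × Option Mark)}
    (h : (Status.fixed .blue, m) ::ₘ σ = k.ms) (hσ : ∀ m', (Status.fixed .blue, m') ∉ σ)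
    (hk : k.Rest) : σ = 0 ∧ (k = .U1 ∧ m = none ∨ k = .R1 ∧ m = some .R ∨ k = .N1 ∧ m = some .N) := by
  have h1 : (Status.fixed .blue, m) ∈ k.ms := by rw [← h]; simp
  have h2 : ∀ {m₁ m₂}, k.ms = {(Status.fixed .blue, m₁), (Status.fixed .blue, m₂)} → False := by
    intro m₁ m₂ h2
    have h3 := congrArg Multiset.card h
    rw [h2] at h h3
    obtain ⟨z, hz⟩ := Multiset.card_pos_iff_exists_mem.1 (show 0 < σ.card by simp at h3; omega)
    have h4 : z ∈ (Status.fixed .blue, m) ::ₘ σ := by simp [hz]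
    rw [h] at h4
    have h5 : z.1 = Status.fixed .blue := by
      simp at h4; rcases h4 with h4 | h4 <;> rw [h4]
    exact hσ z.2 (by rw [← h5]; exact hz)
  unfold Kind.Rest at hk
  have hz : ∀ {m'}, k.ms = {(Status.fixed .blue, m')} → σ = 0 := by
    intro m' h3
    have h4 := congrArg Multiset.card h
    rw [h3] at h4; simpa using h4
  cases k <;> first
    | exact absurd rfl hk.1
    | exact absurd rfl hk.2
    | exact (h2 rfl).elim
    | (refine ⟨hz rfl, ?_⟩; simpa [Kind.ms] using h1)
    | (simp [Kind.ms] at h1)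

/-- Bins with one blue item of an active type are open. -/
lemma openBin_of_single (hg : GoodBins P s) (ha : P.Act (P.typeOf x)) {m : Option Mark}
    (hb : sg (P.typeOf x) (content s b) = {(.fixed .blue, m)}) : P.OpenBin s x .blue b := by
  obtain ⟨q, hq, h1, h2, h3, -⟩ := exists_of_mem_sg (i := P.typeOf x) (c := content s b)
    (st := .fixed .blue) (m := m) (by rw [hb]; simp)
  have hq' := mem_content.1 hq
  refine ⟨⟨q, hq'.1, hq'.2, h1, h2⟩, ?_⟩
  rw [if_neg ha.ne_last]
  change P.colSum (content s b) .blue < _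
  rw [ha.fit, ← (hg b).blue_card]
  have h4 : (content s b).filter (fun p => p.HasColor .blue) ≤
      (content s b).filter (fun p => p.typ = P.typeOf x ∧ p.status ≠ .bonus) := by
    have h5 : (content s b).filter (fun p => p.HasColor .blue) = ((content s b).filter
        (fun p => p.typ = P.typeOf x ∧ p.status ≠ .bonus)).filter (fun p => p.HasColor .blue) := by
      rw [Multiset.filter_filter]
      apply Multiset.filter_congr
      intro p hp
      refine ⟨fun h => ⟨h, ?_, h.not_bonus⟩, fun h => h.1⟩
      rw [← h1]; exact (hg b).same .blue p hp q hq h (.inr h2)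
    rw [h5]; exact Multiset.filter_le _ _
  have h5 := Multiset.card_le_card h4
  have h6 := congrArg Multiset.card hb
  unfold sg at h6
  rw [Multiset.card_map] at h6
  rw [h6] at h5
  simp at h5; omega

/-- This is the condition `h0` of `BlueStep.mix` and `BlueStep.new`: a blue item that finds no open
bin shows that no bin has a single blue item of its type with a definite colour. -/
lemma no_single (hg : GoodBins P s) (ha : P.Act (P.typeOf x)) 
    (ho : ∀ b, ¬ P.OpenBin s x .blue b) : kcount s (P.typeOf x) .U1 = 0 ∧
      kcount s (P.typeOf x) .R1 = 0 ∧ kcount s (P.typeOf x) .N1 = 0 := by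
  refine ⟨?_, ?_, ?_⟩ <;>
  · by_contra h
    obtain ⟨b, hb⟩ := exists_of_kcount h
    exact ho b (openBin_of_single hg ha hb)

/-- Since `redfit` is 1 for active types, only bins with one blue item can be open. If that item is
marked, the bin temporarily has kind `XR` or `XN`, and the change becomes a proper one after the
mark has been copied. -/
lemma open_kinds (hg : GoodBins P s) (ha : P.Act (P.typeOf x)) (hk : KindedRest s (P.typeOf x))
    (ho : P.OpenBin s x c b) : c = .blue ∧
      BlueArrived (kcount s (P.typeOf x)) (P.typeOf x) (newItem P x (.fixed c) b ::ₘ s) := by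
  obtain ⟨⟨q, hq, hqb, hqt, hqs⟩, hfit⟩ := ho
  rw [if_neg ha.ne_last] at hfit
  change P.colSum (content s b) c < _ at hfit
  have hqc : q ∈ content s b := by simp [hq, hqb]
  have hcol : q.HasColor c := .inr hqs
  have h1 := Params.GoodBin.mult_le_colSum (P := P) hqc hcol
  have h2 := (hg b).one_le_mult hqc
  rcases c
  · simp only [Params.fit, ha.redfit] at hfit; omega
  refine ⟨rfl, ?_⟩
  rw [ha.fit] at hfit
  obtain ⟨c', hc'⟩ := Multiset.exists_cons_of_mem hqc
  obtain ⟨k, hk1, hk2⟩ := hk b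
  have hgb := hg b
  rw [hc'] at hfit hgb
  rw [Params.colSum_cons, if_pos hcol] at hfit
  have hk3 := hk2
  rw [hc', sg_cons_pos hqt hcol.not_bonus, hqs] at hk3
  obtain ⟨hz, hcase⟩ := kind_single_blue hk3 (fun m' hm' => by
    obtain ⟨p, hp, -, h4, -⟩ := exists_of_mem_sg hm'
    have h5 := Params.GoodBin.mult_le_colSum (P := P) hp (.inr h4)
    have h6 := hgb.one_le_mult (p := p) (by simp [hp])
    omega) hk1
  set p := newItem P x (.fixed .blue) b with hp
  have e1 : ∀ b' ≠ b, sg (P.typeOf x) (content (p ::ₘ s) b') = sg (P.typeOf x) (content s b') :=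
    fun b' hb => by rw [content_cons_ne (Ne.symm hb)]
  have e2 : sg (P.typeOf x) (content (p ::ₘ s) b) =
      {(.fixed .blue, none), (.fixed .blue, q.mark)} := by
    change sg (P.typeOf x) (content (p ::ₘ s) p.bin) = _
    rw [content_cons_self, sg_cons_pos (p := p) rfl (by simp [hp]), hc', sg_cons_pos hqt
      hcol.not_bonus, hz, hqs]; rfl
  have e3 : ∀ b' ≠ b, ∃ l : Kind, l.Rest ∧ sg (P.typeOf x) (content (p ::ₘ s) b') = l.ms :=
    fun b' hb => by rw [e1 b' hb]; exact hk b'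
  rcases hcase with ⟨rfl, hm⟩ | ⟨rfl, hm⟩ | ⟨rfl, hm⟩
  · rw [hm] at e2
    refine .inl ⟨fun b' => ?_, .openU (kcount_move_one b e1 hk2 e2)⟩
    by_cases hb : b' = b
    · rw [hb]; exact ⟨.U2, by simp [Kind.Rest], e2⟩
    · exact e3 b' hb
  · rw [hm] at e2
    exact .inr ⟨b, .XR, .R2, .inl rfl, e2, e3, fun a' ha' =>
      .openR ((kcount_move_one b e1 hk2 (k' := .XR) e2).comp ha')⟩
  · rw [hm] at e2
    exact .inr ⟨b, .XN, .N2, .inr rfl, e2, e3, fun a' ha' =>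
      .openN ((kcount_move_one b e1 hk2 (k' := .XN) e2).comp ha')⟩

/-- Two blue medium items leave too little room for a red item of an active type, so the receiving
bin had no items of type `i`, that is, kind `O`. -/
lemma compatible_kinds (hg : GoodBins P s) (hx : 0 < x ∧ x ≤ 1) (ha : P.Act (P.typeOf x))
    (hk : KindedRest s (P.typeOf x)) (hco : P.Compatible s x c b) :
    KindedRest (newItem P x (.fixed c) b ::ₘ fixBin s b) (P.typeOf x) ∧
      Move 1 .O (Kind.mixed c) (kcount s (P.typeOf x))
        (kcount (newItem P x (.fixed c) b ::ₘ fixBin s b) (P.typeOf x)) := by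
  obtain ⟨d, hcd, hcol, ⟨q, hq⟩, hN1, hN2, hact⟩ := compatible_spec hg hx hco
  have hne : ∀ q ∈ content s b, q.typ ≠ P.typeOf x := fun q hq h => hact q hq ⟨h ▸ ha, ha⟩
  set p := newItem P x (.fixed c) b with hp
  have e0 : sg (P.typeOf x) (content s b) = Kind.O.ms := sg_eq_zero fun q hq => .inl (hne q hq)
  have e1 : ∀ b' ≠ b, sg (P.typeOf x) (content (p ::ₘ fixBin s b) b') =
      sg (P.typeOf x) (content s b') := fun b' hb => by
    rw [hp, content_compatible, if_neg (Ne.symm hb)]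
  have e2 : sg (P.typeOf x) (content (p ::ₘ fixBin s b) b) = {(.fixed c, none)} := by
    rw [hp, content_compatible, if_pos rfl, sg_cons_pos (p := newItem P x (.fixed c) b) rfl (by simp),
      sg_eq_zero]
    · rfl
    · intro q hq
      obtain ⟨q, hq', rfl⟩ := Multiset.mem_map.1 hq
      exact .inl (hne q hq')
  have e3 : sg (P.typeOf x) (content (p ::ₘ fixBin s b) b) =
      (Kind.mixed c).ms := by
    rw [e2]; rcases c <;> rfl
  refine ⟨fun b' => ?_, kcount_move_one b e1 e0 e3⟩
  by_cases hb : b' = b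
  · rw [hb]; exact ⟨_, by rcases c <;> simp [Kind.Rest, Kind.mixed], e3⟩
  · rw [e1 b' hb]; exact hk b'

lemma new_kinds (hk : KindedRest s (P.typeOf x))
    (hb : ∀ p ∈ s, p.bin < b) :
    KindedRest (newItem P x (.prov c) b ::ₘ s) (P.typeOf x) ∧
      Move 1 .O (Kind.prov c) (kcount s (P.typeOf x))
        (kcount (newItem P x (.prov c) b ::ₘ s) (P.typeOf x)) := by
  have hz := content_fresh hb
  set p := newItem P x (.prov c) b with hp
  have e1 : ∀ b' ≠ b, sg (P.typeOf x) (content (p ::ₘ s) b') =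
      sg (P.typeOf x) (content s b') := fun b' hb => by rw [content_cons_ne (Ne.symm hb)]
  have e3 : sg (P.typeOf x) (content (p ::ₘ s) b) =
      (Kind.prov c).ms := by
    change sg (P.typeOf x) (content (p ::ₘ s) p.bin) = _
    rw [content_cons_self, sg_cons_pos (p := p) rfl (by simp [hp])]
    change _ ::ₘ sg _ (content s b) = _
    rw [hz, sg_zero]; rcases c <;> rfl
  refine ⟨fun b' => ?_, kcount_move_one b e1 (by rw [hz, sg_zero]; rfl) e3⟩
  by_cases hb : b' = b
  · rw [hb]; exact ⟨_, by rcases c <;> simp [Kind.Rest, Kind.prov], e3⟩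
  · rw [e1 b' hb]; exact hk b'

/-! ### Types that are not active -/

/-- Bin `b` has items of definite colour `c` among `A`, and it can receive another one of type
`j`. -/
def OpenFor (P : Params) (A : Packing) (j : ℕ) (c : Color) (b : ℕ) : Prop :=
  (∃ p ∈ content A b, p.status = .fixed c) ∧ P.colSum (content A b) c < P.fit c j

/-- The conditions on the items `A` of a type `j` that is neither active nor the last one. -/
structure InactiveInv (P : Params) (j : ℕ) (A : Packing) : Prop where
  unique : ∀ c b b', OpenFor P A j c b → OpenFor P A j c b' → b = b'
  lower : P.redfrac j * P.nTot A j - 1 < P.nRed A j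
  upper : (P.nRed A j : ℝ) ≤ P.redfrac j * P.nTot A j + P.redfit j

/-- The condition on the items `A` of the last type: all bins but one are almost full. -/
def LastInv (P : Params) (A : Packing) : Prop :=
  ∀ p ∈ A, ∀ p' ∈ A, p.bin < p'.bin → 1 - P.t P.N < ((content A p.bin).map Item.size).sum

/-- An item goes into the open bin if there is one; otherwise its own bin is the only one that can
become open. -/
lemma openFor_cons {P : Params} {A : Packing} {j : ℕ} {c : Color} {p : Item}
    (hp : p.status = .fixed c) (hm : 1 ≤ P.mult p)
    (hu : ∀ d b b', OpenFor P A j d b → OpenFor P A j d b' → b = b')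
    (ho : OpenFor P A j c p.bin ∨ ∀ b, ¬ OpenFor P A j c b) :
    ∀ d b b', OpenFor P (p ::ₘ A) j d b → OpenFor P (p ::ₘ A) j d b' → b = b' := by
  have key : ∀ d b, OpenFor P (p ::ₘ A) j d b → OpenFor P A j d b ∨ (d = c ∧ b = p.bin) := by
    rintro d b ⟨⟨q, hq, hqs⟩, h⟩
    by_cases hdb : d = c ∧ b = p.bin
    · exact .inr hdb
    left
    have h1 : P.colSum (content A b) d ≤ P.colSum (content (p ::ₘ A) b) d := by
      rw [content_cons]; split_ifs
      · rw [Params.colSum_cons]; omega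
      · rfl
    refine ⟨⟨q, ?_, hqs⟩, by omega⟩
    rw [content_cons] at hq
    split_ifs at hq with hb
    · rcases Multiset.mem_cons.1 hq with rfl | hq
      · rw [hp] at hqs; cases hqs; exact absurd ⟨rfl, hb.symm⟩ hdb
      · exact hq
    · exact hq
  intro d b b' h h'
  rcases key d b h with h1 | ⟨rfl, rfl⟩ <;> rcases key d b' h' with h2 | ⟨h2, h3⟩
  · exact hu d b b' h1 h2
  · subst h2; subst h3
    rcases ho with ho | ho
    · exact hu d b p.bin h1 ho
    · exact absurd h1 (ho b)
  · rcases ho with ho | ho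
    · exact hu d p.bin b' ho h2
    · exact absurd h2 (ho b')
  · exact h3.symm

section

variable {P : Params} {s : Packing} {x : ℝ} {c : Color} {b : ℕ}

lemma filter_typ_content (hg : GoodBins P s) {j : ℕ} {c : Color} {b : ℕ} {q : Item}
    (hq : q ∈ content s b) (hqt : q.typ = j) (hqc : q.HasColor c) :
    P.colSum (content (s.filter (fun p => p.typ = j)) b) c = P.colSum (content s b) c := by
  unfold Params.colSum
  rw [content_filter, Multiset.filter_filter]
  congr 2
  apply Multiset.filter_congr
  intro p hp
  refine ⟨fun h => h.1, fun h => ⟨h, ?_⟩⟩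
  rw [← hqt]; exact (hg b).same c p hp q hq h hqc

lemma openBin_iff (hg : GoodBins P s) (hN : P.typeOf x ≠ P.N) :
    P.OpenBin s x c b ↔ OpenFor P (s.filter (fun p => p.typ = P.typeOf x)) (P.typeOf x) c b := by
  unfold Params.OpenBin OpenFor
  rw [if_neg hN]
  constructor
  · rintro ⟨⟨q, h1, h2, h3, h4⟩, h5⟩
    have hq : q ∈ content s b := by simp [h1, h2]
    refine ⟨⟨q, ?_, h4⟩, ?_⟩
    · rw [content_filter, Multiset.mem_filter]; exact ⟨hq, h3⟩
    · rw [filter_typ_content hg hq h3 (.inr h4)]; exact h5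
  · rintro ⟨⟨q, h1, h4⟩, h5⟩
    rw [content_filter, Multiset.mem_filter] at h1
    rw [filter_typ_content hg h1.1 h1.2 (.inr h4)] at h5
    rw [mem_content] at h1
    exact ⟨⟨q, h1.1.1, h1.1.2, h1.2, h4⟩, h5⟩

lemma filter_fixBin (hg : GoodBins P s) {j : ℕ} (hj : ¬ P.Act j) (b : ℕ) :
    (fixBin s b).filter (fun p => p.typ = j) = s.filter (fun p => p.typ = j) := by
  rw [fixBin_eq, Multiset.filter_map]
  have h1 : ((fun p : Item => p.typ = j) ∘ fun p => if p.bin = b then p.fixed else p) =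
      fun p => p.typ = j := by
    funext p; simp only [Function.comp]; split_ifs <;> rfl
  rw [Multiset.filter_congr (q := fun p => p.typ = j)
    (fun p _ => by rw [← congrFun h1 p])]
  conv_rhs => rw [← Multiset.map_id (s.filter (fun p => p.typ = j))]
  apply Multiset.map_congr rfl
  intro p hp
  rw [Multiset.mem_filter] at hp
  have h2 : ∀ d, p.status ≠ .prov d := fun d hd =>
    hj (hp.2 ▸ ((hg p.bin).prov p (mem_content_self hp.1) d hd).1)
  split_ifs
  · rcases p with ⟨_, _, (d | _ | _), _, _, _⟩
    · exact absurd rfl (h2 d)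
    · rfl
    · rfl
  · rfl

/-! ### The effect of packing one item on all types -/

/-- The effect of packing a new item with colour `c`. -/
structure PackEffect (P : Params) (s : Packing) (x : ℝ) (c : Color) (s' : Packing) : Prop where
  good : GoodBins P s'
  sep : Separated P s'
  passive : ∀ i, i ≠ P.typeOf x → KindedRest s i →
    KindedRest s' i ∧ Passive (kcount s i) (kcount s' i)
  blue : P.Act (P.typeOf x) → KindedRest s (P.typeOf x) → c = .blue →
    BlueArrived (kcount s (P.typeOf x)) (P.typeOf x) s'
  red : P.Act (P.typeOf x) → KindedRest s (P.typeOf x) → c = .red →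
    KindedRest s' (P.typeOf x) ∧ (Move 1 .O .RU (kcount s (P.typeOf x)) (kcount s' (P.typeOf x)) ∨
      Move 1 .O .PR (kcount s (P.typeOf x)) (kcount s' (P.typeOf x)))
  batched : ∀ i m T C, Batched s i m T C → Batched s' i m T C
  other : ∀ j, ¬ P.Act j → j ≠ P.typeOf x →
    s'.filter (fun p => p.typ = j) = s.filter (fun p => p.typ = j)
  self : ¬ P.Act (P.typeOf x) → ∃ b, s'.filter (fun p => p.typ = P.typeOf x) =
      newItem P x (.fixed c) b ::ₘ s.filter (fun p => p.typ = P.typeOf x) ∧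
    (P.typeOf x ≠ P.N → OpenFor P (s.filter (fun p => p.typ = P.typeOf x)) (P.typeOf x) c b ∨
      ∀ b, ¬ OpenFor P (s.filter (fun p => p.typ = P.typeOf x)) (P.typeOf x) c b) ∧
    (P.typeOf x = P.N → c = .blue → P.OpenBin s x c b ∨ ((∀ p ∈ s, p.bin < b) ∧
      ∀ b', P.OpenBin s x c b' → ∃ p ∈ s, p.typ = P.N ∧ b' < p.bin))

lemma Batched.cons {i : ℕ} {m : Mark} {T C : ℕ} (h : Batched s i m T C) {p : Item}
    (hp : p.mark = none) : Batched (p ::ₘ s) i m T C := by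
  refine h.of_subset fun q hq h1 h2 => ?_
  rcases Multiset.mem_cons.1 hq with rfl | hq
  · rw [hp] at h2; cases h2
  · exact ⟨q, hq, h1, h2, rfl, rfl⟩

lemma Batched.fixBin {i : ℕ} {m : Mark} {T C : ℕ} (h : Batched s i m T C) (b : ℕ) :
    Batched (fixBin s b) i m T C := by
  refine h.of_subset fun q hq h1 h2 => ?_
  rw [fixBin_eq] at hq
  obtain ⟨p, hp, rfl⟩ := Multiset.mem_map.1 hq
  split_ifs at h1 h2 ⊢ <;> exact ⟨p, hp, h1, h2, rfl, rfl⟩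

lemma pack_effect (hg : GoodBins P s) (hs : Separated P s) (hx : 0 < x ∧ x ≤ 1)
    (hr : c = .red → 0 < P.redfrac (P.typeOf x))
    (hbo : c = .red → SomeBonus s → P.Act (P.typeOf x)) {s' : Packing} (h : P.Pack s x c s') :
    PackEffect P s x c s' := by
  rcases h with ⟨b, ho, rfl⟩ | ⟨ho, ⟨b, hco, rfl⟩ | ⟨hco, b, hb, rfl⟩⟩
  · obtain ⟨h1, h2⟩ := open_effect hg hs hx hr ho
    refine ⟨h1, h2, fun i hi hk => ?_, fun ha hk _ => (open_kinds hg ha hk ho).2, fun ha hk hc => ?_,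
      fun i m T C hB => hB.cons rfl, fun j _ hj => ?_, fun _ => ⟨b, ?_, fun hN => .inl ?_,
        fun _ _ => .inl ho⟩⟩
    · obtain ⟨h3, h4⟩ := passive_cons (p := newItem P x (.fixed c) b) hk (.inl hi.symm)
      refine ⟨h3, .inl ?_⟩
      rw [h4]; exact Move.refl _ _ _
    · have := (open_kinds hg ha hk ho).1
      rw [hc] at this; cases this
    · rw [Multiset.filter_cons, if_neg hj.symm, zero_add]
    · rw [Multiset.filter_cons, if_pos rfl, Multiset.singleton_add]
    · exact (openBin_iff hg hN).1 ho
  · obtain ⟨h1, h2⟩ := compatible_effect hg hs hx hr hco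
    refine ⟨h1, h2, fun i hi hk => passive_compatible hg hk hi.symm _, fun ha hk hc => ?_,
      fun ha hk hc => ?_, fun i m T C hB => (hB.fixBin b).cons rfl, fun j hj1 hj => ?_,
      fun ha => ⟨b, ?_, fun hN => .inr fun b' hb' => ?_, fun hN hc => ?_⟩⟩
    · obtain ⟨h3, h4⟩ := compatible_kinds hg hx ha hk hco
      subst hc
      exact .inl ⟨h3, .mix (no_single hg ha fun b' hb' => ha.ne_last (ho b' hb').1) h4⟩
    · obtain ⟨h3, h4⟩ := compatible_kinds hg hx ha hk hco
      subst hc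
      exact ⟨h3, .inl h4⟩
    · rw [Multiset.filter_cons, if_neg hj.symm, zero_add, filter_fixBin hg hj1]
    · rw [Multiset.filter_cons, if_pos rfl, Multiset.singleton_add, filter_fixBin hg ha]
    · exact hN (ho b' ((openBin_iff hg hN).2 hb')).1
    · obtain ⟨d, -, -, -, h3, -⟩ := compatible_spec hg hx hco
      exact absurd hN (h3 hc)
  · obtain ⟨h1, h2⟩ := new_effect hg hs hx hr hbo hco hb rfl
    set st := if P.IsActive (P.typeOf x) then Status.prov c else .fixed c with hst
    refine ⟨h1, h2, fun i hi hk => ?_, fun ha hk hc => ?_,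
      fun ha hk hc => ?_, fun i m T C hB => hB.cons rfl, fun j hj1 hj => ?_,
      fun ha => ⟨b, ?_, fun hN => .inr fun b' hb' => ?_, fun hN hc => ?_⟩⟩
    · obtain ⟨h3, h4⟩ := passive_cons (p := newItem P x st b) hk (.inl hi.symm)
      refine ⟨h3, .inl ?_⟩
      rw [h4]; exact Move.refl _ _ _
    · rw [if_pos ha.active] at hst
      rw [hst]
      obtain ⟨h3, h4⟩ := new_kinds (c := c) hk hb
      subst hc
      exact .inl ⟨h3, .new (no_single hg ha fun b' hb' => ha.ne_last (ho b' hb').1) h4⟩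
    · rw [if_pos ha.active] at hst
      rw [hst]
      obtain ⟨h3, h4⟩ := new_kinds (c := c) hk hb
      subst hc
      exact ⟨h3, .inr h4⟩
    · rw [Multiset.filter_cons, if_neg hj.symm, zero_add]
    · have : ¬ P.IsActive (P.typeOf x) := fun h =>
        ha ⟨(Params.typeOf_spec hx.2).1, Params.typeOf_le x, h⟩
      rw [if_neg this] at hst
      rw [Multiset.filter_cons, if_pos rfl, Multiset.singleton_add, hst]
    · exact hN (ho b' ((openBin_iff hg hN).2 hb')).1
    · exact .inr ⟨hb, fun b' hb' => (ho b' hb').2⟩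

/-- Items of the last type have size at most `t N`. If one does not fit into the newest bin of this
type, that bin is filled above `1 - t N`, so it may lose its role as the exceptional one. -/
lemma lastInv_pack (hg : GoodBins P s) (hN : P.typeOf x = P.N)
    (hx : 0 < x ∧ x ≤ 1)
    (hA : LastInv P (s.filter (fun p => p.typ = P.N)))
    (ho : P.OpenBin s x .blue b ∨ ((∀ p ∈ s, p.bin < b) ∧
      ∀ b', P.OpenBin s x .blue b' → ∃ p ∈ s, p.typ = P.N ∧ b' < p.bin)) :
    LastInv P (newItem P x (.fixed .blue) b ::ₘ s.filter (fun p => p.typ = P.N)) := by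
  set A := s.filter (fun p => p.typ = P.N) with hAdef
  set p₀ := newItem P x (.fixed .blue) b with hp₀
  have hmono : ∀ b', ((content A b').map Item.size).sum ≤
      ((content (p₀ ::ₘ A) b').map Item.size).sum := by
    intro b'
    rw [content_cons]; split_ifs
    · rw [Multiset.map_cons, Multiset.sum_cons]
      have : p₀.size = x := rfl
      rw [this]; linarith [hx.1]
    · exact le_rfl
  rcases ho with ⟨⟨q, hq, hqb, hqt, hqs⟩, -⟩ | ⟨hb, ho⟩
  · have hqA : q ∈ A := Multiset.mem_filter.2 ⟨hq, hqt.trans hN⟩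
    have key : ∀ p ∈ p₀ ::ₘ A, ∃ p' ∈ A, p'.bin = p.bin := by
      intro p hp
      rcases Multiset.mem_cons.1 hp with rfl | hp
      · exact ⟨q, hqA, hqb⟩
      · exact ⟨p, hp, rfl⟩
    intro p hp p' hp' hlt
    obtain ⟨p₁, h1, h2⟩ := key p hp
    obtain ⟨p₂, h3, h4⟩ := key p' hp'
    have := hA p₁ h1 p₂ h3 (by omega)
    rw [h2] at this
    exact this.trans_le (hmono _)
  · intro p hp p' hp' hlt
    have hpA : p ∈ A := by
      rcases Multiset.mem_cons.1 hp with rfl | hp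
      · exfalso
        rcases Multiset.mem_cons.1 hp' with rfl | hp'
        · exact lt_irrefl _ hlt
        · have := hb p' (Multiset.mem_filter.1 hp').1
          exact lt_asymm hlt this
      · exact hp
    by_cases hex : ∃ p'' ∈ A, p.bin < p''.bin
    · obtain ⟨p'', h1, h2⟩ := hex
      exact (hA p hpA p'' h1 h2).trans_le (hmono _)
    · have hps := Multiset.mem_filter.1 hpA
      have hno : ¬ P.OpenBin s x .blue p.bin := by
        intro h
        obtain ⟨p'', h1, h2, h3⟩ := ho _ h
        exact hex ⟨p'', Multiset.mem_filter.2 ⟨h1, h2⟩, h3⟩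
      have hna : ¬ P.Act p.typ := fun h => h.ne_last hps.2
      have hst : p.status = .fixed .blue := by
        have hpc := mem_content_self hps.1
        rcases p.color_cases with h | h | h
        · rcases h with h | h
          · exact absurd ((hg p.bin).prov p hpc _ h).1 hna
          · exact h
        · have := (hg p.bin).red_pos p hpc h
          rw [hps.2, P.redfrac_last] at this
          exact absurd this (lt_irrefl _)
        · exact absurd ((hg p.bin).bonus p hpc h).1 hna
      have hsum : content A p.bin = content s p.bin := by
        rw [hAdef, content_filter, Multiset.filter_eq_self]
        exact (hg p.bin).last p (mem_content_self hps.1) hps.2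
      have h2 : 1 < ((content s p.bin).map Item.size).sum + x := by
        by_contra hc
        refine hno ⟨⟨p, hps.1, rfl, hps.2.trans hN.symm, hst⟩, ?_⟩
        rw [if_pos hN]; exact not_lt.1 hc
      have h3 := (Params.typeOf_spec (P := P) hx.2).2
      rw [hN] at h3
      have h4 := hmono p.bin
      rw [hsum] at h4
      linarith

end

/-! ### The invariants of the algorithm -/

lemma nTot_filter (P : Params) (s : Packing) (j : ℕ) :
    P.nTot (s.filter (fun p => p.typ = j)) j = P.nTot s j := by
  unfold Params.nTot; rw [Multiset.filter_filter]
  congr 2; apply Multiset.filter_congr; intro p _; tauto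

lemma nRed_filter (P : Params) (s : Packing) (j : ℕ) :
    P.nRed (s.filter (fun p => p.typ = j)) j = P.nRed s j := by
  unfold Params.nRed; rw [Multiset.filter_filter]
  congr 2; apply Multiset.filter_congr; intro p _; tauto

lemma nTot_cons (P : Params) (p : Item) (A : Packing) (j : ℕ) : P.nTot (p ::ₘ A) j =
    (if p.typ = j ∧ p.status ≠ .bonus then P.mult p else 0) + P.nTot A j := by
  unfold Params.nTot; rw [Multiset.filter_cons]; split_ifs <;> simp

lemma nRed_cons (P : Params) (p : Item) (A : Packing) (j : ℕ) : P.nRed (p ::ₘ A) j =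
    (if p.typ = j ∧ p.HasColor .red then P.mult p else 0) + P.nRed A j := by
  unfold Params.nRed; rw [Multiset.filter_cons]; split_ifs <;> simp

/-- A reduced item counts as `redfit` items and fills its share of the bin alone, so relabelling a
bonus item creates no open bin. -/
lemma openFor_cons_full {P : Params} {A : Packing} {j : ℕ} {p : Item} {c : Color}
    (hp : p.status = .fixed c) (hm : P.fit c j ≤ P.mult p)
    (hu : ∀ d b b', OpenFor P A j d b → OpenFor P A j d b' → b = b') :
    ∀ d b b', OpenFor P (p ::ₘ A) j d b → OpenFor P (p ::ₘ A) j d b' → b = b' := by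
  have key : ∀ d b, OpenFor P (p ::ₘ A) j d b → OpenFor P A j d b := by
    rintro d b ⟨⟨q, hq, hqs⟩, h⟩
    rw [content_cons] at hq h
    split_ifs at hq h with hb
    · rw [Params.colSum_cons, Item.hasColor_fixed hp] at h
      split_ifs at h with hcd
      · subst hcd; omega
      · rcases Multiset.mem_cons.1 hq with rfl | hq
        · rw [hp] at hqs; cases hqs; exact absurd rfl hcd
        · exact ⟨⟨q, hq, hqs⟩, by omega⟩
    · exact ⟨⟨q, hq, hqs⟩, h⟩
  exact fun d b b' h h' => hu d b b' (key d b h) (key d b' h')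

/-- A bound for the number of bins with items that were marked with `R` or `N` in one step. -/
def classMax (P : Params) (i : ℕ) : ℕ :=
  ⌈1 / P.redfrac i + Kind.potMax (P.redfrac i) + 3⌉₊

/-- The conditions on an active type `i` after `T` items have arrived. -/
structure ActiveInv (P : Params) (i T : ℕ) (s : Packing) : Prop where
  rest : KindedRest s i
  inv : Kind.Inv (P.redfrac i) (kcount s i)
  batchR : Batched s i .R T (classMax P i)
  batchN : Batched s i .N T (classMax P i)

/-- The conditions on the types that are not active. -/
structure PassiveInv (P : Params) (s : Packing) : Prop where
  inactive : ∀ j, 1 ≤ j → j < P.N → ¬ P.Act j → InactiveInv P j (s.filter (fun p => p.typ = j))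
  last : LastInv P (s.filter (fun p => p.typ = P.N))

/-- The invariants after `T` items have arrived. -/
structure RunInv (P : Params) (T : ℕ) (s : Packing) : Prop where
  good : GoodBins P s
  sep : Separated P s
  active : ∀ i, P.Act i → ActiveInv P i T s
  passive : PassiveInv P s

/-- The conditions after a new item has been packed into `s`. -/
structure Packed (P : Params) (s u : Packing) : Prop where
  good : GoodBins P u
  sep : Separated P u
  active : ∀ i, P.Act i → Arrived (P.redfrac i) (kcount s i) i u
  batched : ∀ i m T C, Batched s i m T C → Batched u i m T C
  passive : PassiveInv P u

section

variable {P : Params} {s u : Packing} {x : ℝ} {T : ℕ}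

lemma redfrac_pos_of_lt {i n r : ℕ} (h1 : 1 ≤ i) (hN : i ≤ P.N)
    (h : r < ⌊P.redfrac i * ((n : ℝ) + 1)⌋₊) : 0 < P.redfrac i := by
  rcases (P.redfrac_nonneg i h1 hN).eq_or_lt with h0 | h0
  · rw [← h0] at h; simp at h
  · exact h0

lemma guard_iff {i n r : ℕ} (h1 : 1 ≤ i) (hN : i ≤ P.N) :
    r < ⌊P.redfrac i * ((n : ℝ) + 1)⌋₊ ↔ (r : ℝ) + 1 ≤ P.redfrac i * (n + 1) := by
  have := P.redfrac_nonneg i h1 hN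
  rw [← Nat.succ_le_iff, Nat.le_floor_iff (by positivity)]
  push_cast; rfl

/-- The conditions on the types other than the active ones after packing an item. -/
lemma PackEffect.passiveInv {c : Color} {s₁ : Packing} (h : PackEffect P s₁ x c u)
    (hx : 0 < x ∧ x ≤ 1) (hg : GoodBins P s₁) (hs : PassiveInv P s)
    (hcN : P.typeOf x = P.N → c = .blue)
    (ho : ∀ j, ¬ P.Act j → j ≠ P.typeOf x →
      s₁.filter (fun p => p.typ = j) = s.filter (fun p => p.typ = j))
    (hN : P.typeOf x = P.N →
      s₁.filter (fun p => p.typ = P.N) = s.filter (fun p => p.typ = P.N))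
    (hu : ¬ P.Act (P.typeOf x) → P.typeOf x < P.N → ∀ d b b',
      OpenFor P (s₁.filter (fun p => p.typ = P.typeOf x)) (P.typeOf x) d b →
      OpenFor P (s₁.filter (fun p => p.typ = P.typeOf x)) (P.typeOf x) d b' → b = b')
    (hl : ¬ P.Act (P.typeOf x) → P.typeOf x < P.N →
      P.redfrac (P.typeOf x) * (P.nTot s₁ (P.typeOf x) + 1) - 1 <
        P.nRed s₁ (P.typeOf x) + (if c = .red then 1 else 0) ∧
      (P.nRed s₁ (P.typeOf x) : ℝ) + (if c = .red then 1 else 0) ≤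
        P.redfrac (P.typeOf x) * (P.nTot s₁ (P.typeOf x) + 1) + P.redfit (P.typeOf x)) :
    PassiveInv P u := by
  constructor
  · intro j hj1 hjN hj
    by_cases hjx : j = P.typeOf x
    · subst hjx
      obtain ⟨b, h1, h2, -⟩ := h.self hj
      obtain ⟨h3, h4⟩ := hl hj hjN
      have e1 : (P.nTot (u.filter (fun p => p.typ = P.typeOf x)) (P.typeOf x) : ℝ) =
          P.nTot s₁ (P.typeOf x) + 1 := by
        rw [h1, nTot_cons, if_pos ⟨rfl, by simp⟩, Params.mult_of_typ rfl, nTot_filter]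
        push_cast; ring
      have e2 : (P.nRed (u.filter (fun p => p.typ = P.typeOf x)) (P.typeOf x) : ℝ) =
          P.nRed s₁ (P.typeOf x) + (if c = .red then 1 else 0) := by
        rw [h1, nRed_cons, Params.mult_of_typ rfl, nRed_filter, Item.hasColor_fixed (c := c) rfl]
        split_ifs with h5 h6 h6
        · push_cast; ring
        · exact absurd h5.2 h6
        · exact absurd ⟨rfl, h6⟩ h5
        · push_cast; ring
      refine ⟨?_, by rw [e1, e2]; exact h3, by rw [e1, e2]; exact h4⟩
      rw [h1]
      exact openFor_cons rfl (by rw [Params.mult_of_typ rfl]) (hu hj hjN) (h2 hjN.ne)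
    · rw [h.other j hj hjx, ho j hj hjx]
      exact hs.inactive j hj1 hjN hj
  · by_cases hjx : P.N = P.typeOf x
    · have hna : ¬ P.Act (P.typeOf x) := fun ha => ha.ne_last hjx.symm
      obtain ⟨b, h1, -, h2⟩ := h.self hna
      obtain rfl := hcN hjx.symm
      have h3 := h2 hjx.symm rfl
      have h4 := lastInv_pack hg hjx.symm hx (by rw [hN hjx.symm]; exact hs.last) h3
      rw [← hjx] at h1
      rw [h1]; exact h4
    · have hna : ¬ P.Act P.N := fun ha => ha.ne_last rfl
      rw [h.other _ hna hjx, ho _ hna hjx]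
      exact hs.last

/-- The cases are those of the algorithm: a bonus item is relabelled and the new item is blue, the
new item is red, it becomes a bonus item, or it is blue. For active types the guard is translated
into counts; for the others it keeps the number of red items near `α n`. -/
lemma packNew_effect (hI : RunInv P T s) (hx : 0 < x ∧ x ≤ 1) (h : P.PackNew s x u) :
    Packed P s u := by
  obtain ⟨hi1, hxt⟩ := Params.typeOf_spec (P := P) hx.2
  have hiN := Params.typeOf_le (P := P) x
  have hα := P.redfrac_nonneg _ hi1 hiN
  have hα' := P.redfrac_lt _ hi1 hiN
  obtain ⟨hg, hs, hact, hpas⟩ := hI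
  unfold Params.PackNew at h
  simp only at h
  set i := P.typeOf x with hi
  have hcount : ∀ i, P.Act i → P.nTot s i = Kind.tot (kcount s i) ∧
      P.nRed s i = Kind.red (kcount s i) := fun i ha =>
    ⟨Params.nTot_eq ha (hact i ha).rest.kinded, Params.nRed_eq ha (hact i ha).rest.kinded⟩
  split_ifs at h with hguard hrep hbon
  · have hpos := redfrac_pos_of_lt hi1 hiN hguard
    obtain ⟨q, r, rfl, ⟨hqb, hqr⟩, h⟩ := h
    set q' : Item := { q with typ := i, status := .fixed .red } with hq'
    have hgq := hg q.bin
    rw [content_cons_self] at hgq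
    obtain ⟨hqa, hqm, y, hcy, hyb, hyl⟩ := hgq.bonus q (by simp) hqb
    have hg1 : GoodBins P (q' ::ₘ r) := by
      refine hg.update rfl (hgq.relabel hqb hi1 hiN hpos rfl rfl ?_ (.inl hqm))
      rcases hqr with hqr | hqr
      · exact .inl hqr.symm
      · exact .inr ⟨fun ha => not_lt.2 hqr ha.space, Params.typeOf_t hx.2⟩
    have hs1 : Separated P (q' ::ₘ r) := relabel_separated hg hqb rfl rfl hs
    have hpe := pack_effect hg1 hs1 hx (c := .blue) (by simp) (by simp) h
    have hfil : ∀ j, ¬ P.Act j → j ≠ i → (q' ::ₘ r).filter (fun p => p.typ = j) =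
        (q ::ₘ r).filter (fun p => p.typ = j) := by
      intro j hj hji
      rw [Multiset.filter_cons, Multiset.filter_cons, if_neg (show q'.typ ≠ j from hji.symm),
        if_neg (fun h : q.typ = j => hj (h ▸ hqa))]
    have hbat : ∀ i m T C, Batched (q ::ₘ r) i m T C → Batched (q' ::ₘ r) i m T C := by
      intro i' m T C hB
      refine hB.of_subset fun p hp h1 h2 => ?_
      rcases Multiset.mem_cons.1 hp with rfl | hp
      · exact absurd (hqm.symm.trans h2) (by simp)
      · exact ⟨p, by simp [hp], h1, h2, rfl, rfl⟩
    have hsgne : ∀ i', i' ≠ i → ∀ b, sg i' (content (q' ::ₘ r) b) = sg i' (content (q ::ₘ r) b) := by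
      intro i' hi' b
      rw [content_cons, content_cons]
      change (sg i' (if q.bin = b then _ else _) = _)
      split_ifs
      · rw [sg_cons_neg (.inr hqb), sg_cons_neg (p := q') (.inl (fun h => hi' h.symm))]
      · rfl
    refine ⟨hpe.good, hpe.sep, fun i' ha => ?_, fun i m T C hB => hpe.batched i m T C (hbat i m T C hB),
      hpe.passiveInv hx hg1 hpas (fun _ => rfl) hfil ?_ ?_ ?_⟩
    · by_cases hii : i' = i
      · subst hii
        have hz := sg_bonus ha hgq hqb
        have e1 : sg i (content (q ::ₘ r) q.bin) = Kind.O.ms := by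
          rw [content_cons_self, sg_cons_neg (.inr hqb), hz]; rfl
        have e2 : sg i (content (q' ::ₘ r) q.bin) = Kind.RU.ms := by
          change sg i (content (q' ::ₘ r) q'.bin) = _
          rw [content_cons_self, sg_cons_pos (p := q') rfl (by simp [hq'])]
          change (_, q.mark) ::ₘ sg i (content r q.bin) = _
          rw [hqm, hz]; rfl
        have e3 : ∀ b ≠ q.bin, sg i (content (q' ::ₘ r) b) = sg i (content (q ::ₘ r) b) :=
          fun b hb => sg_update_ne (p := q) (p' := q') rfl hb
        have hk1 : KindedRest (q' ::ₘ r) i := fun b => by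
          by_cases hb : b = q.bin
          · rw [hb]; exact ⟨.RU, by simp [Kind.Rest], e2⟩
          · rw [e3 b hb]; exact (hact i ha).rest b
        refine (hpe.blue ha hk1 rfl).arrived fun a' ha' => ?_
        refine .relabel ?_ (kcount_move_one q.bin e3 e1 e2) ha'
        rw [← (hcount i ha).1, ← (hcount i ha).2]; exact hguard
      · have hk1 : KindedRest (q' ::ₘ r) i' := fun b => by
          rw [hsgne i' hii]; exact (hact i' ha).rest b
        obtain ⟨h1, h2⟩ := hpe.passive i' hii hk1
        rw [kcount_congr (hsgne i' hii)] at h2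
        exact .inl ⟨h1, h2.arrive⟩
    · intro h1
      exact absurd h1 (Params.redfrac_pos_ne_last hpos)
    · intro hna hlt
      rw [Multiset.filter_cons, if_pos (show q'.typ = i from rfl), Multiset.singleton_add]
      have hqi : q.typ ≠ i := fun h : q.typ = P.typeOf x => hna (h ▸ hqa)
      refine openFor_cons_full (c := .red) rfl ?_ ?_
      · have : P.Reduced q' := by
          change i ≠ P.typeOf q.size
          rw [← hgq.typ_eq_of_act (by simp) hqa]; exact hqi.symm
        rw [Params.mult, if_pos this]; exact le_rfl
      · have := (hpas.inactive i hi1 hlt hna).unique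
        rw [Multiset.filter_cons, if_neg hqi, zero_add] at this
        exact this
    · intro hna hlt
      have hqi : q.typ ≠ i := fun h : q.typ = P.typeOf x => hna (h ▸ hqa)
      have h1 := hpas.inactive i hi1 hlt hna
      have h2 := h1.lower
      have h3 := h1.upper
      rw [nTot_filter, nRed_filter] at h2 h3
      rw [guard_iff hi1 hiN] at hguard
      have : P.Reduced q' := by
        change i ≠ P.typeOf q.size
        rw [← hgq.typ_eq_of_act (by simp) hqa]; exact hqi.symm
      have hm : P.mult q' = P.redfit i := by rw [Params.mult, if_pos this]
      have hfit : (1 : ℝ) ≤ P.redfit i := by exact_mod_cast P.redfit_pos i hi1 hiN hpos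
      rw [nTot_cons, if_neg (fun h => hqi h.1), zero_add] at hguard h2 h3
      rw [nRed_cons, if_neg (fun h => hqi h.1), zero_add] at hguard h2 h3
      rw [nTot_cons, if_pos ⟨rfl, by simp [hq']⟩, nRed_cons, if_pos ⟨rfl, .inr rfl⟩, hm]
      push_cast
      -- Relabelling adds `redfit` red items at once, hence the slack `redfit` in `upper`. In
      -- `lower` it suffices that `α (redfit + 1) ≤ redfit`.
      constructor <;> nlinarith
  · have hpos := redfrac_pos_of_lt hi1 hiN hguard
    -- If a bonus item exists but may not be relabelled, then `redspace (needs i) > 1/3`, so the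
    -- type is active.
    have hbo : SomeBonus s → P.Act i := by
      rintro ⟨q, hq, hqb⟩
      refine Params.act_of_space hi1 hiN hpos fun h => hrep ⟨q, hq, hqb, .inr h⟩
    have hpe := pack_effect hg hs hx (c := .red) (fun _ => hpos) (fun _ => hbo) h
    refine ⟨hpe.good, hpe.sep, fun i' ha => ?_, hpe.batched,
      hpe.passiveInv hx hg hpas (fun h => absurd h (Params.redfrac_pos_ne_last hpos))
        (fun _ _ _ => rfl) (fun _ => rfl)
        (fun hna hlt => (hpas.inactive i hi1 hlt hna).unique) ?_⟩
    · by_cases hii : i' = i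
      · subst hii
        obtain ⟨h1, h2⟩ := hpe.red ha (hact i ha).rest rfl
        rw [(hcount i ha).1, (hcount i ha).2] at hguard
        rcases h2 with h2 | h2
        · exact .inl ⟨h1, .redMix hguard h2⟩
        · exact .inl ⟨h1, .redNew hguard h2⟩
      · obtain ⟨h1, h2⟩ := hpe.passive i' hii (hact i' ha).rest
        exact .inl ⟨h1, h2.arrive⟩
    · intro hna hlt
      have h1 := hpas.inactive i hi1 hlt hna
      have h2 := h1.lower
      have h3 := h1.upper
      rw [nTot_filter, nRed_filter] at h2 h3
      rw [guard_iff hi1 hiN] at hguard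
      have hfit : (1 : ℝ) ≤ P.redfit i := by exact_mod_cast P.redfit_pos i hi1 hiN hpos
      simp only [if_true]
      constructor <;> nlinarith
  · obtain ⟨ha, -⟩ := hbon
    have hai : P.Act i := ⟨hi1, hiN, ha⟩
    obtain ⟨b, ⟨hm, y, hy, hyb, hyc, hyl, hycomb⟩, rfl⟩ := h
    set p : Item := ⟨x, i, .bonus, none, 0, b⟩ with hp
    have hmix : ∀ b', b' ≠ b → (Mixed (p ::ₘ s) b' ↔ Mixed s b') := by
      intro b' hb'
      rw [mixed_iff, mixed_iff, content_cons_ne (Ne.symm hb')]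
    have hmixb : Mixed (p ::ₘ s) b := .inr ⟨p, by simp, rfl, rfl⟩
    refine ⟨fun b' => ?_, ⟨?_, ?_⟩, fun i' ha' => ?_, fun i m T C hB => hB.cons rfl, ?_, ?_⟩
    · rw [content_cons]
      split_ifs with hb
      · have hb' : b = b' := hb
        subst hb'
        exact (hg b).add_bonus hx ha (by rwa [← mixed_iff]) (by simp [hy, hyb]) hyc hyl b
      · exact hg b'
    · rintro z j ⟨p', h1, h2, rfl, h3⟩ ⟨p'', h4, h5, rfl, h6⟩
      have n1 : p'.bin ≠ b := fun h => h3 (h ▸ hmixb)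
      have n2 : p''.bin ≠ b := fun h => h6 (h ▸ hmixb)
      rcases Multiset.mem_cons.1 h1 with rfl | h1
      · exact absurd rfl n1
      rcases Multiset.mem_cons.1 h4 with rfl | h4
      · exact absurd rfl n2
      rw [hmix _ n1] at h3
      rw [hmix _ n2] at h6
      exact hs.comb _ _ ⟨p', h1, h2, rfl, h3⟩ ⟨p'', h4, h5, rfl, h6⟩
    -- Before the bonus item came, its large companion was in an unmixed bin and had `leaves = K`. A
    -- red item of a type that is not active would have been combinable with it.
    · rintro - j ⟨p'', h4, h5, rfl, h6⟩
      have n2 : p''.bin ≠ b := fun h => h6 (h ▸ hmixb)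
      rcases Multiset.mem_cons.1 h4 with rfl | h4
      · exact absurd rfl n2
      rw [hmix _ n2] at h6
      by_contra hna
      obtain ⟨-, -, h7, h8⟩ := item_spec hg h4
      have h9 := (hg p''.bin).red_pos p'' (mem_content_self h4) h5
      refine hs.comb y.size p''.typ ⟨y, hy, hyc, rfl, by rw [hyb]; exact hm⟩ ⟨p'', h4, h5, rfl, h6⟩
        ⟨hycomb.1, ?_⟩
      rw [if_neg (fun h => hna ⟨h7, h8, h.2, h9⟩)]
      have h10 := hycomb.1
      unfold Params.leavesOf at h10 ⊢
      have hyl' : 1 / 2 < y.size := hyl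
      rw [if_pos hyl'] at h10 ⊢
      split_ifs at h10 ⊢
      · exact P.needs_le _ h7 h8 h9
      · exact absurd h10 (lt_irrefl _)
    · obtain ⟨h1, h2⟩ := passive_cons (p := p) (hact i' ha').rest (.inr rfl)
      refine .inl ⟨h1, .none ?_⟩
      rw [h2]; exact Move.refl _ _ _
    · intro j hj1 hjN hj
      rw [Multiset.filter_cons, if_neg (fun h : i = j => hj (h ▸ hai)), zero_add]
      exact hpas.inactive j hj1 hjN hj
    · rw [Multiset.filter_cons, if_neg (fun h : i = P.N => hai.ne_last h), zero_add]
      exact hpas.last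
  · have hpe := pack_effect hg hs hx (c := .blue) (by simp) (by simp) h
    refine ⟨hpe.good, hpe.sep, fun i' ha => ?_, hpe.batched,
      hpe.passiveInv hx hg hpas (fun h => rfl)
        (fun _ _ _ => rfl) (fun _ => rfl)
        (fun hna hlt => (hpas.inactive i hi1 hlt hna).unique) ?_⟩
    · by_cases hii : i' = i
      · subst hii
        rw [(hcount i ha).1, (hcount i ha).2] at hguard
        exact (hpe.blue ha (hact i ha).rest rfl).arrived fun a' ha' => .blue (not_lt.1 hguard) ha'
      · obtain ⟨h1, h2⟩ := hpe.passive i' hii (hact i' ha).rest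
        exact .inl ⟨h1, h2.arrive⟩
    · intro hna hlt
      have h1 := hpas.inactive i hi1 hlt hna
      have h2 := h1.lower
      have h3 := h1.upper
      rw [nTot_filter, nRed_filter] at h2 h3
      rw [guard_iff hi1 hiN] at hguard
      simp only [reduceCtorEq, if_false, add_zero]
      constructor <;> nlinarith

end

section

variable {P : Params} {s u u' : Packing} {x : ℝ} {T : ℕ}

lemma markAndColor_effect {i : ℕ} (hi : P.Act i) {a : Kind → ℕ} (hg : GoodBins P u)
    (hs : Separated P u) (ha : Kind.Inv (P.redfrac i) a) (hA : Arrived (P.redfrac i) a i u)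
    (hbR : Batched u i .R T (classMax P i)) (hbN : Batched u i .N T (classMax P i))
    (h : P.markAndColor (T + 1) i u u') :
    GoodBins P u' ∧ Separated P u' ∧ SameOff i u u' ∧ ActiveInv P i (T + 1) u' := by
  have h0 := hi.redfrac_pos
  have h1 := hi.redfrac_lt
  unfold Params.markAndColor at h
  rw [if_pos hi.active] at h
  obtain ⟨s₁, s₂, s₃, c1, c2, c3, c4⟩ := h
  obtain ⟨e1, A1, b1⟩ := copyMark_effect hi hg hs hA c1
  obtain ⟨k1, -⟩ := A1.core h0 h1 ha
  -- The class has `x` blue items and a red one, and `x ≤ 1/α + potMax + 2`.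
  have hC1 : P.xTwo s₁ i .R + 1 ≤ classMax P i := by
    have := k1.xt_R_le h0 h1
    rw [xTwo_eq e1.good e1.rest.kinded]
    unfold classMax
    rw [← Nat.cast_le (α := ℝ)]
    refine le_trans ?_ (Nat.le_ceil _)
    push_cast
    change (Kind.xt _ _ (kcount s₁ i .RR) : ℝ) + 1 ≤ _
    linarith
  obtain ⟨e2, A2, b2, b2'⟩ := markR_effect hi e1.good e1.sep e1.rest c2 hC1
  obtain ⟨k2, -⟩ := A2.core h0 h1 k1
  obtain ⟨e3, A3, b3⟩ := markB_effect hi e2.good e2.sep e2.rest c3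
  obtain ⟨k3, -⟩ := A3.core h0 h1 k2
  have hC3 : P.xTwo s₃ i .N + 1 ≤ classMax P i := by
    have := k3.xt_N_le h0 h1
    rw [xTwo_eq e3.good e3.rest.kinded]
    unfold classMax
    rw [← Nat.cast_le (α := ℝ)]
    refine le_trans ?_ (Nat.le_ceil _)
    push_cast
    change (Kind.xt _ _ (kcount s₃ i .RN) : ℝ) + 1 ≤ _
    linarith
  obtain ⟨e4, A4, b4, b4'⟩ := markN_effect hi e3.good e3.sep e3.rest c4 hC3
  exact ⟨e4.good, e4.sep, ((e1.off.trans e2.off).trans e3.off).trans e4.off, e4.rest,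
    Kind.Inv.step h0 h1 ha A1 A2 A3 A4,
    b4' _ (b3 _ _ _ (by simp) (b2 (b1 _ _ _ hbR))),
    b4 (b3 _ _ _ (by simp) (b2' _ (b1 _ _ _ hbN)))⟩

lemma SameOff.arrived {i j : ℕ} {α : ℝ} {a : Kind → ℕ} (h : SameOff i s u) (hj : j ≠ i)
    (hA : Arrived α a j s) : Arrived α a j u := by
  unfold Arrived at hA ⊢
  unfold KindedRest at hA ⊢
  simp only [h.sg hj, h.kcount hj]
  exact hA

lemma SameOff.activeInv {i j : ℕ} (h : SameOff i s u) (hj : j ≠ i)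
    (hA : ActiveInv P j T s) : ActiveInv P j T u :=
  ⟨h.kindedRest hj hA.rest, h.kcount hj ▸ hA.inv, h.batched hj hA.batchR, h.batched hj hA.batchN⟩

lemma SameOff.passiveInv {i : ℕ} (h : SameOff i s u) (hi : P.Act i) (hA : PassiveInv P s) :
    PassiveInv P u := by
  refine ⟨fun j h1 h2 h3 => ?_, ?_⟩
  · rw [h j (fun h => h3 (h ▸ hi))]; exact hA.inactive j h1 h2 h3
  · rw [h P.N hi.ne_last.symm]; exact hA.last

/-- Marking for one type leaves all items of the other types as they are. So after `n` types the
smaller ones satisfy the invariants for time `T + 1`, and the larger ones are still in the state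
right after packing. -/
lemma forTypes_effect (hI : RunInv P T s) (hP : Packed P s u) {n : ℕ} (hn : n ≤ P.N)
    (h : ForTypes (P.markAndColor (T + 1)) n u u') :
    GoodBins P u' ∧ Separated P u' ∧ PassiveInv P u' ∧
      (∀ i, P.Act i → i ≤ n → ActiveInv P i (T + 1) u') ∧
      ∀ i, P.Act i → n < i → Arrived (P.redfrac i) (kcount s i) i u' ∧
        Batched u' i .R T (classMax P i) ∧ Batched u' i .N T (classMax P i) := by
  induction n generalizing u' with
  | zero =>
    rw [show u' = u from h]
    exact ⟨hP.good, hP.sep, hP.passive, fun i hi h => absurd hi.pos (by omega), fun i hi _ =>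
      ⟨hP.active i hi, hP.batched _ _ _ _ (hI.active i hi).batchR,
        hP.batched _ _ _ _ (hI.active i hi).batchN⟩⟩
  | succ n ih =>
    obtain ⟨v, h1, h2⟩ := h
    obtain ⟨g1, g2, g3, g4, g5⟩ := ih (by omega) h1
    by_cases ha : P.Act (n + 1)
    · obtain ⟨k1, k2, k3⟩ := g5 _ ha (Nat.lt_succ_self n)
      obtain ⟨e1, e2, e3, e4⟩ := markAndColor_effect ha g1 g2 (hI.active _ ha).inv k1 k2 k3 h2
      refine ⟨e1, e2, e3.passiveInv ha g3, fun i hi hin => ?_, fun i hi hin => ?_⟩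
      · by_cases hii : i = n + 1
        · subst hii; exact e4
        · exact e3.activeInv hii (g4 i hi (by omega))
      · obtain ⟨l1, l2, l3⟩ := g5 i hi (by omega)
        have hii : i ≠ n + 1 := by omega
        exact ⟨e3.arrived hii l1, e3.batched hii l2, e3.batched hii l3⟩
    · have : u' = v := by
        unfold Params.markAndColor at h2
        rwa [if_neg fun h => ha ⟨by omega, hn, h⟩] at h2
      rw [this]
      refine ⟨g1, g2, g3, fun i hi hin => ?_, fun i hi hin => g5 i hi (by omega)⟩
      refine g4 i hi ?_
      rcases Nat.lt_or_ge i (n + 1) with h | h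
      · omega
      · exact absurd (le_antisymm hin h ▸ hi) ha

end

/-- The invariants of the algorithm. -/
theorem runInv (P : Params) {σ : List ℝ} {s : Packing} (hσ : ∀ x ∈ σ, 0 < x ∧ x ≤ 1)
    (h : P.Run σ s) : RunInv P σ.length s := by
  induction h with
  | nil =>
    have hsg : ∀ i b, sg i (content 0 b) = 0 := fun i b => by simp [content, sg_zero]
    have hB : ∀ i m C, Batched 0 i m 0 C := fun i m C =>
      ⟨by simp, fun τ => ⟨∅, by simp, by simp⟩⟩
    refine ⟨fun b => ?_, ⟨?_, ?_⟩, fun i hi => ⟨fun b => ⟨.O, by simp [Kind.Rest], hsg i b⟩, ?_,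
      hB _ _ _, hB _ _ _⟩, ⟨fun j hj1 hjN hj => ⟨?_, ?_, ?_⟩, ?_⟩⟩
    · simp only [content, Multiset.filter_zero]; exact Params.GoodBin.zero
    · rintro y j ⟨p, hp, -⟩; simp at hp
    · rintro ⟨p, hp, -⟩; simp at hp
    · refine Kind.Inv.zero hi.redfrac_pos hi.redfrac_lt fun k hk => ?_
      by_contra hc
      obtain ⟨b, hb⟩ := exists_of_kcount hc
      rw [hsg] at hb
      exact hk (Kind.ms_injective (k := .O) hb).symm
    · rintro c b b' ⟨⟨p, hp, -⟩, -⟩; simp [content] at hp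
    · simp [Params.nTot, Params.nRed]
    · simp [Params.nTot, Params.nRed]
    · intro p hp; simp at hp
  | snoc σ x s u s' hr hp hf ih =>
    have hI := ih fun y hy => hσ y (by simp [hy])
    have hP := packNew_effect hI (hσ x (by simp)) hp
    obtain ⟨g1, g2, g3, g4, -⟩ := forTypes_effect hI hP le_rfl hf
    rw [List.length_append, List.length_singleton]
    exact ⟨g1, g2, fun i hi => g4 i hi hi.le, g3⟩

/-! ### Removing bins -/

/-- At most `C` bins have contents with property `Q`. -/
def Few (Q : Packing → Prop) (s : Packing) (C : ℝ) : Prop :=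
  ∃ F : Finset ℕ, (F.card : ℝ) ≤ C ∧ ∀ b, Q (content s b) → b ∈ F

/-- `s'` arises from `s` by removing at most `n` bins. -/
def Cut (n : ℕ) (s s' : Packing) : Prop :=
  ∃ F : Finset ℕ, F.card ≤ n ∧ s' = s.filter (fun p => p.bin ∉ F)

section

variable {P : Params} {s s' s'' : Packing} {C D : ℝ} {Q Q' : Packing → Prop}

lemma content_filter_bin' (s : Packing) (Q : ℕ → Prop) [DecidablePred Q] (b : ℕ) :
    content (s.filter (fun p => Q p.bin)) b = if Q b then content s b else 0 := by
  convert content_filter_bin s Q b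

lemma Few.mono (h : Few Q s C) (hC : C ≤ D) : Few Q s D :=
  let ⟨F, h1, h2⟩ := h; ⟨F, h1.trans hC, h2⟩

lemma Few.of_imp (h : Few Q s C) (hQ : ∀ b, Q' (content s' b) → Q (content s b)) : Few Q' s' C :=
  let ⟨F, h1, h2⟩ := h; ⟨F, h1, fun b hb => h2 b (hQ b hb)⟩

lemma Few.or (h : Few Q s C) (h' : Few Q' s D) : Few (fun c => Q c ∨ Q' c) s (C + D) := by
  obtain ⟨F, h1, h2⟩ := h
  obtain ⟨F', h3, h4⟩ := h'
  refine ⟨F ∪ F', ?_, fun b hb => Finset.mem_union.2 (hb.imp (h2 b) (h4 b))⟩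
  have : ((F ∪ F').card : ℝ) ≤ F.card + F'.card := by exact_mod_cast Finset.card_union_le F F'
  linarith

lemma Few.of_forall_not (h : ∀ b, ¬ Q (content s b)) (hC : 0 ≤ C) : Few Q s C :=
  ⟨∅, by simpa using hC, fun b hb => absurd hb (h b)⟩

/-- Few bins for each of finitely many conditions. -/
lemma Few.iUnion {ι : Type*} {S : Finset ι} {R : ι → Packing → Prop} {D : ι → ℝ}
    (h : ∀ i ∈ S, Few (R i) s (D i)) : Few (fun c => ∃ i ∈ S, R i c) s (∑ i ∈ S, D i) := by
  choose! F hF1 hF2 using h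
  refine ⟨S.biUnion F, ?_, ?_⟩
  · have h1 : ((S.biUnion F).card : ℝ) ≤ ∑ i ∈ S, ((F i).card : ℝ) := by
      exact_mod_cast Finset.card_biUnion_le
    exact h1.trans (Finset.sum_le_sum hF1)
  · rintro b ⟨i, hi, hb⟩
    exact Finset.mem_biUnion.2 ⟨i, hi, hF2 i hi b hb⟩

lemma few_kind {i : ℕ} {k : Kind} (hk : k ≠ .O) (h : (kcount s i k : ℝ) ≤ C) :
    Few (fun c => sg i c = k.ms) s C := by
  refine ⟨(bins s).filter (fun b => sg i (content s b) = k.ms), ?_, fun b hb => ?_⟩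
  · rw [← kcount_eq hk (Finset.Subset.refl _)]; exact h
  · rw [Finset.mem_filter]
    refine ⟨?_, hb⟩
    by_contra hc
    rw [content_eq_zero hc, sg_zero] at hb
    exact hk (Kind.ms_injective (k := .O) hb).symm

lemma kcount_le_of_few {i : ℕ} {k : Kind} (hk : k ≠ .O)
    (h : Few (fun c => sg i c = k.ms) s C) : (kcount s i k : ℝ) ≤ C := by
  obtain ⟨F, h1, h2⟩ := h
  refine le_trans ?_ h1
  rw [kcount_eq hk (Finset.Subset.refl _)]
  exact_mod_cast Finset.card_le_card fun b hb => h2 b (Finset.mem_filter.1 hb).2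

lemma Cut.refl (s : Packing) : Cut 0 s s :=
  ⟨∅, by simp, by simp⟩

lemma Cut.trans {n m : ℕ} (h : Cut n s s') (h' : Cut m s' s'') : Cut (n + m) s s'' := by
  obtain ⟨F, h1, rfl⟩ := h
  obtain ⟨F', h2, rfl⟩ := h'
  refine ⟨F ∪ F', (Finset.card_union_le _ _).trans (add_le_add h1 h2), ?_⟩
  rw [Multiset.filter_filter]
  apply Multiset.filter_congr
  intro p _
  simp only [Finset.mem_union]; tauto

lemma Cut.content {n : ℕ} (h : Cut n s s') (b : ℕ) :
    content s' b = content s b ∨ content s' b = 0 := by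
  obtain ⟨F, -, rfl⟩ := h
  rw [content_filter_bin' s (fun b => b ∉ F)]
  split_ifs
  · exact .inr rfl
  · exact .inl rfl

lemma Cut.few {n : ℕ} (h : Cut n s s') (hQ : ¬ Q 0) (hf : Few Q s C) : Few Q s' C := by
  refine hf.of_imp fun b hb => ?_
  rcases h.content b with h | h
  · rwa [h] at hb
  · rw [h] at hb; exact absurd hb hQ

lemma Cut.goodBins {n : ℕ} (h : Cut n s s') (hg : GoodBins P s) : GoodBins P s' := fun b => by
  rcases h.content b with h | h <;> rw [h]
  · exact hg b
  · exact Params.GoodBin.zero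

lemma Cut.mem {n : ℕ} (h : Cut n s s') {p : Item} (hp : p ∈ s') :
    p ∈ s ∧ ExtremeHarmonic.content s' p.bin = ExtremeHarmonic.content s p.bin := by
  constructor
  · obtain ⟨F, -, rfl⟩ := h; exact (Multiset.mem_filter.1 hp).1
  · rcases h.content p.bin with h | h
    · exact h
    · have := mem_content_self hp
      rw [h] at this; simp at this

lemma Cut.kindedRest {n : ℕ} (h : Cut n s s') {i : ℕ} (hk : KindedRest s i) :
    KindedRest s' i := fun b => by
  rcases h.content b with h | h <;> rw [h]
  · exact hk b
  · exact ⟨.O, by simp [Kind.Rest], sg_zero i⟩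

lemma Cut.separated {n : ℕ} (h : Cut n s s') (hs : Separated P s) : Separated P s' := by
  have hm : ∀ p ∈ s', (Mixed s' p.bin ↔ Mixed s p.bin) := fun p hp =>
    mixed_congr (h.mem hp).2
  refine hs.of_imp ?_ ?_ ?_
  · rintro y ⟨p, hp, h1, h2, h3⟩
    exact ⟨y, ⟨p, (h.mem hp).1, h1, h2, by rwa [← hm p hp]⟩, fun _ h => h⟩
  · rintro j ⟨p, hp, h1, h2, h3⟩
    exact ⟨p, (h.mem hp).1, h1, h2, by rwa [← hm p hp]⟩
  · rintro ⟨p, hp, h1⟩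
    exact ⟨p, (h.mem hp).1, h1⟩

lemma Cut.numBins {n : ℕ} (h : Cut n s s') : (numBins s : ℝ) ≤ numBins s' + n := by
  obtain ⟨F, h1, rfl⟩ := h
  rw [numBins_eq, numBins_eq]
  have h2 : bins s ⊆ bins (s.filter (fun p => p.bin ∉ F)) ∪ F := by
    intro b hb
    obtain ⟨p, hp, rfl⟩ := mem_bins.1 hb
    by_cases hF : p.bin ∈ F
    · exact Finset.mem_union_right _ hF
    · exact Finset.mem_union_left _ (mem_bins.2 ⟨p, Multiset.mem_filter.2 ⟨hp, hF⟩, rfl⟩)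
  have h3 := (Finset.card_le_card h2).trans (Finset.card_union_le _ _)
  have h4 : (bins s).card ≤ (bins (s.filter (fun p => p.bin ∉ F))).card + n := by omega
  exact_mod_cast h4

lemma Cut.sum {n : ℕ} (h : Cut n s s') (f : Item → ℝ) {A : ℝ} (hA : 0 ≤ A)
    (hf : ∀ b, |((ExtremeHarmonic.content s b).map f).sum| ≤ A) :
    |(s.map f).sum - (s'.map f).sum| ≤ A * n := by
  obtain ⟨F, h1, rfl⟩ := h
  have h2 : (s.map f).sum = ((s.filter (fun p => p.bin ∉ F)).map f).sum +
      ((s.filter (fun p => ¬ p.bin ∉ F)).map f).sum := by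
    rw [← Multiset.sum_add, ← Multiset.map_add, Multiset.filter_add_not]
  have h3 : bins (s.filter (fun p => ¬ p.bin ∉ F)) ⊆ F := by
    intro b hb
    obtain ⟨p, hp, rfl⟩ := mem_bins.1 hb
    simpa using (Multiset.mem_filter.1 hp).2
  rw [h2, add_sub_cancel_left, ← sum_content f _ h3]
  refine (Finset.abs_sum_le_sum_abs _ _).trans ?_
  refine (Finset.sum_le_card_nsmul F _ A fun b hb => ?_).trans ?_
  · rw [content_filter_bin' s (fun b => ¬ b ∉ F), if_pos (by simpa using hb)]
    exact hf b
  · rw [nsmul_eq_mul, mul_comm]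
    exact mul_le_mul_of_nonneg_left (by exact_mod_cast h1) hA

/-- Bins with a property that few bins have are removed. -/
lemma Few.cut (h : Few Q s C) {R : Item → Prop} [DecidablePred R]
    (hR : ∀ p ∈ s, ∀ q ∈ s, p.bin = q.bin → R p → R q)
    (hQ : ∀ p ∈ s, ¬ R p → Q (content s p.bin)) : Cut ⌊C⌋₊ s (s.filter R) := by
  obtain ⟨F, h1, h2⟩ := h
  refine ⟨F.filter (fun b => ∃ p ∈ s, p.bin = b ∧ ¬ R p), ?_, ?_⟩
  · refine (Finset.card_filter_le _ _).trans ?_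
    exact Nat.le_floor h1
  · apply Multiset.filter_congr
    intro p hp
    rw [Finset.mem_filter]
    constructor
    · rintro h3 ⟨-, q, hq, h4, h5⟩
      exact h5 (hR p hp q hq h4.symm h3)
    · intro h3
      by_contra h4
      exact h3 ⟨h2 _ (hQ p hp h4), p, hp, rfl, h4⟩

end

/-! ### The invariants of post-processing -/

section

variable (P : Params)

/-- The contribution of an item to the deficit of red items of type `j` with mark `m`. -/
def dv (j : ℕ) (m : Option Mark) (p : Item) : ℝ :=
  if p.typ = j ∧ p.mark = m ∧ p.status ≠ .bonus then
    (P.mult p : ℝ) * (P.redfrac j - if p.HasColor .red then 1 else 0) else 0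

/-- The deficit of red items of type `j` with mark `m`. -/
def dev (s : Packing) (j : ℕ) (m : Option Mark) : ℝ := (s.map (dv P j m)).sum

/-- The bin with contents `c` could receive another item of type `j` and colour `col`. -/
def LowBin (j : ℕ) (col : Color) (c : Packing) : Prop :=
  (∃ p ∈ c, p.typ = j ∧ p.HasColor col) ∧ P.colSum c col < P.fit col j

/-- A bin with items of the last type that is not almost full. -/
def LowLast (c : Packing) : Prop :=
  (∃ p ∈ c, p.typ = P.N) ∧ (c.map Item.size).sum ≤ 1 - P.t P.N

/-- The conditions that hold during post-processing. -/
structure PostInv (C : ℝ) (s : Packing) : Prop where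
  good : GoodBins P s
  sep : Separated P s
  fixed : ∀ p ∈ s, ∀ c, p.status ≠ .prov c
  rest : ∀ i, P.Act i → KindedRest s i
  dev_le : ∀ j, 1 ≤ j → j < P.N → ∀ m, |dev P s j m| ≤ C
  low : ∀ j, 1 ≤ j → j < P.N → ∀ col, Few (LowBin P j col) s C
  last : Few (LowLast P) s C

/-- A bound for the number of items of one type in a bin. -/
def binMax : ℕ := ∑ j ∈ Finset.range P.N, (P.bluefit j + P.redfit j)

end

section

variable {P : Params} {s s' : Packing} {C D : ℝ}

lemma fit_le_binMax {j : ℕ} (hj : j < P.N) : P.bluefit j + P.redfit j ≤ binMax P :=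
  Finset.single_le_sum (f := fun j => P.bluefit j + P.redfit j) (fun _ _ => Nat.zero_le _)
    (Finset.mem_range.2 hj)

lemma sum_color_le {c : Packing} (hg : P.GoodBin c) {j : ℕ} (hj : j ≠ P.N) (d : Color) :
    (c.map (fun p => if p.typ = j ∧ p.HasColor d then P.mult p else 0)).sum ≤ P.fit d j := by
  by_cases h : ∃ q ∈ c, q.typ = j ∧ q.HasColor d
  · obtain ⟨q, hq, rfl, hqd⟩ := h
    refine le_trans ?_ (hg.csum d q hq hqd hj)
    unfold Params.colSum
    have h1 : ((c.filter (fun p => p.HasColor d)).map P.mult).sum =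
        (c.map (fun p => if p.HasColor d then P.mult p else 0)).sum := by
      clear hq hg
      induction c using Multiset.induction_on with
      | empty => simp
      | cons p c ih =>
        rw [Multiset.filter_cons, Multiset.map_cons, Multiset.sum_cons, ← ih]
        split_ifs <;> simp
    rw [h1]
    refine Multiset.sum_map_le_sum_map _ _ fun p _ => ?_
    split_ifs with h2 h3 h3
    · exact le_rfl
    · exact absurd h2.2 h3
    · exact Nat.zero_le _
    · exact le_rfl
  · push Not at h
    rw [Multiset.map_congr rfl (g := fun _ => 0)]
    · simp
    · intro p hp; rw [if_neg]; rintro ⟨h1, h2⟩; exact h p hp h1 h2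

lemma abs_dv_le {j : ℕ} (h1 : 1 ≤ j) (hj : j < P.N) (m : Option Mark) (p : Item) :
    |dv P j m p| ≤ ((if p.typ = j ∧ p.HasColor .blue then P.mult p else 0 : ℕ) : ℝ) +
      ((if p.typ = j ∧ p.HasColor .red then P.mult p else 0 : ℕ) : ℝ) := by
  have hα := P.redfrac_nonneg j h1 hj.le
  have hα' := P.redfrac_lt j h1 hj.le
  have hm0 : (0 : ℝ) ≤ P.mult p := by positivity
  unfold dv
  by_cases h : p.typ = j ∧ p.mark = m ∧ p.status ≠ .bonus
  · rw [if_pos h]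
    rcases Item.not_bonus_iff.1 h.2.2 with hc | hc
    · have hr : ¬ p.HasColor .red := fun h' => by cases hc.unique h'
      rw [if_neg hr, if_pos ⟨h.1, hc⟩, if_neg (fun h' => hr h'.2), sub_zero, abs_mul,
        abs_of_nonneg hm0, abs_of_nonneg hα]
      push_cast; nlinarith
    · have hr : ¬ p.HasColor .blue := fun h' => by cases hc.unique h'
      rw [if_pos hc, if_neg (fun h' => hr h'.2), if_pos ⟨h.1, hc⟩, abs_mul,
        abs_of_nonneg hm0, abs_of_nonpos (by linarith)]
      push_cast; nlinarith
  · rw [if_neg h, abs_zero]; positivity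

/-- The items of each colour and type in a bin are bounded by `bluefit` or `redfit`, so one bin
contributes a bounded amount to any deficit. -/
lemma abs_sum_dv_le {c : Packing} (hg : P.GoodBin c) {j : ℕ} (h1 : 1 ≤ j) (hj : j < P.N)
    (m : Option Mark) : |(c.map (dv P j m)).sum| ≤ binMax P := by
  have h2 := Multiset.abs_sum_le_sum_abs (s := c.map (dv P j m))
  rw [Multiset.map_map] at h2
  refine h2.trans ?_
  refine (Multiset.sum_map_le_sum_map _ _ fun p _ => abs_dv_le h1 hj m p).trans ?_
  rw [Multiset.sum_map_add]
  have h3 := sum_color_le hg hj.ne .blue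
  have h4 := sum_color_le hg hj.ne .red
  have h5 := fit_le_binMax hj
  have h6 : (c.map (fun p => if p.typ = j ∧ p.HasColor .blue then P.mult p else 0)).sum +
      (c.map (fun p => if p.typ = j ∧ p.HasColor .red then P.mult p else 0)).sum ≤ binMax P := by
    simp only [Params.fit] at h3 h4; omega
  have h7 : ∀ f : Item → ℕ, (c.map (fun p => (f p : ℝ))).sum = ((c.map f).sum : ℕ) := by
    intro f
    clear hg h2 h3 h4 h6
    induction c using Multiset.induction_on with
    | empty => simp
    | cons p c ih => rw [Multiset.map_cons, Multiset.sum_cons, ih, Multiset.map_cons,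
        Multiset.sum_cons, Nat.cast_add]
  rw [h7, h7]; exact_mod_cast h6

/-- This licenses discarding boundedly many bins: the deficits change by at most `binMax` per bin,
and no other condition can be violated by removing whole bins. -/
lemma PostInv.cut {n : ℕ} (h : PostInv P C s) (hc : Cut n s s') :
    PostInv P (C + binMax P * n) s' := by
  have h0 : C ≤ C + binMax P * n := by
    have : (0 : ℝ) ≤ binMax P * n := by positivity
    linarith
  refine ⟨hc.goodBins h.good, hc.separated h.sep, fun p hp => h.fixed p (hc.mem hp).1,
    fun i hi => hc.kindedRest (h.rest i hi), fun j h1 hj m => ?_,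
    fun j h1 hj col => (hc.few (by rintro ⟨⟨p, hp, _⟩, _⟩; simp at hp) (h.low j h1 hj col)).mono h0,
    (hc.few (by rintro ⟨⟨p, hp, _⟩, _⟩; simp at hp) h.last).mono h0⟩
  have h2 := hc.sum (dv P j m) (A := binMax P) (by positivity)
    fun b => abs_sum_dv_le (h.good b) h1 hj m
  have h3 := h.dev_le j h1 hj m
  unfold dev at h3 ⊢
  rw [abs_le] at h2 h3 ⊢
  constructor <;> linarith

lemma PostInv.mono (h : PostInv P C s) (hC : C ≤ D) : PostInv P D s :=
  ⟨h.good, h.sep, h.fixed, h.rest, fun j h1 hj m => (h.dev_le j h1 hj m).trans hC,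
    fun j h1 hj col => (h.low j h1 hj col).mono hC, h.last.mono hC⟩

end

/-! ### The deficits of the types -/

/-- The deficit of red items with a mark in terms of the numbers of bins of each kind. -/
def Kind.dev (α : ℝ) (a : Kind → ℕ) : Option Mark → ℝ
  | some .R => α * (a .R1 + 2 * a .R2 + a .RR + a .XR) - a .RR
  | some .N => α * (a .N1 + 2 * a .N2 + a .RN + a .XN) - a .RN
  | some .B => α * (2 * a .B2 + a .RB) - a .RB
  | none => α * (a .PB + a .PR + a .U1 + 2 * a .U2 + a .RU + a .XR + a .XN) - (a .PR + a .RU)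

section

variable {P : Params} {s s' : Packing} {C : ℝ} {i j : ℕ}

lemma dev_cons (p : Item) (s : Packing) (j : ℕ) (m : Option Mark) :
    dev P (p ::ₘ s) j m = dv P j m p + dev P s j m := by simp [dev]

lemma dv_of_act (hi : P.Act i) (m : Option Mark) (p : Item) : dv P i m p =
    P.redfrac i * (if p.typ = i ∧ p.mark = m ∧ p.status ≠ .bonus then 1 else 0) -
      if p.typ = i ∧ p.mark = m ∧ p.HasColor .red then 1 else 0 := by
  unfold dv
  by_cases h : p.typ = i
  · have h1 : P.mult p = 1 := Params.mult_of_act (h ▸ hi)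
    by_cases h2 : p.mark = m <;> by_cases h3 : p.HasColor .red
    · simp [h, h1, h2, h3, h3.not_bonus]
    · simp [h, h1, h2, h3]
    · simp [h2]
    · simp [h2]
  · simp [h]

lemma dev_eq_card (hi : P.Act i) (m : Option Mark) (s : Packing) : dev P s i m =
    P.redfrac i * (s.filter (fun p => p.typ = i ∧ p.mark = m ∧ p.status ≠ .bonus)).card -
      (s.filter (fun p => p.typ = i ∧ p.mark = m ∧ p.HasColor .red)).card := by
  induction s using Multiset.induction_on with
  | empty => simp [dev]
  | cons p s ih =>
    rw [dev_cons, ih, dv_of_act hi, Multiset.filter_cons, Multiset.filter_cons, Multiset.card_add,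
      Multiset.card_add]
    split_ifs <;> simp <;> ring

lemma dev_eq_kind (hi : P.Act i) (h : Kinded s i) (m : Option Mark) :
    dev P s i m = Kind.dev (P.redfrac i) (kcount s i) m := by
  rw [dev_eq_card hi, card_eq_kcount h (fun q => q.2 = m) (fun p _ => by tauto),
    card_eq_kcount h (fun q => q.2 = m ∧ (q.1 = .prov .red ∨ q.1 = .fixed .red))
      (fun p _ => ⟨fun h => ⟨h.1, h.2.2.not_bonus, h.2.1, h.2.2⟩,
        fun h => ⟨h.1, h.2.2.1, h.2.2.2⟩⟩)]
  rcases m with _ | _ | _ | _ <;>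
    simp [Kind.all, Kind.ms, Kind.dev, Multiset.filter_singleton] <;> left <;> ring

lemma sum_dv_mark (s : Packing) (j : ℕ) :
    (s.map (fun p => dv P j p.mark p)).sum = P.redfrac j * P.nTot s j - P.nRed s j := by
  induction s using Multiset.induction_on with
  | empty => simp [Params.nTot, Params.nRed]
  | cons p s ih =>
    rw [Multiset.map_cons, Multiset.sum_cons, ih, nTot_cons, nRed_cons]
    unfold dv
    by_cases h : p.typ = j
    · by_cases h3 : p.HasColor .red
      · simp [h, h3, h3.not_bonus]; ring
      · by_cases h4 : p.status = .bonus
        · simp [h3, h4]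
        · simp [h, h3, h4]; ring
    · simp [h]

lemma dev_none_eq (hm : ∀ p ∈ s, p.typ = j → p.mark = none) :
    dev P s j none = P.redfrac j * P.nTot s j - P.nRed s j := by
  rw [← sum_dv_mark, dev, Multiset.map_congr rfl fun p hp => ?_]
  by_cases h : p.typ = j
  · rw [hm p hp h]
  · simp [dv, h]

lemma dev_some_eq_zero {m : Mark} (hm : ∀ p ∈ s, p.typ = j → p.mark = none) :
    dev P s j (some m) = 0 := by
  unfold dev
  rw [Multiset.map_congr rfl (g := fun _ => 0)]
  · simp
  · intro p hp
    unfold dv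
    rw [if_neg]
    rintro ⟨h1, h2, -⟩
    rw [hm p hp h1] at h2; cases h2

lemma GoodBins.mark_none (hg : GoodBins P s) (hj : ¬ P.Act j) :
    ∀ p ∈ s, p.typ = j → p.mark = none := by
  rintro p hp rfl
  by_contra hc
  exact hj ((hg p.bin).mark p (mem_content_self hp) hc)

/-- A bound for the deficits and for some kinds of bins. -/
def kindBound (α : ℝ) : ℝ := |Kind.potMax α| + |Kind.gapMax α| + |Kind.surplusMax α| +
  |Kind.provRedMax α| + 4

/-- For `R` and `N` the deficit differs from the gap by `α R1` or `α N1`, which `open_le` bounds.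
For unmarked items the lower bound comes from `surplus_le`, and the upper bound from `lower` once
the marked parts are subtracted. -/
lemma abs_kindDev_le {α : ℝ} (h0 : 0 ≤ α) (h1 : α < 1 / 3) {a : Kind → ℕ} (h : Kind.Inv α a)
    (m : Option Mark) : |Kind.dev α a m| ≤ kindBound α := by
  have hp := le_abs_self (Kind.potMax α)
  have hg := le_abs_self (Kind.gapMax α)
  have hs := le_abs_self (Kind.surplusMax α)
  have hr := abs_nonneg (Kind.provRedMax α)
  have hg0 := abs_nonneg (Kind.gapMax α)
  have hs0 := abs_nonneg (Kind.surplusMax α)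
  obtain ⟨⟨a1, a2, a3, a4, a5, a6, a7, a8, a9, a10, a11⟩, a12, a13⟩ := h
  have b1 : (0 : ℝ) ≤ a .R1 := by positivity
  have b2 : (0 : ℝ) ≤ a .N1 := by positivity
  have b3 : (0 : ℝ) ≤ a .PB := by positivity
  have b4 : (0 : ℝ) ≤ a .U1 := by positivity
  have c1 : α * a .R1 ≤ a .R1 := by nlinarith
  have c2 : α * a .N1 ≤ a .N1 := by nlinarith
  have c3 : 0 ≤ α * a .R1 := by positivity
  have c4 : 0 ≤ α * a .N1 := by positivity
  have c5 : 0 ≤ α * a .PB := by positivity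
  simp only [Kind.gapR, Kind.gapN, Kind.gapB, Kind.surplus, Kind.rtot, Kind.rred] at *
  unfold kindBound
  rw [abs_le]
  rcases m with _ | _ | _ | _ <;> simp only [Kind.dev, a10, a11] <;> push_cast <;>
    constructor <;> linarith

end

/-! ### Bins that are removed first -/

section

variable {P : Params} {s : Packing} {T : ℕ}

lemma few_of_unique {Q : Packing → Prop}
    (h : ∀ b b', Q (content s b) → Q (content s b') → b = b') : Few Q s 1 := by
  by_cases hb : ∃ b, Q (content s b)
  · obtain ⟨b, hb⟩ := hb
    exact ⟨{b}, by simp, fun b' hb' => by simp [h b' b hb' hb]⟩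
  · exact Few.of_forall_not (fun b hc => hb ⟨b, hc⟩) zero_le_one

lemma RunInv.few_kind (h : RunInv P T s) {i : ℕ} (hi : P.Act i) {k : Kind}
    (hk : k = .PB ∨ k = .PR ∨ k = .U1 ∨ k = .R1 ∨ k = .N1) :
    Few (fun c => sg i c = k.ms) s (kindBound (P.redfrac i)) := by
  obtain ⟨⟨-, -, -, -, -, -, -, h1, -, -⟩, -, h2⟩ := (h.active i hi).inv
  have hp := le_abs_self (Kind.potMax (P.redfrac i))
  have hr := le_abs_self (Kind.provRedMax (P.redfrac i))
  have hp0 := abs_nonneg (Kind.potMax (P.redfrac i))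
  have hr0 := abs_nonneg (Kind.provRedMax (P.redfrac i))
  have hg0 := abs_nonneg (Kind.gapMax (P.redfrac i))
  have hs0 := abs_nonneg (Kind.surplusMax (P.redfrac i))
  have b1 : (0 : ℝ) ≤ kcount s i .PB := by positivity
  have b2 : (0 : ℝ) ≤ kcount s i .U1 := by positivity
  have b3 : (0 : ℝ) ≤ kcount s i .R1 := by positivity
  have b4 : (0 : ℝ) ≤ kcount s i .N1 := by positivity
  apply ExtremeHarmonic.few_kind
  · rcases hk with rfl | rfl | rfl | rfl | rfl <;> simp
  · unfold kindBound
    rcases hk with rfl | rfl | rfl | rfl | rfl <;> linarith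

lemma RunInv.few_prov (h : RunInv P T s) {i : ℕ} (hi : P.Act i) :
    Few (fun c => ∃ p ∈ c, p.typ = i ∧ ∃ col, p.status = .prov col) s
      (2 * kindBound (P.redfrac i)) := by
  rw [two_mul]
  refine ((h.few_kind hi (k := .PB) (.inl rfl)).or
    (h.few_kind hi (k := .PR) (.inr (.inl rfl)))).of_imp ?_
  rintro b ⟨p, hp, ht, col, hc⟩
  obtain ⟨k, -, hk⟩ := (h.active i hi).rest b
  have hm := mem_sg hp ht (by rw [hc]; simp)
  rw [hk, hc] at hm
  simp only [hk, Kind.ms_eq_iff]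
  cases k <;> cases col <;> simp_all [Kind.ms]

/-- A red item of an active type fills its share alone. A bin with room for another blue item has
only one, so it is of kind `PB`, `U1`, `R1` or `N1`. -/
lemma RunInv.few_low_act (h : RunInv P T s) {i : ℕ} (hi : P.Act i) (col : Color) :
    Few (LowBin P i col) s (4 * kindBound (P.redfrac i)) := by
  have e : 4 * kindBound (P.redfrac i) = kindBound (P.redfrac i) + kindBound (P.redfrac i) +
    (kindBound (P.redfrac i) + kindBound (P.redfrac i)) := by ring
  rw [e]
  refine (((h.few_kind hi (k := .PB) (.inl rfl)).or
    (h.few_kind hi (k := .U1) (.inr (.inr (.inl rfl))))).or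
    ((h.few_kind hi (k := .R1) (.inr (.inr (.inr (.inl rfl))))).or
    (h.few_kind hi (k := .N1) (.inr (.inr (.inr (.inr rfl))))))).of_imp ?_
  rintro b ⟨⟨p, hp, ht, hc⟩, hlt⟩
  obtain ⟨k, -, hk⟩ := (h.active i hi).rest b
  have h1 := Params.GoodBin.mult_le_colSum (P := P) hp hc
  rw [Params.mult_of_act (ht ▸ hi)] at h1
  cases col with
  | red =>
    have : P.fit .red i = 1 := hi.redfit
    omega
  | blue =>
    rw [hi.fit, ← (h.good b).blue_card] at hlt
    have h2 : (sg i (content s b)).card ≤ 1 ∨ ¬ (∀ x ∈ sg i (content s b),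
        x.1 = .prov .blue ∨ x.1 = .fixed .blue) := by
      by_contra hcon
      push Not at hcon
      obtain ⟨h3, h4⟩ := hcon
      have h5 : (sg i (content s b)).card ≤
          ((content s b).filter (fun p => p.HasColor .blue)).card := by
        unfold sg
        rw [Multiset.card_map]
        apply Multiset.card_le_card
        rw [Multiset.le_filter]
        refine ⟨Multiset.filter_le _ _, fun q hq => ?_⟩
        rw [Multiset.mem_filter] at hq
        exact h4 _ (mem_sg hq.1 hq.2.1 hq.2.2)
      omega
    have hm := mem_sg hp ht hc.not_bonus
    rw [hk] at hm h2
    simp only [hk, Kind.ms_eq_iff]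
    rcases hc with hc | hc <;> rw [hc] at hm <;> cases k <;> simp_all [Kind.ms]

lemma RunInv.few_low_passive (h : RunInv P T s) {j : ℕ} (h1 : 1 ≤ j) (hj : j < P.N)
    (hi : ¬ P.Act j) (col : Color) : Few (LowBin P j col) s 1 := by
  have key : ∀ b, LowBin P j col (content s b) →
      OpenFor P (s.filter (fun p => p.typ = j)) j col b := by
    rintro b ⟨⟨p, hp, ht, hc⟩, hlt⟩
    have hf : ((content s b).filter (fun p => p.typ = j)).filter (fun p => p.HasColor col) =
        (content s b).filter (fun p => p.HasColor col) := by
      rw [Multiset.filter_filter]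
      apply Multiset.filter_congr
      intro q hq
      exact ⟨fun h => h.1, fun h' => ⟨h', ht ▸ (h.good b).same col q hq p hp h' hc⟩⟩
    refine ⟨⟨p, ?_, ?_⟩, ?_⟩
    · rw [content_filter, Multiset.mem_filter]; exact ⟨hp, ht⟩
    · rcases hc with hc | hc
      · exact absurd ((h.good b).prov p hp col hc).1 (ht ▸ hi)
      · exact hc
    · rw [content_filter, Params.colSum, hf]; exact hlt
  exact few_of_unique fun b b' hb hb' =>
    (h.passive.inactive j h1 hj hi).unique col b b' (key b hb) (key b' hb')

lemma RunInv.few_low_last (h : RunInv P T s) : Few (LowLast P) s 1 := by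
  have key : ∀ b b', b < b' → LowLast P (content s b) → (∃ p ∈ content s b', p.typ = P.N) →
      False := by
    rintro b b' hbb ⟨⟨p, hp, ht⟩, hlt⟩ ⟨p', hp', ht'⟩
    obtain ⟨hps, rfl⟩ := mem_content.1 hp
    obtain ⟨hps', rfl⟩ := mem_content.1 hp'
    have h1 := h.passive.last p (Multiset.mem_filter.2 ⟨hps, ht⟩) p'
      (Multiset.mem_filter.2 ⟨hps', ht'⟩) hbb
    rw [content_filter, Multiset.filter_eq_self.2 fun q hq => (h.good p.bin).last p hp ht q hq] at h1
    linarith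
  refine few_of_unique fun b b' hb hb' => ?_
  rcases lt_trichotomy b b' with h1 | h1 | h1
  · exact (key b b' h1 hb hb'.1).elim
  · exact h1
  · exact (key b' b h1 hb' hb.1).elim

end

section

variable {P : Params} {s : Packing} {T : ℕ}

/-- Such a bin has kind `R1` or `N1`, and there are few bins of these kinds. -/
lemma sg_eq_of_singleBlue (h : RunInv P T s) {q : Item} (hq : Params.SingleBlue s q) :
    P.Act q.typ ∧ ∃ m, (m = .N ∨ m = .R) ∧ q.mark = some m ∧
      sg q.typ (content s q.bin) = {(.fixed .blue, some m)} := by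
  obtain ⟨hqs, hc, hm, hcard⟩ := hq
  have hqc := mem_content_self hqs
  have hact := (h.good q.bin).mark q hqc (by rcases hm with hm | hm <;> simp [hm])
  refine ⟨hact, ?_⟩
  have hfix : q.status = .fixed .blue := by
    rcases hc with hc | hc
    · have := ((h.good q.bin).prov q hqc _ hc).2.1
      rcases hm with hm | hm <;> rw [this] at hm <;> cases hm
    · exact hc
  obtain ⟨k, hkr, hk⟩ := (h.active q.typ hact).rest q.bin
  have h1 := mem_sg hqc rfl hc.not_bonus
  have h2 : (sg q.typ (content s q.bin)).card ≤ 1 ∨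
      ¬ (∀ x ∈ sg q.typ (content s q.bin), x.1 = .fixed .blue) := by
    by_contra hcon
    push Not at hcon
    obtain ⟨h3, h4⟩ := hcon
    have h5 : (sg q.typ (content s q.bin)).card ≤
        ((content s q.bin).filter (fun p => p.HasColor .blue)).card := by
      unfold sg
      rw [Multiset.card_map]
      apply Multiset.card_le_card
      rw [Multiset.le_filter]
      refine ⟨Multiset.filter_le _ _, fun q hq => ?_⟩
      rw [Multiset.mem_filter] at hq
      exact .inr (h4 _ (mem_sg hq.1 hq.2.1 hq.2.2))
    omega
  rw [hk, hfix] at h1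
  rw [hk] at h2 ⊢
  rcases hm with hm | hm <;> rw [hm] at h1
  · refine ⟨.N, .inl rfl, hm, ?_⟩
    cases k <;> simp_all [Kind.ms, Kind.Rest]
  · refine ⟨.R, .inr rfl, hm, ?_⟩
    cases k <;> simp_all [Kind.ms, Kind.Rest]

/-- The bins that are removed because of a single blue item of type `i` with mark `m`. -/
lemma RunInv.few_single_mark (h : RunInv P T s) {i : ℕ} {m : Mark} {n : ℕ} {C : ℝ}
    (hB : Batched s i m T n) (hF : Few (fun c => sg i c = {(.fixed .blue, some m)}) s C) :
    ∃ F : Finset ℕ, (F.card : ℝ) ≤ C * n ∧ ∀ q, Params.SingleBlue s q → q.typ = i → q.mark = some m →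
      ∀ b, (q.bin = b ∨ ∃ p ∈ s, p.bin = b ∧ p.typ = q.typ ∧ p.mark = q.mark ∧
        p.batch = q.batch) → b ∈ F := by
  obtain ⟨G, hG, hG'⟩ := hF
  choose E hE hE' using hB.class_card
  -- The only blue item of the bin determines the time, so each such bin condemns the bins of just
  -- one class.
  have hτ : ∀ b, ∃ τ, ∀ q, Params.SingleBlue s q → q.bin = b → q.batch = τ := by
    intro b
    by_cases hb : ∃ q, Params.SingleBlue s q ∧ q.bin = b
    · obtain ⟨q, hq, rfl⟩ := hb
      refine ⟨q.batch, fun q' hq' hb => ?_⟩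
      obtain ⟨a, ha⟩ := Multiset.card_eq_one.1 hq.2.2.2
      have h1 : q ∈ (content s q.bin).filter (fun p => p.HasColor .blue) :=
        Multiset.mem_filter.2 ⟨mem_content_self hq.1, hq.2.1⟩
      have h2 : q' ∈ (content s q.bin).filter (fun p => p.HasColor .blue) :=
        Multiset.mem_filter.2 ⟨hb ▸ mem_content_self hq'.1, hq'.2.1⟩
      rw [ha, Multiset.mem_singleton] at h1 h2
      rw [h1, h2]
    · exact ⟨0, fun q hq hqb => absurd ⟨q, hq, hqb⟩ hb⟩
  choose τ hτ using hτ
  refine ⟨G.biUnion fun b => E (τ b), ?_, ?_⟩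
  · have h1 := Finset.card_biUnion_le_card_mul G (fun b => E (τ b)) n fun b _ => hE (τ b)
    have h2 : ((G.biUnion fun b => E (τ b)).card : ℝ) ≤ G.card * n := by exact_mod_cast h1
    refine h2.trans ?_
    gcongr
  · intro q hq ht hm b hb
    obtain ⟨-, m', -, hm', hsg⟩ := sg_eq_of_singleBlue h hq
    obtain rfl : m' = m := by rw [hm] at hm'; cases hm'; rfl
    rw [ht] at hsg
    refine Finset.mem_biUnion.2 ⟨q.bin, hG' _ hsg, ?_⟩
    have hqτ := hτ q.bin q hq rfl
    rcases hb with rfl | ⟨p, hp, rfl, h1, h2, h3⟩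
    · exact hE' _ q hq.1 ht hm hqτ
    · exact hE' _ p hp (h1.trans ht) (h2.trans hm) (h3.trans hqτ)

/-- A bound for the number of bins that are removed because of items of type `i`. -/
def badMax (P : Params) (i : ℕ) : ℝ :=
  8 * kindBound (P.redfrac i) + 2 * (kindBound (P.redfrac i) * classMax P i) + P.redfit i + 3

lemma kindBound_pos (α : ℝ) : 0 < kindBound α := by unfold kindBound; positivity

lemma RunInv.few_low (h : RunInv P T s) {j : ℕ} (h1 : 1 ≤ j) (hj : j < P.N) (col : Color) :
    Few (LowBin P j col) s (4 * kindBound (P.redfrac j) + 1) := by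
  have := kindBound_pos (P.redfrac j)
  by_cases hi : P.Act j
  · exact (h.few_low_act hi col).mono (by linarith)
  · exact (h.few_low_passive h1 hj hi col).mono (by linarith)

/-- Provisionally coloured bins are few by the potential and the surplus, and partially filled ones
because they have room for another blue item. Bins with a single blue marked item are few, and each
causes the removal of one class with at most `classMax` bins. -/
lemma RunInv.few_bad (h : RunInv P T s) : ∃ F : Finset ℕ,
    (F.card : ℝ) ≤ ∑ i ∈ Finset.range (P.N + 1), badMax P i ∧ ∀ b, P.BadBin s b → b ∈ F := by
  have hsingle : ∀ i, P.Act i → ∃ F : Finset ℕ,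
      (F.card : ℝ) ≤ 2 * (kindBound (P.redfrac i) * classMax P i) ∧
      ∀ q, Params.SingleBlue s q → q.typ = i → ∀ b, (q.bin = b ∨
        ∃ p ∈ s, p.bin = b ∧ p.typ = q.typ ∧ p.mark = q.mark ∧ p.batch = q.batch) → b ∈ F := by
    intro i hi
    obtain ⟨F, hF, hF'⟩ := h.few_single_mark (h.active i hi).batchR
      (h.few_kind hi (k := .R1) (by simp))
    obtain ⟨G, hG, hG'⟩ := h.few_single_mark (h.active i hi).batchN
      (h.few_kind hi (k := .N1) (by simp))
    refine ⟨F ∪ G, ?_, fun q hq ht b hb => ?_⟩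
    · have : ((F ∪ G).card : ℝ) ≤ F.card + G.card := by exact_mod_cast Finset.card_union_le F G
      linarith
    · rcases hq.2.2.1 with hm | hm
      · exact Finset.mem_union_right _ (hG' q hq ht hm b hb)
      · exact Finset.mem_union_left _ (hF' q hq ht hm b hb)
  have key : ∀ i ∈ Finset.range (P.N + 1), ∃ F : Finset ℕ, (F.card : ℝ) ≤ badMax P i ∧
      (P.Act i → ∀ b, (∃ p ∈ content s b, p.typ = i ∧ ∃ col, p.status = .prov col) → b ∈ F) ∧
      (P.Act i → ∀ q, Params.SingleBlue s q → q.typ = i → ∀ b, (q.bin = b ∨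
        ∃ p ∈ s, p.bin = b ∧ p.typ = q.typ ∧ p.mark = q.mark ∧ p.batch = q.batch) → b ∈ F) ∧
      (1 ≤ i → i < P.N → ∀ b, LowBin P i .blue (content s b) → b ∈ F) ∧
      (∀ b, LowLast P (content s b) → b ∈ F) := by
    intro i _
    have hpos := kindBound_pos (P.redfrac i)
    have hpos2 : (0 : ℝ) ≤ kindBound (P.redfrac i) * classMax P i := by positivity
    obtain ⟨F₁, c1, h1⟩ : ∃ F : Finset ℕ, (F.card : ℝ) ≤ 2 * kindBound (P.redfrac i) ∧ (P.Act i →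
        ∀ b, (∃ p ∈ content s b, p.typ = i ∧ ∃ col, p.status = .prov col) → b ∈ F) := by
      by_cases hi : P.Act i
      · obtain ⟨F, hF, hF'⟩ := h.few_prov hi
        exact ⟨F, hF, fun _ => hF'⟩
      · exact ⟨∅, by simpa using hpos.le, fun h => absurd h hi⟩
    obtain ⟨F₂, c2, h2⟩ : ∃ F : Finset ℕ,
        (F.card : ℝ) ≤ 2 * (kindBound (P.redfrac i) * classMax P i) ∧
        (P.Act i → ∀ q, Params.SingleBlue s q → q.typ = i → ∀ b, (q.bin = b ∨
        ∃ p ∈ s, p.bin = b ∧ p.typ = q.typ ∧ p.mark = q.mark ∧ p.batch = q.batch) → b ∈ F) := by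
      by_cases hi : P.Act i
      · obtain ⟨F, hF, hF'⟩ := hsingle i hi
        exact ⟨F, hF, fun _ => hF'⟩
      · exact ⟨∅, by simpa using hpos2, fun h => absurd h hi⟩
    obtain ⟨F₃, c3, h3⟩ : ∃ F : Finset ℕ, (F.card : ℝ) ≤ 4 * kindBound (P.redfrac i) + 1 ∧
        (1 ≤ i → i < P.N → ∀ b, LowBin P i .blue (content s b) → b ∈ F) := by
      by_cases hi : 1 ≤ i ∧ i < P.N
      · obtain ⟨F, hF, hF'⟩ := h.few_low hi.1 hi.2 .blue
        exact ⟨F, hF, fun _ _ => hF'⟩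
      · exact ⟨∅, by simp; linarith, fun h1 h2 => absurd ⟨h1, h2⟩ hi⟩
    obtain ⟨F₄, c4, h4⟩ := h.few_low_last
    refine ⟨F₁ ∪ F₂ ∪ (F₃ ∪ F₄), ?_, ?_, ?_, ?_, ?_⟩
    · have e : (F₁ ∪ F₂ ∪ (F₃ ∪ F₄)).card ≤ F₁.card + F₂.card + (F₃.card + F₄.card) :=
        (Finset.card_union_le _ _).trans
          (add_le_add (Finset.card_union_le _ _) (Finset.card_union_le _ _))
      have e' : ((F₁ ∪ F₂ ∪ (F₃ ∪ F₄)).card : ℝ) ≤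
        F₁.card + F₂.card + (F₃.card + F₄.card) := by exact_mod_cast e
      have e2 : (0 : ℝ) ≤ P.redfit i := by positivity
      unfold badMax
      linarith
    · intro hi b hb; simp [h1 hi b hb]
    · intro hi q hq ht b hb; simp [h2 hi q hq ht b hb]
    · intro hi hN b hb; simp [h3 hi hN b hb]
    · intro b hb; simp [h4 b hb]
  choose! F hF h1 h2 h3 h4 using key
  refine ⟨(Finset.range (P.N + 1)).biUnion F, ?_, ?_⟩
  · have h1 : (((Finset.range (P.N + 1)).biUnion F).card : ℝ) ≤
        ∑ i ∈ Finset.range (P.N + 1), ((F i).card : ℝ) := by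
      exact_mod_cast Finset.card_biUnion_le
    exact h1.trans (Finset.sum_le_sum hF)
  · have hr : ∀ i, i ≤ P.N → i ∈ Finset.range (P.N + 1) := fun i hi => by simp; omega
    intro b hb
    rw [Finset.mem_biUnion]
    rcases hb with ⟨p, hp, rfl, col, hc⟩ | ⟨hred, hbon, p, hp, rfl, hc, -, hlt⟩ | ⟨q, hq, hb⟩
    · have hpc := mem_content_self hp
      have hi := ((h.good p.bin).prov p hpc col hc).1
      exact ⟨p.typ, hr _ hi.le, h1 _ (hr _ hi.le) hi _ ⟨p, hpc, rfl, col, hc⟩⟩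
    · have hpc := mem_content_self hp
      have hi := (h.good p.bin).item p hpc
      split_ifs at hlt with hN
      · exact ⟨p.typ, hr _ hi.2.2.2, h4 _ (hr _ hi.2.2.2) _ ⟨⟨p, hpc, hN⟩, hlt⟩⟩
      · rw [(h.good p.bin).blue_card] at hlt
        exact ⟨p.typ, hr _ hi.2.2.2, h3 _ (hr _ hi.2.2.2) hi.2.2.1
          (lt_of_le_of_ne hi.2.2.2 hN) _ ⟨⟨p, hpc, rfl, hc⟩, hlt⟩⟩
    · have hi := (sg_eq_of_singleBlue h hq).1
      exact ⟨q.typ, hr _ hi.le, h2 _ (hr _ hi.le) hi q hq rfl b hb⟩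

lemma RunInv.abs_dev_le (h : RunInv P T s) {j : ℕ} (h1 : 1 ≤ j) (hj : j < P.N)
    (m : Option Mark) : |dev P s j m| ≤ badMax P j := by
  have hpos := kindBound_pos (P.redfrac j)
  have hpos2 : (0 : ℝ) ≤ kindBound (P.redfrac j) * classMax P j := by positivity
  have hpos3 : (0 : ℝ) ≤ P.redfit j := by positivity
  by_cases hi : P.Act j
  · rw [dev_eq_kind hi (h.active j hi).rest.kinded]
    refine (abs_kindDev_le hi.redfrac_pos.le hi.redfrac_lt (h.active j hi).inv m).trans ?_
    unfold badMax; linarith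
  · have hm := h.good.mark_none hi
    unfold badMax
    cases m with
    | some m => rw [dev_some_eq_zero hm, abs_zero]; linarith
    | none =>
      have h2 := h.passive.inactive j h1 hj hi
      have h3 := h2.lower
      have h4 := h2.upper
      rw [nTot_filter, nRed_filter] at h3 h4
      rw [dev_none_eq hm, abs_le]
      constructor <;> linarith

/-- The packing after the first bins have been removed. -/
theorem exists_postInv (P : Params) : ∃ (C : ℝ) (n : ℕ), ∀ T s, RunInv P T s →
    Cut n s (s.filter (fun p => ¬ P.BadBin s p.bin)) ∧
      PostInv P C (s.filter (fun p => ¬ P.BadBin s p.bin)) := by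
  set D := ∑ i ∈ Finset.range (P.N + 1), badMax P i with hD
  have hb0 : ∀ i, 3 ≤ badMax P i := fun i => by
    have := kindBound_pos (P.redfrac i)
    unfold badMax
    have h2 : (0 : ℝ) ≤ kindBound (P.redfrac i) * classMax P i := by positivity
    have h3 : (0 : ℝ) ≤ P.redfit i := by positivity
    linarith
  have hle : ∀ i, i ≤ P.N → badMax P i ≤ D := fun i hi =>
    Finset.single_le_sum (f := badMax P) (fun i _ => by linarith [hb0 i])
      (Finset.mem_range.2 (by omega))
  have hle' : ∀ i, i ≤ P.N → 4 * kindBound (P.redfrac i) + 1 ≤ D := fun i hi => by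
    refine le_trans ?_ (hle i hi)
    have := kindBound_pos (P.redfrac i)
    unfold badMax
    have h2 : (0 : ℝ) ≤ kindBound (P.redfrac i) * classMax P i := by positivity
    have h3 : (0 : ℝ) ≤ P.redfit i := by positivity
    linarith
  refine ⟨D + binMax P * ⌊D⌋₊, ⌊D⌋₊, fun T s h => ?_⟩
  have hcut : Cut ⌊D⌋₊ s (s.filter (fun p => ¬ P.BadBin s p.bin)) := by
    obtain ⟨F, hF, hF'⟩ := h.few_bad
    refine ⟨F.filter (fun b => P.BadBin s b), ?_, ?_⟩
    · exact (Finset.card_filter_le _ _).trans (Nat.le_floor hF)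
    · apply Multiset.filter_congr
      intro p _
      rw [Finset.mem_filter]
      exact ⟨fun h1 h2 => h1 h2.2, fun h1 h2 => h1 ⟨hF' _ h2, h2⟩⟩
  refine ⟨hcut, ?_⟩
  have h0 : D ≤ D + binMax P * ⌊D⌋₊ := by
    have : (0 : ℝ) ≤ binMax P * ⌊D⌋₊ := by positivity
    linarith
  have h1D : 1 ≤ D := by linarith [hle 0 (Nat.zero_le _), hb0 0]
  refine ⟨hcut.goodBins h.good, hcut.separated h.sep, fun p hp c hc => ?_,
    fun i hi => hcut.kindedRest (h.active i hi).rest, fun j h1 hj m => ?_, fun j h1 hj col => ?_, ?_⟩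
  · obtain ⟨hp, hb⟩ := Multiset.mem_filter.1 hp
    exact hb (.inl ⟨p, hp, rfl, c, hc⟩)
  · have h2 := hcut.sum (dv P j m) (A := binMax P) (by positivity)
      fun b => abs_sum_dv_le (h.good b) h1 hj m
    have h3 := (h.abs_dev_le h1 hj m).trans (hle j hj.le)
    unfold dev at h3 ⊢
    rw [abs_le] at h2 h3 ⊢
    constructor <;> linarith
  · refine (hcut.few ?_ (h.few_low h1 hj col)).mono ((hle' j hj.le).trans h0)
    rintro ⟨⟨p, hp, _⟩, _⟩; simp at hp
  · refine (hcut.few ?_ h.few_low_last).mono (h1D.trans h0)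
    rintro ⟨⟨p, hp, _⟩, _⟩; simp at hp

end

/-! ### Changing marks after the run -/

section

variable {P : Params} {s s' s'' : Packing} {i : ℕ} {m : Option Mark} {m' : Mark} {C D α : ℝ}

/-- A red item of type `i` gets the mark `m'`. -/
lemma remark_red_effect (hi : P.Act i) {q : Item} {r : Packing} (hg : GoodBins P (q ::ₘ r))
    (hk : KindedRest (q ::ₘ r) i) (ht : q.typ = i) (hq : q.status = .fixed .red)
    (hm : q.mark = m) (hR : m' = .R → Mixed (q ::ₘ r) q.bin) :
    GoodBins P ({ q with mark := some m' } ::ₘ r) ∧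
      SameColors (q ::ₘ r) ({ q with mark := some m' } ::ₘ r) ∧
      SameOff i (q ::ₘ r) ({ q with mark := some m' } ::ₘ r) ∧
      KindedRest ({ q with mark := some m' } ::ₘ r) i ∧
      Move 1 (Kind.redKind m) (Kind.redKind (some m')) (kcount (q ::ₘ r) i)
        (kcount ({ q with mark := some m' } ::ₘ r) i) := by
  have hqc := mem_content_self (Multiset.mem_cons_self q r)
  have hnb : q.status ≠ .bonus := by rw [hq]; simp
  obtain ⟨k, hkr, hkb⟩ := hk q.bin
  have hmem := mem_sg hqc ht hnb
  rw [hkb, hq, hm] at hmem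
  have hk3 := kind_of_red hmem
  have hsg := hkb
  rw [hk3, redKind_ms, content_cons_self, sg_cons_pos ht hnb, hq, hm] at hkb
  have hz : sg i (content r q.bin) = 0 :=
    (Multiset.cons_inj_right _).1 (hkb.trans (Multiset.cons_zero _).symm)
  set q' : Item := { q with mark := some m' } with hq'
  have hbin : q'.bin = q.bin := rfl
  have hnew : sg i (content (q' ::ₘ r) q.bin) = (Kind.redKind (some m')).ms := by
    rw [← hbin, content_cons_self, sg_cons_pos (by exact ht) (by exact hnb), hbin, hz, redKind_ms,
      hq', hq]
    rfl
  refine ⟨hg.update hbin ?_, ?_, SameOff.cons ht ht (SameOff.refl i r), fun b => ?_,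
    kcount_move_one q.bin (fun b' hb' => sg_update_ne hbin hb') (hk3 ▸ hsg) hnew⟩
  · have hgq := hg q.bin
    rw [content_cons_self] at hgq
    refine hgq.remark_cons ⟨rfl, rfl, rfl, rfl, .inr ⟨by simp [hq'], ht ▸ hi, ⟨_, hq⟩, ?_⟩⟩
    -- A red item gets mark `R` only in a mixed bin. A companion bonus item cannot be the sole
    -- reason for that, since it in turn requires a blue item, so `mark_R` persists.
    intro _ hmR
    have h1 := hR (by simpa [hq'] using hmR)
    rw [mixed_iff, content_cons_self] at h1
    rcases h1 with h1 | ⟨p, hp, hpb⟩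
    · exact h1.1
    · obtain ⟨-, -, y, hy, hyb, -⟩ := hgq.bonus p hp hpb
      exact ⟨y, by rw [hy]; simp, .inr hyb⟩
  · simp only [SameColors, Multiset.map_cons]; rfl
  · by_cases hb : b = q.bin
    · exact ⟨_, redKind_rest _, hb ▸ hnew⟩
    · rw [sg_update_ne hbin hb]; exact hk b

/-- The items of `s'` are those of `s`, but marks `m` of items of type `i` may have changed
to `m'`. -/
def Traced (i : ℕ) (m : Option Mark) (m' : Mark) (s s' : Packing) : Prop :=
  ∀ p' ∈ s', ∃ p ∈ s, p.bin = p'.bin ∧ p.typ = p'.typ ∧ p.status = p'.status ∧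
    (p.mark = p'.mark ∨ (p.typ = i ∧ p.mark = m ∧ p'.mark = some m'))

lemma Traced.refl (s : Packing) : Traced i m m' s s := fun p hp => ⟨p, hp, rfl, rfl, rfl, .inl rfl⟩

lemma Traced.trans (hm : m ≠ some m') (h : Traced i m m' s s') (h' : Traced i m m' s' s'') :
    Traced i m m' s s'' := by
  intro p₂ hp₂
  obtain ⟨p₁, hp₁, a1, a2, a3, a4⟩ := h' p₂ hp₂
  obtain ⟨p, hp, b1, b2, b3, b4⟩ := h p₁ hp₁
  refine ⟨p, hp, b1.trans a1, b2.trans a2, b3.trans a3, ?_⟩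
  rcases a4 with a4 | ⟨a4, a5, a6⟩ <;> rcases b4 with b4 | ⟨b4, b5, b6⟩
  · exact .inl (b4.trans a4)
  · exact .inr ⟨b4, b5, a4 ▸ b6⟩
  · exact .inr ⟨b2.trans a4, b4.trans a5, a6⟩
  · rw [b6] at a5; exact absurd a5.symm hm

/-- The effect of changing marks `m` to `m'` on items of type `i`. -/
structure Reassigned (P : Params) (i : ℕ) (m : Option Mark) (m' : Mark) (s s' : Packing) :
    Prop where
  good : GoodBins P s'
  colors : SameColors s s'
  off : SameOff i s s'
  rest : KindedRest s' i
  traced : Traced i m m' s s'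

lemma Reassigned.refl (hg : GoodBins P s) (hk : KindedRest s i) : Reassigned P i m m' s s :=
  ⟨hg, rfl, SameOff.refl _ _, hk, Traced.refl s⟩

lemma Reassigned.trans (hm : m ≠ some m') (h : Reassigned P i m m' s s')
    (h' : Reassigned P i m m' s' s'') : Reassigned P i m m' s s'' :=
  ⟨h'.good, Eq.trans h.colors h'.colors, h.off.trans h'.off, h'.rest, h.traced.trans hm h'.traced⟩

lemma fixed_of_hasColor (hf : ∀ p ∈ s, ∀ c, p.status ≠ .prov c) {p : Item} (hp : p ∈ s) {c : Color}
    (hc : p.HasColor c) : p.status = .fixed c := hc.resolve_left (hf p hp c)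

/-- The pairs change their mark first and the red item afterwards. The latter is not among the items
of the pairs, and mixedness does not depend on marks. -/
lemma reassign_effect (hi : P.Act i) (hg : GoodBins P s) (hk : KindedRest s i)
    (hf : ∀ p ∈ s, ∀ c, p.status ≠ .prov c) {okRed : Packing → Item → Prop}
    {okBin : Packing → ℕ → Prop} (hR : m' = .R → ∀ q, okRed s q → Mixed s q.bin)
    (h : P.reassign i m m' okRed okBin s s') : Reassigned P i m m' s s' ∧
      ∃ t a, (2 * t = P.xOne s i m' ∨ 2 * t = P.xOne s i m' + 1) ∧
        Move t (Kind.pairKind m) (Kind.pairKind (some m')) (kcount s i) a ∧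
        Move 1 (Kind.redKind m) (Kind.redKind (some m')) a (kcount s' i) := by
  obtain ⟨T, q, r, rfl, hT, hx, ht, hc, hm, hok, rfl⟩ := h
  have hq := fixed_of_hasColor hf (Multiset.mem_cons_self q r) hc
  set g : Item → Item := fun p => if p.bin ∈ T ∧ p.typ = i ∧ p.HasColor .blue ∧ p.mark = m
    then { p with mark := some m' } else p with hgdef
  have hgq : g q = q := by
    rw [hgdef]; simp only
    rw [if_neg]
    rintro ⟨-, -, h, -⟩; cases h.unique hc
  obtain ⟨k1, k2, k3, k4, k5⟩ := pairs_effect (M := m') (m := m) (g := g) hi hg hk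
    (fun b hb => (hasPair_iff hk).1 (hT b hb).1)
    (fun p _ h1 h2 h3 h4 => by
      have e : g p = { p with mark := some m' } := if_pos ⟨h1, h2, .inr h3, h4⟩
      rw [e]; exact ⟨⟨rfl, rfl, rfl, rfl⟩, rfl⟩)
    (fun p _ h => if_neg h)
  rw [Multiset.map_cons, hgq] at k1 k2 k3 k4 k5
  obtain ⟨l1, l2, l3, l4, l5⟩ := remark_red_effect (m := m) (m' := m') hi k1 k4 ht hq hm
    (fun h => (k2.mixed _).2 (hR h q hok))
  refine ⟨⟨l1, Eq.trans k2 l2, k3.trans l3, l4, ?_⟩, T.card, _, hx, k5, l5⟩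
  intro p' hp'
  rcases Multiset.mem_cons.1 hp' with rfl | hp'
  · exact ⟨q, Multiset.mem_cons_self _ _, rfl, rfl, rfl, .inr ⟨ht, hm, rfl⟩⟩
  · obtain ⟨p, hp, rfl⟩ := Multiset.mem_map.1 hp'
    refine ⟨p, Multiset.mem_cons_of_mem hp, ?_⟩
    by_cases h : p.bin ∈ T ∧ p.typ = i ∧ p.HasColor .blue ∧ p.mark = m
    · have e : g p = { p with mark := some m' } := if_pos h
      rw [e]; exact ⟨rfl, rfl, rfl, .inr ⟨h.2.1, h.2.2.2, rfl⟩⟩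
    · have e : g p = p := if_neg h
      rw [e]; exact ⟨rfl, rfl, rfl, .inl rfl⟩

/-! ### The change of the deficits -/

lemma Kind.dev_pairs {t : ℕ} {a a' : Kind → ℕ} (hm : m ≠ some m')
    (h : Move t (Kind.pairKind m) (Kind.pairKind (some m')) a a') (l : Option Mark) :
    Kind.dev α a' l = Kind.dev α a l + (if l = some m' then 2 * α * t else 0) -
      (if l = m then 2 * α * t else 0) := by
  obtain ⟨e1, e2, e3, e4, e5, e6, e7, e8, e9, e10, e11, e12, e13, e14, e15⟩ := h.eqs
  rcases m with _ | _ | _ | _ <;> rcases m' with _ | _ | _ <;> first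
    | exact absurd rfl hm
    | (rcases l with _ | _ | _ | _ <;>
      simp [Kind.pairKind] at e1 e2 e3 e4 e5 e6 e7 e8 e9 e10 e11 e12 e13 e14 e15 <;>
      simp [Kind.dev, *] <;> ring)

lemma Kind.dev_red {a a' : Kind → ℕ} (hm : m ≠ some m')
    (h : Move 1 (Kind.redKind m) (Kind.redKind (some m')) a a') (l : Option Mark) :
    Kind.dev α a' l = Kind.dev α a l + (if l = some m' then α - 1 else 0) -
      (if l = m then α - 1 else 0) := by
  obtain ⟨e1, e2, e3, e4, e5, e6, e7, e8, e9, e10, e11, e12, e13, e14, e15⟩ := h.eqs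
  rcases m with _ | _ | _ | _ <;> rcases m' with _ | _ | _ <;> first
    | exact absurd rfl hm
    | (rcases l with _ | _ | _ | _ <;>
      simp [Kind.redKind] at e1 e2 e3 e4 e5 e6 e7 e8 e9 e10 e11 e12 e13 e14 e15 <;>
      simp [Kind.dev, *] <;> ring)

lemma Kind.dev_some (a : Kind → ℕ) (m' : Mark) : Kind.dev α a (some m') =
    α * Kind.totMark a m' - a (Kind.redKind (some m')) := by
  cases m' <;> simp [Kind.dev, Kind.totMark, Kind.redKind]

/-- The new deficit is nonnegative when `2 t ≥ x`, since one more red item is then permitted. If `x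
≠ 0`, minimality and `2 t ≤ x + 1` keep it below `2 α < 1`; if `x = 0`, then `t = 0` and the deficit
decreases. So repeated steps never accumulate an error. -/
lemma abs_dev_step (hα : 0 < α) (hα' : α < 1 / 3) {n r t : ℕ} {x : ℕ} (hx : x = Kind.xo α n r)
    (ht : 2 * t = x ∨ 2 * t = x + 1) (hC : 1 ≤ C) (h : |α * n - r| ≤ C) :
    |α * n - r + 2 * α * t + (α - 1)| ≤ C := by
  obtain ⟨h1, h2⟩ := Kind.xo_spec hα n r
  rw [← hx] at h1 h2
  rw [abs_le] at h ⊢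
  have ht1 : (x : ℝ) ≤ 2 * t := by exact_mod_cast (by omega : x ≤ 2 * t)
  have ht2 : (2 * t : ℝ) ≤ x + 1 := by exact_mod_cast (by omega : 2 * t ≤ x + 1)
  have e1 := mul_le_mul_of_nonneg_left ht1 hα.le
  have e2 := mul_le_mul_of_nonneg_left ht2 hα.le
  refine ⟨by nlinarith, ?_⟩
  by_cases hx0 : x = 0
  · have : t = 0 := by omega
    subst this
    simp only [Nat.cast_zero, mul_zero]; linarith
  · have := h2 hx0; nlinarith

/-- The deficits after a step that changes marks. -/
lemma reassign_dev (hi : P.Act i) (hm : m ≠ some m') (hg : GoodBins P s) (hk : KindedRest s i)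
    (hf : ∀ p ∈ s, ∀ c, p.status ≠ .prov c) {okRed : Packing → Item → Prop}
    {okBin : Packing → ℕ → Prop} (hR : m' = .R → ∀ q, okRed s q → Mixed s q.bin)
    (h : P.reassign i m m' okRed okBin s s') (hC : 1 ≤ C) (hd : |dev P s i (some m')| ≤ C) :
    |dev P s' i (some m')| ≤ C ∧
      dev P s' i m + dev P s' i (some m') = dev P s i m + dev P s i (some m') ∧
      ∀ l, l ≠ m → l ≠ some m' → dev P s' i l = dev P s i l := by
  obtain ⟨hr, t, a, hx, h1, h2⟩ := reassign_effect hi hg hk hf hR h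
  rw [xOne_eq hg hk.kinded] at hx
  simp only [dev_eq_kind hi hk.kinded, dev_eq_kind hi hr.rest.kinded] at hd ⊢
  simp only [Kind.dev_red hm h2, Kind.dev_pairs hm h1, if_true, if_neg hm, if_neg (Ne.symm hm)]
  refine ⟨?_, by ring, fun l hl hl' => by simp [hl, hl']⟩
  rw [Kind.dev_some] at hd ⊢
  have := abs_dev_step hi.redfrac_pos hi.redfrac_lt rfl hx hC hd
  rw [abs_le] at this ⊢
  constructor <;> linarith

end

section

variable {P : Params} {s s' s'' : Packing} {i j : ℕ} {m : Option Mark} {m' : Mark} {C D α : ℝ}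

/-! ### Properties that do not depend on marks -/

lemma SameColors.content (h : SameColors s s') (b : ℕ) :
    (ExtremeHarmonic.content s b).map Item.erase =
      (ExtremeHarmonic.content s' b).map Item.erase := by
  have h1 : ∀ p : Item, p.erase.bin = p.bin := fun _ => rfl
  rw [← content_map h1, ← content_map h1, h]

lemma lowBin_erase (c : Packing) (col : Color) :
    LowBin P j col (c.map Item.erase) ↔ LowBin P j col c := by
  have h : P.colSum (c.map Item.erase) col = P.colSum c col := by
    unfold Params.colSum
    rw [Multiset.filter_map, Multiset.map_map]
    simp only [Function.comp_def, Item.erase_hasColor]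
    rfl
  unfold LowBin
  rw [h]
  simp only [Multiset.mem_map, exists_exists_and_eq_and, Item.erase_hasColor]
  rfl

lemma lowLast_erase (c : Packing) : LowLast P (c.map Item.erase) ↔ LowLast P c := by
  unfold LowLast
  rw [Multiset.map_map]
  simp only [Multiset.mem_map, exists_exists_and_eq_and]
  rfl

lemma SameColors.lowBin (h : SameColors s s') (col : Color) (b : ℕ) :
    LowBin P j col (ExtremeHarmonic.content s' b) ↔
      LowBin P j col (ExtremeHarmonic.content s b) := by
  rw [← lowBin_erase, ← h.content, lowBin_erase]

lemma SameColors.lowLast (h : SameColors s s') (b : ℕ) :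
    LowLast P (ExtremeHarmonic.content s' b) ↔ LowLast P (ExtremeHarmonic.content s b) := by
  rw [← lowLast_erase, ← h.content, lowLast_erase]

lemma dev_filter (s : Packing) (j : ℕ) (m : Option Mark) :
    dev P (s.filter (fun p => p.typ = j)) j m = dev P s j m := by
  induction s using Multiset.induction_on with
  | empty => rfl
  | cons p s ih =>
    rw [Multiset.filter_cons, dev_cons, ← ih]
    split_ifs with h
    · rw [Multiset.singleton_add, dev_cons]
    · rw [zero_add, dv, if_neg (fun h' => h h'.1), zero_add]

lemma SameOff.dev (h : SameOff i s s') (hj : j ≠ i) (m : Option Mark) :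
    ExtremeHarmonic.dev P s' j m = ExtremeHarmonic.dev P s j m := by
  rw [← dev_filter, h j hj, dev_filter]

lemma PostInv.nonneg (h : PostInv P C s) : 0 ≤ C := by
  obtain ⟨F, h1, -⟩ := h.last
  exact le_trans (by positivity) h1

/-- The conditions are preserved if only colours and marks of items of type `i` change. -/
lemma PostInv.of_sameOff (h : PostInv P C s) (hC : C ≤ D) (hg : GoodBins P s')
    (hc : SameColors s s') (ho : SameOff i s s') (hk : KindedRest s' i)
    (hf : ∀ p ∈ s', ∀ c, p.status ≠ .prov c) (hd : ∀ m, |dev P s' i m| ≤ D) :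
    PostInv P D s' where
  good := hg
  sep := hc.separated h.sep
  fixed := hf
  rest j hj := by
    by_cases hji : j = i
    · exact hji ▸ hk
    · exact ho.kindedRest hji (h.rest j hj)
  dev_le j h1 hj m := by
    by_cases hji : j = i
    · exact hji ▸ hd m
    · rw [ho.dev hji]; exact (h.dev_le j h1 hj m).trans hC
  low j h1 hj col := ((h.low j h1 hj col).of_imp fun b => (hc.lowBin col b).1).mono hC
  last := (h.last.of_imp fun b => (hc.lowLast b).1).mono hC

lemma Traced.fixed (h : Traced i m m' s s') (hf : ∀ p ∈ s, ∀ c, p.status ≠ .prov c) :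
    ∀ p ∈ s', ∀ c, p.status ≠ .prov c := by
  intro p' hp' c hc
  obtain ⟨p, hp, -, -, h3, -⟩ := h p' hp'
  exact hf p hp c (h3.trans hc)

lemma Params.Act.lt (hi : P.Act i) : i < P.N := lt_of_le_of_ne hi.le hi.ne_last

/-- The effect of a loop that changes marks `m` to `m'`. -/
lemma reassign_loop (hi : P.Act i) (hm : m ≠ some m') (h : PostInv P C s) (hC : 1 ≤ C)
    {okRed : Packing → Item → Prop} {okBin : Packing → ℕ → Prop}
    (hR : m' = .R → ∀ s q, okRed s q → Mixed s q.bin)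
    (hs : Relation.ReflTransGen (P.reassign i m m' okRed okBin) s s') :
    Reassigned P i m m' s s' ∧ PostInv P (3 * C) s' := by
  have hd := h.dev_le i hi.pos hi.lt
  -- The loop invariant bounds the deficit of the target mark and keeps its sum with the deficit of
  -- the source. The deficit of the source alone need not be controlled at each step.
  have key : Reassigned P i m m' s s' ∧ |dev P s' i (some m')| ≤ C ∧
      dev P s' i m + dev P s' i (some m') = dev P s i m + dev P s i (some m') ∧
      ∀ l, l ≠ m → l ≠ some m' → dev P s' i l = dev P s i l := by
    induction hs with
    | refl => exact ⟨Reassigned.refl h.good (h.rest i hi), hd _, rfl, fun _ _ _ => rfl⟩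
    | tail _ h2 ih =>
      obtain ⟨a1, a2, a3, a4⟩ := ih
      have hf := a1.traced.fixed h.fixed
      obtain ⟨b1, b2, b3⟩ := reassign_dev hi hm a1.good a1.rest hf (fun e => hR e _) h2 hC a2
      have b0 := (reassign_effect hi a1.good a1.rest hf (fun e => hR e _) h2).1
      exact ⟨a1.trans hm b0, b1, b2.trans a3,
        fun l hl hl' => (b3 l hl hl').trans (a4 l hl hl')⟩
  obtain ⟨a1, a2, a3, a4⟩ := key
  refine ⟨a1, h.of_sameOff (by linarith) a1.good a1.colors a1.off a1.rest
    (a1.traced.fixed h.fixed) fun l => ?_⟩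
  by_cases hl : l = m
  -- The sum of both deficits is at most `2 C` in absolute value and the one of the target at most
  -- `C`, whence `3 C`.
  · have h1 := hd m
    have h2 := hd (some m')
    rw [hl]
    rw [abs_le] at *
    constructor <;> linarith
  · by_cases hl' : l = some m'
    · rw [hl']; linarith
    · rw [a4 l hl hl']; linarith [hd l]

/-! ### Loops that have ended -/

/-- As a suitable red item is present, the step must fail for lack of pairs. By minimality, `α x` is
at most 1 plus the surplus of red items with the target mark, which is bounded. -/
lemma stuck_pairs (hi : P.Act i) (h : PostInv P C s) {okRed : Packing → Item → Prop}
    {okBin : Packing → ℕ → Prop} (hst : ∀ u, ¬ P.reassign i m m' okRed okBin s u) {q : Item}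
    (hq : q ∈ s) (ht : q.typ = i) (hc : q.HasColor .red) (hqm : q.mark = m) (hok : okRed s q) :
    P.redfrac i * ((bins s).filter
      (fun b => sg i (content s b) = (Kind.pairKind m).ms ∧ okBin s b)).card ≤ 1 + C := by
  have hk := h.rest i hi
  set B := (bins s).filter (fun b => sg i (content s b) = (Kind.pairKind m).ms ∧ okBin s b)
  have h1 : B.card < (P.xOne s i m' + 1) / 2 := by
    by_contra hcon
    push Not at hcon
    obtain ⟨T, hTB, hT⟩ := Finset.exists_subset_card_eq hcon
    obtain ⟨r, hr⟩ := Multiset.exists_cons_of_mem hq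
    refine hst _ ⟨T, q, r, hr, fun b hb => ?_, by omega, ht, hc, hqm, hok, rfl⟩
    have := (Finset.mem_filter.1 (hTB hb)).2
    exact ⟨(hasPair_iff hk).2 this.1, this.2⟩
  have hd := h.dev_le i hi.pos hi.lt (some m')
  rw [dev_eq_kind hi hk.kinded, Kind.dev_some] at hd
  rw [xOne_eq h.good hk.kinded] at h1
  obtain ⟨-, h2⟩ := Kind.xo_spec hi.redfrac_pos (Kind.totMark (kcount s i) m')
    (kcount s i (Kind.redKind (some m')))
  have h3 := h2 (by omega)
  have h4 : (B.card : ℝ) ≤ Kind.xo (P.redfrac i) (Kind.totMark (kcount s i) m')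
    (kcount s i (Kind.redKind (some m'))) := by exact_mod_cast (by omega)
  have h5 := mul_le_mul_of_nonneg_left h4 hi.redfrac_pos.le
  rw [abs_le] at hd
  linarith

/-- A single blue item of an active type leaves its bin low, because `bluefit` is 2. -/
lemma PostInv.few_single (h : PostInv P C s) (hi : P.Act i) {k : Kind}
    (hk : k = .U1 ∨ k = .R1 ∨ k = .N1) : Few (fun c => sg i c = k.ms) s C := by
  refine (h.low i hi.pos hi.lt .blue).of_imp fun b hb => ?_
  have h1 : ∃ m, sg i (content s b) = {(.fixed .blue, m)} := by
    rcases hk with rfl | rfl | rfl <;> exact ⟨_, hb⟩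
  obtain ⟨m, h1⟩ := h1
  obtain ⟨p, hp, ht, hst, -⟩ := exists_of_mem_sg (i := i) (c := content s b) (st := .fixed .blue)
    (m := m) (by rw [h1]; simp)
  refine ⟨⟨p, hp, ht, .inr hst⟩, ?_⟩
  rw [hi.fit, ← (h.good b).blue_card]
  have h2 : ((content s b).filter (fun p => p.HasColor .blue)).card ≤
      (sg i (content s b)).card := by
    unfold sg
    rw [Multiset.card_map]
    apply Multiset.card_le_card
    rw [Multiset.le_filter]
    refine ⟨Multiset.filter_le _ _, fun q hq => ?_⟩
    rw [Multiset.mem_filter] at hq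
    exact ⟨((h.good b).same .blue q hq.1 p hp hq.2 (.inr hst)).trans ht, hq.2.not_bonus⟩
  rw [h1, Multiset.card_singleton] at h2
  omega

lemma PostInv.kcount_prov (h : PostInv P C s) {k : Kind} (hk : k = .PB ∨ k = .PR) (i : ℕ) :
    kcount s i k = 0 := by
  rw [kcount_eq (by rcases hk with rfl | rfl <;> simp) (Finset.Subset.refl _),
    Finset.card_eq_zero, Finset.filter_eq_empty_iff]
  intro b _ hb
  have h1 : ∃ c, (Status.prov c, none) ∈ sg i (content s b) := by
    rw [hb]; rcases hk with rfl | rfl <;> exact ⟨_, by simp [Kind.ms]; rfl⟩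
  obtain ⟨c, h1⟩ := h1
  obtain ⟨p, hp, -, hst, -⟩ := exists_of_mem_sg h1
  exact h.fixed p (mem_content.1 hp).1 c hst

lemma KindedRest.kcount_X (h : KindedRest s i) : kcount s i .XR = 0 ∧ kcount s i .XN = 0 := by
  have key : ∀ k : Kind, k ≠ .O → ¬ k.Rest → kcount s i k = 0 := by
    intro k hk0 hk
    rw [kcount_eq hk0 (Finset.Subset.refl _), Finset.card_eq_zero, Finset.filter_eq_empty_iff]
    intro b _ hb
    obtain ⟨k', h1, h2⟩ := h b
    rw [h2, Kind.ms_eq_iff] at hb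
    exact hk (hb ▸ h1)
  exact ⟨key _ (by simp) (by simp [Kind.Rest]), key _ (by simp) (by simp [Kind.Rest])⟩

/-- The deficit in terms of bins with pairs of blue items and bins with a red item. -/
lemma PostInv.dev_eq_pairs (h : PostInv P C s) (hi : P.Act i) (m : Option Mark) :
    ∃ σ : ℝ, 0 ≤ σ ∧ σ ≤ C ∧ dev P s i m = P.redfrac i * (σ + 2 * kcount s i (Kind.pairKind m) +
      kcount s i (Kind.redKind m)) - kcount s i (Kind.redKind m) := by
  have hk := h.rest i hi
  rw [dev_eq_kind hi hk.kinded]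
  have e1 := h.kcount_prov (.inl rfl) i
  have e2 := h.kcount_prov (.inr rfl) i
  obtain ⟨e3, e4⟩ := hk.kcount_X
  have hs : ∀ k : Kind, k = .U1 ∨ k = .R1 ∨ k = .N1 → (kcount s i k : ℝ) ≤ C := fun k hk =>
    kcount_le_of_few (by rcases hk with rfl | rfl | rfl <;> simp) (h.few_single hi hk)
  rcases m with _ | _ | _ | _
  · exact ⟨kcount s i .U1, by positivity, hs _ (by simp), by
      simp [Kind.dev, Kind.pairKind, Kind.redKind, e1, e2, e3, e4]⟩
  · exact ⟨kcount s i .N1, by positivity, hs _ (by simp), by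
      simp [Kind.dev, Kind.pairKind, Kind.redKind, e4]⟩
  -- Blue `B`-items occur only in pairs, so the contribution of single items vanishes.
  · exact ⟨0, le_rfl, h.nonneg, by simp [Kind.dev, Kind.pairKind, Kind.redKind]⟩
  · exact ⟨kcount s i .R1, by positivity, hs _ (by simp), by
      simp [Kind.dev, Kind.pairKind, Kind.redKind, e3]⟩

/-- With few pairs and few single blue items, a bounded deficit forces few red items, as `1 - α ≥
2/3`. -/
lemma PostInv.red_le (h : PostInv P C s) (hi : P.Act i) {B : ℝ}
    (hB : P.redfrac i * kcount s i (Kind.pairKind m) ≤ B) :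
    (kcount s i (Kind.redKind m) : ℝ) ≤ 3 * C + 3 * B := by
  obtain ⟨σ, h1, h2, h3⟩ := h.dev_eq_pairs hi m
  have hd := h.dev_le i hi.pos hi.lt m
  rw [h3, abs_le] at hd
  have hα := hi.redfrac_pos
  have hα' := hi.redfrac_lt
  have h4 : P.redfrac i * σ ≤ C := by nlinarith
  have h5 : (0 : ℝ) ≤ kcount s i (Kind.redKind m) := by positivity
  have h6 : P.redfrac i * kcount s i (Kind.redKind m) ≤ 1 / 3 * kcount s i (Kind.redKind m) :=
    mul_le_mul_of_nonneg_right hα'.le h5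
  nlinarith

/-- Without red items the deficit counts the blue ones, so its bound limits the pairs. -/
lemma PostInv.pairs_le (h : PostInv P C s) (hi : P.Act i)
    (hr : kcount s i (Kind.redKind m) = 0) :
    P.redfrac i * kcount s i (Kind.pairKind m) ≤ C := by
  obtain ⟨σ, h1, h2, h3⟩ := h.dev_eq_pairs hi m
  have hd := h.dev_le i hi.pos hi.lt m
  rw [h3, hr, abs_le] at hd
  have hα := hi.redfrac_pos
  have h4 : 0 ≤ P.redfrac i * σ := by positivity
  have h5 : 0 ≤ P.redfrac i * kcount s i (Kind.pairKind m) := by positivity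
  push_cast at hd
  nlinarith

end

/-! ### What the final marking leaves behind -/

/-- Items of type `i` whose marks prevent the bin from being counted. -/
def Stray (i : ℕ) (c : Packing) : Prop :=
  (∃ p ∈ c, p.typ = i ∧ p.status ≠ .bonus ∧ p.mark = none) ∨
    (MixedC c ∧ ∃ p ∈ c, p.typ = i ∧ (p.mark = some .N ∨ (p.mark = some .B ∧ p.HasColor .red)))

/-- A mixed bin with an item of type `i` with mark `m` and colour `col`. -/
def ColorStray (i : ℕ) (m : Option Mark) (col : Color) (c : Packing) : Prop :=
  MixedC c ∧ ∃ p ∈ c, p.typ = i ∧ p.HasColor col ∧ p.mark = m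

/-- A bin with an unmarked item of type `i`. -/
def UnmarkedBin (i : ℕ) (c : Packing) : Prop :=
  ∃ p ∈ c, p.typ = i ∧ p.status ≠ .bonus ∧ p.mark = none

section

variable {P : Params} {s s' s'' : Packing} {i j : ℕ} {m l : Option Mark} {m' : Mark}
  {C D α : ℝ} {col : Color}

lemma Reassigned.content_traced (h : Reassigned P i m m' s s') {b : ℕ} {p' : Item}
    (hp' : p' ∈ content s' b) : ∃ p ∈ content s b, p.typ = p'.typ ∧ p.status = p'.status ∧
      (p.mark = p'.mark ∨ (p.typ = i ∧ p.mark = m ∧ p'.mark = some m')) := by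
  rw [mem_content] at hp'
  obtain ⟨p, hp, h1, h2, h3, h4⟩ := h.traced p' hp'.1
  exact ⟨p, mem_content.2 ⟨hp, h1.trans hp'.2⟩, h2, h3, h4⟩

lemma Reassigned.colorStray (h : Reassigned P i m m' s s') {b : ℕ}
    (hs : ColorStray i l col (content s' b)) : ColorStray i l col (content s b) ∨
      (l = some m' ∧ ColorStray i m col (content s b)) := by
  obtain ⟨h1, p', hp', h2, h3, h4⟩ := hs
  rw [← mixed_iff, h.colors.mixed, mixed_iff] at h1
  obtain ⟨p, hp, a1, a2, a3⟩ := h.content_traced hp'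
  have hc : p.HasColor col := by unfold Item.HasColor at h3 ⊢; rwa [a2]
  rcases a3 with a3 | ⟨-, a3, a4⟩
  · exact .inl ⟨h1, p, hp, a1.trans h2, hc, a3.trans h4⟩
  · exact .inr ⟨h4 ▸ a4, h1, p, hp, a1.trans h2, hc, a3⟩

lemma Reassigned.unmarkedBin (h : Reassigned P i m m' s s') {b : ℕ}
    (hs : UnmarkedBin i (content s' b)) : UnmarkedBin i (content s b) := by
  obtain ⟨p', hp', h2, h3, h4⟩ := hs
  obtain ⟨p, hp, a1, a2, a3⟩ := h.content_traced hp'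
  rcases a3 with a3 | ⟨-, a3, a4⟩
  · exact ⟨p, hp, a1.trans h2, a2 ▸ h3, a3.trans h4⟩
  · rw [h4] at a4; cases a4

lemma PostInv.sg_red (h : PostInv P C s) (hi : P.Act i) {b : ℕ} {p : Item}
    (hp : p ∈ content s b) (ht : p.typ = i) (hc : p.HasColor .red) (hm : p.mark = m) :
    sg i (content s b) = (Kind.redKind m).ms := by
  obtain ⟨k, -, hk⟩ := h.rest i hi b
  have h1 := mem_sg hp ht hc.not_bonus
  rw [hk, fixed_of_hasColor h.fixed (mem_content.1 hp).1 hc, hm] at h1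
  rw [hk, kind_of_red h1]

lemma redKind_ne_O (m : Option Mark) : Kind.redKind m ≠ .O := by
  rcases m with _ | _ | _ | _ <;> simp [Kind.redKind]

lemma pairKind_ne_O (m : Option Mark) : Kind.pairKind m ≠ .O := by
  rcases m with _ | _ | _ | _ <;> simp [Kind.pairKind]

/-- After a loop that needs red items in mixed bins few of these are left. -/
lemma few_red_of_stuck (hi : P.Act i) (h : PostInv P C s) {okRed : Packing → Item → Prop}
    (hst : ∀ u, ¬ P.reassign i m m' okRed (fun _ _ => True) s u)
    (hex : (∃ p ∈ s, p.typ = i ∧ p.HasColor .red ∧ p.mark = m ∧ Mixed s p.bin) →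
      ∃ p ∈ s, p.typ = i ∧ p.HasColor .red ∧ p.mark = m ∧ okRed s p) :
    Few (ColorStray i m .red) s (6 * C + 3) ∧
      ((∀ b, ¬ ColorStray i m .red (content s b)) ∨
        P.redfrac i * kcount s i (Kind.pairKind m) ≤ 1 + C) := by
  have hC := h.nonneg
  by_cases hq : ∃ p ∈ s, p.typ = i ∧ p.HasColor .red ∧ p.mark = m ∧ Mixed s p.bin
  · obtain ⟨q, h1, h2, h3, h4, h5⟩ := hex hq
    have h6 := stuck_pairs hi h hst h1 h2 h3 h4 h5
    simp only [and_true] at h6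
    rw [← kcount_eq (pairKind_ne_O m) (Finset.Subset.refl _)] at h6
    refine ⟨?_, .inr h6⟩
    have h7 := h.red_le hi h6
    refine (few_kind (redKind_ne_O m) (h7.trans (by linarith))).of_imp ?_
    rintro b ⟨-, p, hp, ht, hc, hpm⟩
    exact h.sg_red hi hp ht hc hpm
  · have h1 : ∀ b, ¬ ColorStray i m .red (content s b) := by
      rintro b ⟨hx, p, hp, ht, hc, hpm⟩
      obtain ⟨hps, rfl⟩ := mem_content.1 hp
      exact hq ⟨p, hps, ht, hc, hpm, mixed_iff.2 hx⟩
    exact ⟨Few.of_forall_not h1 (by linarith), .inl h1⟩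

lemma kcount_redKind_eq_zero
    (hn : ∀ p ∈ s, p.typ = i → p.HasColor .red → p.mark ≠ m) :
    kcount s i (Kind.redKind m) = 0 := by
  rw [kcount_eq (redKind_ne_O m) (Finset.Subset.refl _), Finset.card_eq_zero,
    Finset.filter_eq_empty_iff]
  intro b _ hb
  obtain ⟨p, hp, ht, hst, hm, -⟩ := exists_of_mem_sg (i := i) (c := content s b)
    (st := .fixed .red) (m := m) (by rw [hb, redKind_ms]; simp)
  exact hn p (mem_content.1 hp).1 ht (.inr hst) hm

/-- After the loop for unmarked items few of these are left. -/
lemma few_unmarked_of_stuck (hi : P.Act i) (h : PostInv P C s)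
    (hst : ∀ u, ¬ P.reassign i none m' (fun u q => Mixed u q.bin) (fun _ _ => True) s u) :
    Few (UnmarkedBin i) s (C + (1 + C) / P.redfrac i + (6 * C + 3)) := by
  have hα := hi.redfrac_pos
  have hC := h.nonneg
  obtain ⟨h1, h2⟩ := few_red_of_stuck hi h hst (fun h => h)
  have hU2 : P.redfrac i * kcount s i (Kind.pairKind none) ≤ 1 + C := by
    rcases h2 with h2 | h2
    -- Unmarked coloured items are always in mixed bins. So if no mixed bin has an unmarked red
    -- item, there is none at all.
    · refine (h.pairs_le hi (kcount_redKind_eq_zero ?_)).trans (by linarith)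
      intro p hp ht hc hm
      refine h2 p.bin ⟨.inl ?_, p, mem_content_self hp, ht, hc, hm⟩
      exact mixed_of_unmarked hi h.good (h.rest i hi) hp ht hm (fixed_of_hasColor h.fixed hp hc)
    · exact h2
  have hU2' : (kcount s i .U2 : ℝ) ≤ (1 + C) / P.redfrac i := by
    rw [le_div_iff₀ hα, mul_comm]; exact hU2
  refine (((h.few_single hi (k := .U1) (.inl rfl)).or (few_kind (by simp) hU2')).or h1).of_imp ?_
  rintro b ⟨p, hp, ht, hnb, hm⟩
  rcases Item.not_bonus_iff.1 hnb with hc | hc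
  · left
    obtain ⟨k, hkr, hk⟩ := h.rest i hi b
    have h3 := mem_sg hp ht hnb
    rw [hk, fixed_of_hasColor h.fixed (mem_content.1 hp).1 hc, hm] at h3
    simp only [hk, Kind.ms_eq_iff]
    cases k <;> simp_all [Kind.ms, Kind.Rest]
  · right
    refine ⟨.inl ?_, p, hp, ht, hc, hm⟩
    obtain ⟨hps, rfl⟩ := mem_content.1 hp
    exact mixed_of_unmarked hi h.good (h.rest i hi) hps ht hm (fixed_of_hasColor h.fixed hps hc)

/-- After the last loop few mixed bins with blue items with mark `N` are left. -/
lemma few_blue_of_stuck (hi : P.Act i) (h : PostInv P C s)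
    (hst : ∀ u, ¬ P.reassign i (some .N) .B (fun u q => ∀ p ∈ u, p.typ = i → p.HasColor .red →
      p.mark = some .N → p.size ≤ q.size) Mixed s u) :
    Few (ColorStray i (some .N) .blue) s (C + (1 + C) / P.redfrac i) := by
  have hα := hi.redfrac_pos
  have hC := h.nonneg
  have h2 : Few (fun c => MixedC c ∧ sg i c = Kind.N2.ms) s ((1 + C) / P.redfrac i) := by
    by_cases hq : ∃ p ∈ s, p.typ = i ∧ p.HasColor .red ∧ p.mark = some .N
    · obtain ⟨q, hq, hmax⟩ := Multiset.exists_max_image Item.size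
        (s := s.filter (fun p => p.typ = i ∧ p.HasColor .red ∧ p.mark = some .N)) (by
          obtain ⟨p, hp, h1⟩ := hq
          exact fun h0 => Multiset.notMem_zero p (h0 ▸ Multiset.mem_filter.2 ⟨hp, h1⟩))
      rw [Multiset.mem_filter] at hq
      have h3 := stuck_pairs hi h hst hq.1 hq.2.1 hq.2.2.1 hq.2.2.2
        (fun p hp h1 h2 h3 => hmax p (Multiset.mem_filter.2 ⟨hp, h1, h2, h3⟩))
      refine ⟨_, (le_div_iff₀ hα).2 (by rw [mul_comm]; exact h3), fun b hb => ?_⟩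
      rw [Finset.mem_filter]
      refine ⟨?_, hb.2, mixed_iff.2 hb.1⟩
      rw [← content_ne_zero]
      intro h0
      have := hb.2
      rw [h0, sg_zero] at this
      simp [Kind.ms] at this
    · have h3 := h.pairs_le hi (m := some .N) (kcount_redKind_eq_zero
        fun p hp h1 h2 h3 => hq ⟨p, hp, h1, h2, h3⟩)
      refine (few_kind (i := i) (k := .N2) (C := (1 + C) / P.redfrac i) (by simp) ?_).of_imp
        fun b hb => hb.2
      rw [le_div_iff₀ hα, mul_comm]
      exact h3.trans (by linarith)
  refine ((h.few_single hi (k := .N1) (.inr (.inr rfl))).or h2).of_imp ?_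
  rintro b ⟨hx, p, hp, ht, hc, hm⟩
  obtain ⟨k, hkr, hk⟩ := h.rest i hi b
  have h3 := mem_sg hp ht hc.not_bonus
  rw [hk, fixed_of_hasColor h.fixed (mem_content.1 hp).1 hc, hm] at h3
  simp only [hk, Kind.ms_eq_iff, hx, true_and]
  cases k <;> simp_all [Kind.ms, Kind.Rest]

/-- The effect of the final marking for an active type. -/
lemma finalMark_effect (hi : P.Act i) (hC : 1 ≤ C) (h : PostInv P C s)
    (hs : P.finalMark i s s') : SameColors s s' ∧ SameOff i s s' ∧
      PostInv P (400 * C + 10 + (2 + 200 * C) / P.redfrac i) s' ∧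
      Few (Stray i) s' (400 * C + 10 + (2 + 200 * C) / P.redfrac i) := by
  have hα := hi.redfrac_pos
  unfold Params.finalMark at hs
  rw [if_pos hi.active] at hs
  obtain ⟨s₁, s₂, s₃, ⟨l1, e1⟩, ⟨l2, e2⟩, ⟨l3, e3⟩, ⟨l4, e4⟩⟩ := hs
  obtain ⟨r1, i1⟩ := reassign_loop hi (by simp) h hC (fun _ s q hq => hq.1) l1
  obtain ⟨r2, i2⟩ := reassign_loop hi (by simp) i1 (by linarith) (fun _ s q hq => hq) l2
  obtain ⟨r3, i3⟩ := reassign_loop hi (by simp) i2 (by linarith) (fun _ s q hq => hq) l3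
  obtain ⟨r4, i4⟩ := reassign_loop hi (by simp) i3 (by linarith) (fun h => by cases h) l4
  have f1 := (few_red_of_stuck hi i1 e1 (by
    rintro ⟨p, hp, h1⟩
    obtain ⟨q, hq, hmax⟩ := Multiset.exists_max_image Item.size (s := s₁.filter
      (fun p => p.typ = i ∧ p.HasColor .red ∧ p.mark = some .N ∧ Mixed s₁ p.bin))
      (fun h0 => Multiset.notMem_zero p (h0 ▸ Multiset.mem_filter.2 ⟨hp, h1⟩))
    rw [Multiset.mem_filter] at hq
    exact ⟨q, hq.1, hq.2.1, hq.2.2.1, hq.2.2.2.1, hq.2.2.2.2, fun p hp h1 h2 h3 h4 =>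
      hmax p (Multiset.mem_filter.2 ⟨hp, h1, h2, h3, h4⟩)⟩)).1
  have f2 := (few_red_of_stuck hi i2 e2 (fun h => h)).1
  have f3 := few_unmarked_of_stuck hi i3 e3
  have f4 := few_blue_of_stuck hi i4 e4
  -- Each of the four loops multiplies the bound by 3. The two quotients come from the pairs left by
  -- the third and by the fourth loop; the constants in the statement are generous.
  have hdiv : (1 + 3 * (3 * (3 * C))) / P.redfrac i +
      (1 + 3 * (3 * (3 * (3 * C)))) / P.redfrac i ≤ (2 + 200 * C) / P.redfrac i := by
    rw [← add_div]
    exact div_le_div_of_nonneg_right (by linarith) hα.le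
  have hpos : 0 ≤ (2 + 200 * C) / P.redfrac i := by positivity
  refine ⟨Eq.trans (Eq.trans (Eq.trans r1.colors r2.colors) r3.colors) r4.colors,
    ((r1.off.trans r2.off).trans r3.off).trans r4.off, ?_, ?_⟩
  · refine { i4 with
      dev_le := fun j h1 hj m => (i4.dev_le j h1 hj m).trans (by linarith)
      low := fun j h1 hj col => (i4.low j h1 hj col).mono (by linarith)
      last := i4.last.mono (by linarith) }
  · -- red items with mark `N` or `B` in mixed bins
    have g1 : Few (ColorStray i (some .N) .red) s₃ _ := f1.of_imp fun b hb => by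
      have h3 := (r3.colorStray hb).resolve_right (by simp)
      exact (r2.colorStray h3).resolve_right (by simp)
    have g2 : Few (ColorStray i (some .B) .red) s₃ _ := f2.of_imp fun b hb =>
      (r3.colorStray hb).resolve_right (by simp)
    refine Few.mono (((g1.or g2).or f3).of_imp (s' := s')
      (Q' := fun c => UnmarkedBin i c ∨ ColorStray i (some .N) .red c ∨
        ColorStray i (some .B) .red c) ?_ |>.or f4 |>.of_imp ?_) ?_
    rotate_left
    · rintro b (hb | ⟨hx, p, hp, ht, hb⟩)
      · exact .inl (.inl hb)
      · have hnb : p.status ≠ .bonus := by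
          intro hc
          have := ((i4.good b).bonus p hp hc).2.1
          rw [this] at hb; rcases hb with hb | hb
          · cases hb
          · cases hb.1
        rcases hb with hb | ⟨hb, hc⟩
        · rcases Item.not_bonus_iff.1 hnb with hc | hc
          · exact .inr ⟨hx, p, hp, ht, hc, hb⟩
          · exact .inl (.inr (.inl ⟨hx, p, hp, ht, hc, hb⟩))
        · exact .inl (.inr (.inr ⟨hx, p, hp, ht, hc, hb⟩))
    · linarith
    · rintro b (hb | hb | hb)
      · exact .inr (r4.unmarkedBin hb)
      · exact .inl (.inl ((r4.colorStray hb).resolve_right (by simp)))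
      -- The last loop turns `N` into `B`. A red `B`-item in a mixed bin was therefore a red `B`- or
      -- `N`-item in a mixed bin before, and both were few.
      · rcases r4.colorStray hb with h5 | ⟨-, h5⟩
        · exact .inl (.inr h5)
        · exact .inl (.inl h5)

lemma stray_of_sameOff (hc : SameColors s s') (ho : SameOff i s s') (hj : j ≠ i) {b : ℕ}
    (h : Stray j (content s' b)) : Stray j (content s b) := by
  have key : ∀ p ∈ content s' b, p.typ = j → p ∈ content s b := by
    intro p hp ht
    rw [mem_content] at hp ⊢
    have h1 : p ∈ s'.filter (fun p => p.typ = j) := Multiset.mem_filter.2 ⟨hp.1, ht⟩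
    rw [ho j hj] at h1
    exact ⟨(Multiset.mem_filter.1 h1).1, hp.2⟩
  rcases h with ⟨p, hp, h1, h2⟩ | ⟨h1, p, hp, h2, h3⟩
  · exact .inl ⟨p, key p hp h1, h1, h2⟩
  · rw [← mixed_iff, hc.mixed, mixed_iff] at h1
    exact .inr ⟨h1, p, key p hp h2, h2, h3⟩

/-- The effect of the final marking. -/
lemma forTypes_finalMark (P : Params) (C : ℝ) (n : ℕ) (hn : n ≤ P.N) : ∃ D : ℝ, 1 ≤ D ∧
    ∀ s s', PostInv P C s → ForTypes P.finalMark n s s' →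
      PostInv P D s' ∧ SameColors s s' ∧ ∀ i, i ≤ n → P.Act i → Few (Stray i) s' D := by
  induction n with
  | zero =>
    refine ⟨max C 1, le_max_right _ _, fun s s' h hs => ?_⟩
    cases hs
    refine ⟨h.mono (le_max_left _ _), rfl, fun i hi hact => ?_⟩
    have := hact.pos; omega
  | succ n ih =>
    obtain ⟨D, hD, ih⟩ := ih (by omega)
    by_cases hi : P.Act (n + 1)
    · have hα := hi.redfrac_pos
      have hpos : 0 ≤ (2 + 200 * D) / P.redfrac (n + 1) := by positivity
      refine ⟨400 * D + 10 + (2 + 200 * D) / P.redfrac (n + 1), by linarith, ?_⟩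
      rintro s s' h ⟨u, h1, h2⟩
      obtain ⟨a1, a2, a3⟩ := ih s u h h1
      obtain ⟨b1, b2, b3, b4⟩ := finalMark_effect hi hD a1 h2
      refine ⟨b3, Eq.trans a2 b1, fun i hin hact => ?_⟩
      by_cases hin' : i = n + 1
      · exact hin' ▸ b4
      · exact ((a3 i (by omega) hact).of_imp fun b => stray_of_sameOff b1 b2 hin').mono
          (by linarith)
    · refine ⟨D, hD, ?_⟩
      rintro s s' h ⟨u, h1, h2⟩
      obtain ⟨a1, a2, a3⟩ := ih s u h h1
      unfold Params.finalMark at h2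
      rw [if_neg fun h => hi ⟨by omega, hn, h⟩] at h2
      subst h2
      refine ⟨a1, a2, fun i hin hact => a3 i ?_ hact⟩
      by_contra hc
      exact hi ((by omega : n + 1 = i) ▸ hact)

end

section

variable {P : Params} {s s' : Packing} {i : ℕ} {m : Mark} {C : ℝ}

/-! ### Restoring the fractions of red items -/

lemma dev_of_sg (hi : P.Act i) (m : Option Mark) (c : Packing) : dev P c i m =
    P.redfrac i * ((sg i c).filter (fun q => q.2 = m)).card -
      ((sg i c).filter (fun q => q.2 = m ∧ (q.1 = .prov .red ∨ q.1 = .fixed .red))).card := by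
  rw [dev_eq_card hi]
  unfold sg
  rw [Multiset.filter_map, Multiset.card_map, Multiset.filter_filter, Multiset.filter_map,
    Multiset.card_map, Multiset.filter_filter]
  congr 3
  · congr 1
    apply Multiset.filter_congr
    intro p _; simp only [Function.comp]; tauto
  · apply Multiset.filter_congr
    intro p _
    simp only [Function.comp]
    exact ⟨fun h => ⟨⟨h.2.1, h.2.2⟩, h.1, h.2.2.not_bonus⟩, fun h => ⟨h.2.1, h.1.1, h.1.2⟩⟩

lemma dev_content_add (s : Packing) (b j : ℕ) (m : Option Mark) :
    dev P (content s b) j m + dev P (s.filter (fun p => p.bin ≠ b)) j m = dev P s j m := by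
  unfold dev content
  rw [← Multiset.sum_add, ← Multiset.map_add, Multiset.filter_add_not]

lemma dev_mark (hi : P.Act i) (hg : GoodBins P s) (hk : KindedRest s i) (m : Mark) :
    dev P s i (some m) = P.redfrac i * nTotMark s i m - nRedMark s i m := by
  rw [dev_eq_kind hi hk.kinded, Kind.dev_some, nTotMark_eq hg hk.kinded, nRedMark_eq hk.kinded]

/-- A blue bin is removed only if the deficit is at least 1, which lowers it by `α` or `2 α`; a red
one only if it is negative, which raises it by `1 - α`. Since `α < 1/3`, the distance to 1/2 falls
by at least `α` even if 1/2 is passed, so the loop removes boundedly many bins. -/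
lemma restoreStep_effect (hi : P.Act i) (hg : GoodBins P s) (hk : KindedRest s i)
    (hf : ∀ p ∈ s, ∀ c, p.status ≠ .prov c) (h : P.restoreStep i m s s') : Cut 1 s s' ∧
      |dev P s' i (some m) - 1 / 2| + P.redfrac i ≤ |dev P s i (some m) - 1 / 2| := by
  obtain ⟨p, hp, ht, hm, hcol, rfl⟩ := h
  have hα := hi.redfrac_pos
  have hα' := hi.redfrac_lt
  refine ⟨⟨{p.bin}, by simp, Multiset.filter_congr fun q _ => by simp⟩, ?_⟩
  have hsplit := dev_content_add (P := P) s p.bin i (some m)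
  have hd := dev_mark hi hg hk m
  obtain ⟨k, hkr, hkb⟩ := hk p.bin
  have hdb := dev_of_sg hi (some m) (content s p.bin)
  have hpc := mem_content_self hp
  rcases hcol with ⟨hlt, hc⟩ | ⟨hlt, hc⟩
  · have hmem := mem_sg hpc ht hc.not_bonus
    rw [hkb, fixed_of_hasColor hf hp hc, hm] at hmem
    have h1 : dev P (content s p.bin) i (some m) = P.redfrac i ∨
        dev P (content s p.bin) i (some m) = 2 * P.redfrac i := by
      rw [hdb, hkb]
      cases m <;> cases k <;>
        simp_all [Kind.ms, Kind.Rest, Multiset.filter_singleton] <;>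
        (right; ring1)
    have h2 : 1 ≤ dev P s i (some m) := by
      have h3 := (Nat.le_floor_iff (by positivity)).1 (Nat.succ_le_of_lt hlt)
      push_cast at h3
      linarith
    have h4 : |dev P s i (some m) - 1 / 2| = dev P s i (some m) - 1 / 2 :=
      abs_of_nonneg (by linarith)
    rw [h4]
    rcases h1 with h1 | h1 <;>
      · rcases abs_cases (dev P (s.filter fun q => q.bin ≠ p.bin) i (some m) - 1 / 2) with
          ⟨h5, -⟩ | ⟨h5, -⟩ <;> rw [h5] <;> linarith
  · have hmem := mem_sg hpc ht hc.not_bonus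
    rw [hkb, fixed_of_hasColor hf hp hc, hm] at hmem
    have h1 : dev P (content s p.bin) i (some m) = P.redfrac i - 1 := by
      rw [hdb, hkb, kind_of_red hmem, redKind_ms]
      simp [Multiset.filter_singleton]
    have h2 : dev P s i (some m) < 0 := by
      have h3 := (Nat.floor_lt (by positivity)).1 hlt
      linarith
    have h4 : |dev P s i (some m) - 1 / 2| = -(dev P s i (some m) - 1 / 2) :=
      abs_of_nonpos (by linarith)
    rw [h4]
    rcases abs_cases (dev P (s.filter fun q => q.bin ≠ p.bin) i (some m) - 1 / 2) with
      ⟨h5, -⟩ | ⟨h5, -⟩ <;> rw [h5] <;> linarith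

lemma restoreStep_loop (hi : P.Act i) (hg : GoodBins P s) (hk : KindedRest s i)
    (hf : ∀ p ∈ s, ∀ c, p.status ≠ .prov c) (h : Relation.ReflTransGen (P.restoreStep i m) s s') :
    ∃ n, Cut n s s' ∧
      |dev P s' i (some m) - 1 / 2| + P.redfrac i * n ≤ |dev P s i (some m) - 1 / 2| := by
  induction h with
  | refl => exact ⟨0, Cut.refl s, by simp⟩
  | tail _ h2 ih =>
    obtain ⟨n, h3, h4⟩ := ih
    obtain ⟨h5, h6⟩ := restoreStep_effect hi (h3.goodBins hg) (h3.kindedRest hk)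
      (fun p hp => hf p (h3.mem hp).1) h2
    exact ⟨n + 1, h3.trans h5, by push_cast; linarith⟩

lemma restoreStep_cut (hi : P.Act i) (h : PostInv P C s)
    (hs : Relation.ReflTransGen (P.restoreStep i m) s s') :
    ∃ n, Cut n s s' ∧ n ≤ ⌊(C + 1) / P.redfrac i⌋₊ := by
  obtain ⟨n, h1, h2⟩ := restoreStep_loop hi h.good (h.rest i hi) h.fixed hs
  refine ⟨n, h1, Nat.le_floor ?_⟩
  rw [le_div_iff₀ hi.redfrac_pos, mul_comm]
  have h3 := h.dev_le i hi.pos hi.lt (some m)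
  have h4 := abs_nonneg (dev P s' i (some m) - 1 / 2)
  have h5 : |dev P s i (some m) - 1 / 2| ≤ |dev P s i (some m)| + |1 / 2| := abs_sub _ _
  rw [abs_of_pos (by norm_num : (0 : ℝ) < 1 / 2)] at h5
  linarith

lemma Cut.le {n k : ℕ} (h : Cut n s s') (hn : n ≤ k) : Cut k s s' :=
  let ⟨F, h1, h2⟩ := h; ⟨F, h1.trans hn, h2⟩

/-- A bounded number of bins is removed to restore the fractions for one type. -/
lemma restore_cut (P : Params) (C : ℝ) (i : ℕ) (hi : i ≤ P.N) (h1 : 1 ≤ i) : ∃ k : ℕ,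
    ∀ s s', PostInv P C s → P.restore i s s' → Cut k s s' := by
  by_cases hact : P.Act i
  · have step : ∀ D : ℝ, ∃ k : ℕ, ∀ m s s', PostInv P D s →
        WhileStep (P.restoreStep i m) s s' → Cut k s s' := fun D =>
      ⟨_, fun m s s' h hs => by
        obtain ⟨n, h1, h2⟩ := restoreStep_cut hact h hs.1
        exact h1.le h2⟩
    obtain ⟨k₁, a1⟩ := step C
    obtain ⟨k₂, a2⟩ := step (C + binMax P * k₁)
    obtain ⟨k₃, a3⟩ := step (C + binMax P * k₁ + binMax P * k₂)
    refine ⟨k₁ + k₂ + k₃, fun s s' h hs => ?_⟩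
    unfold Params.restore at hs
    rw [if_pos hact.active] at hs
    obtain ⟨s₁, s₂, b1, b2, b3⟩ := hs
    have c1 := a1 _ _ _ h b1
    have c2 := a2 _ _ _ (h.cut c1) b2
    exact (c1.trans c2).trans (a3 _ _ _ ((h.cut c1).cut c2) b3)
  · refine ⟨0, fun s s' _ hs => ?_⟩
    unfold Params.restore at hs
    rw [if_neg fun h => hact ⟨h1, hi, h⟩] at hs
    exact hs ▸ Cut.refl s

lemma forTypes_restore (P : Params) (C : ℝ) (n : ℕ) (hn : n ≤ P.N) : ∃ k : ℕ,
    ∀ s s', PostInv P C s → ForTypes P.restore n s s' → Cut k s s' := by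
  induction n with
  | zero => exact ⟨0, fun s s' _ hs => by cases hs; exact Cut.refl _⟩
  | succ n ih =>
    obtain ⟨k, ih⟩ := ih (by omega)
    obtain ⟨k', h'⟩ := restore_cut P (C + binMax P * k) (n + 1) hn (by omega)
    refine ⟨k + k', ?_⟩
    rintro s s' h ⟨u, h1, h2⟩
    have c1 := ih _ _ h h1
    exact c1.trans (h' _ _ (h.cut c1) h2)

/-! ### Removing wrongly mixed bins -/

/-- The effect of post-processing up to the restoration of the fractions of red items. -/
lemma exists_restored (P : Params) : ∃ (C : ℝ) (n : ℕ), ∀ T s s₁ s₂, RunInv P T s →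
    ForTypes P.finalMark P.N (s.filter (fun p => ¬ P.BadBin s p.bin)) s₁ →
    ForTypes P.restore P.N (s₁.filter (fun p => ¬ Params.WronglyMixed s₁ p.bin)) s₂ →
    PostInv P C s₂ ∧ (∀ i, P.Act i → Few (UnmarkedBin i) s₂ C) ∧ (numBins s : ℝ) ≤ numBins s₂ + n := by
  obtain ⟨C₀, n₀, h0⟩ := exists_postInv P
  obtain ⟨C₁, hC1, h1⟩ := forTypes_finalMark P C₀ P.N le_rfl
  set k := ⌊∑ _i ∈ Finset.range (P.N + 1), C₁⌋₊
  obtain ⟨n₂, h2⟩ := forTypes_restore P (C₁ + binMax P * k) P.N le_rfl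
  refine ⟨C₁ + binMax P * k + binMax P * n₂, n₀ + (k + n₂), fun T s s₁ s₂ hrun hm hr => ?_⟩
  obtain ⟨a1, a2⟩ := h0 T s hrun
  obtain ⟨b1, b2, b3⟩ := h1 _ _ a2 hm
  have hfew : Few (fun c => ∃ i ∈ Finset.range (P.N + 1), P.Act i ∧ Stray i c) s₁
      (∑ _i ∈ Finset.range (P.N + 1), C₁) := by
    refine Few.iUnion fun i hi => ?_
    by_cases hact : P.Act i
    · exact (b3 i (by simpa [Nat.lt_succ_iff] using hi) hact).of_imp fun b hb => hb.2
    · exact Few.of_forall_not (fun b hb => hact hb.1) (by linarith)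
  have hcut : Cut k s₁ (s₁.filter (fun p => ¬ Params.WronglyMixed s₁ p.bin)) := by
    refine hfew.cut (fun p _ q _ hpq hn => by rwa [hpq] at hn) fun p hp hw => ?_
    rw [not_not] at hw
    obtain ⟨hx, q, hq, hqb, hqm⟩ := hw
    have hqc : q ∈ content s₁ p.bin := mem_content.2 ⟨hq, hqb⟩
    have hact := (b1.good p.bin).mark q hqc (by
      intro h; rw [h] at hqm; rcases hqm with h | h
      · cases h
      · cases h.1)
    exact ⟨q.typ, by simpa [Nat.lt_succ_iff] using hact.le, hact,
      .inr ⟨mixed_iff.1 hx, q, hqc, rfl, hqm⟩⟩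
  have c1 := h2 _ _ (b1.cut hcut) hr
  have hall := hcut.trans c1
  refine ⟨(b1.cut hcut).cut c1, fun i hact => ?_, ?_⟩
  · have h3 : Few (UnmarkedBin i) s₁ C₁ := (b3 i hact.le hact).of_imp fun b hb => .inl hb
    refine (hall.few ?_ h3).mono ?_
    · rintro ⟨p, hp, _⟩; simp at hp
    · have e1 : (0 : ℝ) ≤ binMax P * k := by positivity
      have e2 : (0 : ℝ) ≤ binMax P * n₂ := by positivity
      linarith
  · have e1 := a1.numBins
    have e2 := hall.numBins
    have e3 : numBins s₁ = numBins (s.filter (fun p => ¬ P.BadBin s p.bin)) := by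
      rw [numBins_eq, numBins_eq, b2.bins]
    rw [e3] at e2
    push_cast at e2 ⊢
    linarith

end

/-! ### Turning bonus items into coloured items -/

/-- A bin without bonus items, with the mark `R` on all items of active types. -/
def Fresh (P : Params) (c : Packing) : Prop :=
  ∀ p ∈ c, p.status ≠ .bonus ∧ (p.mark = some .R ∨ (p.mark = none ∧ ¬ P.Act p.typ))

/-- A bin with a bonus item of type `i`. -/
def BonusBin (i : ℕ) (c : Packing) : Prop := ∃ p ∈ c, p.typ = i ∧ p.status = .bonus

/-- The effect of turning bonus items into coloured items. -/
structure Shrunk (P : Params) (s s' : Packing) : Prop where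
  fresh : ∀ b, content s' b = content s b ∨ Fresh P (content s' b)
  numBins : numBins s' = numBins s

section

variable {P : Params} {s s' s'' : Packing} {i j : ℕ} {C : ℝ}

lemma Shrunk.refl (s : Packing) : Shrunk P s s := ⟨fun _ => .inl rfl, rfl⟩

lemma Shrunk.trans (h : Shrunk P s s') (h' : Shrunk P s' s'') : Shrunk P s s'' := by
  refine ⟨fun b => ?_, h'.numBins.trans h.numBins⟩
  rcases h'.fresh b with h1 | h1
  · rcases h.fresh b with h2 | h2
    · exact .inl (h1.trans h2)
    · exact .inr (h1 ▸ h2)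
  · exact .inr h1

lemma Shrunk.few (h : Shrunk P s s') {Q : Packing → Prop} (hQ : ∀ c, Fresh P c → ¬ Q c)
    (hs : Few Q s C) : Few Q s' C :=
  hs.of_imp fun b hb => by
    rcases h.fresh b with h1 | h1
    · rwa [h1] at hb
    · exact absurd hb (hQ _ h1)

lemma Fresh.not_bonusBin {c : Packing} (h : Fresh P c) : ¬ BonusBin i c :=
  fun ⟨p, hp, _, hb⟩ => (h p hp).1 hb

lemma Fresh.not_unmarkedBin (hi : P.Act i) {c : Packing} (h : Fresh P c) : ¬ UnmarkedBin i c := by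
  rintro ⟨p, hp, rfl, _, hm⟩
  rcases (h p hp).2 with h1 | h1
  · rw [hm] at h1; cases h1
  · exact h1.2 hi

lemma typeOf_eq_spec {x : ℝ} (h1 : 1 ≤ i) (h : P.typeOf x = i) : x ≤ P.t i :=
  (Nat.findGreatest_of_ne_zero h (by omega)).2

/-- The items of a bin of which the bonus item and the large item are changed. -/
lemma bonus_bin (hg : GoodBins P s) {b : ℕ} {p : Item} (hp : p ∈ s) (hb : p.bin = b)
    (hbon : p.status = .bonus) : P.Act p.typ ∧ p.typ = P.typeOf p.size ∧ p.mark = none ∧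
      ∃ y, content s b = {p, y} ∧ y.status = .fixed .blue ∧ IsLarge y.size ∧ y.bin = b ∧
        y.typ = P.typeOf y.size ∧ 1 / 2 < P.t y.typ ∧ ¬ P.Act y.typ ∧ y.typ ≠ P.N ∧
        y.mark = none := by
  subst hb
  have hpc := mem_content_self hp
  obtain ⟨h1, h2, y, h3, h4, h5⟩ := (hg p.bin).bonus p hpc hbon
  have hy : y ∈ content s p.bin := by rw [h3]; simp
  exact ⟨h1, (hg p.bin).typ_eq_of_act hpc h1, h2, y, h3, h4, h5, (mem_content.1 hy).2,
    (hg p.bin).bonus_y hy h4 h5⟩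

/-- A bin with two blue items of type `i` with mark `R`. -/
lemma goodBin_pair (hi : P.Act i) {p y : Item} (hp : 0 < p.size ∧ p.size ≤ 1) (hpt : p.typ = i)
    (hpt' : P.typeOf p.size = i) (hps : p.status = .fixed .blue) (hpm : p.mark = some .R)
    (hy : 0 < y.size ∧ y.size ≤ 1) (hyt : y.typ = i) (hyt' : P.typeOf y.size = i)
    (hys : y.status = .fixed .blue) (hym : y.mark = some .R) : P.GoodBin {p, y} := by
  have h1 : P.GoodBin {y} := .single hy (hyt.trans hyt'.symm) (hyt ▸ hi)
    (.inr ⟨.blue, .R, hys, hym, by simp⟩)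
  have h2 := h1.add_open hp (col := .blue) (by simp) (q := y) (by simp) (by rw [hyt, hpt']) hys
    (.inr (by rw [Params.colSum_singleton, if_pos (.inr hys), hpt', hi.fit,
      Params.mult_of_act (hyt ▸ hi)]; omega)) p.bin
  refine h2.remark_cons (p' := p) ⟨rfl, by rw [hpt, hpt'], hps, rfl, .inr ⟨by simp [hpm], ?_,
    ⟨_, rfl⟩, ?_⟩⟩
  · rw [hpt']; exact hi
  · intro h; rw [Item.hasColor_fixed rfl] at h; cases h

/-- The effect on the bins of one step that turns bonus items into coloured items. -/
lemma shrinkStep_bins (hi : P.Act i) (hg : GoodBins P s) {T : Finset ℕ} {b₀ : ℕ} {f : ℕ → ℝ}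
    (hT : ∀ b ∈ T, ∃ p ∈ s, p.bin = b ∧ p.typ = i ∧ p.status = .bonus)
    (hf : ∀ b ∈ T, 0 < f b ∧ P.typeOf (f b) = i)
    {g : Item → Item} (hgdef : g = fun p => if p.bin ∈ T then
        if p.status = .bonus then
          { p with status := .fixed (if p.bin = b₀ then .red else .blue), mark := some .R }
        else if IsLarge p.size ∧ p.bin ≠ b₀ then
          { p with size := f p.bin, typ := i, mark := some .R }
        else p
      else p) : (∀ b, content (s.map g) b = (content s b).map g) ∧
      (∀ p, p.bin ∉ T → g p = p) ∧
      ∀ b ∈ T, sg i (content s b) = 0 ∧ (∀ j, P.Act j → sg j (content s b) = 0) ∧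
        P.GoodBin (content (s.map g) b) ∧ Fresh P (content (s.map g) b) ∧
        (∀ p ∈ content (s.map g) b, p.typ ≠ P.N ∧ (∀ c, p.status ≠ .prov c) ∧
          (p.typ = i ∨ ¬ P.Act p.typ)) ∧
        (∀ j col, ¬ LowBin P j col (content (s.map g) b)) ∧
        (∀ p ∈ content s b, ∀ j, 1 ≤ j → j < P.N → j ≠ i → ∀ m, dv P j m (g p) = dv P j m p) ∧
        ((b ≠ b₀ ∧ sg i (content (s.map g) b) = Kind.R2.ms ∧
          ∀ p ∈ content (s.map g) b, p.typ = i ∧ p.HasColor .blue) ∨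
        (b = b₀ ∧ sg i (content (s.map g) b) = Kind.RR.ms ∧ MixedC (content (s.map g) b))) := by
  have hbin : ∀ p, (g p).bin = p.bin := by
    intro p; rw [hgdef]; dsimp only; split_ifs <;> rfl
  refine ⟨content_map hbin s, fun p hp => by rw [hgdef]; exact if_neg hp, fun b hb => ?_⟩
  obtain ⟨p, hps, rfl, hpi, hpb⟩ := hT b hb
  obtain ⟨hpa, hpt, hpm, y, hc, hy1, hy2, hy3, hy4, hy5, hy6, hy7, hy8⟩ := bonus_bin hg hps rfl hpb
  have hgb := hg p.bin
  have hp0 := hgb.item p (mem_content_self hps)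
  have hy0 := hgb.item y (by rw [hc]; simp)
  have hyi : y.typ ≠ i := fun h => hy6 (h ▸ hi)
  have hyb : y.status ≠ .bonus := by rw [hy1]; simp
  have hiN := hi.ne_last
  have hcont : content (s.map g) p.bin = {g p, g y} := by rw [content_map hbin, hc]; simp
  have hgp : g p = { p with
      status := .fixed (if p.bin = b₀ then .red else .blue), mark := some .R } := by
    rw [hgdef]; dsimp only; rw [if_pos hb, if_pos hpb]
  have hsg : ∀ j, P.Act j → sg j (content s p.bin) = 0 := fun j hj => by
    rw [hc]
    refine sg_eq_zero fun q hq => ?_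
    rw [Multiset.insert_eq_cons, Multiset.mem_cons, Multiset.mem_singleton] at hq
    rcases hq with rfl | rfl
    · exact .inr hpb
    · exact .inl fun h => hy6 (h ▸ hj)
  refine ⟨hsg i hi, hsg, ?_⟩
  by_cases hb0 : p.bin = b₀
  · have hgy : g y = y := by
      rw [hgdef]; dsimp only
      rw [if_pos (by rw [hy3]; exact hb), if_neg hyb, if_neg fun h => h.2 (hy3.trans hb0)]
    rw [if_pos hb0] at hgp
    have hps' : (g p).status = .fixed .red := by rw [hgp]
    have hpm' : (g p).mark = some .R := by rw [hgp]
    have hpt' : (g p).typ = i := by rw [hgp]; exact hpi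
    rw [hgy] at hcont
    have hgood : P.GoodBin {g p, y} := by
      rw [hc] at hgb
      refine Params.GoodBin.relabel hgb hpb (by rw [hpt']; exact hi.pos) (by rw [hpt']; exact hi.le)
        (by rw [hpt']; exact hi.redfrac_pos) (by rw [hgp]) hps' (.inl (by rw [hgp]))
        (.inr (by rw [hpt']; exact hi))
    rw [hcont]
    refine ⟨hgood, ?_, ?_, ?_, ?_, .inr ⟨hb0, ?_, .inl ⟨⟨y, by simp, .inr hy1⟩,
      g p, by simp, .inr hps'⟩⟩⟩
    · intro q hq
      rw [Multiset.insert_eq_cons, Multiset.mem_cons, Multiset.mem_singleton] at hq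
      rcases hq with rfl | rfl
      · exact ⟨by rw [hps']; simp, .inl hpm'⟩
      · exact ⟨hyb, .inr ⟨hy8, hy6⟩⟩
    · intro q hq
      rw [Multiset.insert_eq_cons, Multiset.mem_cons, Multiset.mem_singleton] at hq
      rcases hq with rfl | rfl
      · exact ⟨by rw [hpt']; exact hiN, by rw [hps']; simp, .inl hpt'⟩
      · exact ⟨hy7, by rw [hy1]; simp, .inr hy6⟩
    · rintro j col ⟨⟨q, hq, rfl, hqc⟩, hlt⟩
      have h1 := Params.GoodBin.mult_le_colSum (P := P) hq hqc
      rw [Multiset.insert_eq_cons, Multiset.mem_cons, Multiset.mem_singleton] at hq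
      rcases hq with rfl | rfl
      · rw [Item.hasColor_fixed hps'] at hqc
        subst hqc
        rw [Params.mult_of_act (hpt' ▸ hi)] at h1
        have : P.fit .red (g p).typ = 1 := by rw [hpt']; exact hi.redfit
        omega
      · rw [Item.hasColor_fixed hy1] at hqc
        subst hqc
        rw [Params.mult_of_typ hy4] at h1
        have : P.fit .blue q.typ = 1 := Params.bluefit_large hy0.2.2.1 hy0.2.2.2 hy5
        omega
    · rw [hc]
      intro q hq j _ _ hj m
      rw [Multiset.insert_eq_cons, Multiset.mem_cons, Multiset.mem_singleton] at hq
      rcases hq with rfl | rfl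
      · unfold dv
        rw [if_neg (by rw [hpt']; exact fun h => hj h.1.symm),
          if_neg (by rw [hpi]; exact fun h => hj h.1.symm)]
      · rw [hgy]
    · rw [Multiset.insert_eq_cons, sg_cons_pos hpt' (by rw [hps']; simp), hps', hpm', sg_eq_zero]
      · rfl
      · simp [hyi]
  · have hgy : g y = { y with size := f p.bin, typ := i, mark := some .R } := by
      rw [hgdef]; dsimp only
      rw [hy3, if_pos hb, if_neg hyb, if_pos ⟨hy2, hb0⟩]
    rw [if_neg hb0] at hgp
    have hps' : (g p).status = .fixed .blue := by rw [hgp]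
    have hpm' : (g p).mark = some .R := by rw [hgp]
    have hpt' : (g p).typ = i := by rw [hgp]; exact hpi
    have hys' : (g y).status = .fixed .blue := by rw [hgy]; exact hy1
    have hym' : (g y).mark = some .R := by rw [hgy]
    have hyt' : (g y).typ = i := by rw [hgy]
    have hysz : (g y).size = f p.bin := by rw [hgy]
    have hpsz : (g p).size = p.size := by rw [hgp]
    obtain ⟨hf1, hf2⟩ := hf p.bin hb
    have hgood : P.GoodBin {g p, g y} := by
      refine goodBin_pair hi (by rw [hpsz]; exact ⟨hp0.1, hp0.2.1⟩) hpt'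
        (by rw [hpsz, ← hpt, hpi]) hps' hpm' ?_ hyt' (by rw [hysz, hf2]) hys' hym'
      rw [hysz]
      exact ⟨hf1, (typeOf_eq_spec hi.pos hf2).trans (Params.t_le_one hi.pos hi.le)⟩
    rw [hcont]
    have hall : ∀ q ∈ ({g p, g y} : Packing), q.typ = i ∧ q.status = .fixed .blue ∧
        q.mark = some .R := by
      intro q hq
      rw [Multiset.insert_eq_cons, Multiset.mem_cons, Multiset.mem_singleton] at hq
      rcases hq with rfl | rfl
      · exact ⟨hpt', hps', hpm'⟩
      · exact ⟨hyt', hys', hym'⟩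
    refine ⟨hgood, fun q hq => ⟨?_, .inl (hall q hq).2.2⟩, fun q hq => ⟨?_, ?_, .inl (hall q hq).1⟩,
      ?_, ?_, .inl ⟨hb0, ?_, fun q hq => ⟨(hall q hq).1, .inr (hall q hq).2.1⟩⟩⟩
    · rw [(hall q hq).2.1]; simp
    · rw [(hall q hq).1]; exact hiN
    · rw [(hall q hq).2.1]; simp
    · rintro j col ⟨⟨q, hq, rfl, hqc⟩, hlt⟩
      rw [Item.hasColor_fixed (hall q hq).2.1] at hqc
      subst hqc
      rw [(hall q hq).1, hi.fit, Multiset.insert_eq_cons, Params.colSum_cons,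
        Params.colSum_singleton, if_pos (.inr hps'), if_pos (.inr hys'),
        Params.mult_of_act (hpt' ▸ hi), Params.mult_of_act (hyt' ▸ hi)] at hlt
      omega
    · rw [hc]
      intro q hq j h1 hjN hj m
      rw [Multiset.insert_eq_cons, Multiset.mem_cons, Multiset.mem_singleton] at hq
      rcases hq with rfl | rfl
      · unfold dv
        rw [if_neg (by rw [hpt']; exact fun h => hj h.1.symm),
          if_neg (by rw [hpi]; exact fun h => hj h.1.symm)]
      · unfold dv
        rw [if_neg (by rw [hyt']; exact fun h => hj h.1.symm)]
        split_ifs with h2 h3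
        · rw [Item.hasColor_fixed hy1] at h3; cases h3
        -- Replacing the large item leaves the deficits of its type unchanged, since large types
        -- have no red fraction and the item was blue.
        · rw [← h2.1, P.redfrac_large q.typ hy0.2.2.1 hy0.2.2.2 hy5]; simp
        · rfl
    · rw [Multiset.insert_eq_cons, sg_cons_pos hpt' (by rw [hps']; simp),
        ← Multiset.cons_zero (g y), sg_cons_pos hyt' (by rw [hys']; simp), hps', hpm', hys', hym',
        sg_zero]
      rfl

end

section

variable {P : Params} {s s' s'' : Packing} {i j : ℕ} {C : ℝ}

/-- All chosen bins but one become `R2` and the last one `RR`, so the deficit of `R` changes as in a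
marking step. The new blue pairs are in unmixed bins; but as a bonus item existed, all unmixed red
items are of active types, and a blue medium item is never combinable with those. The red item gets
its mark next to the large item. -/
lemma shrinkStep_effect (hi : P.Act i) (hC : 1 ≤ C) (h : PostInv P C s)
    (hs : P.shrinkStep i s s') : PostInv P C s' ∧ Shrunk P s s' := by
  obtain ⟨T, b₀, f, hb0, hT, hx, hf, rfl⟩ := hs
  have hk := h.rest i hi
  set g : Item → Item := fun p => if p.bin ∈ T then
        if p.status = .bonus then
          { p with status := .fixed (if p.bin = b₀ then .red else .blue), mark := some .R }
        else if IsLarge p.size ∧ p.bin ≠ b₀ then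
          { p with size := f p.bin, typ := i, mark := some .R }
        else p
      else p with hg
  obtain ⟨hcont, hoff, hbins⟩ := shrinkStep_bins hi h.good (fun b hb => (hT b hb).1) hf hg
  have hout : ∀ b ∉ T, content (s.map g) b = content s b := fun b hb => by
    rw [hcont, Multiset.map_congr rfl fun p hp => hoff p (by rwa [(mem_content.1 hp).2]),
      Multiset.map_id']
  have hgood : GoodBins P (s.map g) := fun b => by
    by_cases hb : b ∈ T
    · exact (hbins b hb).2.2.1
    · rw [hout b hb]; exact h.good b
  have hkind : ∀ b ∈ T, (b ≠ b₀ ∧ sg i (content (s.map g) b) = Kind.R2.ms) ∨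
      (b = b₀ ∧ sg i (content (s.map g) b) = Kind.RR.ms) := fun b hb => by
    rcases (hbins b hb).2.2.2.2.2.2.2 with h1 | h1
    · exact .inl ⟨h1.1, h1.2.1⟩
    · exact .inr ⟨h1.1, h1.2.1⟩
  have hrest : KindedRest (s.map g) i := fun b => by
    by_cases hb : b ∈ T
    · rcases hkind b hb with h1 | h1
      · exact ⟨.R2, by simp [Kind.Rest], h1.2⟩
      · exact ⟨.RR, by simp [Kind.Rest], h1.2⟩
    · rw [hout b hb]; exact hk b
  have hcount : ∀ k : Kind, k ≠ .O → kcount (s.map g) i k =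
      kcount s i k + (T.filter (fun b => sg i (content (s.map g) b) = k.ms)).card := by
    intro k hk0
    have h1 := kcount_change (s := s) (s' := s.map g) (i := i) T
      (fun b hb => by rw [hout b hb]) hk0
    rw [Finset.filter_false_of_mem (s := T) (p := fun b => sg i (content s b) = k.ms)] at h1
    · simpa using h1
    · intro b hb h2
      rw [(hbins b hb).1] at h2
      exact hk0 (Kind.ms_injective (k := .O) h2).symm
  have hR2 : (T.filter (fun b => sg i (content (s.map g) b) = Kind.R2.ms)).card = T.card - 1 := by
    rw [← Finset.card_erase_of_mem hb0]
    congr 1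
    ext b
    rw [Finset.mem_filter, Finset.mem_erase]
    constructor
    · rintro ⟨hb, h1⟩
      rcases hkind b hb with h2 | h2
      · exact ⟨h2.1, hb⟩
      · rw [h2.2, Kind.ms_eq_iff] at h1; cases h1
    · rintro ⟨h1, hb⟩
      exact ⟨hb, ((hkind b hb).resolve_right fun h => h1 h.1).2⟩
  have hRR : (T.filter (fun b => sg i (content (s.map g) b) = Kind.RR.ms)).card = 1 := by
    rw [Finset.card_eq_one]
    refine ⟨b₀, ?_⟩
    ext b
    rw [Finset.mem_filter, Finset.mem_singleton]
    constructor
    · rintro ⟨hb, h1⟩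
      rcases hkind b hb with h2 | h2
      · rw [h2.2, Kind.ms_eq_iff] at h1; cases h1
      · exact h2.1
    · rintro rfl
      exact ⟨hb0, ((hkind b hb0).resolve_left fun h => h.1 rfl).2⟩
  have hother : ∀ k : Kind, k ≠ .O → k ≠ .R2 → k ≠ .RR → kcount (s.map g) i k = kcount s i k := by
    intro k h0 h1 h2
    rw [hcount k h0, Finset.filter_false_of_mem, Finset.card_empty, add_zero]
    intro b hb h3
    rcases hkind b hb with h4 | h4 <;> rw [h4.2, Kind.ms_eq_iff] at h3
    · exact h1 h3.symm
    · exact h2 h3.symm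
  have hmixed : ∀ b ∉ T, (Mixed (s.map g) b ↔ Mixed s b) := fun b hb => mixed_congr (hout b hb)
  have hmem : ∀ p ∈ s.map g, p.bin ∉ T → p ∈ s := fun p hp hb => by
    have := mem_content_self hp
    rw [hout _ hb] at this
    exact (mem_content.1 this).1
  have hbon : SomeBonus s := by
    obtain ⟨p, hp, -, -, hb⟩ := (hT b₀ hb0).1
    exact ⟨p, hp, hb⟩
  have hred : ∀ j, UnmixedRed (s.map g) j → UnmixedRed s j := by
    rintro j ⟨p, hp, hc, ht, hm⟩
    by_cases hb : p.bin ∈ T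
    · rcases (hbins _ hb).2.2.2.2.2.2.2 with h1 | h1
      · cases hc.unique (h1.2.2 p (mem_content_self hp)).2
      · exact absurd (mixed_iff.2 h1.2.2) hm
    · exact ⟨p, hmem p hp hb, hc, ht, fun h => hm ((hmixed _ hb).2 h)⟩
  refine ⟨⟨hgood, ⟨?_, fun _ j hj => h.sep.bonus hbon j (hred j hj)⟩, ?_, ?_, ?_, ?_, ?_⟩,
    ⟨fun b => ?_, ?_⟩⟩
  · rintro y j ⟨p, hp, hc, rfl, hm⟩ hj
    by_cases hb : p.bin ∈ T
    · have hpc := mem_content_self hp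
      rcases (hbins _ hb).2.2.2.2.2.2.2 with h1 | h1
      · have ht := (h1.2.2 p hpc).1
        refine Params.not_typeCombinable_medium ((hgood p.bin).item p hpc).2.1 ?_
          (h.sep.bonus hbon j (hred j hj))
        rw [← (hgood p.bin).typ_eq_of_act hpc (ht ▸ hi), ht]
        exact hi.active.1
      · exact absurd (mixed_iff.2 h1.2.2) hm
    · exact h.sep.comb _ j ⟨p, hmem p hp hb, hc, rfl, fun h => hm ((hmixed _ hb).2 h)⟩ (hred j hj)
  · intro p hp
    by_cases hb : p.bin ∈ T
    · exact ((hbins _ hb).2.2.2.2.1 p (mem_content_self hp)).2.1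
    · exact h.fixed p (hmem p hp hb)
  · intro j hj b
    by_cases hji : j = i
    · exact hji ▸ hrest b
    by_cases hb : b ∈ T
    · refine ⟨.O, by simp [Kind.Rest], sg_eq_zero fun p hp => ?_⟩
      rcases ((hbins b hb).2.2.2.2.1 p hp).2.2 with h1 | h1
      · exact .inl fun h => hji (h.symm.trans h1)
      · exact .inl fun h => h1 (h ▸ hj)
    · rw [hout b hb]; exact h.rest j hj b
  · intro j h1 hj m
    have hd := h.dev_le j h1 hj m
    by_cases hji : j = i
    · subst hji
      rw [dev_eq_kind hi hrest.kinded]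
      rw [dev_eq_kind hi hk.kinded] at hd
      by_cases hm : m = some .R
      · subst hm
        rw [xOne_eq h.good hk.kinded] at hx
        rw [Kind.dev_some] at hd
        have hTc : 1 ≤ T.card := Finset.card_pos.2 ⟨b₀, hb0⟩
        -- `2 T.card` is `x + 2` or `x + 3`, so the `T.card - 1` new pairs have `x` or `x + 1` blue
        -- items.
        have h2 := abs_dev_step hi.redfrac_pos hi.redfrac_lt (t := T.card - 1) rfl (by omega) hC hd
        have e1 := hcount .R2 (by simp)
        have e2 := hcount .RR (by simp)
        rw [hR2] at e1
        rw [hRR] at e2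
        simp only [Kind.dev, e1, e2, hother .R1 (by simp) (by simp) (by simp),
          hother .XR (by simp) (by simp) (by simp)]
        simp only [Kind.totMark, Kind.redKind] at h2
        push_cast at h2 ⊢
        rw [abs_le] at h2 ⊢
        constructor <;> linarith
      · have e : Kind.dev (P.redfrac j) (kcount (s.map g) j) m =
            Kind.dev (P.redfrac j) (kcount s j) m := by
          rcases m with _ | _ | _ | _
          case some.R => exact absurd rfl hm
          all_goals
            simp only [Kind.dev]
            simp only [hother _ (by simp : Kind.PB ≠ .O) (by simp) (by simp),
              hother _ (by simp : Kind.PR ≠ .O) (by simp) (by simp),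
              hother _ (by simp : Kind.U1 ≠ .O) (by simp) (by simp),
              hother _ (by simp : Kind.U2 ≠ .O) (by simp) (by simp),
              hother _ (by simp : Kind.RU ≠ .O) (by simp) (by simp),
              hother _ (by simp : Kind.N1 ≠ .O) (by simp) (by simp),
              hother _ (by simp : Kind.N2 ≠ .O) (by simp) (by simp),
              hother _ (by simp : Kind.RN ≠ .O) (by simp) (by simp),
              hother _ (by simp : Kind.B2 ≠ .O) (by simp) (by simp),
              hother _ (by simp : Kind.RB ≠ .O) (by simp) (by simp),
              hother _ (by simp : Kind.XR ≠ .O) (by simp) (by simp),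
              hother _ (by simp : Kind.XN ≠ .O) (by simp) (by simp)]
        rw [e]; exact hd
    · have e : dev P (s.map g) j m = dev P s j m := by
        unfold dev
        rw [Multiset.map_map]
        congr 1
        refine Multiset.map_congr rfl fun p hp => ?_
        by_cases hb : p.bin ∈ T
        · exact (hbins _ hb).2.2.2.2.2.2.1 p (mem_content_self hp) j h1 hj hji m
        · simp only [Function.comp, hoff p hb]
      rw [e]; exact hd
  · intro j h1 hj col
    refine (h.low j h1 hj col).of_imp fun b hb => ?_
    by_cases hbT : b ∈ T
    · exact absurd hb ((hbins b hbT).2.2.2.2.2.1 j col)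
    · rwa [hout b hbT] at hb
  · refine h.last.of_imp fun b hb => ?_
    by_cases hbT : b ∈ T
    · obtain ⟨⟨p, hp, ht⟩, -⟩ := hb
      exact absurd ht ((hbins b hbT).2.2.2.2.1 p hp).1
    · rwa [hout b hbT] at hb
  · by_cases hb : b ∈ T
    · exact .inr (hbins b hb).2.2.2.1
    · exact .inl (hout b hb)
  · rw [numBins_eq, numBins_eq]
    congr 1
    ext b
    rw [← content_ne_zero, ← content_ne_zero, hcont, ne_eq, Multiset.map_eq_zero]

/-- After the loop few bonus items are left. -/
lemma few_bonus_of_stuck (hi : P.Act i) (h : PostInv P C s)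
    (hst : ∀ u, ¬ P.shrinkStep i s u) :
    Few (BonusBin i) s ((1 + C) / P.redfrac i + 1) := by
  have hα := hi.redfrac_pos
  have hk := h.rest i hi
  have hC := h.nonneg
  set B := (bins s).filter (fun b => BonusBin i (content s b))
  refine ⟨B, ?_, fun b hb => ?_⟩
  · by_contra hcon
    have hx : B.card < (P.xOne s i .R + 3) / 2 := by
      by_contra hc
      push Not at hc
      obtain ⟨T, hTB, hT⟩ := Finset.exists_subset_card_eq hc
      obtain ⟨b₀, hb0⟩ := Finset.card_pos.1 (by omega : 0 < T.card)
      have hbon : ∀ b ∈ T, ∃ p ∈ s, p.bin = b ∧ p.typ = i ∧ p.status = .bonus := by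
        intro b hb
        obtain ⟨p, hp, h1, h2⟩ := (Finset.mem_filter.1 (hTB hb)).2
        rw [mem_content] at hp
        exact ⟨p, hp.1, hp.2, h1, h2⟩
      obtain ⟨p, hp, hpb, hpt, hps⟩ := hbon b₀ hb0
      -- The sizes of the shrunk items are arbitrary within type `i`; the size of any bonus item of
      -- this type will do.
      refine hst _ ⟨T, b₀, fun _ => p.size, hb0, fun b hb => ?_, by omega, fun b hb => ?_, rfl⟩
      · obtain ⟨q, hq, h1, h2, h3⟩ := hbon b hb
        obtain ⟨-, -, -, y, h4, -, h5, h6, -⟩ := bonus_bin h.good hq h1 h3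
        exact ⟨⟨q, hq, h1, h2, h3⟩, y, (mem_content.1 (by rw [h4]; simp : y ∈ content s b)).1, h6, h5⟩
      · have h1 := ((h.good p.bin).item p (mem_content_self hp)).1
        exact ⟨h1, by rw [← (bonus_bin h.good hp rfl hps).2.1, hpt]⟩
    have hd := h.dev_le i hi.pos hi.lt (some .R)
    rw [dev_eq_kind hi hk.kinded, Kind.dev_some, abs_le] at hd
    rw [xOne_eq h.good hk.kinded] at hx
    obtain ⟨-, h2⟩ := Kind.xo_spec hα (Kind.totMark (kcount s i) .R)
      (kcount s i (Kind.redKind (some .R)))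
    set x := Kind.xo (P.redfrac i) (Kind.totMark (kcount s i) .R)
      (kcount s i (Kind.redKind (some .R)))
    have hdiv : 0 ≤ (1 + C) / P.redfrac i := by positivity
    push Not at hcon
    have hB1 : 1 < B.card := by
      have : (1 : ℝ) < B.card := by linarith
      exact_mod_cast this
    have h3 := h2 (by omega)
    have h4 : (B.card : ℝ) ≤ x + 1 := by exact_mod_cast (by omega : B.card ≤ x + 1)
    have h5 : (1 + C) / P.redfrac i < x := by linarith
    rw [div_lt_iff₀ hα] at h5
    linarith
  · rw [Finset.mem_filter]
    refine ⟨?_, hb⟩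
    rw [← content_ne_zero]
    intro h0
    obtain ⟨p, hp, -⟩ := hb
    rw [h0] at hp; simp at hp

/-- The effect of turning bonus items into coloured items, for all types. -/
lemma forTypes_shrink (P : Params) {C : ℝ} (hC : 1 ≤ C) (n : ℕ) (hn : n ≤ P.N) : ∃ D : ℝ,
    ∀ s s', PostInv P C s → ForTypes P.shrink n s s' →
      PostInv P C s' ∧ Shrunk P s s' ∧ ∀ i, i ≤ n → P.Act i → Few (BonusBin i) s' D := by
  induction n with
  | zero =>
    refine ⟨0, fun s s' h hs => ?_⟩
    cases hs
    exact ⟨h, Shrunk.refl _, fun i hi hact => by have := hact.pos; omega⟩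
  | succ n ih =>
    obtain ⟨D, ih⟩ := ih (by omega)
    refine ⟨max D ((1 + C) / P.redfrac (n + 1) + 1), ?_⟩
    rintro s s' h ⟨u, h1, h2⟩
    obtain ⟨a1, a2, a3⟩ := ih s u h h1
    unfold Params.shrink at h2
    by_cases hi : P.Act (n + 1)
    · rw [if_pos hi.active] at h2
      have key : PostInv P C s' ∧ Shrunk P u s' := by
        obtain ⟨h3, -⟩ := h2
        induction h3 with
        | refl => exact ⟨a1, Shrunk.refl _⟩
        | tail _ h4 ih =>
          obtain ⟨b1, b2⟩ := shrinkStep_effect hi hC ih.1 h4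
          exact ⟨b1, ih.2.trans b2⟩
      refine ⟨key.1, a2.trans key.2, fun i hin hact => ?_⟩
      by_cases hin' : i = n + 1
      · subst hin'
        exact (few_bonus_of_stuck hi key.1 h2.2).mono (le_max_right _ _)
      · exact (key.2.few (fun c hc => hc.not_bonusBin) (a3 i (by omega) hact)).mono
          (le_max_left _ _)
    · rw [if_neg fun h => hi ⟨by omega, hn, h⟩] at h2
      subst h2
      refine ⟨a1, a2, fun i hin hact => (a3 i ?_ hact).mono (le_max_left _ _)⟩
      by_contra hc
      exact hi ((by omega : n + 1 = i) ▸ hact)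

end

namespace Params

variable (P : Params)

/-- The size of a reduced item is replaced by the size of the items that replace it. -/
def unreduce (p : Item) : Item := if P.Reduced p then { p with size := P.t p.typ } else p

/-- The item is counted by the weight functions. -/
def Kept (p : Item) : Prop := p.status ≠ .bonus ∧ ¬ (P.IsActive p.typ ∧ p.mark = none)

end Params

section

variable {P : Params} {s s' u : Packing} {i : ℕ} {C : ℝ}

/-! ### The modified input -/

lemma unreduce_eq (p : Item) : (P.unreduce p).typ = p.typ ∧ (P.unreduce p).status = p.status ∧
    (P.unreduce p).mark = p.mark := by
  unfold Params.unreduce; split_ifs <;> exact ⟨rfl, rfl, rfl⟩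

/-- A reduced item becomes `mult` equal items, so sums over the modified input are sums over the
packing with multiplicities. This lets the count of bins stay with the packed items. -/
lemma sum_modified (F : Item → ℝ) (s : Packing) :
    ((P.dropUnmarked (P.splitReduced s)).map F).sum =
      (s.map (fun p => if P.Kept p then P.mult p * F (P.unreduce p) else 0)).sum := by
  have key : ∀ p : Item, (((if P.Reduced p then Multiset.replicate (P.redfit p.typ)
      { p with size := P.t p.typ } else {p}).filter
        (fun p => p.status ≠ .bonus ∧ ¬ (P.IsActive p.typ ∧ p.mark = none))).map F).sum =
      if P.Kept p then P.mult p * F (P.unreduce p) else 0 := by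
    intro p
    unfold Params.Kept Params.mult Params.unreduce
    by_cases hr : P.Reduced p
    · rw [if_pos hr, if_pos hr, if_pos hr, Multiset.filter_congr (q := fun _ =>
        p.status ≠ .bonus ∧ ¬ (P.IsActive p.typ ∧ p.mark = none)) fun q hq => by
          rw [Multiset.eq_of_mem_replicate hq]]
      split_ifs with hk
      · rw [Multiset.filter_eq_self.2 fun _ _ => hk, Multiset.map_replicate,
          Multiset.sum_replicate, nsmul_eq_mul]
      · rw [Multiset.filter_eq_nil.2 fun _ _ => hk]; simp
    · rw [if_neg hr, if_neg hr, if_neg hr, Multiset.filter_singleton]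
      split_ifs <;> simp
  induction s using Multiset.induction_on with
  | empty => simp [Params.splitReduced, Params.dropUnmarked]
  | cons p s ih =>
    rw [Multiset.map_cons, Multiset.sum_cons, ← ih, ← key p]
    unfold Params.splitReduced Params.dropUnmarked
    rw [Multiset.cons_bind, Multiset.filter_add, Multiset.map_add, Multiset.sum_add]

lemma mem_modified {q : Item} (hq : q ∈ P.dropUnmarked (P.splitReduced s)) :
    ∃ p ∈ s, q = P.unreduce p := by
  unfold Params.dropUnmarked Params.splitReduced at hq
  obtain ⟨p, hp, hqp⟩ := Multiset.mem_bind.1 (Multiset.mem_filter.1 hq).1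
  refine ⟨p, hp, ?_⟩
  unfold Params.unreduce
  split_ifs at hqp ⊢
  · exact Multiset.eq_of_mem_replicate hqp
  · exact Multiset.mem_singleton.1 hqp

lemma unreduce_spec (hg : GoodBins P s) {p : Item} (hp : p ∈ s) :
    P.mult (P.unreduce p) = 1 ∧ 0 < (P.unreduce p).size ∧ (P.unreduce p).size ≤ 1 := by
  have hpc := mem_content_self hp
  have hi := (hg p.bin).item p hpc
  unfold Params.unreduce
  split_ifs with h
  · refine ⟨?_, Params.t_pos' hi.2.2.1 hi.2.2.2, Params.t_le_one hi.2.2.1 hi.2.2.2⟩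
    exact Params.mult_of_typ ((hg p.bin).reduced p hpc h).2.2.2.symm
  · exact ⟨Params.mult_of_typ (not_not.1 h), hi.1, hi.2.1⟩

/-- The surplus of red items of type `i` among the items that are counted is bounded. -/
lemma PostInv.abs_sum_kept_le (h : PostInv P C s) (h1 : 1 ≤ i) (hN : i ≤ P.N) :
    |((P.dropUnmarked (P.splitReduced s)).map (fun p => dv P i p.mark p)).sum| ≤ 3 * C := by
  have hC := h.nonneg
  have hun : ∀ p ∈ s, P.mult p * dv P i (P.unreduce p).mark (P.unreduce p) = dv P i p.mark p := by
    intro p hp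
    obtain ⟨e1, e2, e3⟩ := unreduce_eq (P := P) p
    unfold dv Item.HasColor
    rw [e1, e2, e3, (unreduce_spec h.good hp).1, mul_ite, mul_zero, Nat.cast_one, one_mul]
  rw [sum_modified, Multiset.map_congr rfl fun p hp => by rw [hun p hp]]
  rcases hN.lt_or_eq with hN | rfl
  · by_cases hi : P.Act i
    -- Unmarked items of active types are dropped, so just the deficits of the three marks remain.
    · have e : (s.map (fun p => if P.Kept p then dv P i p.mark p else 0)).sum =
          dev P s i (some .N) + dev P s i (some .B) + dev P s i (some .R) := by
        unfold dev
        rw [← Multiset.sum_map_add, ← Multiset.sum_map_add]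
        congr 1
        refine Multiset.map_congr rfl fun p _ => ?_
        unfold Params.Kept dv
        by_cases ht : p.typ = i <;> by_cases hb : p.status = .bonus
        · simp [hb]
        · have hact : P.IsActive p.typ := ht ▸ hi.active
          rcases hm : p.mark with _ | _ | _ | _ <;> simp [ht, hb, hi.active]
        · simp [ht]
        · simp [ht]
      have h2 := h.dev_le i h1 hN (some .N)
      have h3 := h.dev_le i h1 hN (some .B)
      have h4 := h.dev_le i h1 hN (some .R)
      rw [e]
      rw [abs_le] at *
      constructor <;> linarith
    · have e : (s.map (fun p => if P.Kept p then dv P i p.mark p else 0)).sum =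
          dev P s i none := by
        unfold dev
        congr 1
        refine Multiset.map_congr rfl fun p hp => ?_
        unfold Params.Kept dv
        by_cases ht : p.typ = i
        · have hm := h.good.mark_none hi p hp ht
          have hact : ¬ P.IsActive p.typ := fun h => hi ⟨h1, hN.le, ht ▸ h⟩
          by_cases hb : p.status = .bonus <;> simp [hm, hact, hb]
        · simp [ht]
      rw [e]
      linarith [h.dev_le i h1 hN none]
  · rw [Multiset.map_congr rfl (g := fun _ => (0 : ℝ))]
    · simpa using hC
    · intro p hp
      unfold dv
      split_ifs with h2 h3 h4 <;> try rfl
      · have := (h.good p.bin).red_pos p (mem_content_self hp) h4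
        rw [h3.1, P.redfrac_last] at this
        exact absurd this (lt_irrefl _)
      · rw [P.redfrac_last]; simp

/-- The number of superfluous red items of one type that are removed. -/
lemma dropRedStep_loop (h1 : 1 ≤ i) (hN : i ≤ P.N) (hm : ∀ p ∈ s, P.mult p = 1)
    (hs : Relation.ReflTransGen (P.dropRedStep i) s s') : ∃ X : Packing, s = X + s' ∧
      (∀ p ∈ X, p.typ = i) ∧
      (X.card : ℝ) ≤ 3 / 2 * (|(s.map (fun p => dv P i p.mark p)).sum| + 1) := by
  have hα := P.redfrac_nonneg i h1 hN
  have hα' := P.redfrac_lt i h1 hN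
  set ψ : Packing → ℝ := fun u => (u.map (fun p => dv P i p.mark p)).sum with hψ
  -- The deficit `ψ` is negative before each removal and grows by `1 - α ≥ 2/3`, so it stays below 1
  -- and the number of removals is bounded by its initial size.
  have key : ∃ X : Packing, s = X + s' ∧ (∀ p ∈ X, p.typ = i) ∧
      2 / 3 * (X.card : ℝ) ≤ ψ s' - ψ s ∧ (X.card = 0 ∨ ψ s' < 1) := by
    induction hs with
    | refl => exact ⟨0, by simp, by simp, by simp, .inl rfl⟩
    | tail _ h2 ih =>
      obtain ⟨X, rfl, h3, h4, -⟩ := ih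
      obtain ⟨hlt, p, rfl, ht, hc⟩ := h2
      refine ⟨p ::ₘ X, by simp, ?_, ?_, .inr ?_⟩
      · intro q hq
        rcases Multiset.mem_cons.1 hq with rfl | hq
        · exact ht
        · exact h3 q hq
      all_goals
        have hp : dv P i p.mark p = P.redfrac i - 1 := by
          unfold dv
          rw [if_pos ⟨ht, rfl, hc.not_bonus⟩, if_pos hc, hm p (by simp)]; simp
        simp only [hψ, Multiset.map_cons, Multiset.sum_cons, hp, Multiset.card_cons] at h4 ⊢
        have h5 := (Nat.floor_lt (by positivity)).1 hlt
        have h6 := sum_dv_mark (P := P) (p ::ₘ _) i ▸ sub_neg.2 h5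
        rw [Multiset.map_cons, Multiset.sum_cons, hp] at h6
      · push_cast; linarith
      · linarith
  obtain ⟨X, h2, h3, h4, h5⟩ := key
  refine ⟨X, h2, h3, ?_⟩
  have h6 := neg_abs_le (ψ s)
  have h7 := abs_nonneg (ψ s)
  rcases h5 with h5 | h5
  · rw [h5]; simp only [Nat.cast_zero]; positivity
  · linarith

lemma forTypes_dropRed {A : Packing} (hm : ∀ p ∈ A, P.mult p = 1)
    (hA : ∀ i, 1 ≤ i → i ≤ P.N → |(A.map (fun p => dv P i p.mark p)).sum| ≤ C) (n : ℕ)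
    (hn : n ≤ P.N) (hs : ForTypes (fun i => WhileStep (P.dropRedStep i)) n A s') :
    ∃ X : Packing, A = X + s' ∧ (∀ p ∈ X, p.typ ≤ n) ∧ (X.card : ℝ) ≤ n * (3 / 2 * (C + 1)) := by
  induction n generalizing s' with
  | zero => cases hs; exact ⟨0, by simp, by simp, by simp⟩
  | succ n ih =>
    obtain ⟨u, h1, h2, -⟩ := hs
    obtain ⟨X, rfl, h3, h4⟩ := ih (by omega) h1
    obtain ⟨Y, rfl, h5, h6⟩ := dropRedStep_loop (P := P) (i := n + 1) (by omega) hn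
      (fun p hp => hm p (Multiset.mem_add.2 (.inr hp))) h2
    refine ⟨X + Y, by rw [add_assoc], fun p hp => ?_, ?_⟩
    · rcases Multiset.mem_add.1 hp with hp | hp
      · exact (h3 p hp).trans (by omega)
      · exact (h5 p hp).le
    · have h7 := hA (n + 1) (by omega) hn
      have h8 : (X.map (fun p => dv P (n + 1) p.mark p)).sum = 0 := by
        rw [Multiset.map_congr rfl (g := fun _ => (0 : ℝ))]
        · simp
        · intro p hp
          unfold dv
          rw [if_neg]
          rintro ⟨h9, -⟩
          have := h3 p hp; omega
      rw [Multiset.map_add, Multiset.sum_add, h8, zero_add] at h7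
      rw [Multiset.card_add]
      push_cast
      linarith

end

/-! ### Counting bins -/

/-- A packing in which all bins are full and all items are counted. -/
structure Clean (P : Params) (C : ℝ) (s : Packing) : Prop where
  inv : PostInv P C s
  not_low : ∀ b j col, 1 ≤ j → j < P.N → ¬ LowBin P j col (content s b)
  not_last : ∀ b, ¬ LowLast P (content s b)
  not_bonus : ∀ p ∈ s, p.status ≠ .bonus
  marked : ∀ p ∈ s, P.Act p.typ → p.mark ≠ none

namespace Params

variable (P : Params) (k : ℕ)

/-- The share of a bin with blue items, or with red items that need space `k`, of an item. -/
def blueShare (p : Item) : ℝ :=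
  if p.typ = P.N then p.size / (1 - P.t P.N)
  else (P.mult p : ℝ) * if p.HasColor .red then
    (if k < P.needs p.typ ∨ (P.needs p.typ = k ∧ p.mark ≠ some .R) then 1 / (P.redfit p.typ : ℝ)
      else 0)
    else 1 / (P.bluefit p.typ : ℝ)

/-- The share of a bin with red items, or with blue items of class less than `k`, of an item. -/
def redShare (p : Item) : ℝ :=
  if p.typ = P.N then p.size / (1 - P.t P.N)
  else (P.mult p : ℝ) * if p.HasColor .red then 1 / (P.redfit p.typ : ℝ) else
    (if P.blueClass p.size p.typ < k then 1 / (P.bluefit p.typ : ℝ) else 0)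

end Params

section

variable {P : Params} {s s' : Packing} {C D : ℝ} {k : ℕ}

lemma last_pos (P : Params) : 0 < 1 - P.t P.N := by linarith [P.no_straddle_last]

lemma blueShare_nonneg {p : Item} (hp : 0 < p.size) : 0 ≤ P.blueShare k p := by
  have := last_pos P
  unfold Params.blueShare; split_ifs <;> positivity

lemma redShare_nonneg {p : Item} (hp : 0 < p.size) : 0 ≤ P.redShare k p := by
  have := last_pos P
  unfold Params.redShare; split_ifs <;> positivity

/-- A full bin has shares of total size at least one. -/
lemma one_le_sum_of_color {c : Packing} (hg : P.GoodBin c) {ω : Item → ℝ} (hω : ∀ p ∈ c, 0 ≤ ω p)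
    {q : Item} {col : Color} (hq : q ∈ c) (hc : q.HasColor col)
    (hlow : ¬ LowBin P q.typ col c)
    (h : ∀ p ∈ c, p.HasColor col → p.typ = q.typ → ω p = (P.mult p : ℝ) * (1 / (P.fit col q.typ : ℝ))) :
    1 ≤ (c.map ω).sum := by
  have hfit : 1 ≤ P.fit col q.typ := Params.one_le_fit_of_pos (hg.item q hq).2.2.1
    (hg.item q hq).2.2.2 fun e => hg.red_pos q hq (e ▸ hc)
  have hge : P.fit col q.typ ≤ P.colSum c col := by
    by_contra hlt
    exact hlow ⟨⟨q, hq, rfl, hc⟩, by omega⟩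
  have h1 : ((c.filter (fun p => p.HasColor col)).map ω).sum ≤ (c.map ω).sum := by
    conv_rhs => rw [← Multiset.filter_add_not (fun p : Item => p.HasColor col) c]
    rw [Multiset.map_add, Multiset.sum_add]
    refine le_add_of_nonneg_right (Multiset.sum_nonneg fun x hx => ?_)
    obtain ⟨p, hp, rfl⟩ := Multiset.mem_map.1 hx
    exact hω p (Multiset.mem_filter.1 hp).1
  refine le_trans ?_ h1
  rw [Multiset.map_congr rfl fun p hp => h p (Multiset.mem_filter.1 hp).1
    (Multiset.mem_filter.1 hp).2 (hg.same col p (Multiset.mem_filter.1 hp).1 q hq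
      (Multiset.mem_filter.1 hp).2 hc), Multiset.sum_map_mul_right]
  have h2 : ((c.filter (fun p => p.HasColor col)).map (fun p => (P.mult p : ℝ))).sum =
      P.colSum c col := by
    unfold Params.colSum
    rw [Nat.cast_multiset_sum, Multiset.map_map]; rfl
  have h3 : (0 : ℝ) < P.fit col q.typ := by exact_mod_cast hfit
  rw [h2, mul_one_div, le_div_iff₀ h3, one_mul]
  exact_mod_cast hge

lemma one_le_sum_of_last (hc : Clean P C s) {b : ℕ} {q : Item} (hq : q ∈ content s b)
    (hqN : q.typ = P.N) {ω : Item → ℝ} (h : ∀ p, p.typ = P.N → ω p = p.size / (1 - P.t P.N)) :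
    1 ≤ ((content s b).map ω).sum := by
  have h1 := hc.not_last b
  have h2 : 1 - P.t P.N < ((content s b).map Item.size).sum := by
    by_contra hlt
    exact h1 ⟨⟨q, hq, hqN⟩, not_lt.1 hlt⟩
  rw [Multiset.map_congr rfl fun p hp => h p ((hc.inv.good b).last q hq hqN p hp)]
  simp only [div_eq_mul_inv]
  rw [Multiset.sum_map_mul_right, ← div_eq_mul_inv, le_div_iff₀ (last_pos P), one_mul]
  exact h2.le

lemma Clean.color (hc : Clean P C s) {p : Item} (hp : p ∈ s) :
    p.HasColor .blue ∨ p.HasColor .red := Item.not_bonus_iff.1 (hc.not_bonus p hp)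

lemma GoodBins.red_ne_last (hg : GoodBins P s) {p : Item} (hp : p ∈ s) (h : p.HasColor .red) :
    p.typ ≠ P.N :=
  Params.redfrac_pos_ne_last ((hg p.bin).red_pos p (mem_content_self hp) h)

lemma Clean.lowBin (hc : Clean P C s) {q : Item} (hq : q ∈ s) (hN : q.typ ≠ P.N) (col : Color) :
    ¬ LowBin P q.typ col (content s q.bin) := by
  have h := (hc.inv.good q.bin).item q (mem_content_self hq)
  exact hc.not_low _ _ _ h.2.2.1 (lt_of_le_of_ne h.2.2.2 hN)

lemma Clean.not_mixed (hc : Clean P C s) {b : ℕ}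
    (h : (∀ p ∈ content s b, ¬ p.HasColor .blue) ∨ ∀ p ∈ content s b, ¬ p.HasColor .red) :
    ¬ Mixed s b := by
  rw [mixed_iff]
  rintro (⟨⟨p, hp, h1⟩, ⟨q, hq, h2⟩⟩ | ⟨p, hp, h1⟩)
  · exact h.elim (fun h => h p hp h1) fun h => h q hq h2
  · exact hc.not_bonus p (mem_content.1 hp).1 h1

/-- A bin with a blue item is filled with blue ones. A bin without is unmixed and red, so its items
need at least `k` and have no mark `R`, which makes `w_k` count them fully. -/
lemma Clean.one_le_blueShare (hc : Clean P C s) (hk : ∀ j, UnmixedRed s j → k ≤ P.needs j) {b : ℕ}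
    (hb : b ∈ bins s) : 1 ≤ ((content s b).map (P.blueShare k)).sum := by
  have hg := hc.inv.good b
  have h0 : ∀ p ∈ content s b, 0 ≤ P.blueShare k p := fun p hp => blueShare_nonneg (hg.item p hp).1
  by_cases hq : ∃ q ∈ content s b, q.HasColor .blue
  · obtain ⟨q, hq, hqc⟩ := hq
    obtain ⟨hqs, rfl⟩ := mem_content.1 hq
    by_cases hN : q.typ = P.N
    · exact one_le_sum_of_last hc hq hN fun p hp => if_pos hp
    · refine one_le_sum_of_color hg h0 hq hqc (hc.lowBin hqs hN _) fun p _ hpc hpt => ?_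
      have hr : ¬ p.HasColor .red := fun h => by cases h.unique hpc
      unfold Params.blueShare
      rw [if_neg (hpt ▸ hN), if_neg hr, hpt]; rfl
  · push Not at hq
    obtain ⟨q, hqs, rfl⟩ := mem_bins.1 hb
    have hqc := mem_content_self hqs
    have hqr := (hc.color hqs).resolve_left (hq q hqc)
    have hN := hc.inv.good.red_ne_last hqs hqr
    have hkn := hk q.typ ⟨q, hqs, hqr, rfl, hc.not_mixed (.inl hq)⟩
    refine one_le_sum_of_color hg h0 hqc hqr (hc.lowBin hqs hN _) fun p hp hpc hpt => ?_
    have hmark : p.mark ≠ some .R := fun hm => by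
      obtain ⟨y, hy, hyb⟩ := hg.mark_R p hp hpc hm
      exact hq y hy hyb
    unfold Params.blueShare
    rw [if_neg (hpt ▸ hN), if_pos hpc, if_pos, hpt]
    · rfl
    · rw [hpt]
      rcases hkn.lt_or_eq with h | h
      · exact .inl h
      · exact .inr ⟨h.symm, hmark⟩

/-- Blue items in unmixed bins have a small class. -/
lemma Clean.blueClass_lt (hc : Clean P C s)
    (hk : k = P.K + 1 ∨ ∃ j, UnmixedRed s j ∧ P.needs j = k) {p : Item} (hp : p ∈ s)
    (hpc : p.HasColor .blue) (hm : ¬ Mixed s p.bin) : P.blueClass p.size p.typ < k := by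
  have hpb := mem_content_self hp
  have hg := hc.inv.good p.bin
  have hi := hg.item p hpb
  rcases hk with rfl | ⟨j, hj, rfl⟩
  · refine Nat.lt_succ_of_le ?_
    unfold Params.blueClass
    split_ifs
    · exact Nat.findGreatest_le _
    · exact Nat.zero_le _
    · exact P.leaves_le _ hi.2.2.1 hi.2.2.2
  · by_contra hge
    push Not at hge
    refine hc.inv.sep.comb p.size j ⟨p, hp, hpc, rfl, hm⟩ hj ?_
    obtain ⟨q, hq, hqr, rfl, -⟩ := hj
    have hqi := (hc.inv.good q.bin).item q (mem_content_self hq)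
    have hα := (hc.inv.good q.bin).red_pos q (mem_content_self hq) hqr
    have hn1 := P.needs_pos q.typ hqi.2.2.1 hqi.2.2.2 hα
    have hnK := P.needs_le q.typ hqi.2.2.1 hqi.2.2.2 hα
    unfold Params.blueClass at hge
    unfold Params.TypeCombinable Params.leavesOf IsLarge
    split_ifs at hge with h1 h2
    · rw [if_pos h1, if_pos h2]
      refine ⟨by omega, ?_⟩
      split_ifs with h3
      -- For a large and a medium item the class is defined by sizes. The space `redspace (needs j)`
      -- fits next to the large item, and it bounds `t j` since `redfit` is 1.
      · have h4 := (Nat.findGreatest_of_ne_zero (n := P.K)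
          (P := fun j => 1 ≤ j ∧ P.redspace j ≤ 1 - p.size) rfl (by omega)).2
        have h5 := Params.redspace_mono hn1 hge (Nat.findGreatest_le _)
        have h6 := P.redfit_space q.typ hqi.2.2.1 hqi.2.2.2 hα
        rw [P.redfit_medium q.typ hqi.2.2.1 hqi.2.2.2 hα h3.2.1] at h6
        push_cast at h6
        linarith
      · exact hnK
    · omega
    · rw [if_neg h1, if_neg fun h => h1 h.1, ← hg.typ_eq_of_blue hpb hpc]
      exact ⟨by omega, hge⟩

/-- A bin with a red item is filled with red ones. A bin without is unmixed and blue, so by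
separation from the red type that needs `k` its items have class below `k` and `v_k` counts them;
for `k = K + 1` every class is small enough. -/
lemma Clean.one_le_redShare (hc : Clean P C s)
    (hk : k = P.K + 1 ∨ ∃ j, UnmixedRed s j ∧ P.needs j = k) {b : ℕ} (hb : b ∈ bins s) :
    1 ≤ ((content s b).map (P.redShare k)).sum := by
  have hg := hc.inv.good b
  have h0 : ∀ p ∈ content s b, 0 ≤ P.redShare k p := fun p hp => redShare_nonneg (hg.item p hp).1
  by_cases hq : ∃ q ∈ content s b, q.HasColor .red
  · obtain ⟨q, hq, hqc⟩ := hq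
    obtain ⟨hqs, rfl⟩ := mem_content.1 hq
    have hN := hc.inv.good.red_ne_last hqs hqc
    refine one_le_sum_of_color hg h0 hq hqc (hc.lowBin hqs hN _) fun p _ hpc hpt => ?_
    unfold Params.redShare
    rw [if_neg (hpt ▸ hN), if_pos hpc, hpt]; rfl
  · push Not at hq
    obtain ⟨q, hqs, rfl⟩ := mem_bins.1 hb
    have hqc := mem_content_self hqs
    have hqr := (hc.color hqs).resolve_right (hq q hqc)
    by_cases hN : q.typ = P.N
    · exact one_le_sum_of_last hc hqc hN fun p hp => if_pos hp
    · refine one_le_sum_of_color hg h0 hqc hqr (hc.lowBin hqs hN _) fun p hp hpc hpt => ?_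
      have h1 := mem_content.1 hp
      unfold Params.redShare
      rw [if_neg (hpt ▸ hN), if_neg (hq p hp), if_pos, hpt]
      · rfl
      · exact hc.blueClass_lt hk h1.1 hpc (h1.2 ▸ hc.not_mixed (.inr hq))

lemma numBins_le_sum {ω : Item → ℝ} (h : ∀ b ∈ bins s, 1 ≤ ((content s b).map ω).sum) :
    (numBins s : ℝ) ≤ (s.map ω).sum := by
  rw [numBins_eq, ← sum_content ω s (Finset.Subset.refl _)]
  have := Finset.card_nsmul_le_sum (bins s) (fun b => ((content s b).map ω).sum) 1 h
  simpa using this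

/-! ### Shares and weights -/

lemma sum_map_finset_sum {ι : Type*} (S : Finset ι) (f : ι → Item → ℝ) (s : Packing) :
    (s.map (fun p => ∑ x ∈ S, f x p)).sum = ∑ x ∈ S, (s.map (f x)).sum := by
  induction s using Multiset.induction_on with
  | empty => simp
  | cons p s ih => simp [ih, Finset.sum_add_distrib]

/-- Total shares and total weights differ by a bounded amount. -/
lemma PostInv.sum_share_le (h : PostInv P C s) {κ : ℕ → Option Mark → ℝ} (hκ : ∀ j m, |κ j m| ≤ 1)
    {W ω : Item → ℝ} (hW : ∀ p ∈ s, W p =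
      ω p + if p.typ = P.N then 0 else κ p.typ p.mark * dv P p.typ p.mark p) :
    (s.map ω).sum ≤ (s.map W).sum + P.N * 4 * C := by
  have hC := h.nonneg
  set M : Finset (Option Mark) := {none, some .N, some .B, some .R} with hM
  have hMm : ∀ m, m ∈ M := fun m => by rcases m with _ | _ | _ | _ <;> simp [hM]
  set S := Finset.Ico 1 P.N ×ˢ M with hS
  have h1 : ∀ p ∈ s, W p = ω p + ∑ x ∈ S, κ x.1 x.2 * dv P x.1 x.2 p := by
    intro p hp
    have hi := (h.good p.bin).item p (mem_content_self hp)
    rw [hW p hp]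
    congr 1
    split_ifs with hN
    · rw [Finset.sum_eq_zero]
      rintro ⟨j, m⟩ hx
      have := (Finset.mem_Ico.1 (Finset.mem_product.1 hx).1).2
      unfold dv
      rw [if_neg, mul_zero]
      rintro ⟨h2, -⟩
      simp only at this h2; omega
    · rw [Finset.sum_eq_single (p.typ, p.mark)]
      · rintro ⟨j, m⟩ _ hx
        unfold dv
        rw [if_neg, mul_zero]
        rintro ⟨rfl, rfl, -⟩; exact hx rfl
      · intro hx
        refine absurd (Finset.mem_product.2 ⟨Finset.mem_Ico.2 ⟨hi.2.2.1, ?_⟩, hMm _⟩) hx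
        exact lt_of_le_of_ne hi.2.2.2 hN
  rw [Multiset.map_congr rfl h1, Multiset.sum_map_add, sum_map_finset_sum]
  have h2 : ∀ x ∈ S, -C ≤ (s.map fun p => κ x.1 x.2 * dv P x.1 x.2 p).sum := by
    rintro ⟨j, m⟩ hx
    have hj := Finset.mem_Ico.1 (Finset.mem_product.1 hx).1
    rw [Multiset.sum_map_mul_left]
    have h3 := h.dev_le j hj.1 hj.2 m
    have h4 : |κ j m * dev P s j m| ≤ 1 * C := by
      rw [abs_mul]; exact mul_le_mul (hκ j m) h3 (abs_nonneg _) zero_le_one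
    have h5 := (abs_le.1 h4).1
    unfold dev at h5
    linarith
  have h3 := Finset.card_nsmul_le_sum S _ _ h2
  have h4 : S.card ≤ P.N * 4 := by
    rw [hS, Finset.card_product, Nat.card_Ico]
    exact Nat.mul_le_mul (Nat.sub_le _ _) Finset.card_le_four
  have h5 : (S.card : ℝ) * C ≤ P.N * 4 * C :=
    mul_le_mul_of_nonneg_right (by exact_mod_cast h4) hC
  rw [nsmul_eq_mul] at h3
  linarith

lemma one_div_nat_le (n : ℕ) : 0 ≤ 1 / (n : ℝ) ∧ 1 / (n : ℝ) ≤ 1 := by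
  refine ⟨by positivity, ?_⟩
  rw [one_div]; exact Nat.cast_inv_le_one n

lemma abs_sub_le_one {x y : ℝ} (hx : 0 ≤ x ∧ x ≤ 1) (hy : 0 ≤ y ∧ y ≤ 1) : |x - y| ≤ 1 := by
  rw [abs_le]; constructor <;> linarith [hx.1, hx.2, hy.1, hy.2]

lemma unreduce_last (hg : GoodBins P s) {p : Item} (hp : p ∈ s) (hN : p.typ = P.N) :
    P.unreduce p = p ∧ P.mult p = 1 := by
  have h : p.typ = P.typeOf p.size := by
    by_contra hr
    exact hg.red_ne_last hp ((hg p.bin).reduced p (mem_content_self hp) hr).1 hN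
  exact ⟨if_neg (not_not.2 h), Params.mult_of_typ h⟩

lemma Clean.numBins_le_w (hc : Clean P C s) (hk : ∀ j, UnmixedRed s j → k ≤ P.needs j) :
    (numBins s : ℝ) ≤
      (s.map (fun p => P.mult p * P.w k (P.unreduce p))).sum + P.N * 4 * C := by
  refine (numBins_le_sum fun b hb => hc.one_le_blueShare hk hb).trans ?_
  -- The coefficient is the share of a red item minus that of a blue one; weight minus share is this
  -- difference times the item's part of the deficit. It depends on the mark, which is why deficits
  -- are bounded for each mark.
  refine hc.inv.sum_share_le (κ := fun j m => (if k < P.needs j ∨ (P.needs j = k ∧ m ≠ some .R)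
    then 1 / (P.redfit j : ℝ) else 0) - 1 / (P.bluefit j : ℝ)) (fun j m => ?_) fun p hp => ?_
  · refine abs_sub_le_one ?_ (one_div_nat_le _)
    split_ifs
    · exact one_div_nat_le _
    · exact ⟨le_rfl, zero_le_one⟩
  · obtain ⟨e1, -, e3⟩ := unreduce_eq (P := P) p
    unfold Params.w Params.blueShare
    by_cases hN : p.typ = P.N
    · obtain ⟨e4, e5⟩ := unreduce_last hc.inv.good hp hN
      rw [e4, e5, if_pos hN, if_pos hN, if_pos hN]; simp
    · rw [e1, e3, if_neg hN, if_neg hN, if_neg hN, show dv P p.typ p.mark p = (P.mult p : ℝ) * (P.redfrac p.typ -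
        if p.HasColor .red then 1 else 0) from if_pos ⟨rfl, rfl, hc.not_bonus p hp⟩]
      split_ifs <;> ring

lemma Clean.numBins_le_v (hc : Clean P C s)
    (hk : k = P.K + 1 ∨ ∃ j, UnmixedRed s j ∧ P.needs j = k) : (numBins s : ℝ) ≤
      (s.map (fun p => P.mult p * P.v k (P.unreduce p))).sum + P.N * 4 * C := by
  refine (numBins_le_sum fun b hb => hc.one_le_redShare hk hb).trans ?_
  -- The class of a large item depends on its size, but large types have `α = 0` and no red items.
  -- Their contribution to the deficit vanishes, so using `leaves j` here is harmless.
  refine hc.inv.sum_share_le (κ := fun j _ => 1 / (P.redfit j : ℝ) -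
    if P.leaves j < k then 1 / (P.bluefit j : ℝ) else 0) (fun j m => ?_) fun p hp => ?_
  · refine abs_sub_le_one (one_div_nat_le _) ?_
    split_ifs
    · exact one_div_nat_le _
    · exact ⟨le_rfl, zero_le_one⟩
  · obtain ⟨e1, -, e3⟩ := unreduce_eq (P := P) p
    have hpc := mem_content_self hp
    have hg := hc.inv.good p.bin
    have hi := hg.item p hpc
    unfold Params.v Params.redShare
    by_cases hN : p.typ = P.N
    · obtain ⟨e4, e5⟩ := unreduce_last hc.inv.good hp hN
      rw [e4, e5, if_pos hN, if_pos hN, if_pos hN]; simp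
    · rw [e1, if_neg hN, if_neg hN, if_neg hN, show dv P p.typ p.mark p = (P.mult p : ℝ) * (P.redfrac p.typ -
        if p.HasColor .red then 1 else 0) from if_pos ⟨rfl, rfl, hc.not_bonus p hp⟩]
      by_cases hr : p.HasColor .red
      · have ht : P.t p.typ ≤ 1 / 2 := by
          by_contra hlt
          have h1 := hg.red_pos p hpc hr
          rw [P.redfrac_large p.typ hi.2.2.1 hi.2.2.2 (not_le.1 hlt)] at h1
          exact lt_irrefl _ h1
        have hsz : (P.unreduce p).size ≤ P.t p.typ := by
          unfold Params.unreduce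
          split_ifs with h
          · exact le_rfl
          · rw [not_not.1 h]; exact (Params.typeOf_spec hi.2.1).2
        have hcl : P.blueClass (P.unreduce p).size p.typ = P.leaves p.typ :=
          if_neg (by linarith)
        rw [hcl]
        simp only [if_pos hr]
        split_ifs <;> ring
      · have htyp := hg.typ_eq_of_blue hpc ((hc.color hp).resolve_right hr)
        rw [show P.unreduce p = p from if_neg (not_not.2 htyp)]
        simp only [if_neg hr]
        by_cases hl : 1 / 2 < p.size
        · have ht := (Params.isLarge_iff (P := P) hi.2.1).1 hl
          rw [← htyp] at ht
          rw [P.redfrac_large p.typ hi.2.2.1 hi.2.2.2 ht]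
          split_ifs <;> ring
        · rw [show P.blueClass p.size p.typ = P.leaves p.typ from if_neg hl]
          split_ifs <;> ring

/-- Weights are between zero and two. -/
lemma weight_bounds {p : Item} (h1 : 1 ≤ p.typ) (hN : p.typ ≤ P.N) (h0 : 0 < p.size)
    (hs : p.size ≤ 1) (k : ℕ) :
    (0 ≤ P.w k p ∧ P.w k p ≤ 2) ∧ 0 ≤ P.v k p ∧ P.v k p ≤ 2 := by
  have hα := P.redfrac_nonneg p.typ h1 hN
  have hα' := P.redfrac_lt p.typ h1 hN
  have hb := one_div_nat_le (P.bluefit p.typ)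
  have hr := one_div_nat_le (P.redfit p.typ)
  have e1 : 0 ≤ (1 - P.redfrac p.typ) / P.bluefit p.typ ∧
      (1 - P.redfrac p.typ) / P.bluefit p.typ ≤ 1 := by
    rw [← mul_one_div]; constructor <;> nlinarith
  have e2 : 0 ≤ P.redfrac p.typ / P.redfit p.typ ∧ P.redfrac p.typ / P.redfit p.typ ≤ 1 := by
    rw [← mul_one_div]; constructor <;> nlinarith
  have e3 : 0 ≤ p.size / (1 - P.t P.N) ∧ p.size / (1 - P.t P.N) ≤ 2 := by
    have h3 := last_pos P
    refine ⟨by positivity, ?_⟩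
    rw [div_le_iff₀ h3]; linarith [P.no_straddle_last]
  unfold Params.w Params.v
  refine ⟨?_, ?_⟩ <;> split_ifs <;> constructor <;> linarith [e1.1, e1.2, e2.1, e2.2, e3.1, e3.2]

end

/-! ### Removing the remaining defects and concluding -/

section

variable {P : Params} {s s' : Packing} {C D : ℝ}

/-- The smallest space needed by red items that are not combined with blue items. -/
lemma exists_smallest_need (hg : GoodBins P s) : ∃ k ∈ Finset.Icc 1 (P.K + 1),
    (∀ j, UnmixedRed s j → k ≤ P.needs j) ∧
      (k = P.K + 1 ∨ ∃ j, UnmixedRed s j ∧ P.needs j = k) := by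
  by_cases h : ∃ k j, UnmixedRed s j ∧ P.needs j = k
  · obtain ⟨j, hj, hjk⟩ := Nat.find_spec h
    obtain ⟨q, hq, hqr, rfl, -⟩ := id hj
    have hi := (hg q.bin).item q (mem_content_self hq)
    have hα := (hg q.bin).red_pos q (mem_content_self hq) hqr
    have h1 := P.needs_pos q.typ hi.2.2.1 hi.2.2.2 hα
    have h2 := P.needs_le q.typ hi.2.2.1 hi.2.2.2 hα
    exact ⟨Nat.find h, Finset.mem_Icc.2 (by omega), fun j' hj' => Nat.find_min' h ⟨j', hj', rfl⟩,
      .inr ⟨_, hj, hjk⟩⟩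
  · exact ⟨P.K + 1, by simp, fun j hj => absurd ⟨_, j, hj, rfl⟩ h, .inl rfl⟩

/-- All bins that are not full or contain an item that is not counted can be removed. -/
lemma exists_clean (P : Params) (C D : ℝ) : ∃ n : ℕ, ∀ s, PostInv P C s →
    (∀ i, P.Act i → Few (UnmarkedBin i) s C) → (∀ i, P.Act i → Few (BonusBin i) s D) →
    ∃ s', Cut n s s' ∧ Clean P (C + binMax P * n) s' := by
  set E : ℝ := ∑ _i ∈ Finset.range (P.N + 1), (C + C + (C + |D|))
  refine ⟨⌊E + C⌋₊, fun s h hu hb => ?_⟩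
  have hC := h.nonneg
  set R : ℕ → Packing → Prop := fun i c => ((1 ≤ i ∧ i < P.N ∧ LowBin P i .blue c) ∨
    (1 ≤ i ∧ i < P.N ∧ LowBin P i .red c)) ∨ (P.Act i ∧ UnmarkedBin i c) ∨
    (P.Act i ∧ BonusBin i c) with hR
  have hlow : ∀ i col, Few (fun c => 1 ≤ i ∧ i < P.N ∧ LowBin P i col c) s C := fun i col => by
    by_cases hi : 1 ≤ i ∧ i < P.N
    · exact (h.low i hi.1 hi.2 col).of_imp fun b hb => hb.2.2
    · exact Few.of_forall_not (fun b hb => hi ⟨hb.1, hb.2.1⟩) hC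
  have hact : ∀ i (Q : Packing → Prop) (A : ℝ), 0 ≤ A → (P.Act i → Few Q s A) →
      Few (fun c => P.Act i ∧ Q c) s A := fun i Q A hA hQ => by
    by_cases hi : P.Act i
    · exact (hQ hi).of_imp fun b hb => hb.2
    · exact Few.of_forall_not (fun b hb => hi hb.1) hA
  have hfew : Few (fun c => (∃ i ∈ Finset.range (P.N + 1), R i c) ∨ LowLast P c) s (E + C) :=
    (Few.iUnion fun i _ => ((hlow i .blue).or (hlow i .red)).or ((hact i _ _ hC (hu i)).or
      (hact i _ _ (abs_nonneg D) fun hi => (hb i hi).mono (le_abs_self D)))).or h.last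
  set T : ℕ → Prop := fun b =>
    ¬ ((∃ i ∈ Finset.range (P.N + 1), R i (content s b)) ∨ LowLast P (content s b)) with hT
  have hcut : Cut ⌊E + C⌋₊ s (s.filter (fun p => T p.bin)) :=
    hfew.cut (fun p _ q _ hpq hp => by rwa [hpq] at hp) fun p _ hp => not_not.1 hp
  refine ⟨_, hcut, h.cut hcut, ?_, ?_, ?_, ?_⟩
  · intro b j col h1 hj hl
    rw [content_filter_bin' s T] at hl
    split_ifs at hl with hb
    · refine hb (.inl ⟨j, by simp; omega, .inl ?_⟩)
      cases col
      · exact .inr ⟨h1, hj, hl⟩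
      · exact .inl ⟨h1, hj, hl⟩
    · obtain ⟨⟨p, hp, _⟩, _⟩ := hl; simp at hp
  · intro b hl
    rw [content_filter_bin' s T] at hl
    split_ifs at hl with hb
    · exact hb (.inr hl)
    · obtain ⟨⟨p, hp, _⟩, _⟩ := hl; simp at hp
  · intro p hp hs
    obtain ⟨hp, hb⟩ := Multiset.mem_filter.1 hp
    have hpc := mem_content_self hp
    have hi := ((h.good p.bin).bonus p hpc hs).1
    exact hb (.inl ⟨p.typ, by simpa [Nat.lt_succ_iff] using hi.le, .inr (.inr ⟨hi, p, hpc, rfl, hs⟩)⟩)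
  · intro p hp hi hm
    obtain ⟨hp, hb⟩ := Multiset.mem_filter.1 hp
    have hpc := mem_content_self hp
    have hs : p.status ≠ .bonus := fun hs =>
      hb (.inl ⟨p.typ, by simpa [Nat.lt_succ_iff] using hi.le,
        .inr (.inr ⟨hi, p, hpc, rfl, hs⟩)⟩)
    exact hb (.inl ⟨p.typ, by simpa [Nat.lt_succ_iff] using hi.le,
      .inr (.inl ⟨hi, p, hpc, rfl, hs, hm⟩)⟩)

/-- The weight of the modified input is at least the weight of the items in a clean part. -/
lemma sum_weight_le {n : ℕ} (h : PostInv P C s) (hcut : Cut n s s') (hc : Clean P D s')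
    {u : Packing}
    (hs : ForTypes (fun i => WhileStep (P.dropRedStep i)) P.N (P.dropUnmarked (P.splitReduced s)) u)
    {F : Item → ℝ} (hF : ∀ p : Item, 1 ≤ p.typ → p.typ ≤ P.N → 0 < p.size → p.size ≤ 1 →
      0 ≤ F p ∧ F p ≤ 2) :
    (s'.map (fun p => P.mult p * F (P.unreduce p))).sum ≤
      (u.map F).sum + 2 * (P.N * (3 / 2 * (3 * C + 1))) := by
  have hFs : ∀ p ∈ s, 0 ≤ F (P.unreduce p) ∧ F (P.unreduce p) ≤ 2 := fun p hp => by
    have hi := (h.good p.bin).item p (mem_content_self hp)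
    have h1 := unreduce_spec h.good hp
    have h2 := (unreduce_eq (P := P) p).1
    exact hF _ (h2 ▸ hi.2.2.1) (h2 ▸ hi.2.2.2) h1.2.1 h1.2.2
  obtain ⟨X, hX, -, hXc⟩ := forTypes_dropRed (fun q hq => by
    obtain ⟨p, hp, rfl⟩ := mem_modified hq
    exact (unreduce_spec h.good hp).1) (fun i h1 hN => h.abs_sum_kept_le h1 hN) P.N le_rfl hs
  have h1 := sum_modified (P := P) F s
  rw [hX, Multiset.map_add, Multiset.sum_add] at h1
  have h2 : (X.map F).sum ≤ X.card * 2 := by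
    have := Multiset.sum_le_card_nsmul (X.map F) 2 fun x hx => by
      obtain ⟨q, hq, rfl⟩ := Multiset.mem_map.1 hx
      obtain ⟨p, hp, rfl⟩ := mem_modified (hX ▸ Multiset.mem_add.2 (.inl hq))
      exact (hFs p hp).2
    simpa using this
  have h3 : (s'.map (fun p => P.mult p * F (P.unreduce p))).sum ≤
      (s.map (fun p => if P.Kept p then P.mult p * F (P.unreduce p) else 0)).sum := by
    -- Every item of the clean part is counted in the modified input, and the items outside it have
    -- nonnegative weight. So only the red items dropped at the end are lost.
    rw [Multiset.map_congr rfl (g := fun p => if P.Kept p then P.mult p * F (P.unreduce p) else 0)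
      fun p hp => (if_pos ⟨hc.not_bonus p hp, fun hk => ?_⟩).symm]
    · obtain ⟨S, -, rfl⟩ := hcut
      conv_rhs => rw [← Multiset.filter_add_not (fun p : Item => p.bin ∉ S) s]
      rw [Multiset.map_add, Multiset.sum_add]
      refine le_add_of_nonneg_right (Multiset.sum_nonneg fun x hx => ?_)
      obtain ⟨p, hp, rfl⟩ := Multiset.mem_map.1 hx
      have h4 := (hFs p (Multiset.mem_filter.1 hp).1).1
      split_ifs <;> positivity
    · have hi := (hc.inv.good p.bin).item p (mem_content_self hp)
      exact hc.marked p hp ⟨hi.2.2.1, hi.2.2.2, hk.1⟩ hk.2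
  linarith

end

/-- The number of bins is bounded by the weight of the modified input. -/
lemma exists_numBins_le (P : Params) : ∃ C : ℝ, ∀ (σ : List ℝ) (s s' : Packing),
    (∀ x ∈ σ, 0 < x ∧ x ≤ 1) → P.Run σ s → P.PostResult s s' →
    ∃ k ∈ Finset.Icc 1 (P.K + 1),
      (numBins s : ℝ) ≤ min (s'.map (P.w k)).sum (s'.map (P.v k)).sum + C := by
  obtain ⟨C₀, n₀, h0⟩ := exists_restored P
  set C := max C₀ 1
  obtain ⟨D, h1⟩ := forTypes_shrink P (le_max_right C₀ 1) P.N le_rfl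
  obtain ⟨n, h2⟩ := exists_clean P C D
  refine ⟨2 * (P.N * (3 / 2 * (3 * C + 1))) + P.N * 4 * (C + binMax P * n) + n + n₀,
    fun σ s s' hσ hrun hpost => ?_⟩
  obtain ⟨s₁, s₂, s₃, hm, hr, hsh, hd⟩ := hpost
  obtain ⟨a1, a2, a3⟩ := h0 _ s s₁ s₂ (runInv P hσ hrun) hm hr
  obtain ⟨b1, b2, b3⟩ := h1 _ _ (a1.mono (le_max_left _ _)) hsh
  obtain ⟨s₄, hcut, hc⟩ := h2 s₃ b1
    (fun i hi => b2.few (fun c hf => hf.not_unmarkedBin hi) ((a2 i hi).mono (le_max_left _ _)))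
    (fun i hi => b3 i hi.le hi)
  -- The index is chosen from the clean part. One and the same `k` serves both weight functions, as
  -- the minimum requires.
  obtain ⟨k, hk, hk1, hk2⟩ := exists_smallest_need hc.inv.good
  refine ⟨k, hk, ?_⟩
  have e1 := hcut.numBins
  rw [b2.numBins] at e1
  have e2 := hc.numBins_le_w hk1
  have e3 := hc.numBins_le_v hk2
  have e4 := sum_weight_le b1 hcut hc hd (F := P.w k)
    fun p h1 hN hp hp' => (weight_bounds h1 hN hp hp' k).1
  have e5 := sum_weight_le b1 hcut hc hd (F := P.v k)
    fun p h1 hN hp hp' => (weight_bounds h1 hN hp hp' k).2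
  rw [← min_add_add_right]
  exact le_min (by linarith) (by linarith)

end

end ExtremeHarmonic

theorem mainTheorem5 (P : ExtremeHarmonic.Params) :
    ∃ C : ℝ, ∀ σ : List ℝ, (∀ x ∈ σ, 0 < x ∧ x ≤ 1) →
      ∀ s : ExtremeHarmonic.Packing, P.Run σ s →
      ∀ s' : ExtremeHarmonic.Packing, P.PostResult s s' →
        (ExtremeHarmonic.numBins s : ℝ) ≤
          (Finset.Icc 1 (P.K + 1)).sup' (Finset.nonempty_Icc.mpr (Nat.le_add_left 1 P.K))
            (fun k => min (s'.map (P.w k)).sum (s'.map (P.v k)).sum) + C := by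
  obtain ⟨C, h⟩ := ExtremeHarmonic.exists_numBins_le P
  refine ⟨C, fun σ hσ s hrun s' hpost => ?_⟩
  obtain ⟨k, hk, hle⟩ := h σ s s' hσ hrun hpost
  exact hle.trans (add_le_add_left (Finset.le_sup'
    (fun k => min (s'.map (P.w k)).sum (s'.map (P.v k)).sum) hk) C)
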